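/- Let $M$ be a smooth manifold (Hausdorff, second countable or, more generally, $\sigma$-compact), let $A$, $E$, $C$ be smooth real vector bundles of finite rank over $M$, and let $A$ carry a Lie algebroid structure with anchor $\rho_A$ and bracket $[\cdot,\cdot]$. **Definitions.** A *double vector bundle* $D$ with sides $A$, $E$ and core $C$ is a manifold $D$ with compatible vector bundle structures over $E$ and over $A$ (the projection to either side is linear for the other structure, and $(d_1+_Ed_2)+_A(d_3+_Ed_4)=(d_1+_Ad_3)+_E(d_2+_Ad_4)$), together with an identification of $C$ with the intersection of the kernels of $D\to A$ and $D\to E$. A section of $D\to E$ is *linear* if it is a vector bundle morphism from $E\to M$ to $D\to A$ over some $X_0\in\Gamma(A)$, its base section; $\alpha\in\Gamma(C)$ defines the *core section* $e\mapsto \alpha(q(e))+_A 0_e$, where $q:E\to M$ is the projection; $\phi\in\mathrm{Hom}(E,C)$ defines the linear section $e\mapsto\phi(e)+_A0_e$ over $0$. A *VB-algebroid* (inducing the given structure on $A$) is such a $D$ with a Lie algebroid structure $(\rho_D,[\cdot,\cdot]_D)$ on $D\to E$ such that $\rho_D:D\to TE$ is a bundle morphism from $D\to A$ to $TE\to TM$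 over $\rho_A$; brackets of linear sections over $X_0,Y_0$ are linear over $[X_0,Y_0]$; brackets of a linear and a core section are core; brackets of core sections vanish. An *isomorphism* of VB-algebroids is a diffeomorphism that is linear over $A$ and over $E$, induces the identity on $A$, $E$ and $C$, and preserves anchors and brackets. A *horizontal lift* is a $C^\infty(M)$-linear map $X\mapsto \hat X$ from $\Gamma(A)$ to the linear sections of $D\to E$ such that $\hat X$ has base section $X$. Let $\Omega^p(A)=\Gamma(\bigwedge^pA^*)$, with the Lie algebroid differential $d_A$. A *2-term superconnection* is an operator $\mathcal D$ on $\Omega(A)\otimes_{C^\infty(M)}\Gamma(C[1]\oplus E)$ (sections of $C$ have degree $-1$ and sections of $E$ have degree $0$) of total degree $1$ with $\mathcal D(\omega s)=(d_A\omega)s+(-1)^p\omega\wedge\mathcal D(s)$ for $\omega\in\Omega^p(A)$; it is *flat* if $\mathcal D^2=0$. A horizontal lift of $D$ defines $$\langle\partial\alpha,l\rangle=-\rho_D(\alpha)(l),\quad \nabla^c_X\alpha=[\hat X,\alpha]_D,\quad \langle\nabla^s_X\varepsilon,l\rangle=\rho_A(X)\langle\varepsilon,l\rangle-\langle\varepsilon,\rho_D(\hat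 X)(l)\rangle,\quad \Omega_{X,Y}=\widehat{[X,Y]}-[\hat X,\hat Y]_D$$ for $X,Y\in\Gamma(A)$, $\alpha\in\Gamma(C)$, $\varepsilon\in\Gamma(E)$, $l\in\Gamma(E^*)$, and the operator $\mathcal D=\partial+D^c+D^s+\Omega$, where $D^c$, $D^s$ are the operators associated with $\nabla^c$, $\nabla^s$ (extended by zero), $\partial(\omega\alpha)=(-1)^p\omega\,\partial(\alpha)$, $\partial(\omega\varepsilon)=0$, $\Omega(\omega\varepsilon)=(-1)^p\omega\wedge\Omega(\varepsilon)$ and $\Omega(\omega\alpha)=0$ for $\omega\in\Omega^p(A)$. An element $\sigma\in\Gamma(A^*\otimes E^*\otimes C)$ acts as the operator of total degree $0$ with $\sigma(\omega\varepsilon)=\omega\wedge\sigma(\varepsilon)$, $\sigma(\omega\alpha)=0$. Two flat 2-term superconnections are *equivalent* if $\mathcal D'=u\mathcal D u^{-1}$ with $u=1+\sigma$ for some $\sigma\in\Gamma(A^*\otimes E^*\otimes C)$. For operators, $\mathrm{ad}(P)Q=[P,Q]$. **Theorem.** 1. Every VB-algebroid $D$ with sides $A$, $E$ and core $C$ has a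 horizontal lift. For every horizontal lift the data $(\partial,\nabla^c,\nabla^s,\Omega)$ exist and are uniquely determined, and $\mathcal D=\partial+D^c+D^s+\Omega$ is a flat 2-term superconnection. 2. For two horizontal lifts $X\mapsto\hat X$ and $X\mapsto\hat X'$ of $D$ there is a unique $\sigma\in\Gamma(A^*\otimes E^*\otimes C)$ with $\sigma_X=\hat X'-\hat X$ for all $X\in\Gamma(A)$, and the associated superconnections $\mathcal D$, $\mathcal D'$ satisfy $$\mathcal D'=\mathcal D+[\sigma,\mathcal D]+\tfrac12[\sigma,[\sigma,\mathcal D]],\qquad [\sigma,[\sigma,[\sigma,\mathcal D]]]=0 .$$ Hence $\mathrm{ad}(\sigma)^n\mathcal D=0$ for $n\ge3$, and $$\mathcal D'=\sum_{n=0}^\infty\frac1{n!}\,\mathrm{ad}(\sigma)^n\mathcal D=\exp(\mathrm{ad}(\sigma))\,\mathcal D=u\,\mathcal D\,u^{-1},\qquad\text{where } u=1+\sigma \text{ is invertible.}$$ 3. Sending $D$ to the superconnection of any of its horizontal lifts gives a well-defined bijection from the isomorphism classes of VB-algebroids with sides $A$, $E$ and core $C$ (inducing the given Lie algebroid structure on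 $A$) to the equivalence classes of flat 2-term superconnections on $C[1]\oplus E$. -/

import Mathlib

noncomputable section

namespace VBA


section Koszul
open AlternatingMap
variable {R L N : Type*} [CommRing R] [Algebra ℝ R]
  [AddCommGroup L] [Module R L] [Module ℝ L] [IsScalarTower ℝ R L]
  [AddCommGroup N] [Module R N] [Module ℝ N] [IsScalarTower ℝ R N]

/-- An alternating `R`-multilinear map, viewed as an alternating `ℝ`-multilinear map. -/
def realForm (R : Type*) {L N : Type*} [CommRing R] [Algebra ℝ R]
    [AddCommGroup L] [Module R L] [Module ℝ L] [IsScalarTower ℝ R L]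
    [AddCommGroup N] [Module R N] [Module ℝ N] [IsScalarTower ℝ R N] (p : ℕ) :
    (L [⋀^Fin p]→ₗ[R] N) →ₗ[ℝ] L [⋀^Fin p]→ₗ[ℝ] N where
  toFun ω := { ω.toMultilinearMap.restrictScalars ℝ with
    map_eq_zero_of_eq' := ω.map_eq_zero_of_eq' }
  map_add' _ _ := rfl
  map_smul' _ _ := rfl

@[simp] theorem realForm_apply (p : ℕ) (ω : L [⋀^Fin p]→ₗ[R] N) (v : Fin p → L) :
    realForm R p ω v = ω v := rfl

/-- The alternating map
`(X_0, …, X_p) ↦ 2 ∑_{i<j} (-1)^{i+j+1} ω([X_i, X_j], X_0, …, no X_i, …, no X_j, …, X_p)`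
for a skew-symmetric bracket; see `koszul_succ_apply` for the resulting formula. -/
def bracketTerm (br : L →ₗ[ℝ] L →ₗ[ℝ] L) :
    (p : ℕ) → (L [⋀^Fin p]→ₗ[ℝ] N) → L [⋀^Fin (p + 1)]→ₗ[ℝ] N
  | 0, _ => 0
  | n + 1, ω => alternatizeUncurryFin
      (alternatizeUncurryFinLM ∘ₗ
        (LinearMap.llcomp ℝ L L (L [⋀^Fin n]→ₗ[ℝ] N) ω.curryLeft) ∘ₗ br)

/-- `(X_0, …, X_p) ↦ ∑_i (-1)^i ∇_{X_i} (ω(X_0, …, no X_i, …, X_p))`. -/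
def derivTerm (nab : L →ₗ[ℝ] N →ₗ[ℝ] N) (p : ℕ) (ω : L [⋀^Fin p]→ₗ[ℝ] N) :
    L [⋀^Fin (p + 1)]→ₗ[ℝ] N := alternatizeUncurryFin
    { toFun := fun X => (nab X).compAlternatingMap ω
      map_add' := fun X Y => by ext v; simp
      map_smul' := fun c X => by ext v; simp }

theorem derivTerm_apply (nab : L →ₗ[ℝ] N →ₗ[ℝ] N) (p : ℕ) (ω : L [⋀^Fin p]→ₗ[ℝ] N)
    (v : Fin (p + 1) → L) :
    derivTerm nab p ω v = ∑ i : Fin (p + 1), (-1 : ℤ) ^ (i : ℕ) • nab (v i) (ω (i.removeNth v)) := by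
  simp [derivTerm, alternatizeUncurryFin_apply]

theorem bracketTerm_apply_aux (br : L →ₗ[ℝ] L →ₗ[ℝ] L) (n : ℕ) (ω : L [⋀^Fin (n + 1)]→ₗ[ℝ] N)
    (v : Fin (n + 2) → L) :
    bracketTerm br (n + 1) ω v = ∑ i : Fin (n + 2), (-1 : ℤ) ^ (i : ℕ) •
      ∑ j : Fin (n + 1), (-1 : ℤ) ^ (j : ℕ) •
        ω (Matrix.vecCons (br (v i) (i.removeNth v j)) (j.removeNth (i.removeNth v))) := by
  simp [bracketTerm, alternatizeUncurryFin_apply]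

/-- The Koszul differential
`(dω)(X_0, …, X_p) = ∑_i (-1)^i ∇_{X_i} (ω(…, no X_i, …))
  + ∑_{i<j} (-1)^{i+j} ω([X_i, X_j], …, no X_i, …, no X_j, …)`
of an alternating `p`-form; the explicit formula is `koszul_succ_apply`. -/
def koszul (br : L →ₗ[ℝ] L →ₗ[ℝ] L) (nab : L →ₗ[ℝ] N →ₗ[ℝ] N) (p : ℕ)
    (ω : L [⋀^Fin p]→ₗ[ℝ] N) : L [⋀^Fin (p + 1)]→ₗ[ℝ] N :=
  derivTerm nab p ω - (2⁻¹ : ℝ) • bracketTerm br p ω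

theorem koszul_zero_apply (br : L →ₗ[ℝ] L →ₗ[ℝ] L) (nab : L →ₗ[ℝ] N →ₗ[ℝ] N)
    (ω : L [⋀^Fin 0]→ₗ[ℝ] N) (v : Fin 1 → L) : koszul br nab 0 ω v = nab (v 0) (ω ![]) := by
  have : Fin.removeNth 0 v = ![] := Subsingleton.elim _ _
  simp [koszul, bracketTerm, derivTerm_apply, this]

/-- The Koszul formula; the pair of indices `i < j` is written as `i.castSucc < j.succ`. -/
theorem koszul_succ_apply (br : L →ₗ[ℝ] L →ₗ[ℝ] L) (hbr : ∀ X, br X X = 0)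
    (nab : L →ₗ[ℝ] N →ₗ[ℝ] N) (n : ℕ) (ω : L [⋀^Fin (n + 1)]→ₗ[ℝ] N) (v : Fin (n + 2) → L) :
    koszul br nab (n + 1) ω v =
      ∑ i : Fin (n + 2), (-1 : ℤ) ^ (i : ℕ) • nab (v i) (ω (i.removeNth v))
      + ∑ i : Fin (n + 1), ∑ j ≥ i, (-1 : ℤ) ^ ((i.castSucc : ℕ) + (j.succ : ℕ)) •
        ω (Matrix.vecCons (br (v i.castSucc) (v j.succ))
          (j.removeNth (i.castSucc.removeNth v))) := by
  have h : ∀ X Y, br Y X = - br X Y := by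
    intro X Y
    have := hbr (X + Y)
    simp only [map_add, LinearMap.add_apply, hbr, zero_add, add_zero] at this
    exact eq_neg_of_add_eq_zero_left this
  have h' : ∀ (X Y : L) (w : Fin n → L), ω (Matrix.vecCons (br Y X) w) =
      - ω (Matrix.vecCons (br X Y) w) := by
    intro X Y w
    rw [h X Y]
    have := (ω.curryLeft).map_neg (br X Y)
    exact congrArg (fun g => g w) this
  rw [koszul, AlternatingMap.sub_apply, derivTerm_apply, sub_eq_add_neg]
  congr 1
  rw [AlternatingMap.smul_apply, bracketTerm,
    alternatizeUncurryFin_alternatizeUncurryFinLM_comp_apply, Finset.smul_sum,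
    ← Finset.sum_neg_distrib]
  refine Finset.sum_congr rfl fun i _ => ?_
  rw [Finset.smul_sum, ← Finset.sum_neg_distrib]
  refine Finset.sum_congr rfl fun j _ => ?_
  simp only [LinearMap.comp_apply, LinearMap.llcomp_apply, curryLeft_apply_apply]
  rw [h' (v i.castSucc) (v j.succ), sub_neg_eq_add, ← two_smul ℝ, smul_comm, smul_smul,
    smul_comm]
  norm_num [← add_assoc, pow_succ]

theorem linear_of_slot_zero {p : ℕ} (g : L [⋀^Fin (p + 1)]→ₗ[ℝ] N)
    (h : ∀ (f : R) (X : L) (w : Fin p → L),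
      g (Matrix.vecCons (f • X) w) = f • g (Matrix.vecCons X w))
    (v : Fin (p + 1) → L) (i : Fin (p + 1)) (f : R) (X : L) :
    g (Function.update v i (f • X)) = f • g (Function.update v i X) := by
  have key : ∀ Z, g (Function.update v i Z) =
      (-1 : ℤ) ^ (i : ℕ) • g (Matrix.vecCons Z (i.removeNth v)) := by
    intro Z
    rw [← map_insertNth]
    congr 1
    rw [Fin.insertNth_removeNth]
  rw [key, key, h, smul_comm]

variable (R L) in
/-- A Lie-Rinehart structure: an `ℝ`-bilinear Lie bracket on the `R`-module `L` and an `R`-linear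
anchor `L → Der(R)` satisfying the Leibniz rule. -/
structure LieRinehartData where
  br : L →ₗ[ℝ] L →ₗ[ℝ] L
  rho : L →ₗ[R] Derivation ℝ R R
  br_self : ∀ X, br X X = 0
  jacobi : ∀ X Y Z, br X (br Y Z) = br (br X Y) Z + br Y (br X Z)
  leibniz : ∀ X (f : R) Y, br X (f • Y) = f • br X Y + rho X f • Y

variable (P : LieRinehartData R L)

variable (N) in
/-- An `L`-connection on the `R`-module `N`. -/
structure LieRinehartData.Connection where
  nabla : L →ₗ[R] N →ₗ[ℝ] N
  leibniz : ∀ X (f : R) (n : N), nabla X (f • n) = f • nabla X n + P.rho X f • n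

variable {P}

theorem LieRinehartData.br_smul_left (X : L) (f : R) (Y : L) :
    P.br (f • X) Y = f • P.br X Y - P.rho Y f • X := by
  have h : ∀ X Y, P.br Y X = - P.br X Y := by
    intro X Y
    have := P.br_self (X + Y)
    simp only [map_add, LinearMap.add_apply, P.br_self, zero_add, add_zero] at this
    exact eq_neg_of_add_eq_zero_left this
  rw [h Y, P.leibniz, h X Y]
  simp only [neg_add_rev, smul_neg, neg_neg]
  abel

theorem koszul_slot_zero (D : P.Connection N) {p : ℕ} (ω : L [⋀^Fin p]→ₗ[R] N)
    (f : R) (X : L) (w : Fin p → L) :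
    koszul P.br (D.nabla.restrictScalars ℝ) p (realForm R p ω) (Matrix.vecCons (f • X) w) =
      f • koszul P.br (D.nabla.restrictScalars ℝ) p (realForm R p ω) (Matrix.vecCons X w) := by
  have rem : ∀ {n : ℕ} (Z : L) (u : Fin (n + 1) → L) (i : Fin (n + 1)),
      (i.succ).removeNth (Matrix.vecCons Z u) = Matrix.vecCons Z (i.removeNth u) := by
    intro n Z u i
    ext k
    refine Fin.cases ?_ (fun k => ?_) k <;> simp [Fin.removeNth]
  have rem0 : ∀ {n : ℕ} (Z : L) (u : Fin n → L),
      (0 : Fin (n + 1)).removeNth (Matrix.vecCons Z u) = u := by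
    intro n Z u
    ext k
    simp [Fin.removeNth]
  have lin : ∀ {n : ℕ} (η : L [⋀^Fin (n + 1)]→ₗ[R] N) (g : R) (Z : L) (u : Fin n → L),
      η (Matrix.vecCons (g • Z) u) = g • η (Matrix.vecCons Z u) := by
    intro n η g Z u
    exact η.toMultilinearMap.cons_smul u g Z
  cases p with
  | zero => simp [koszul_zero_apply]
  | succ n =>
    have lin2 : ∀ (Y : L) (u : Fin n → L) (j : Fin n),
        ω (Matrix.vecCons Y ((j.succ).removeNth (Matrix.vecCons (f • X) u))) =
          f • ω (Matrix.vecCons Y ((j.succ).removeNth (Matrix.vecCons X u))) := by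
      intro Y u j
      cases n with
      | zero => exact j.elim0
      | succ m =>
        rw [rem, rem]
        exact lin (ω.curryLeft Y) f X _
    have addl : ∀ (Y Z : L) (u : Fin n → L), ω (Matrix.vecCons (Y - Z) u) =
        ω (Matrix.vecCons Y u) - ω (Matrix.vecCons Z u) := by
      intro Y Z u
      exact congrArg (fun g => g u) (ω.curryLeft.map_sub Y Z)
    have addl' : ∀ (Y Z : L) (u : Fin n → L), ω (Matrix.vecCons (Y + Z) u) =
        ω (Matrix.vecCons Y u) + ω (Matrix.vecCons Z u) := by
      intro Y Z u
      exact congrArg (fun g => g u) (ω.curryLeft.map_add Y Z)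
    have eA : ∀ Z : L, derivTerm (D.nabla.restrictScalars ℝ) (n + 1) (realForm R (n + 1) ω)
          (Matrix.vecCons Z w) = D.nabla Z (ω w) + ∑ k : Fin (n + 1), (-1 : ℤ) ^ (k + 1 : ℕ) •
            D.nabla (w k) (ω (Matrix.vecCons Z (k.removeNth w))) := by
      intro Z
      rw [derivTerm_apply, Fin.sum_univ_succ]
      simp only [rem, rem0, realForm_apply, LinearMap.restrictScalars_apply, Fin.val_succ,
        Fin.val_zero, pow_zero, one_smul, Matrix.cons_val_zero, Matrix.cons_val_succ]
    have eB : ∀ Z : L, bracketTerm P.br (n + 1) (realForm R (n + 1) ω) (Matrix.vecCons Z w) =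
        ∑ k : Fin (n + 1), (-1 : ℤ) ^ (k : ℕ) •
          ω (Matrix.vecCons (P.br Z (w k)) (k.removeNth w)) +
        ∑ k : Fin (n + 1), (-1 : ℤ) ^ (k + 1 : ℕ) •
          (ω (Matrix.vecCons (P.br (w k) Z) (k.removeNth w)) +
            ∑ j : Fin n, (-1 : ℤ) ^ (j + 1 : ℕ) •
              ω (Matrix.vecCons (P.br (w k) (k.removeNth w j))
                (j.succ.removeNth (Matrix.vecCons Z (k.removeNth w))))) := by
      intro Z
      rw [bracketTerm_apply_aux, Fin.sum_univ_succ]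
      congr 1
      · simp only [rem0, realForm_apply, Fin.val_zero, pow_zero, one_smul, Matrix.cons_val_zero]
      · refine Finset.sum_congr rfl fun k _ => ?_
        rw [Fin.sum_univ_succ]
        simp only [rem, rem0, realForm_apply, Fin.val_succ,
          Fin.val_zero, pow_zero, one_smul, Matrix.cons_val_zero, Matrix.cons_val_succ]
    have hA : derivTerm (D.nabla.restrictScalars ℝ) (n + 1) (realForm R (n + 1) ω)
          (Matrix.vecCons (f • X) w) =
        f • derivTerm (D.nabla.restrictScalars ℝ) (n + 1) (realForm R (n + 1) ω)
          (Matrix.vecCons X w)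
        - ∑ k : Fin (n + 1), (-1 : ℤ) ^ (k : ℕ) •
            P.rho (w k) f • ω (Matrix.vecCons X (k.removeNth w)) := by
      rw [eA, eA, smul_add, map_smul, LinearMap.smul_apply, add_sub_assoc, Finset.smul_sum,
        ← Finset.sum_sub_distrib]
      congr 1
      refine Finset.sum_congr rfl fun k _ => ?_
      rw [lin, D.leibniz, smul_add, smul_comm f, pow_succ, mul_neg_one, neg_smul, neg_smul]
      abel
    have hB : bracketTerm P.br (n + 1) (realForm R (n + 1) ω) (Matrix.vecCons (f • X) w) =
        f • bracketTerm P.br (n + 1) (realForm R (n + 1) ω) (Matrix.vecCons X w)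
        - (2 : ℝ) • ∑ k : Fin (n + 1), (-1 : ℤ) ^ (k : ℕ) •
            P.rho (w k) f • ω (Matrix.vecCons X (k.removeNth w)) := by
      rw [eB, eB, two_smul, smul_add, Finset.smul_sum, Finset.smul_sum,
        ← sub_sub, add_sub_right_comm, add_sub_assoc, ← Finset.sum_sub_distrib,
        ← Finset.sum_sub_distrib]
      congr 1
      · refine Finset.sum_congr rfl fun k _ => ?_
        rw [LieRinehartData.br_smul_left, addl, lin, lin, smul_sub, smul_comm f]
      · refine Finset.sum_congr rfl fun k _ => ?_
        simp only [lin2, P.leibniz, addl', lin]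
        rw [smul_comm f ((-1 : ℤ) ^ (k + 1 : ℕ)), smul_add f, Finset.smul_sum]
        simp only [smul_comm f]
        rw [pow_succ, mul_neg_one]
        simp only [neg_smul, smul_add]
        abel
    rw [koszul, AlternatingMap.sub_apply, AlternatingMap.sub_apply, AlternatingMap.smul_apply,
      AlternatingMap.smul_apply, hA, hB, smul_sub, smul_sub, smul_smul (2⁻¹ : ℝ) 2,
      smul_comm f]
    norm_num

theorem derivTerm_add (nab : L →ₗ[ℝ] N →ₗ[ℝ] N) (p : ℕ) (ω η : L [⋀^Fin p]→ₗ[ℝ] N) :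
    derivTerm nab p (ω + η) = derivTerm nab p ω + derivTerm nab p η := by
  ext v
  simp [derivTerm_apply, Finset.sum_add_distrib]

theorem derivTerm_smul (nab : L →ₗ[ℝ] N →ₗ[ℝ] N) (p : ℕ) (c : ℝ) (ω : L [⋀^Fin p]→ₗ[ℝ] N) :
    derivTerm nab p (c • ω) = c • derivTerm nab p ω := by
  ext v
  simp only [derivTerm_apply, AlternatingMap.smul_apply, Finset.smul_sum, map_smul, smul_comm c]

theorem bracketTerm_add (br : L →ₗ[ℝ] L →ₗ[ℝ] L) (p : ℕ) (ω η : L [⋀^Fin p]→ₗ[ℝ] N) :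
    bracketTerm br p (ω + η) = bracketTerm br p ω + bracketTerm br p η := by
  cases p with
  | zero => simp [bracketTerm]
  | succ n =>
    ext v
    simp [bracketTerm_apply_aux, Finset.sum_add_distrib]

theorem bracketTerm_smul (br : L →ₗ[ℝ] L →ₗ[ℝ] L) (p : ℕ) (c : ℝ) (ω : L [⋀^Fin p]→ₗ[ℝ] N) :
    bracketTerm br p (c • ω) = c • bracketTerm br p ω := by
  cases p with
  | zero => simp [bracketTerm]
  | succ n =>
    ext v
    simp only [bracketTerm_apply_aux, AlternatingMap.smul_apply, Finset.smul_sum, smul_comm c]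

/-- The operator `Ω^p(L; N) → Ω^{p+1}(L; N)` associated with a connection by the Koszul formula,
where `Ω^p(L; N)` is the space of alternating `R`-multilinear maps `L^p → N`. -/
def LieRinehartData.Connection.d (D : P.Connection N) (p : ℕ) :
    (L [⋀^Fin p]→ₗ[R] N) →ₗ[ℝ] L [⋀^Fin (p + 1)]→ₗ[R] N where
  toFun ω :=
    { toFun := koszul P.br (D.nabla.restrictScalars ℝ) p (realForm R p ω)
      map_update_add' := fun {inst} v i x y => by
        exact (koszul P.br (D.nabla.restrictScalars ℝ) p (realForm R p ω)).map_update_add v i x y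
      map_update_smul' := fun {inst} v i f x => by
        rw [Subsingleton.elim inst (instDecidableEqFin _)]
        exact linear_of_slot_zero _ (koszul_slot_zero D ω) v i f x
      map_eq_zero_of_eq' :=
        (koszul P.br (D.nabla.restrictScalars ℝ) p (realForm R p ω)).map_eq_zero_of_eq' }
  map_add' ω η := by
    ext v
    change koszul _ _ p (realForm R p (ω + η)) v = koszul _ _ p (realForm R p ω) v +
      koszul _ _ p (realForm R p η) v
    simp only [koszul, map_add, derivTerm_add, bracketTerm_add, smul_add,
      AlternatingMap.sub_apply, AlternatingMap.add_apply]
    abel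
  map_smul' c ω := by
    ext v
    change koszul _ _ p (realForm R p (c • ω)) v = c • koszul _ _ p (realForm R p ω) v
    simp only [koszul, map_smul, derivTerm_smul, bracketTerm_smul,
      AlternatingMap.sub_apply, AlternatingMap.smul_apply, smul_sub, smul_comm c]

theorem LieRinehartData.Connection.d_zero_apply (D : P.Connection N)
    (ω : L [⋀^Fin 0]→ₗ[R] N) (v : Fin 1 → L) : D.d 0 ω v = D.nabla (v 0) (ω ![]) :=
  koszul_zero_apply P.br (D.nabla.restrictScalars ℝ) (realForm R 0 ω) v

theorem LieRinehartData.Connection.d_succ_apply (D : P.Connection N) (n : ℕ)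
    (ω : L [⋀^Fin (n + 1)]→ₗ[R] N) (v : Fin (n + 2) → L) :
    D.d (n + 1) ω v =
      ∑ i : Fin (n + 2), (-1 : ℤ) ^ (i : ℕ) • D.nabla (v i) (ω (i.removeNth v))
      + ∑ i : Fin (n + 1), ∑ j ≥ i, (-1 : ℤ) ^ ((i.castSucc : ℕ) + (j.succ : ℕ)) •
        ω (Matrix.vecCons (P.br (v i.castSucc) (v j.succ))
          (j.removeNth (i.castSucc.removeNth v))) :=
  koszul_succ_apply P.br P.br_self (D.nabla.restrictScalars ℝ) n (realForm R (n + 1) ω) v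

variable (P) in
/-- The anchor, as a connection on `R`. Its operator is the differential `d_A` of scalar forms. -/
def LieRinehartData.trivialConnection : P.Connection R where
  nabla := 
    { toFun := fun X => (P.rho X : R →ₗ[ℝ] R)
      map_add' := fun X Y => by ext; simp
      map_smul' := fun f X => by ext; simp }
  leibniz X f g := by simp [mul_comm]
end Koszul

section Ops
variable {R L N N₁ N₂ N₃ NC NE : Type*} [CommRing R] [Algebra ℝ R]
  [AddCommGroup L] [Module R L] [Module ℝ L] [IsScalarTower ℝ R L]
  [AddCommGroup N] [Module R N] [Module ℝ N] [IsScalarTower ℝ R N]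
  [AddCommGroup N₁] [Module R N₁] [AddCommGroup N₂] [Module R N₂] [AddCommGroup N₃] [Module R N₃]
  [AddCommGroup NC] [Module R NC] [Module ℝ NC] [IsScalarTower ℝ R NC]
  [AddCommGroup NE] [Module R NE] [Module ℝ NE] [IsScalarTower ℝ R NE]

instance instIsScalarTowerForms (ι : Type*) : IsScalarTower ℝ R (L [⋀^ι]→ₗ[R] N) :=
  ⟨fun c f ω => by ext v; simp⟩

/-- The wedge product of forms with values combined by the bilinear map `B`:
`(ω ∧ η)(X_1, …, X_{p+q}) = ∑_s sgn(s) B(ω(X_{s(1)}, …, X_{s(p)}), η(X_{s(p+1)}, …, X_{s(p+q)}))`,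
the sum being over `(p, q)`-shuffles. -/
def wedge (B : N₁ →ₗ[R] N₂ →ₗ[R] N₃) (p q : ℕ) :
    (L [⋀^Fin p]→ₗ[R] N₁) →ₗ[R] (L [⋀^Fin q]→ₗ[R] N₂) →ₗ[R] L [⋀^Fin (p + q)]→ₗ[R] N₃ :=
  TensorProduct.curry
    ((AlternatingMap.domDomCongrₗ R finSumFinEquiv).toLinearMap ∘ₗ
      LinearMap.compAlternatingMapₗ R (TensorProduct.lift B) ∘ₗ AlternatingMap.domCoprod')

variable (R L N) in
/-- The space `Ω(L; N) = ⨁_p Ω^p(L; N)` of `N`-valued forms. For `L = Γ(A)` and `N = Γ(V)` with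
vector bundles `A`, `V` this is `Ω(A) ⊗ Γ(V)`. -/
def Forms : Type _ := DirectSum ℕ fun p => L [⋀^Fin p]→ₗ[R] N

instance : AddCommGroup (Forms R L N) :=
  inferInstanceAs (AddCommGroup (DirectSum ℕ fun p => L [⋀^Fin p]→ₗ[R] N))

instance : Module ℝ (Forms R L N) :=
  inferInstanceAs (Module ℝ (DirectSum ℕ fun p => L [⋀^Fin p]→ₗ[R] N))

/-- The inclusion of `p`-forms. -/
def Forms.of (p : ℕ) : (L [⋀^Fin p]→ₗ[R] N) →ₗ[ℝ] Forms R L N :=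
  DirectSum.lof ℝ ℕ (fun p => L [⋀^Fin p]→ₗ[R] N) p

/-- The component of form degree `p`. -/
def Forms.component (p : ℕ) : Forms R L N →ₗ[ℝ] (L [⋀^Fin p]→ₗ[R] N) :=
  DirectSum.component ℝ ℕ (fun p => L [⋀^Fin p]→ₗ[R] N) p

/-- The linear map determined by its restrictions to `p`-forms. -/
def Forms.lift {Q : Type*} [AddCommGroup Q] [Module ℝ Q]
    (φ : (p : ℕ) → (L [⋀^Fin p]→ₗ[R] N) →ₗ[ℝ] Q) : Forms R L N →ₗ[ℝ] Q :=
  DirectSum.toModule ℝ ℕ Q φ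

theorem Forms.lift_of {Q : Type*} [AddCommGroup Q] [Module ℝ Q]
    (φ : (p : ℕ) → (L [⋀^Fin p]→ₗ[R] N) →ₗ[ℝ] Q) (p : ℕ) (η : L [⋀^Fin p]→ₗ[R] N) :
    Forms.lift φ (Forms.of p η) = φ p η :=
  DirectSum.toModule_lof (R := ℝ) (φ := φ) p η

theorem Forms.hom_ext {Q : Type*} [AddCommGroup Q] [Module ℝ Q] {f g : Forms R L N →ₗ[ℝ] Q}
    (h : ∀ p (η : L [⋀^Fin p]→ₗ[R] N), f (Forms.of p η) = g (Forms.of p η)) : f = g :=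
  DirectSum.linearMap_ext ℝ fun p => LinearMap.ext fun η => h p η

/-- The operator on all forms given on `p`-forms by `φ p`, of form degree `k`. -/
def homogOp (k : ℕ) (φ : (p : ℕ) → (L [⋀^Fin p]→ₗ[R] N) →ₗ[ℝ] L [⋀^Fin (p + k)]→ₗ[R] N) :
    Module.End ℝ (Forms R L N) :=
  Forms.lift fun p => Forms.of (p + k) ∘ₗ φ p

theorem homogOp_of (k : ℕ) (φ : (p : ℕ) → (L [⋀^Fin p]→ₗ[R] N) →ₗ[ℝ] L [⋀^Fin (p + k)]→ₗ[R] N)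
    (p : ℕ) (η : L [⋀^Fin p]→ₗ[R] N) :
    homogOp k φ (Forms.of p η) = Forms.of (p + k) (φ p η) :=
  Forms.lift_of _ p η

/-- Left multiplication by a scalar form. -/
def wedgeLeft {p : ℕ} (ω : L [⋀^Fin p]→ₗ[R] R) : Module.End ℝ (Forms R L N) :=
  Forms.lift fun q =>
    Forms.of (p + q) ∘ₗ (wedge (LinearMap.lsmul R N) p q ω).restrictScalars ℝ

variable (NC NE) in
/-- The module of sections of `C[1] ⊕ E`. -/
def TwoTerm : Type _ := NC × NE

instance : AddCommGroup (TwoTerm NC NE) := inferInstanceAs (AddCommGroup (NC × NE))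

instance {S : Type*} [Semiring S] [Module S NC] [Module S NE] : Module S (TwoTerm NC NE) :=
  inferInstanceAs (Module S (NC × NE))

instance : IsScalarTower ℝ R (TwoTerm NC NE) := inferInstanceAs (IsScalarTower ℝ R (NC × NE))

variable (R NC NE) in
/-- The projection to `C`. -/
def toCore : TwoTerm NC NE →ₗ[R] NC := LinearMap.fst R NC NE

variable (R NC NE) in
/-- The projection to `E`. -/
def toSide : TwoTerm NC NE →ₗ[R] NE := LinearMap.snd R NC NE

variable (R NC NE) in
/-- The inclusion of `C`. -/
def ofCore : NC →ₗ[R] TwoTerm NC NE := LinearMap.inl R NC NE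

variable (R NC NE) in
/-- The inclusion of `E`. -/
def ofSide : NE →ₗ[R] TwoTerm NC NE := LinearMap.inr R NC NE

theorem toSide_ofCore (c : NC) : toSide R NC NE (ofCore R NC NE c) = 0 := rfl

/-- `ω ε ↦ ω ∧ θ(ε)`, `ω α ↦ 0`, for a `q`-form `θ` with values in `Hom(E, C)`. -/
def sideToCoreOp (q : ℕ) (θ : L [⋀^Fin q]→ₗ[R] (NE →ₗ[R] NC)) (p : ℕ) :
    (L [⋀^Fin p]→ₗ[R] TwoTerm NC NE) →ₗ[ℝ] L [⋀^Fin (p + q)]→ₗ[R] TwoTerm NC NE :=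
  (LinearMap.compAlternatingMapₗ R (ofCore R NC NE) ∘ₗ
    (wedge LinearMap.applyₗ p q).flip θ ∘ₗ
    LinearMap.compAlternatingMapₗ R (toSide R NC NE)).restrictScalars ℝ

end Ops

section Superconnections

variable {R L N NC NE : Type*} [CommRing R] [Algebra ℝ R]
  [AddCommGroup L] [Module R L] [Module ℝ L] [IsScalarTower ℝ R L]
  [AddCommGroup NC] [Module R NC] [Module ℝ NC] [IsScalarTower ℝ R NC]
  [AddCommGroup NE] [Module R NE] [Module ℝ NE] [IsScalarTower ℝ R NE]

/-- The operator `σ(ω ε) = ω ∧ σ(ε)`, `σ(ω α) = 0` on forms with values in `C[1] ⊕ E`. -/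
def sigmaOp (σ : L [⋀^Fin 1]→ₗ[R] (NE →ₗ[R] NC)) : Module.End ℝ (Forms R L (TwoTerm NC NE)) :=
  homogOp 1 fun p => sideToCoreOp 1 σ p

/-- The operator `Ω(ω ε) = (-1)^p ω ∧ Ω(ε)`, `Ω(ω α) = 0`, for `ω` of degree `p`. -/
def curvatureOp (Ω : L [⋀^Fin 2]→ₗ[R] (NE →ₗ[R] NC)) : Module.End ℝ (Forms R L (TwoTerm NC NE)) :=
  homogOp 2 fun p => (-1 : ℝ) ^ p • sideToCoreOp 2 Ω p

/-- The operator `∂(ω α) = (-1)^p ω ∂(α)`, `∂(ω ε) = 0`, for `ω` of degree `p`. -/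
def boundaryOp (bd : NC →ₗ[R] NE) : Module.End ℝ (Forms R L (TwoTerm NC NE)) :=
  homogOp 0 fun p => (-1 : ℝ) ^ p •
    (LinearMap.compAlternatingMapₗ R
      (ofSide R NC NE ∘ₗ bd ∘ₗ toCore R NC NE)).restrictScalars ℝ

variable {P : LieRinehartData R L}

/-- The operator `D^c` of a connection on `C`, extended by zero to `E`-valued forms. -/
def coreConnOp (D : P.Connection NC) : Module.End ℝ (Forms R L (TwoTerm NC NE)) :=
  homogOp 1 fun p =>
    (LinearMap.compAlternatingMapₗ R (ofCore R NC NE)).restrictScalars ℝ ∘ₗ D.d p ∘ₗ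
      (LinearMap.compAlternatingMapₗ R (toCore R NC NE)).restrictScalars ℝ

/-- The operator `D^s` of a connection on `E`, extended by zero to `C`-valued forms. -/
def sideConnOp (D : P.Connection NE) : Module.End ℝ (Forms R L (TwoTerm NC NE)) :=
  homogOp 1 fun p =>
    (LinearMap.compAlternatingMapₗ R (ofSide R NC NE)).restrictScalars ℝ ∘ₗ D.d p ∘ₗ
      (LinearMap.compAlternatingMapₗ R (toSide R NC NE)).restrictScalars ℝ

variable (P NC NE) in
/-- A quadruple `(∂, ∇^c, ∇^s, Ω)`: a linear map `C → E`, connections on `C` and on `E`, and a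
2-form with values in `Hom(E, C)`. -/
structure SuperData where
  bd : NC →ₗ[R] NE
  nablaC : P.Connection NC
  nablaS : P.Connection NE
  curv : L [⋀^Fin 2]→ₗ[R] (NE →ₗ[R] NC)

/-- The operator `𝒟 = ∂ + D^c + D^s + Ω`. -/
def SuperData.op (S : SuperData NC NE P) : Module.End ℝ (Forms R L (TwoTerm NC NE)) :=
  boundaryOp S.bd + coreConnOp S.nablaC + sideConnOp S.nablaS + curvatureOp S.curv

/-- `x` is homogeneous of total degree `n`; sections of `C` have degree `-1` and sections of `E`
have degree `0`. -/
def HasTotalDegree (x : Forms R L (TwoTerm NC NE)) (n : ℤ) : Prop :=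
  ∀ (p : ℕ) (v : Fin p → L),
    (toCore R NC NE (x.component p v) ≠ 0 → (p : ℤ) - 1 = n) ∧
    (toSide R NC NE (x.component p v) ≠ 0 → (p : ℤ) = n)

variable (P) in
/-- `𝒟` is a (degree `1`) superconnection on `C[1] ⊕ E`: it raises the total degree by one and
`𝒟(ω ∧ x) = (d_A ω) ∧ x + (-1)^p ω ∧ 𝒟 x` for every `p`-form `ω`. -/
structure IsSuperconnection (𝒟 : Module.End ℝ (Forms R L (TwoTerm NC NE))) : Prop where
  degree_one : ∀ (x : Forms R L (TwoTerm NC NE)) (n : ℤ),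
    HasTotalDegree x n → HasTotalDegree (𝒟 x) (n + 1)
  leibniz : ∀ (p : ℕ) (ω : L [⋀^Fin p]→ₗ[R] R) (x : Forms R L (TwoTerm NC NE)),
    𝒟 (wedgeLeft ω x) =
      wedgeLeft (P.trivialConnection.d p ω) x + (-1 : ℝ) ^ p • wedgeLeft ω (𝒟 x)

variable (P NC NE) in
/-- Flat (degree `1`) superconnections on `C[1] ⊕ E`. -/
structure FlatSuperconnection where
  op : Module.End ℝ (Forms R L (TwoTerm NC NE))
  isSuperconnection : IsSuperconnection P op
  flat : op * op = 0

theorem sideToCoreOp_comp (q r : ℕ) (θ : L [⋀^Fin q]→ₗ[R] (NE →ₗ[R] NC))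
    (τ : L [⋀^Fin r]→ₗ[R] (NE →ₗ[R] NC)) (p : ℕ) (η : L [⋀^Fin p]→ₗ[R] (TwoTerm NC NE)) :
    sideToCoreOp q θ (p + r) (sideToCoreOp r τ p η) = 0 := by
  have h : ∀ ζ : L [⋀^Fin (p + r)]→ₗ[R] NC,
      (toSide R NC NE).compAlternatingMap ((ofCore R NC NE).compAlternatingMap ζ)
        = 0 := by
    intro ζ; ext v; simp [toSide_ofCore]
  simp [sideToCoreOp, h]

theorem sigmaOp_mul (σ τ : L [⋀^Fin 1]→ₗ[R] (NE →ₗ[R] NC)) : sigmaOp σ * sigmaOp τ = 0 := by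
  refine Forms.hom_ext fun p η => ?_
  simp [sigmaOp, homogOp_of, sideToCoreOp_comp]

theorem sigmaOp_add (σ τ : L [⋀^Fin 1]→ₗ[R] (NE →ₗ[R] NC)) :
    sigmaOp (σ + τ) = sigmaOp σ + sigmaOp τ := by
  refine Forms.hom_ext fun p η => ?_
  simp [sigmaOp, homogOp_of, sideToCoreOp]

theorem sigmaOp_zero : sigmaOp (0 : L [⋀^Fin 1]→ₗ[R] (NE →ₗ[R] NC)) = 0 := by
  have h := sigmaOp_add (0 : L [⋀^Fin 1]→ₗ[R] (NE →ₗ[R] NC)) 0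
  rw [add_zero] at h
  exact left_eq_add.mp h

theorem sigmaOp_neg (σ : L [⋀^Fin 1]→ₗ[R] (NE →ₗ[R] NC)) : sigmaOp (-σ) = -sigmaOp σ := by
  have h := sigmaOp_add σ (-σ)
  rw [add_neg_cancel, sigmaOp_zero] at h
  exact (neg_eq_of_add_eq_zero_right h.symm).symm

/-- The automorphism `u = 1 + σ`, with inverse `1 - σ`. -/
def gauge (σ : L [⋀^Fin 1]→ₗ[R] (NE →ₗ[R] NC)) : (Module.End ℝ (Forms R L (TwoTerm NC NE)))ˣ where
  val := 1 + sigmaOp σ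
  inv := 1 - sigmaOp σ
  val_inv := by rw [add_mul, mul_sub, mul_sub, sigmaOp_mul]; simp
  inv_val := by rw [sub_mul, mul_add, mul_add, sigmaOp_mul]; simp

theorem gauge_add (σ τ : L [⋀^Fin 1]→ₗ[R] (NE →ₗ[R] NC)) :
    gauge (σ + τ) = gauge σ * gauge τ := by
  ext1
  change 1 + sigmaOp (σ + τ) = (1 + sigmaOp σ) * (1 + sigmaOp τ)
  rw [sigmaOp_add, add_mul, mul_add, mul_add, sigmaOp_mul]
  simp only [one_mul, mul_one, add_zero]
  abel

theorem gauge_zero : gauge (0 : L [⋀^Fin 1]→ₗ[R] (NE →ₗ[R] NC)) = 1 := by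
  ext1
  change 1 + sigmaOp 0 = 1
  rw [sigmaOp_zero, add_zero]

/-- Two flat superconnections are equivalent when they are conjugate under `u = 1 + σ` for some
`σ ∈ Ω¹(A) ⊗ Hom(E, C)`. -/
def FlatSuperconnection.Equivalent (𝒟 𝒟' : FlatSuperconnection NC NE P) : Prop :=
  ∃ σ : L [⋀^Fin 1]→ₗ[R] (NE →ₗ[R] NC),
    𝒟'.op = (gauge σ : Module.End ℝ (Forms R L (TwoTerm NC NE))) * 𝒟.op * ↑(gauge σ)⁻¹

variable (P NC NE) in
/-- Equivalence of flat superconnections. -/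
def FlatSuperconnection.setoid : Setoid (FlatSuperconnection NC NE P) where
  r := FlatSuperconnection.Equivalent
  iseqv :=
    { refl := fun 𝒟 => ⟨0, by simp [gauge_zero]⟩
      symm := by
        rintro 𝒟 𝒟' ⟨σ, h⟩
        have h1 : gauge (-σ) = (gauge σ)⁻¹ := by
          rw [eq_inv_iff_mul_eq_one, ← gauge_add, neg_add_cancel, gauge_zero]
        refine ⟨-σ, ?_⟩
        rw [h1, h, inv_inv]
        simp [mul_assoc]
      trans := by
        rintro 𝒟 𝒟' 𝒟'' ⟨σ, h⟩ ⟨τ, h'⟩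
        refine ⟨τ + σ, ?_⟩
        rw [h', h, gauge_add, mul_inv_rev]
        simp [mul_assoc] }

end Superconnections

open Bundle Manifold
open scoped ContDiff

section LA
variable {EM : Type*} [NormedAddCommGroup EM] [NormedSpace ℝ EM]
  {H : Type*} [TopologicalSpace H] (I : ModelWithCorners ℝ EM H)
  {M : Type*} [TopologicalSpace M] [ChartedSpace H M]
  (F : Type*) [NormedAddCommGroup F] [NormedSpace ℝ F]
  (V : M → Type*) [TopologicalSpace (TotalSpace F V)]
  [∀ x, AddCommGroup (V x)] [∀ x, Module ℝ (V x)] [∀ x, TopologicalSpace (V x)]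
  [FiberBundle F V] [VectorBundle ℝ F V]

/-- The space `Γ(V)` of smooth sections. -/
abbrev Sections : Type _ := Cₛ^∞⟮I; F, V⟯
variable (M) in
/-- The algebra `C^∞(M)`. -/
abbrev Fns : Type _ := C^∞⟮I, M; ℝ⟯
variable {I F V}
instance instSMulSections : SMul (Fns I M) (Sections I F V) :=
  ⟨fun f s => ⟨fun x => f x • s x, f.contMDiff.smul_section s.contMDiff⟩⟩

theorem smul_sec_apply (f : Fns I M) (s : Sections I F V) (x : M) : (f • s) x = f x • s x := rfl

instance instModuleSections : Module (Fns I M) (Sections I F V) where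
  one_smul s := by ext x; exact one_smul ℝ (s x)
  mul_smul f g s := by ext x; exact mul_smul (f x) (g x) (s x)
  smul_zero f := by ext x; exact smul_zero (f x)
  smul_add f s t := by ext x; exact smul_add (f x) (s x) (t x)
  add_smul f g s := by ext x; exact add_smul (f x) (g x) (s x)
  zero_smul s := by ext x; exact zero_smul ℝ (s x)

instance instTowerSections : IsScalarTower ℝ (Fns I M) (Sections I F V) :=
  ⟨fun c f s => by ext x; exact smul_assoc c (f x) (s x)⟩

variable (I F V) in
/-- A Lie algebroid structure on the vector bundle `V`: a smooth bundle map `anchor : V → TM` and a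
Lie bracket on `Γ(V)` such that `[X, f Y] = f [X, Y] + (anchor(X) f) Y`. -/
structure LieAlgebroid [IsManifold I ∞ M] where
  anchor : (x : M) → V x →ₗ[ℝ] TangentSpace I x
  contMDiff_anchor : ContMDiff (I.prod 𝓘(ℝ, F)) I.tangent ∞
    (fun v : TotalSpace F V => (⟨v.proj, anchor v.proj v.snd⟩ : TangentBundle I M))
  bracket : Sections I F V →ₗ[ℝ] Sections I F V →ₗ[ℝ] Sections I F V
  bracket_self : ∀ X, bracket X X = 0
  jacobi : ∀ X Y Z, bracket X (bracket Y Z) = bracket (bracket X Y) Z + bracket Y (bracket X Z)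
  leibniz : ∀ (X : Sections I F V) (f : Fns I M) (Y : Sections I F V) (x : M),
    bracket X (f • Y) x = f x • bracket X Y x + mvfderiv I f x (anchor x (X x)) • Y x

theorem contMDiff_mvfderiv_apply [IsManifold I ∞ M] (f : Fns I M) (v : (x : M) → TangentSpace I x)
    (hv : ContMDiff I I.tangent ∞ (fun x => (⟨x, v x⟩ : TangentBundle I M))) :
    ContMDiff I 𝓘(ℝ, ℝ) ∞ (fun x => mvfderiv I f x (v x)) := by
  have h1 : ContMDiff I (𝓘(ℝ, ℝ).tangent) ∞
      (fun x => tangentMap I 𝓘(ℝ, ℝ) f (⟨x, v x⟩ : TangentBundle I M)) :=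
    (f.contMDiff.contMDiff_tangentMap (m := ∞) (by simp)).comp hv
  exact (contMDiff_snd_tangentBundle_modelSpace ℝ 𝓘(ℝ, ℝ)).comp h1

variable [IsManifold I ∞ M] (LA : LieAlgebroid I F V)

/-- The anchor as a map of total spaces. -/
def LieAlgebroid.anchorMap (v : TotalSpace F V) : TangentBundle I M :=
  ⟨v.proj, LA.anchor v.proj v.snd⟩

/-- The function `anchor(X) f`. -/
def LieAlgebroid.derivFn (X : Sections I F V) (f : Fns I M) : Fns I M :=
  ⟨fun x => mvfderiv I f x (LA.anchor x (X x)),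
    contMDiff_mvfderiv_apply f _ (LA.contMDiff_anchor.comp X.contMDiff)⟩

theorem LieAlgebroid.derivFn_apply (X : Sections I F V) (f : Fns I M) (x : M) :
    LA.derivFn X f x = mvfderiv I f x (LA.anchor x (X x)) := rfl

theorem mdiffAt_fn (f : Fns I M) (x : M) : MDifferentiableAt I 𝓘(ℝ, ℝ) f x :=
  f.contMDiff.mdifferentiable (by simp) x

/-- The derivation `f ↦ anchor(X) f`. -/
def LieAlgebroid.derivation (X : Sections I F V) : Derivation ℝ (Fns I M) (Fns I M) :=
  Derivation.mk'
    { toFun := LA.derivFn X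
      map_add' := fun f g => by
        ext x
        change mvfderiv I (f + g : M → ℝ) x _ = _
        rw [mvfderiv_add (mdiffAt_fn f x) (mdiffAt_fn g x)]
        rfl
      map_smul' := fun c f => by
        ext x
        have h : ((c • f : Fns I M) : M → ℝ) = (fun _ : M => c) • (f : M → ℝ) := rfl
        change mvfderiv I ((c • f : Fns I M) : M → ℝ) x _ = c • mvfderiv I f x _
        rw [h, mvfderiv_smul mdifferentiableAt_const (mdiffAt_fn f x), mvfderiv_const]
        simp }
    (fun f g => by
      ext x
      change mvfderiv I ((f : M → ℝ) * (g : M → ℝ)) x _ = f x * mvfderiv I g x _ + g x * mvfderiv I f x _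
      rw [mvfderiv_mul (mdiffAt_fn f x) (mdiffAt_fn g x)]
      simp)

/-- The algebraic structure on `Γ(V)` over `C^∞(M)` carried by a Lie algebroid. -/
def LieAlgebroid.lieRinehart : LieRinehartData (Fns I M) (Sections I F V) where
  br := LA.bracket
  rho :=
    { toFun := LA.derivation
      map_add' := fun X Y => by
        ext f x
        change mvfderiv I f x (LA.anchor x (X x + Y x)) =
          mvfderiv I f x (LA.anchor x (X x)) + mvfderiv I f x (LA.anchor x (Y x))
        rw [map_add, map_add]
      map_smul' := fun g X => by
        ext f x
        change mvfderiv I f x (LA.anchor x (g x • X x)) =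
          g x • mvfderiv I f x (LA.anchor x (X x))
        rw [map_smul, map_smul] }
  br_self := LA.bracket_self
  jacobi := LA.jacobi
  leibniz X f Y := by
    ext x
    exact LA.leibniz X f Y x

end LA
section Geometry
universe u v w

/-- The relation `c = a + b` in a vector bundle, for points `a, b, c` of the same fibre. -/
def AddRel {B F : Type*} {V : B → Type*} [∀ x, AddCommGroup (V x)] (p q r : Bundle.TotalSpace F V) :
    Prop :=
  ∃ (x : B) (a b : V x), p = ⟨x, a⟩ ∧ q = ⟨x, b⟩ ∧ r = ⟨x, a + b⟩

/-- Fibrewise scalar multiplication. -/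
def scale {B F : Type*} {V : B → Type*} [∀ x, AddCommGroup (V x)] [∀ x, Module ℝ (V x)] (t : ℝ)
    (p : Bundle.TotalSpace F V) : Bundle.TotalSpace F V :=
  ⟨p.proj, t • p.snd⟩

/-- A smooth real vector bundle of finite rank over `B`, bundled. -/
structure SmoothVectorBundle {EB : Type*} [NormedAddCommGroup EB] [NormedSpace ℝ EB]
    {HB : Type*} [TopologicalSpace HB] (I : ModelWithCorners ℝ EB HB)
    (B : Type*) [TopologicalSpace B] [ChartedSpace HB B] where
  Model : Type u
  [normedAddCommGroup : NormedAddCommGroup Model]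
  [normedSpace : NormedSpace ℝ Model]
  [finiteDimensional : FiniteDimensional ℝ Model]
  Fiber : B → Type u
  [addCommGroup : ∀ x, AddCommGroup (Fiber x)]
  [module : ∀ x, Module ℝ (Fiber x)]
  [topologicalSpace : ∀ x, TopologicalSpace (Fiber x)]
  [topologicalSpaceTotal : TopologicalSpace (Bundle.TotalSpace Model Fiber)]
  [fiberBundle : FiberBundle Model Fiber]
  [vectorBundle : VectorBundle ℝ Model Fiber]
  [contMDiffVectorBundle : ContMDiffVectorBundle ∞ Model Fiber I]

attribute [instance] SmoothVectorBundle.normedAddCommGroup SmoothVectorBundle.normedSpace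
  SmoothVectorBundle.finiteDimensional SmoothVectorBundle.addCommGroup SmoothVectorBundle.module
  SmoothVectorBundle.topologicalSpace SmoothVectorBundle.topologicalSpaceTotal
  SmoothVectorBundle.fiberBundle SmoothVectorBundle.vectorBundle
  SmoothVectorBundle.contMDiffVectorBundle

variable {EM : Type v} [NormedAddCommGroup EM] [NormedSpace ℝ EM]
  {M : Type w} [TopologicalSpace M] [ChartedSpace EM M]
  {FA : Type u} [NormedAddCommGroup FA] [NormedSpace ℝ FA]
  {A : M → Type u} [TopologicalSpace (Bundle.TotalSpace FA A)]
  [∀ x, AddCommGroup (A x)] [∀ x, Module ℝ (A x)] [∀ x, TopologicalSpace (A x)]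
  [FiberBundle FA A] [VectorBundle ℝ FA A]
  {FE : Type u} [NormedAddCommGroup FE] [NormedSpace ℝ FE]
  {E : M → Type u} [TopologicalSpace (Bundle.TotalSpace FE E)]
  [∀ x, AddCommGroup (E x)] [∀ x, Module ℝ (E x)] [∀ x, TopologicalSpace (E x)]
  [FiberBundle FE E] [VectorBundle ℝ FE E]
  {FC : Type u} [NormedAddCommGroup FC] [NormedSpace ℝ FC]
  {C : M → Type u} [TopologicalSpace (Bundle.TotalSpace FC C)]
  [∀ x, AddCommGroup (C x)] [∀ x, Module ℝ (C x)] [∀ x, TopologicalSpace (C x)]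
  [FiberBundle FC C] [VectorBundle ℝ FC C]

variable (EM FA A FE E FC C) in
/-- A double vector bundle with side bundles `A → M`, `E → M` and core `C → M`. The total space `D`
is that of the vector bundle `overE` over `E`; it is identified by the diffeomorphism `swap` with
the total space of the vector bundle `overA` over `A`. The two vector bundle structures are
compatible: the projections to `A` and to `E` are linear (`projA_add`, …, `projE_scale`), and
additions and scalar multiplications satisfy the interchange laws (the laws with scalars follow
from `interchange` by continuity). The map `core` identifies `C` with the intersection of the
kernels of `D → A` and `D → E`. -/
structure DoubleVectorBundle where
  overE : SmoothVectorBundle.{u} (𝓘(ℝ, EM).prod 𝓘(ℝ, FE)) (Bundle.TotalSpace FE E)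
  overA : SmoothVectorBundle.{u} (𝓘(ℝ, EM).prod 𝓘(ℝ, FA)) (Bundle.TotalSpace FA A)
  swap : Diffeomorph ((𝓘(ℝ, EM).prod 𝓘(ℝ, FE)).prod 𝓘(ℝ, overE.Model))
    ((𝓘(ℝ, EM).prod 𝓘(ℝ, FA)).prod 𝓘(ℝ, overA.Model))
    (Bundle.TotalSpace overE.Model overE.Fiber) (Bundle.TotalSpace overA.Model overA.Fiber) ∞
  proj_comm : ∀ d, (swap d).proj.proj = d.proj.proj
  projA_add : ∀ d₁ d₂ d, AddRel d₁ d₂ d → AddRel (swap d₁).proj (swap d₂).proj (swap d).proj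
  projA_scale : ∀ (t : ℝ) d, (swap (scale t d)).proj = scale t (swap d).proj
  projE_add : ∀ d₁ d₂ d, AddRel (swap d₁) (swap d₂) (swap d) → AddRel d₁.proj d₂.proj d.proj
  projE_scale : ∀ (t : ℝ) d, (swap.symm (scale t (swap d))).proj = scale t d.proj
  interchange : ∀ d₁ d₂ d₃ d₄ d₁₂ d₃₄ d₁₃ d₂₄ d,
    AddRel d₁ d₂ d₁₂ → AddRel d₃ d₄ d₃₄ →
    AddRel (swap d₁) (swap d₃) (swap d₁₃) → AddRel (swap d₂) (swap d₄) (swap d₂₄) →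
    AddRel (swap d₁₂) (swap d₃₄) (swap d) → AddRel d₁₃ d₂₄ d
  scaleA_add : ∀ (t : ℝ) d₁ d₂ d, AddRel d₁ d₂ d →
    AddRel (swap.symm (scale t (swap d₁))) (swap.symm (scale t (swap d₂)))
      (swap.symm (scale t (swap d)))
  scaleE_add : ∀ (t : ℝ) d₁ d₂ d, AddRel (swap d₁) (swap d₂) (swap d) →
    AddRel (swap (scale t d₁)) (swap (scale t d₂)) (swap (scale t d))
  scale_comm : ∀ (s t : ℝ) d,
    swap.symm (scale s (swap (scale t d))) = scale t (swap.symm (scale s (swap d)))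
  core : Bundle.TotalSpace FC C → Bundle.TotalSpace overE.Model overE.Fiber
  contMDiff_core : ContMDiff (𝓘(ℝ, EM).prod 𝓘(ℝ, FC))
    ((𝓘(ℝ, EM).prod 𝓘(ℝ, FE)).prod 𝓘(ℝ, overE.Model)) ∞ core
  core_projE : ∀ c, (core c).proj = Bundle.zeroSection FE E c.proj
  core_projA : ∀ c, (swap (core c)).proj = Bundle.zeroSection FA A c.proj
  core_add : ∀ c₁ c₂ c, AddRel c₁ c₂ c → AddRel (core c₁) (core c₂) (core c)
  core_scale : ∀ (t : ℝ) c, core (scale t c) = scale t (core c)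
  core_exists_unique : ∀ (x : M) d, d.proj = Bundle.zeroSection FE E x →
    (swap d).proj = Bundle.zeroSection FA A x → ∃! c, c.proj = x ∧ core c = d

namespace DoubleVectorBundle

variable (D : DoubleVectorBundle EM FA A FE E FC C)

/-- The total space `D`. -/
abbrev Total : Type _ := Bundle.TotalSpace D.overE.Model D.overE.Fiber

/-- The space `Γ(D, E)` of smooth sections of `D → E`. -/
abbrev SectionsE : Type _ :=
  Sections (𝓘(ℝ, EM).prod 𝓘(ℝ, FE)) D.overE.Model D.overE.Fiber

/-- The projection `q^D_A : D → A`. -/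
def projA (d : D.Total) : Bundle.TotalSpace FA A := (D.swap d).proj

/-- `d = d₁ +_A d₂`. -/
def AddA (d₁ d₂ d : D.Total) : Prop := AddRel (D.swap d₁) (D.swap d₂) (D.swap d)

/-- Scalar multiplication in the fibres of `D → A`. -/
def scaleA (t : ℝ) (d : D.Total) : D.Total := D.swap.symm (scale t (D.swap d))

/-- The zero section `E → D`. -/
def zeroE (e : Bundle.TotalSpace FE E) : D.Total := ⟨e, 0⟩

variable {D}

/-- The point `X(e)` of the total space of `D`. -/
def at_ (X : D.SectionsE) (e : Bundle.TotalSpace FE E) : D.Total := ⟨e, X e⟩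

/-- `X` is a linear section with base section `X₀`: a vector bundle morphism from `E → M` to
`D → A` over `X₀ : M → A`. -/
structure IsLinearOver (X : D.SectionsE) (X₀ : Sections 𝓘(ℝ, EM) FA A) : Prop where
  projA_eq : ∀ e, D.projA (at_ X e) = ⟨e.proj, X₀ e.proj⟩
  add : ∀ e₁ e₂ e, AddRel e₁ e₂ e → D.AddA (at_ X e₁) (at_ X e₂) (at_ X e)
  scale : ∀ (t : ℝ) e, at_ X (scale t e) = D.scaleA t (at_ X e)

/-- `X` is the core section defined by `α ∈ Γ(C)`: `X(e) = ι(α(q(e))) +_A 0_e`. -/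
def IsCoreOf (X : D.SectionsE) (α : Sections 𝓘(ℝ, EM) FC C) : Prop :=
  ∀ e, D.AddA (D.core ⟨e.proj, α e.proj⟩) (D.zeroE e) (at_ X e)

/-- `X` is the linear section over `0` defined by the bundle map `φ ∈ Hom(E, C)`:
`X(ε(x)) = ι(φ(ε)(x)) +_A 0_{ε(x)}` for every section `ε` of `E`. -/
def IsHomSection (X : D.SectionsE)
    (φ : Sections 𝓘(ℝ, EM) FE E →ₗ[Fns 𝓘(ℝ, EM) M] Sections 𝓘(ℝ, EM) FC C) : Prop :=
  ∀ (ε : Sections 𝓘(ℝ, EM) FE E) (x : M),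
    D.AddA (D.core ⟨x, φ ε x⟩) (D.zeroE ⟨x, ε x⟩) (at_ X ⟨x, ε x⟩)

variable (D) in
/-- A horizontal lift: a `C^∞(M)`-linear map `h` from `Γ(A)` to the linear sections of `D → E` such
that `h(X)` has base section `X`. -/
structure HorizontalLift where
  lift : Sections 𝓘(ℝ, EM) FA A → D.SectionsE
  lift_add : ∀ X Y, lift (X + Y) = lift X + lift Y
  lift_smul : ∀ (f : Fns 𝓘(ℝ, EM) M) X e, lift (f • X) e = f e.proj • lift X e
  isLinearOver : ∀ X, IsLinearOver (lift X) X

end DoubleVectorBundle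

/-- The relation `v = v₁ +_{TM} v₂` in the vector bundle `TE → TM` whose addition is the
differential of `+ : E ×_M E → E`. -/
def TangentAdd (v₁ v₂ v : TangentBundle (𝓘(ℝ, EM).prod 𝓘(ℝ, FE)) (Bundle.TotalSpace FE E)) :
    Prop :=
  ∃ w : TangentBundle (𝓘(ℝ, EM).prod 𝓘(ℝ, FE × FE)) (Bundle.TotalSpace (FE × FE) (E ×ᵇ E)),
    tangentMap (𝓘(ℝ, EM).prod 𝓘(ℝ, FE × FE)) (𝓘(ℝ, EM).prod 𝓘(ℝ, FE))
        (fun p => (⟨p.proj, p.snd.1⟩ : Bundle.TotalSpace FE E)) w = v₁ ∧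
    tangentMap (𝓘(ℝ, EM).prod 𝓘(ℝ, FE × FE)) (𝓘(ℝ, EM).prod 𝓘(ℝ, FE))
        (fun p => (⟨p.proj, p.snd.2⟩ : Bundle.TotalSpace FE E)) w = v₂ ∧
    tangentMap (𝓘(ℝ, EM).prod 𝓘(ℝ, FE × FE)) (𝓘(ℝ, EM).prod 𝓘(ℝ, FE))
        (fun p => (⟨p.proj, p.snd.1 + p.snd.2⟩ : Bundle.TotalSpace FE E)) w = v

/-- Smooth functions on `E` that are linear on the fibres, i.e. sections of `E*`. -/
structure IsFiberLinear (l : Bundle.TotalSpace FE E → ℝ) : Prop where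
  contMDiff : ContMDiff (𝓘(ℝ, EM).prod 𝓘(ℝ, FE)) 𝓘(ℝ, ℝ) ∞ l
  linear : ∀ x, IsLinearMap ℝ fun v : E x => l ⟨x, v⟩

variable [IsManifold 𝓘(ℝ, EM) ∞ M] [ContMDiffVectorBundle ∞ FE E 𝓘(ℝ, EM)]

variable (FE E FC C) in
open DoubleVectorBundle in
/-- A VB-algebroid with sides `A`, `E` and core `C` which induces the given Lie algebroid structure
`LA` on `A`: a double vector bundle with a Lie algebroid structure on `D → E` whose anchor
`D → TE` is a bundle morphism from `D → A` to `TE → TM` over the anchor of `A`, and whose bracket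
maps linear sections over `X₀`, `Y₀` to a linear section over `[X₀, Y₀]`, a linear and a core
section to a core section, and two core sections to zero. -/
structure VBAlgebroid (LA : LieAlgebroid 𝓘(ℝ, EM) FA A) where
  dvb : DoubleVectorBundle EM FA A FE E FC C
  alg : LieAlgebroid (𝓘(ℝ, EM).prod 𝓘(ℝ, FE)) dvb.overE.Model dvb.overE.Fiber
  anchor_base : ∀ d, tangentMap (𝓘(ℝ, EM).prod 𝓘(ℝ, FE)) 𝓘(ℝ, EM) Bundle.TotalSpace.proj
    (alg.anchorMap d) = LA.anchorMap (dvb.projA d)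
  anchor_add : ∀ d₁ d₂ d, dvb.AddA d₁ d₂ d →
    TangentAdd (alg.anchorMap d₁) (alg.anchorMap d₂) (alg.anchorMap d)
  anchor_scale : ∀ (t : ℝ) d, alg.anchorMap (dvb.scaleA t d) =
    tangentMap (𝓘(ℝ, EM).prod 𝓘(ℝ, FE)) (𝓘(ℝ, EM).prod 𝓘(ℝ, FE)) (scale t) (alg.anchorMap d)
  bracket_linear : ∀ X X₀ Y Y₀, IsLinearOver X X₀ → IsLinearOver Y Y₀ →
    IsLinearOver (alg.bracket X Y) (LA.bracket X₀ Y₀)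
  bracket_core : ∀ X X₀ a α, IsLinearOver X X₀ → IsCoreOf a α → ∃ β, IsCoreOf (alg.bracket X a) β
  bracket_core_core : ∀ a α b β, IsCoreOf a α → IsCoreOf b β → alg.bracket a b = 0

namespace VBAlgebroid

open DoubleVectorBundle

variable {LA : LieAlgebroid 𝓘(ℝ, EM) FA A}

/-- An isomorphism of VB-algebroids with the same sides and core: a diffeomorphism that is linear
for both vector bundle structures, induces the identity of `A`, `E` and `C`, and preserves anchors
and brackets. -/
structure Iso (D D' : VBAlgebroid FE E FC C LA) where
  map : Diffeomorph ((𝓘(ℝ, EM).prod 𝓘(ℝ, FE)).prod 𝓘(ℝ, D.dvb.overE.Model))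
    ((𝓘(ℝ, EM).prod 𝓘(ℝ, FE)).prod 𝓘(ℝ, D'.dvb.overE.Model)) D.dvb.Total D'.dvb.Total ∞
  projE : ∀ d, (map d).proj = d.proj
  projA : ∀ d, D'.dvb.projA (map d) = D.dvb.projA d
  addE : ∀ d₁ d₂ d, AddRel (map d₁) (map d₂) (map d) ↔ AddRel d₁ d₂ d
  scaleE : ∀ (t : ℝ) d, map (scale t d) = scale t (map d)
  addA : ∀ d₁ d₂ d, D'.dvb.AddA (map d₁) (map d₂) (map d) ↔ D.dvb.AddA d₁ d₂ d
  scaleA : ∀ (t : ℝ) d, map (D.dvb.scaleA t d) = D'.dvb.scaleA t (map d)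
  core : ∀ c, map (D.dvb.core c) = D'.dvb.core c
  anchor : ∀ d, D'.alg.anchorMap (map d) = D.alg.anchorMap d
  bracket : ∀ (X Y : D.dvb.SectionsE) (X' Y' : D'.dvb.SectionsE),
    (∀ e, map (at_ X e) = at_ X' e) → (∀ e, map (at_ Y e) = at_ Y' e) →
    ∀ e, map (at_ (D.alg.bracket X Y) e) = at_ (D'.alg.bracket X' Y') e

/-- The identity. -/
def Iso.refl (D : VBAlgebroid FE E FC C LA) : Iso D D where
  map := Diffeomorph.refl _ _ _
  projE _ := rfl
  projA _ := rfl
  addE _ _ _ := Iff.rfl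
  scaleE _ _ := rfl
  addA _ _ _ := Iff.rfl
  scaleA _ _ := rfl
  core _ := rfl
  anchor _ := rfl
  bracket X Y X' Y' hX hY e := by
    have inj : ∀ Z Z' : D.dvb.SectionsE, (∀ e, at_ Z e = at_ Z' e) → Z = Z' := by
      intro Z Z' h
      ext e
      exact eq_of_heq (Bundle.TotalSpace.mk.inj (h e)).2
    rw [inj X X' hX, inj Y Y' hY]
    rfl

/-- The inverse. -/
def Iso.symm {D D' : VBAlgebroid FE E FC C LA} (Φ : Iso D D') : Iso D' D where
  map := Φ.map.symm
  projE d := by rw [← Φ.projE, Φ.map.apply_symm_apply]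
  projA d := by rw [← Φ.projA, Φ.map.apply_symm_apply]
  addE d₁ d₂ d := by
    rw [← Φ.addE, Φ.map.apply_symm_apply, Φ.map.apply_symm_apply, Φ.map.apply_symm_apply]
  scaleE t d := Φ.map.injective (by
    change Φ.map _ = Φ.map _
    rw [Φ.scaleE]
    simp only [Φ.map.apply_symm_apply])
  addA d₁ d₂ d := by
    rw [← Φ.addA, Φ.map.apply_symm_apply, Φ.map.apply_symm_apply, Φ.map.apply_symm_apply]
  scaleA t d := Φ.map.injective (by
    change Φ.map _ = Φ.map _
    rw [Φ.scaleA]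
    simp only [Φ.map.apply_symm_apply])
  core c := Φ.map.injective (by
    change Φ.map _ = Φ.map _
    rw [Φ.core]
    simp only [Φ.map.apply_symm_apply])
  anchor d := by rw [← Φ.anchor, Φ.map.apply_symm_apply]
  bracket X Y X' Y' hX hY e := by
    have h := Φ.bracket X' Y' X Y (fun e => by rw [← hX, Φ.map.apply_symm_apply])
      (fun e => by rw [← hY, Φ.map.apply_symm_apply]) e
    rw [← h, Φ.map.symm_apply_apply]

/-- The composition. -/
def Iso.trans {D D' D'' : VBAlgebroid FE E FC C LA} (Φ : Iso D D') (Ψ : Iso D' D'') : Iso D D'' where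
  map := Φ.map.trans Ψ.map
  projE d := (Ψ.projE _).trans (Φ.projE d)
  projA d := (Ψ.projA _).trans (Φ.projA d)
  addE d₁ d₂ d := (Ψ.addE _ _ _).trans (Φ.addE d₁ d₂ d)
  scaleE t d := (congrArg Ψ.map (Φ.scaleE t d)).trans (Ψ.scaleE t _)
  addA d₁ d₂ d := (Ψ.addA _ _ _).trans (Φ.addA d₁ d₂ d)
  scaleA t d := (congrArg Ψ.map (Φ.scaleA t d)).trans (Ψ.scaleA t _)
  core c := (congrArg Ψ.map (Φ.core c)).trans (Ψ.core c)
  anchor d := (Ψ.anchor _).trans (Φ.anchor d)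
  bracket X Y X'' Y'' hX hY e := by
    have key : ∀ (Z : D.dvb.SectionsE) (Z'' : D''.dvb.SectionsE),
        (∀ e, Ψ.map (Φ.map (at_ Z e)) = at_ Z'' e) →
        ∃ Z' : D'.dvb.SectionsE, (∀ e, Φ.map (at_ Z e) = at_ Z' e) ∧
          ∀ e, Ψ.map (at_ Z' e) = at_ Z'' e := by
      intro Z Z'' h
      have hp : ∀ e, (Φ.map (at_ Z e)).proj = e := fun e => Φ.projE _
      let s : (e : Bundle.TotalSpace FE E) → D'.dvb.overE.Fiber e := fun e =>
        cast (congrArg D'.dvb.overE.Fiber (hp e)) (Φ.map (at_ Z e)).snd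
      have hs : ∀ e, Φ.map (at_ Z e) = ⟨e, s e⟩ := by
        intro e
        have : ∀ (d : D'.dvb.Total) (h : d.proj = e),
            d = ⟨e, cast (congrArg D'.dvb.overE.Fiber h) d.snd⟩ := by
          rintro ⟨b, v⟩ rfl
          rfl
        exact this _ (hp e)
      let Z' : D'.dvb.SectionsE := ⟨s, by
        have := Φ.map.contMDiff.comp Z.contMDiff
        exact this.congr fun e => (hs e).symm⟩
      exact ⟨Z', hs, fun e => by rw [← h e, hs e]; rfl⟩
    obtain ⟨X', hX₁, hX₂⟩ := key X X'' hX
    obtain ⟨Y', hY₁, hY₂⟩ := key Y Y'' hY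
    change Ψ.map (Φ.map _) = _
    rw [Φ.bracket X Y X' Y' hX₁ hY₁, Ψ.bracket X' Y' X'' Y'' hX₂ hY₂]

variable (FE E FC C LA) in
/-- Isomorphism of VB-algebroids, as an equivalence relation. -/
def setoid : Setoid (VBAlgebroid FE E FC C LA) where
  r D D' := Nonempty (Iso D D')
  iseqv :=
    { refl := fun D => ⟨Iso.refl D⟩
      symm := fun ⟨Φ⟩ => ⟨Φ.symm⟩
      trans := fun ⟨Φ⟩ ⟨Ψ⟩ => ⟨Φ.trans Ψ⟩ }

/-- The data `(∂, ∇^c, ∇^s, Ω)` obtained from the VB-algebroid `D` and the horizontal lift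
`X ↦ X̂ = h(X)`:
* `⟨∂ α, l⟩ = - ρ_D(α)(l)` for `α ∈ Γ(C)` and every fibrewise linear function `l` on `E`;
* `∇^c_X α = [X̂, α]_D`;
* `⟨∇^s_X ε, l⟩ = ρ_A(X)⟨ε, l⟩ - ⟨ε, ρ_D(X̂)(l)⟩`;
* `Ω_{X,Y} = h([X, Y]) - [X̂, Ŷ]_D`. -/
structure IsAssociated (D : VBAlgebroid FE E FC C LA) (h : HorizontalLift D.dvb)
    (S : SuperData (Sections 𝓘(ℝ, EM) FC C) (Sections 𝓘(ℝ, EM) FE E) LA.lieRinehart) : Prop where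
  bd : ∀ (α : Sections 𝓘(ℝ, EM) FC C) (a : D.dvb.SectionsE), IsCoreOf a α →
    ∀ l : Bundle.TotalSpace FE E → ℝ, IsFiberLinear (EM := EM) l → ∀ e : Bundle.TotalSpace FE E,
      l ⟨e.proj, S.bd α e.proj⟩ =
        -mvfderiv (𝓘(ℝ, EM).prod 𝓘(ℝ, FE)) l e (D.alg.anchor e (a e))
  nablaC : ∀ (X : Sections 𝓘(ℝ, EM) FA A) (α : Sections 𝓘(ℝ, EM) FC C) (a : D.dvb.SectionsE),
    IsCoreOf a α → IsCoreOf (D.alg.bracket (h.lift X) a) (S.nablaC.nabla X α)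
  nablaS : ∀ (X : Sections 𝓘(ℝ, EM) FA A) (ε : Sections 𝓘(ℝ, EM) FE E)
    (l : Bundle.TotalSpace FE E → ℝ), IsFiberLinear (EM := EM) l → ∀ x : M,
      l ⟨x, S.nablaS.nabla X ε x⟩ =
        mvfderiv 𝓘(ℝ, EM) (fun y => l ⟨y, ε y⟩) x (LA.anchor x (X x)) -
        mvfderiv (𝓘(ℝ, EM).prod 𝓘(ℝ, FE)) l ⟨x, ε x⟩
          (D.alg.anchor ⟨x, ε x⟩ (h.lift X ⟨x, ε x⟩))
  curv : ∀ X Y : Sections 𝓘(ℝ, EM) FA A,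
    IsHomSection (h.lift (LA.bracket X Y) - D.alg.bracket (h.lift X) (h.lift Y)) (S.curv ![X, Y])

/-- `𝒟 = ∂ + D^c + D^s + Ω` is the superconnection of `D` and the horizontal lift `h`. -/
def IsSuperconnectionOf (D : VBAlgebroid FE E FC C LA) (h : HorizontalLift D.dvb)
    (𝒟 : Module.End ℝ (Forms (Fns 𝓘(ℝ, EM) M) (Sections 𝓘(ℝ, EM) FA A)
      (TwoTerm (Sections 𝓘(ℝ, EM) FC C) (Sections 𝓘(ℝ, EM) FE E)))) : Prop :=
  ∃ S, IsAssociated D h S ∧ 𝒟 = S.op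

/-- The horizontal lifts `h` and `h'` differ by `σ`: `h'(X) - h(X) = σ_X` for all `X ∈ Γ(A)`. -/
def DifferBy {D : DoubleVectorBundle EM FA A FE E FC C} (h h' : HorizontalLift D)
    (σ : Sections 𝓘(ℝ, EM) FA A [⋀^Fin 1]→ₗ[Fns 𝓘(ℝ, EM) M]
      (Sections 𝓘(ℝ, EM) FE E →ₗ[Fns 𝓘(ℝ, EM) M] Sections 𝓘(ℝ, EM) FC C)) : Prop :=
  ∀ X, IsHomSection (h'.lift X - h.lift X) (σ ![X])

end VBAlgebroid

end Geometry

end VBA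

end

open VBA Bundle Manifold
open scoped ContDiff
universe u v w

set_option linter.unusedSectionVars false

noncomputable section

namespace VBA

section Cartan

open AlternatingMap

section Wedge

variable {R L N₁ N₂ N₃ : Type*} [CommRing R] [AddCommGroup L] [Module R L]
  [AddCommGroup N₁] [Module R N₁] [AddCommGroup N₂] [Module R N₂] [AddCommGroup N₃] [Module R N₃]

/-- The full antisymmetrisation of `B(θ, η)`. -/
def altSum (B : N₁ →ₗ[R] N₂ →ₗ[R] N₃) {p q n : ℕ} (h : p + q = n)
    (θ : (Fin p → L) → N₁) (η : (Fin q → L) → N₂) (v : Fin n → L) : N₃ :=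
  ∑ s : Equiv.Perm (Fin n), (Equiv.Perm.sign s : ℤ) •
    B (θ fun i => v (s (Fin.cast h (Fin.castAdd q i))))
      (η fun j => v (s (Fin.cast h (Fin.natAdd p j))))

theorem wedge_altSum (B : N₁ →ₗ[R] N₂ →ₗ[R] N₃) {p q : ℕ} (θ : L [⋀^Fin p]→ₗ[R] N₁)
    (η : L [⋀^Fin q]→ₗ[R] N₂) (v : Fin (p + q) → L) :
    (p.factorial * q.factorial) • wedge B p q θ η v = altSum B rfl θ η v := by
  have h1 : wedge B p q θ η v =
      TensorProduct.lift B (θ.domCoprod η (v ∘ finSumFinEquiv)) := rfl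
  have h2 := congrArg (fun g => TensorProduct.lift B (g (v ∘ finSumFinEquiv)))
    (MultilinearMap.domCoprod_alternization_eq θ η)
  simp only [Fintype.card_fin, AlternatingMap.smul_apply, map_nsmul] at h2
  rw [h1, ← h2, MultilinearMap.alternatization_apply, map_sum, altSum,
    ← Equiv.sum_comp (finSumFinEquiv (m := p) (n := q)).permCongr]
  refine Finset.sum_congr rfl fun s _ => ?_
  simp [Equiv.Perm.sign_permCongr, Function.comp_def, Units.smul_def]

/-- The permutation of `Fin (n + 1)` sending `k` to `0` and acting like `e` on the rest. -/
def insertPerm {n : ℕ} (x : Fin (n + 1) × Equiv.Perm (Fin n)) : Equiv.Perm (Fin (n + 1)) :=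
  Equiv.Perm.decomposeFin.symm (0, x.2) * x.1.cycleRange

theorem insertPerm_self {n : ℕ} (k : Fin (n + 1)) (e : Equiv.Perm (Fin n)) :
    insertPerm (k, e) k = 0 := by
  simp [insertPerm]

theorem insertPerm_succAbove {n : ℕ} (k : Fin (n + 1)) (e : Equiv.Perm (Fin n)) (j : Fin n) :
    insertPerm (k, e) (k.succAbove j) = (e j).succ := by
  simp [insertPerm]

theorem sign_insertPerm {n : ℕ} (k : Fin (n + 1)) (e : Equiv.Perm (Fin n)) :
    (Equiv.Perm.sign (insertPerm (k, e)) : ℤ) = (-1) ^ (k : ℕ) * Equiv.Perm.sign e := by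
  simp [insertPerm, mul_comm]

theorem insertPerm_bijective (n : ℕ) : Function.Bijective (insertPerm (n := n)) := by
  rw [Fintype.bijective_iff_injective_and_card]
  constructor
  · rintro ⟨k, e⟩ ⟨k', e'⟩ h
    have hk : k = k' := by
      apply (insertPerm (k', e')).injective
      rw [insertPerm_self, ← h, insertPerm_self]
    subst hk
    refine Prod.ext rfl (Equiv.ext fun j => ?_)
    apply Fin.succ_injective
    change (e j).succ = (e' j).succ
    rw [← insertPerm_succAbove k, ← insertPerm_succAbove k, h]
  · simp [Fintype.card_perm, Nat.factorial_succ]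

theorem altSum_cons (B : N₁ →ₗ[R] N₂ →ₗ[R] N₃) {p q n : ℕ} (h : p + q = n + 1)
    (θ : (Fin p → L) → N₁) (η : (Fin q → L) → N₂) (X : L) (v : Fin n → L) :
    altSum B h θ η (Matrix.vecCons X v) = ∑ k : Fin (n + 1), (-1 : ℤ) ^ (k : ℕ) •
      ∑ e : Equiv.Perm (Fin n), (Equiv.Perm.sign e : ℤ) •
        B (θ fun i => k.insertNth (α := fun _ => L) X (v ∘ e) (Fin.cast h (Fin.castAdd q i)))
          (η fun j => k.insertNth (α := fun _ => L) X (v ∘ e) (Fin.cast h (Fin.natAdd p j))) := by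
  have key : ∀ (k : Fin (n + 1)) (e : Equiv.Perm (Fin n)) (j : Fin (n + 1)),
      (Matrix.vecCons X v : Fin (n + 1) → L) (insertPerm (k, e) j) =
        k.insertNth (α := fun _ => L) X (v ∘ e) j := by
    intro k e j
    rcases Fin.eq_self_or_eq_succAbove k j with rfl | ⟨j, rfl⟩
    · rw [insertPerm_self, Fin.insertNth_apply_same]; rfl
    · rw [insertPerm_succAbove, Fin.insertNth_apply_succAbove]; rfl
  rw [altSum, ← (insertPerm_bijective n).sum_comp, Fintype.sum_prod_type]
  refine Finset.sum_congr rfl fun k _ => ?_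
  rw [Finset.smul_sum]
  refine Finset.sum_congr rfl fun e _ => ?_
  rw [sign_insertPerm, mul_smul]
  simp only [key]

theorem sum_fin_split {n p q : ℕ} (h : p + q = n) {N : Type*} [AddCommMonoid N] (f : Fin n → N) :
    ∑ k, f k = ∑ i : Fin p, f (Fin.cast h (Fin.castAdd q i)) +
      ∑ j : Fin q, f (Fin.cast h (Fin.natAdd p j)) := by
  subst h
  rw [Fin.sum_univ_add]
  rfl

theorem altSum_left (B : N₁ →ₗ[R] N₂ →ₗ[R] N₃) {p q n : ℕ} (h : p + 1 + q = n + 1) (h' : p + q = n)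
    (θ : L [⋀^Fin (p + 1)]→ₗ[R] N₁) (η : (Fin q → L) → N₂) (X : L) (v : Fin n → L)
    (i : Fin (p + 1)) :
    (-1 : ℤ) ^ (i : ℕ) • ∑ e : Equiv.Perm (Fin n), (Equiv.Perm.sign e : ℤ) •
        B (θ fun i' => (Fin.cast h (Fin.castAdd q i)).insertNth (α := fun _ => L) X (v ∘ e)
            (Fin.cast h (Fin.castAdd q i')))
          (η fun j => (Fin.cast h (Fin.castAdd q i)).insertNth (α := fun _ => L) X (v ∘ e)
            (Fin.cast h (Fin.natAdd (p + 1) j))) =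
      altSum B h' (θ.curryLeft X) η v := by
  rw [altSum, Finset.smul_sum]
  refine Finset.sum_congr rfl fun e _ => ?_
  have h1 : (fun i' => (Fin.cast h (Fin.castAdd q i)).insertNth (α := fun _ => L) X (v ∘ e)
            (Fin.cast h (Fin.castAdd q i'))) =
      i.insertNth (α := fun _ => L) X (fun i' => v (e (Fin.cast h' (Fin.castAdd q i')))) := by
    funext i'
    rcases Fin.eq_self_or_eq_succAbove i i' with rfl | ⟨i', rfl⟩
    · rw [Fin.insertNth_apply_same, Fin.insertNth_apply_same]
    · have : Fin.cast h (Fin.castAdd q (i.succAbove i')) =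
          (Fin.cast h (Fin.castAdd q i)).succAbove (Fin.cast h' (Fin.castAdd q i')) := by
        ext
        simp [Fin.succAbove, Fin.lt_def]
        split_ifs <;> rfl
      rw [this, Fin.insertNth_apply_succAbove, Fin.insertNth_apply_succAbove]
      rfl
  have h2 : (fun j => (Fin.cast h (Fin.castAdd q i)).insertNth (α := fun _ => L) X (v ∘ e)
            (Fin.cast h (Fin.natAdd (p + 1) j))) =
      (fun j => v (e (Fin.cast h' (Fin.natAdd p j)))) := by
    funext j
    have : Fin.cast h (Fin.natAdd (p + 1) j) =
          (Fin.cast h (Fin.castAdd q i)).succAbove (Fin.cast h' (Fin.natAdd p j)) := by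
      ext
      have := i.2
      simp [Fin.succAbove, Fin.lt_def]
      split_ifs <;> simp <;> omega
    rw [this, Fin.insertNth_apply_succAbove]
    rfl
  rw [h1, h2, map_insertNth, map_zsmul, LinearMap.smul_apply, smul_comm ((-1 : ℤ) ^ (i : ℕ))]
  congr 1
  rw [smul_smul, ← pow_add, Even.neg_one_pow ⟨_, rfl⟩, one_smul]
  rfl

theorem altSum_right (B : N₁ →ₗ[R] N₂ →ₗ[R] N₃) {p q n : ℕ} (h : p + (q + 1) = n + 1)
    (h' : p + q = n)
    (θ : (Fin p → L) → N₁) (η : L [⋀^Fin (q + 1)]→ₗ[R] N₂) (X : L) (v : Fin n → L)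
    (j : Fin (q + 1)) :
    (-1 : ℤ) ^ (p + j : ℕ) • ∑ e : Equiv.Perm (Fin n), (Equiv.Perm.sign e : ℤ) •
        B (θ fun i => (Fin.cast h (Fin.natAdd p j)).insertNth (α := fun _ => L) X (v ∘ e)
            (Fin.cast h (Fin.castAdd (q + 1) i)))
          (η fun j' => (Fin.cast h (Fin.natAdd p j)).insertNth (α := fun _ => L) X (v ∘ e)
            (Fin.cast h (Fin.natAdd p j'))) =
      (-1 : ℤ) ^ p • altSum B h' θ (η.curryLeft X) v := by
  rw [altSum, Finset.smul_sum, Finset.smul_sum]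
  refine Finset.sum_congr rfl fun e _ => ?_
  have h1 : (fun j' => (Fin.cast h (Fin.natAdd p j)).insertNth (α := fun _ => L) X (v ∘ e)
            (Fin.cast h (Fin.natAdd p j'))) =
      j.insertNth (α := fun _ => L) X (fun j' => v (e (Fin.cast h' (Fin.natAdd p j')))) := by
    funext j'
    rcases Fin.eq_self_or_eq_succAbove j j' with rfl | ⟨j', rfl⟩
    · rw [Fin.insertNth_apply_same, Fin.insertNth_apply_same]
    · have : Fin.cast h (Fin.natAdd p (j.succAbove j')) =
          (Fin.cast h (Fin.natAdd p j)).succAbove (Fin.cast h' (Fin.natAdd p j')) := by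
        ext
        simp [Fin.succAbove, Fin.lt_def]
        split_ifs <;> simp <;> omega
      rw [this, Fin.insertNth_apply_succAbove, Fin.insertNth_apply_succAbove]
      rfl
  have h2 : (fun i => (Fin.cast h (Fin.natAdd p j)).insertNth (α := fun _ => L) X (v ∘ e)
            (Fin.cast h (Fin.castAdd (q + 1) i))) =
      (fun i => v (e (Fin.cast h' (Fin.castAdd q i)))) := by
    funext i
    have : Fin.cast h (Fin.castAdd (q + 1) i) =
          (Fin.cast h (Fin.natAdd p j)).succAbove (Fin.cast h' (Fin.castAdd q i)) := by
      ext
      have := i.2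
      simp [Fin.succAbove, Fin.lt_def]
      split_ifs <;> simp <;> omega
    rw [this, Fin.insertNth_apply_succAbove]
    rfl
  rw [h1, h2, map_insertNth, map_zsmul, smul_comm ((Equiv.Perm.sign e : ℤ)), smul_smul, pow_add,
    mul_assoc, ← pow_add (-1 : ℤ) (j : ℕ), Even.neg_one_pow ⟨(j : ℕ), rfl⟩, mul_one]
  rfl

end Wedge

section FormsAlgebra

variable {R L N N₁ N₂ N₃ N₄ N₅ N₆ : Type*} [CommRing R] [Algebra ℝ R]
  [AddCommGroup L] [Module R L] [Module ℝ L] [IsScalarTower ℝ R L]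
  [AddCommGroup N] [Module R N] [Module ℝ N] [IsScalarTower ℝ R N]
  [AddCommGroup N₁] [Module R N₁] [Module ℝ N₁] [IsScalarTower ℝ R N₁]
  [AddCommGroup N₂] [Module R N₂] [Module ℝ N₂] [IsScalarTower ℝ R N₂]
  [AddCommGroup N₃] [Module R N₃] [Module ℝ N₃] [IsScalarTower ℝ R N₃]
  [AddCommGroup N₄] [Module R N₄] [Module ℝ N₄] [IsScalarTower ℝ R N₄]
  [AddCommGroup N₅] [Module R N₅] [Module ℝ N₅] [IsScalarTower ℝ R N₅]
  [AddCommGroup N₆] [Module R N₆] [Module ℝ N₆] [IsScalarTower ℝ R N₆]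

namespace Forms

/-- The exterior product of all forms. -/
def mul (B : N₁ →ₗ[R] N₂ →ₗ[R] N₃) : Forms R L N₁ →ₗ[ℝ] Forms R L N₂ →ₗ[ℝ] Forms R L N₃ :=
  Forms.lift fun p => LinearMap.flip (Forms.lift fun q => LinearMap.flip
    ((LinearMap.restrictScalars₁₂ ℝ ℝ (wedge B p q)).compr₂ (Forms.of (p + q))))

theorem mul_of (B : N₁ →ₗ[R] N₂ →ₗ[R] N₃) (p q : ℕ) (θ : L [⋀^Fin p]→ₗ[R] N₁)
    (η : L [⋀^Fin q]→ₗ[R] N₂) :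
    mul B (of p θ) (of q η) = of (p + q) (wedge B p q θ η) := by
  rw [mul, lift_of, LinearMap.flip_apply, lift_of]
  rfl

/-- The sign operator `(-1)^p` on `p`-forms. -/
def eps : Forms R L N →ₗ[ℝ] Forms R L N := Forms.lift fun p => (-1 : ℝ) ^ p • of p

theorem eps_of (p : ℕ) (η : L [⋀^Fin p]→ₗ[R] N) : eps (of p η) = (-1 : ℝ) ^ p • of p η := by
  rw [eps, lift_of]; rfl

theorem eps_eps (x : Forms R L N) : eps (eps x) = x := by
  have : (eps ∘ₗ eps : Forms R L N →ₗ[ℝ] Forms R L N) = LinearMap.id := by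
    refine hom_ext fun p η => ?_
    simp only [LinearMap.comp_apply, eps_of, map_smul, smul_smul, LinearMap.id_apply]
    rw [← pow_add, Even.neg_one_pow ⟨p, rfl⟩, one_smul]
  exact congrArg (fun f => f x) this

/-- The interior product on forms of degree `p`. -/
def iotaAux (X : L) : (p : ℕ) → (L [⋀^Fin p]→ₗ[R] N) →ₗ[ℝ] Forms R L N
  | 0 => 0
  | n + 1 => of n ∘ₗ
    { toFun := fun η => η.curryLeft X
      map_add' := fun _ _ => rfl
      map_smul' := fun _ _ => rfl }

/-- The interior product. -/
def iota (X : L) : Forms R L N →ₗ[ℝ] Forms R L N := Forms.lift (iotaAux X)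

theorem iota_of_zero (X : L) (η : L [⋀^Fin 0]→ₗ[R] N) : iota X (of 0 η) = 0 := by
  rw [iota, lift_of]; rfl

theorem iota_of_succ (X : L) (n : ℕ) (η : L [⋀^Fin (n + 1)]→ₗ[R] N) :
    iota X (of (n + 1) η) = of n (η.curryLeft X) := by
  rw [iota, lift_of]; rfl

theorem of_cast {p q : ℕ} (h : p = q) (η : L [⋀^Fin p]→ₗ[R] N) :
    of p η = of q (η.domDomCongr (finCongr h)) := by
  subst h; rfl

theorem component_of (p : ℕ) (η : L [⋀^Fin p]→ₗ[R] N) : component p (of p η) = η :=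
  DirectSum.component.lof_self ..

theorem component_of_ne {p q : ℕ} (h : p ≠ q) (η : L [⋀^Fin p]→ₗ[R] N) :
    component q (of p η) = 0 := by
  classical
  exact (DirectSum.component.of (R := ℝ) ..).trans (dif_neg h)

theorem ext_component {x y : Forms R L N} (h : ∀ p, component p x = component p y) : x = y :=
  DirectSum.ext_component ℝ h

theorem component_iota (X : L) (n : ℕ) (x : Forms R L N) :
    component n (iota X x) = (component (n + 1) x).curryLeft X := by
  have : component n ∘ₗ iota X = (LinearMap.mk (AddHom.mk (fun η : L [⋀^Fin (n + 1)]→ₗ[R] N =>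
      η.curryLeft X) (fun _ _ => rfl)) (fun _ _ => rfl) : _ →ₗ[ℝ] _) ∘ₗ component (n + 1) := by
    refine hom_ext fun p η => ?_
    rcases p with _ | p
    · simp only [LinearMap.comp_apply, iota_of_zero, _root_.map_zero]
      rw [component_of_ne (by omega)]
      simp
    · simp only [LinearMap.comp_apply, iota_of_succ]
      rcases eq_or_ne p n with rfl | h
      · rw [component_of, component_of]; rfl
      · rw [component_of_ne h, component_of_ne (by omega)]; simp
  exact congrArg (fun f => f x) this

/-- A form is zero if its scalar part and all its interior products vanish. -/
theorem eq_zero_of_iota {x : Forms R L N} (h0 : component 0 x = 0) (h : ∀ X, iota X x = 0) :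
    x = 0 := by
  refine ext_component fun p => ?_
  rw [_root_.map_zero]
  rcases p with _ | n
  · exact h0
  · ext v
    have := component_iota (v 0) n x
    rw [h, _root_.map_zero] at this
    have h2 := congrArg (fun g => g (Matrix.vecTail v)) this
    simp only [AlternatingMap.zero_apply, curryLeft_apply_apply] at h2
    rw [AlternatingMap.zero_apply, h2]
    congr 1
    exact (Matrix.cons_head_tail v).symm

theorem iota_of_eq (X : L) {m n : ℕ} (h : m = n + 1) (η : L [⋀^Fin m]→ₗ[R] N) :
    iota X (of m η) = of n ((η.domDomCongr (finCongr h)).curryLeft X) := by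
  rw [of_cast h, iota_of_succ]

theorem wedge_altSum_cast (B : N₁ →ₗ[R] N₂ →ₗ[R] N₃) {p q n : ℕ} (h : p + q = n)
    (θ : L [⋀^Fin p]→ₗ[R] N₁) (η : L [⋀^Fin q]→ₗ[R] N₂) (v : Fin n → L) :
    (p.factorial * q.factorial) • (wedge B p q θ η).domDomCongr (finCongr h) v =
      altSum B h θ η v := by
  subst h
  exact wedge_altSum B θ η v

theorem iota_mul_left (B : N₁ →ₗ[R] N₂ →ₗ[R] N₃) (X : L) {p q n : ℕ} (h : p + q = n + 1)
    (θ : L [⋀^Fin p]→ₗ[R] N₁) (η : L [⋀^Fin q]→ₗ[R] N₂) :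
    ∃ Z : L [⋀^Fin n]→ₗ[R] N₃, mul B (iota X (of p θ)) (of q η) = of n Z ∧ ∀ v : Fin n → L,
      (p.factorial * q.factorial) • Z v = ∑ i : Fin p,
        (-1 : ℤ) ^ (i : ℕ) • ∑ e : Equiv.Perm (Fin n), (Equiv.Perm.sign e : ℤ) •
        B (θ fun i' => (Fin.cast h (Fin.castAdd q i)).insertNth (α := fun _ => L) X (v ∘ e)
            (Fin.cast h (Fin.castAdd q i')))
          (η fun j => (Fin.cast h (Fin.castAdd q i)).insertNth (α := fun _ => L) X (v ∘ e)
            (Fin.cast h (Fin.natAdd p j))) := by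
  rcases p with _ | p
  · exact ⟨0, by simp [iota_of_zero], by simp⟩
  · have h' : p + q = n := by omega
    refine ⟨(wedge B p q (θ.curryLeft X) η).domDomCongr (finCongr h'), ?_, fun v => ?_⟩
    · rw [iota_of_succ, mul_of, ← of_cast]
    · rw [Finset.sum_congr rfl fun i _ => altSum_left B h h' θ η X v i, Finset.sum_const,
        ← wedge_altSum_cast, smul_smul, Finset.card_univ, Fintype.card_fin, Nat.factorial_succ,
        mul_assoc]

theorem iota_mul_right (B : N₁ →ₗ[R] N₂ →ₗ[R] N₃) (X : L) {p q n : ℕ} (h : p + q = n + 1)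
    (θ : L [⋀^Fin p]→ₗ[R] N₁) (η : L [⋀^Fin q]→ₗ[R] N₂) :
    ∃ Z : L [⋀^Fin n]→ₗ[R] N₃, mul B (eps (of p θ)) (iota X (of q η)) = of n Z ∧ ∀ v : Fin n → L,
      (p.factorial * q.factorial) • Z v = ∑ j : Fin q,
        (-1 : ℤ) ^ (p + j : ℕ) • ∑ e : Equiv.Perm (Fin n), (Equiv.Perm.sign e : ℤ) •
        B (θ fun i => (Fin.cast h (Fin.natAdd p j)).insertNth (α := fun _ => L) X (v ∘ e)
            (Fin.cast h (Fin.castAdd q i)))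
          (η fun j' => (Fin.cast h (Fin.natAdd p j)).insertNth (α := fun _ => L) X (v ∘ e)
            (Fin.cast h (Fin.natAdd p j'))) := by
  rcases q with _ | q
  · exact ⟨0, by simp [iota_of_zero], by simp⟩
  · have h' : p + q = n := by omega
    refine ⟨(-1 : ℝ) ^ p • (wedge B p q θ (η.curryLeft X)).domDomCongr (finCongr h'), ?_,
      fun v => ?_⟩
    · rw [iota_of_succ, eps_of, map_smul, LinearMap.smul_apply, mul_of, map_smul, ← of_cast]
    · rw [Finset.sum_congr rfl fun j _ => altSum_right B h h' θ η X v j, Finset.sum_const,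
        ← wedge_altSum_cast, AlternatingMap.smul_apply, Finset.card_univ, Fintype.card_fin,
        Nat.factorial_succ]
      generalize ((wedge B p q) θ (η.curryLeft X)).domDomCongr (finCongr h') v = z
      rcases neg_one_pow_eq_or ℤ p with h | h
      · have h2 : (-1 : ℝ) ^ p = 1 := by exact_mod_cast congrArg (Int.cast : ℤ → ℝ) h
        rw [h, h2, one_smul, one_smul, smul_smul]
        congr 1; ring
      · have h2 : (-1 : ℝ) ^ p = -1 := by exact_mod_cast congrArg (Int.cast : ℤ → ℝ) h
        rw [h, h2, neg_smul, one_smul, neg_smul, one_smul, smul_neg, smul_neg, smul_smul]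
        congr 2; ring

theorem bilin_ext {Q : Type*} [AddCommGroup Q] [Module ℝ Q]
    {f g : Forms R L N₁ →ₗ[ℝ] Forms R L N₂ →ₗ[ℝ] Q}
    (h : ∀ p q (θ : L [⋀^Fin p]→ₗ[R] N₁) (η : L [⋀^Fin q]→ₗ[R] N₂),
      f (of p θ) (of q η) = g (of p θ) (of q η)) (x : Forms R L N₁) (y : Forms R L N₂) :
    f x y = g x y := by
  have : f = g := hom_ext fun p θ => hom_ext fun q η => h p q θ η
  rw [this]

/-- The interior product is an antiderivation. -/
theorem iota_mul (B : N₁ →ₗ[R] N₂ →ₗ[R] N₃) (X : L) (x : Forms R L N₁) (y : Forms R L N₂) :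
    iota X (mul B x y) = mul B (iota X x) y + mul B (eps x) (iota X y) := by
  refine bilin_ext (f := (mul B).compr₂ (iota X))
    (g := mul B ∘ₗ iota X + (mul B ∘ₗ eps).compl₂ (iota X)) (fun p q θ η => ?_) x y
  change iota X (mul B (of p θ) (of q η)) =
    mul B (iota X (of p θ)) (of q η) + mul B (eps (of p θ)) (iota X (of q η))
  rcases hn : p + q with _ | n
  · obtain ⟨rfl, rfl⟩ : p = 0 ∧ q = 0 := by omega
    simp only [iota_of_zero, mul_of, _root_.map_zero, LinearMap.zero_apply, add_zero]
    exact iota_of_zero X _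
  · obtain ⟨Z₁, h₁, h₁'⟩ := iota_mul_left B X hn θ η
    obtain ⟨Z₂, h₂, h₂'⟩ := iota_mul_right B X hn θ η
    rw [h₁, h₂, mul_of, iota_of_eq X hn, ← map_add]
    congr 1
    ext v
    have hne : ((p.factorial * q.factorial : ℕ) : ℝ) ≠ 0 := by positivity
    refine smul_right_injective N₃ hne ?_
    simp only [Nat.cast_smul_eq_nsmul]
    rw [AlternatingMap.add_apply, smul_add, h₁', h₂', curryLeft_apply_apply, wedge_altSum_cast,
      altSum_cons, sum_fin_split hn]
    rfl

variable {P : LieRinehartData R L}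

theorem alternating_swap {n : ℕ} (θ : L [⋀^Fin (n + 2)]→ₗ[R] N) (X Y : L) (u : Fin n → L) :
    θ (Matrix.vecCons X (Matrix.vecCons Y u)) = -θ (Matrix.vecCons Y (Matrix.vecCons X u)) := by
  have h := θ.map_swap (Matrix.vecCons Y (Matrix.vecCons X u)) (i := 0) (j := 1) (by simp)
  rw [← h]
  congr 1
  funext k
  refine Fin.cases ?_ (fun k => Fin.cases ?_ (fun k => ?_) k) k
  · simp
  · simp
  · have : Equiv.swap (0 : Fin (n + 2)) 1 k.succ.succ = k.succ.succ :=
      Equiv.swap_apply_of_ne_of_ne (Fin.succ_ne_zero _)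
        (fun h => Fin.succ_ne_zero k (Fin.succ_injective _ h))
    simp [this]

theorem removeNth_succ_cons {n : ℕ} (Z : L) (u : Fin (n + 1) → L) (i : Fin (n + 1)) :
    (i.succ).removeNth (Matrix.vecCons Z u) = Matrix.vecCons Z (i.removeNth u) := by
  ext k
  refine Fin.cases ?_ (fun k => ?_) k <;> simp [Fin.removeNth]

theorem removeNth_zero_cons {n : ℕ} (Z : L) (u : Fin n → L) :
    (0 : Fin (n + 1)).removeNth (Matrix.vecCons Z u) = u := by
  ext k
  simp [Fin.removeNth]

theorem map_update_eq {n : ℕ} (θ : L [⋀^Fin (n + 1)]→ₗ[R] N) (v : Fin (n + 1) → L)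
    (i : Fin (n + 1)) (Z : L) : θ (Function.update v i Z) =
      (-1 : ℤ) ^ (i : ℕ) • θ (Matrix.vecCons Z (i.removeNth v)) := by
  rw [← AlternatingMap.map_insertNth]
  congr 1
  rw [Fin.insertNth_removeNth]

theorem br_antisymm (P : LieRinehartData R L) (X Y : L) : P.br Y X = -P.br X Y := by
  have := P.br_self (X + Y)
  simp only [map_add, LinearMap.add_apply, P.br_self, zero_add, add_zero] at this
  exact eq_neg_of_add_eq_zero_left this

theorem derivTerm_cons (D : P.Connection N) {n : ℕ} (θ : L [⋀^Fin (n + 1)]→ₗ[R] N) (X : L)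
    (w : Fin (n + 1) → L) :
    derivTerm (D.nabla.restrictScalars ℝ) (n + 1) (realForm R (n + 1) θ) (Matrix.vecCons X w) =
      D.nabla X (θ w) -
        derivTerm (D.nabla.restrictScalars ℝ) n (realForm R n (θ.curryLeft X)) w := by
  rw [derivTerm_apply, derivTerm_apply, Fin.sum_univ_succ, sub_eq_add_neg, ← Finset.sum_neg_distrib]
  simp only [removeNth_succ_cons, removeNth_zero_cons, realForm_apply,
    LinearMap.restrictScalars_apply, Fin.val_succ, Fin.val_zero, pow_zero, one_smul,
    Matrix.cons_val_zero, Matrix.cons_val_succ, pow_succ, mul_neg_one, neg_smul]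
  rfl

theorem bracketTerm_cons {n : ℕ} (θ : L [⋀^Fin (n + 1)]→ₗ[R] N) (X : L)
    (w : Fin (n + 1) → L) :
    bracketTerm P.br (n + 1) (realForm R (n + 1) θ) (Matrix.vecCons X w) =
      (2 : ℝ) • ∑ k : Fin (n + 1), θ (Function.update w k (P.br X (w k))) -
        bracketTerm P.br n (realForm R n (θ.curryLeft X)) w := by
  have hneg : ∀ (Y : L) (u : Fin n → L), θ (Matrix.vecCons (-Y) u) = -θ (Matrix.vecCons Y u) := by
    intro Y u
    exact congrArg (fun g => g u) (θ.curryLeft.map_neg Y)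
  have e1 : bracketTerm P.br (n + 1) (realForm R (n + 1) θ) (Matrix.vecCons X w) =
        ∑ k : Fin (n + 1), θ (Function.update w k (P.br X (w k))) +
        ∑ k : Fin (n + 1), (θ (Function.update w k (P.br X (w k))) +
            (-1 : ℤ) ^ (k : ℕ) • ∑ j : Fin n, (-1 : ℤ) ^ (j : ℕ) •
              θ (Matrix.vecCons (P.br (w k) (k.removeNth w j))
                (j.succ.removeNth (Matrix.vecCons X (k.removeNth w))))) := by
    rw [bracketTerm_apply_aux, Fin.sum_univ_succ]
    congr 1
    · simp only [removeNth_zero_cons, realForm_apply, Fin.val_zero, pow_zero, one_smul,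
        Matrix.cons_val_zero, map_update_eq]
    · refine Finset.sum_congr rfl fun k _ => ?_
      rw [Fin.sum_univ_succ, map_update_eq]
      simp only [removeNth_succ_cons, removeNth_zero_cons, realForm_apply, Fin.val_succ,
        Fin.val_zero, pow_zero, one_smul, Matrix.cons_val_zero, Matrix.cons_val_succ, pow_succ,
        mul_neg_one, neg_smul, Finset.sum_neg_distrib, br_antisymm P X, hneg, smul_add, smul_neg,
        neg_neg]
  rw [e1, Finset.sum_add_distrib, ← add_assoc, ← two_smul ℝ, sub_eq_add_neg]
  congr 1
  rcases n with _ | m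
  · simp [bracketTerm]
  · rw [bracketTerm_apply_aux, ← Finset.sum_neg_distrib]
    refine Finset.sum_congr rfl fun k _ => ?_
    rw [← smul_neg, ← Finset.sum_neg_distrib]
    congr 1
    refine Finset.sum_congr rfl fun j _ => ?_
    rw [removeNth_succ_cons, alternating_swap, smul_neg]
    rfl

/-- The operator `d` on all forms. -/
def dF (D : P.Connection N) : Forms R L N →ₗ[ℝ] Forms R L N := homogOp 1 D.d

theorem dF_of (D : P.Connection N) (p : ℕ) (η : L [⋀^Fin p]→ₗ[R] N) :
    dF D (of p η) = of (p + 1) (D.d p η) := homogOp_of 1 _ p η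

/-- The Lie derivative. -/
def lieF (D : P.Connection N) (X : L) : Forms R L N →ₗ[ℝ] Forms R L N :=
  dF D ∘ₗ iota X + iota X ∘ₗ dF D

theorem lieF_of (D : P.Connection N) (X : L) (p : ℕ) (θ : L [⋀^Fin p]→ₗ[R] N) :
    ∃ ζ : L [⋀^Fin p]→ₗ[R] N, lieF D X (of p θ) = of p ζ ∧
      ∀ w, ζ w = D.nabla X (θ w) - ∑ k, θ (Function.update w k (P.br X (w k))) := by
  rcases p with _ | n
  · refine ⟨(D.d 0 θ).curryLeft X, ?_, fun w => ?_⟩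
    · simp only [lieF, LinearMap.add_apply, LinearMap.comp_apply, iota_of_zero, _root_.map_zero,
        zero_add, dF_of]
      exact iota_of_succ X 0 _
    · rw [AlternatingMap.curryLeft_apply_apply, LieRinehartData.Connection.d_zero_apply]
      simp [Subsingleton.elim w ![]]
  · refine ⟨D.d n (θ.curryLeft X) + (D.d (n + 1) θ).curryLeft X, ?_, fun w => ?_⟩
    · simp only [lieF, LinearMap.add_apply, LinearMap.comp_apply, iota_of_succ, dF_of, map_add]
    · change koszul P.br (D.nabla.restrictScalars ℝ) n (realForm R n (θ.curryLeft X)) w +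
        koszul P.br (D.nabla.restrictScalars ℝ) (n + 1) (realForm R (n + 1) θ)
          (Matrix.vecCons X w) = _
      rw [koszul, koszul, AlternatingMap.sub_apply, AlternatingMap.sub_apply,
        AlternatingMap.smul_apply, AlternatingMap.smul_apply, derivTerm_cons, bracketTerm_cons,
        smul_sub, smul_smul]
      norm_num
      abel

theorem iota_lieF (D : P.Connection N) (X Y : L) (x : Forms R L N) :
    iota Y (lieF D X x) = lieF D X (iota Y x) - iota (P.br X Y) x := by
  have : iota Y ∘ₗ lieF D X = lieF D X ∘ₗ iota Y - iota (P.br X Y) := by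
    refine hom_ext fun p θ => ?_
    simp only [LinearMap.comp_apply, LinearMap.sub_apply]
    obtain ⟨ζ, h, hζ⟩ := lieF_of D X p θ
    rw [h]
    rcases p with _ | n
    · simp [iota_of_zero]
    · rw [iota_of_succ, iota_of_succ, iota_of_succ]
      obtain ⟨ζ', h', hζ'⟩ := lieF_of D X n (θ.curryLeft Y)
      rw [h', ← map_sub]
      congr 1
      ext v
      rw [AlternatingMap.curryLeft_apply_apply, hζ, AlternatingMap.sub_apply, hζ',
        Fin.sum_univ_succ, AlternatingMap.curryLeft_apply_apply,
        AlternatingMap.curryLeft_apply_apply]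
      have h0 : Function.update (Matrix.vecCons Y v) 0 (P.br X (Matrix.vecCons Y v 0)) =
          Matrix.vecCons (P.br X Y) v := by
        simp [Matrix.vecCons]
      have h1 : ∀ k : Fin n, Function.update (Matrix.vecCons Y v) k.succ
          (P.br X (Matrix.vecCons Y v k.succ)) =
          Matrix.vecCons Y (Function.update v k (P.br X (v k))) := by
        intro k
        simp [Matrix.vecCons]
      simp only [h0, h1, AlternatingMap.curryLeft_apply_apply]
      abel
  exact congrArg (fun f => f x) this

/-- The scalar part of a form. -/
def scalar : Forms R L N →ₗ[ℝ] N where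
  toFun x := component 0 x ![]
  map_add' x y := by simp
  map_smul' c x := by simp

theorem scalar_of_zero (η : L [⋀^Fin 0]→ₗ[R] N) : scalar (of 0 η) = η ![] := by
  change component 0 (of 0 η) ![] = _
  rw [component_of]

theorem scalar_of_succ (n : ℕ) (η : L [⋀^Fin (n + 1)]→ₗ[R] N) : scalar (of (n + 1) η) = 0 := by
  change component 0 (of (n + 1) η) ![] = _
  rw [component_of_ne (by omega)]
  rfl

theorem eq_zero_of_scalar {x : Forms R L N} (h0 : scalar x = 0) (h : ∀ X, iota X x = 0) :
    x = 0 := by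
  refine eq_zero_of_iota ?_ h
  ext v
  rw [Subsingleton.elim v ![]]
  exact h0

theorem scalar_eps (x : Forms R L N) : scalar (eps x) = scalar x := by
  have : scalar ∘ₗ eps = (scalar : Forms R L N →ₗ[ℝ] N) := by
    refine hom_ext fun p η => ?_
    rcases p with _ | p
    · simp [eps_of]
    · simp [eps_of, scalar_of_succ]
  exact congrArg (fun f => f x) this

theorem scalar_dF (D : P.Connection N) (x : Forms R L N) : scalar (dF D x) = 0 := by
  have : scalar ∘ₗ dF D = (0 : Forms R L N →ₗ[ℝ] N) := by
    refine hom_ext fun p η => ?_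
    simp [dF_of, scalar_of_succ]
  exact congrArg (fun f => f x) this

theorem scalar_lieF (D : P.Connection N) (X : L) (x : Forms R L N) :
    scalar (lieF D X x) = D.nabla X (scalar x) := by
  have : scalar ∘ₗ lieF D X = D.nabla X ∘ₗ (scalar : Forms R L N →ₗ[ℝ] N) := by
    refine hom_ext fun p η => ?_
    obtain ⟨ζ, h, hζ⟩ := lieF_of D X p η
    rcases p with _ | p
    · simp only [LinearMap.comp_apply, h, scalar_of_zero, hζ]
      simp
    · simp only [LinearMap.comp_apply, h, scalar_of_succ, _root_.map_zero]
  exact congrArg (fun f => f x) this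

theorem wedge_zero_zero (B : N₁ →ₗ[R] N₂ →ₗ[R] N₃) (θ : L [⋀^Fin 0]→ₗ[R] N₁)
    (η : L [⋀^Fin 0]→ₗ[R] N₂) (v : Fin (0 + 0) → L) : wedge B 0 0 θ η v = B (θ ![]) (η ![]) := by
  have h := wedge_altSum B θ η v
  simp only [Nat.factorial_zero, mul_one, one_smul] at h
  rw [h, altSum]
  simp only [Nat.add_zero, Finset.univ_unique, Finset.sum_singleton]
  simp [Subsingleton.elim _ (![] : Fin 0 → L)]

theorem scalar_mul (B : N₁ →ₗ[R] N₂ →ₗ[R] N₃) (x : Forms R L N₁) (y : Forms R L N₂) :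
    scalar (mul B x y) = B (scalar x) (scalar y) := by
  refine bilin_ext (f := (mul B).compr₂ scalar)
    (g := (LinearMap.restrictScalars₁₂ ℝ ℝ B).compl₁₂ scalar scalar) (fun p q θ η => ?_) x y
  change scalar (mul B (of p θ) (of q η)) = B (scalar (of p θ)) (scalar (of q η))
  rw [mul_of]
  rcases p with _ | p
  · rcases q with _ | q
    · rw [scalar_of_zero, scalar_of_zero]
      exact (scalar_of_zero _).trans (wedge_zero_zero B θ η _)
    · rw [scalar_of_succ, _root_.map_zero]
      exact scalar_of_succ (0 + q) _
  · rw [scalar_of_succ, _root_.map_zero, LinearMap.zero_apply,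
      of_cast (show p + 1 + q = p + q + 1 by omega), scalar_of_succ]

theorem iota_of_cases (X : L) (p : ℕ) (θ : L [⋀^Fin p]→ₗ[R] N) :
    iota X (of p θ) = 0 ∨ ∃ p' ζ, p = p' + 1 ∧ iota X (of p θ) = of p' ζ := by
  rcases p with _ | p
  · exact Or.inl (iota_of_zero X θ)
  · exact Or.inr ⟨p, _, rfl, iota_of_succ X p θ⟩

theorem unary_eq_zero {T : Forms R L N₁ →ₗ[ℝ] Forms R L N₂} (c : ℝ)
    (h0 : ∀ x, scalar (T x) = 0) (h : ∀ X x, iota X (T x) = c • T (iota X x)) : T = 0 := by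
  refine hom_ext fun p θ => ?_
  induction p with
  | zero => exact eq_zero_of_scalar (h0 _) fun X => by rw [h, iota_of_zero]; simp
  | succ p ih => exact eq_zero_of_scalar (h0 _) fun X => by rw [h, iota_of_succ, ih]; simp

theorem trilinear_eq_zero
    {T : Forms R L N₁ →ₗ[ℝ] Forms R L N₂ →ₗ[ℝ] Forms R L N₃ →ₗ[ℝ] Forms R L N₄} (c : ℝ)
    (h0 : ∀ x y z, scalar (T x y z) = 0) (h : ∀ X x y z, iota X (T x y z) =
      c • (T (iota X x) y z + T (eps x) (iota X y) z + T (eps x) (eps y) (iota X z))) : T = 0 := by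
  have key : ∀ n p q r, p + q + r = n → ∀ (x : L [⋀^Fin p]→ₗ[R] N₁) (y : L [⋀^Fin q]→ₗ[R] N₂)
      (z : L [⋀^Fin r]→ₗ[R] N₃), T (of p x) (of q y) (of r z) = 0 := by
    intro n
    induction n with
    | zero =>
      intro p q r hn x y z
      obtain ⟨rfl, rfl, rfl⟩ : p = 0 ∧ q = 0 ∧ r = 0 := by omega
      refine eq_zero_of_scalar (h0 _ _ _) fun X => ?_
      simp [h, iota_of_zero]
    | succ n ih =>
      intro p q r hn x y z
      refine eq_zero_of_scalar (h0 _ _ _) fun X => ?_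
      have h1 : T (iota X (of p x)) (of q y) (of r z) = 0 := by
        rcases iota_of_cases X p x with e | ⟨p', ζ, hp, e⟩
        · simp [e]
        · rw [e]; exact ih _ _ _ (by omega) _ _ _
      have h2 : T (of p x) (iota X (of q y)) (of r z) = 0 := by
        rcases iota_of_cases X q y with e | ⟨p', ζ, hp, e⟩
        · simp [e]
        · rw [e]; exact ih _ _ _ (by omega) _ _ _
      have h3 : T (of p x) (of q y) (iota X (of r z)) = 0 := by
        rcases iota_of_cases X r z with e | ⟨p', ζ, hp, e⟩
        · simp [e]
        · rw [e]; exact ih _ _ _ (by omega) _ _ _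
      simp [h, eps_of, h1, h2, h3]
  exact hom_ext fun p x => hom_ext fun q y => hom_ext fun r z => key _ p q r rfl x y z

theorem bilinear_eq_zero {T : Forms R L N₁ →ₗ[ℝ] Forms R L N₂ →ₗ[ℝ] Forms R L N₃} (c : ℝ)
    (h0 : ∀ x y, scalar (T x y) = 0) (h : ∀ X x y, iota X (T x y) =
      c • (T (iota X x) y + T (eps x) (iota X y))) : T = 0 := by
  have key : ∀ n p q, p + q = n → ∀ (x : L [⋀^Fin p]→ₗ[R] N₁) (y : L [⋀^Fin q]→ₗ[R] N₂),
      T (of p x) (of q y) = 0 := by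
    intro n
    induction n with
    | zero =>
      intro p q hn x y
      obtain ⟨rfl, rfl⟩ : p = 0 ∧ q = 0 := by omega
      refine eq_zero_of_scalar (h0 _ _) fun X => ?_
      simp [h, iota_of_zero]
    | succ n ih =>
      intro p q hn x y
      refine eq_zero_of_scalar (h0 _ _) fun X => ?_
      have h1 : T (iota X (of p x)) (of q y) = 0 := by
        rcases iota_of_cases X p x with e | ⟨p', ζ, hp, e⟩
        · simp [e]
        · rw [e]; exact ih _ _ (by omega) _ _
      have h2 : T (of p x) (iota X (of q y)) = 0 := by
        rcases iota_of_cases X q y with e | ⟨p', ζ, hp, e⟩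
        · simp [e]
        · rw [e]; exact ih _ _ (by omega) _ _
      simp [h, eps_of, h1, h2]
  exact hom_ext fun p x => hom_ext fun q y => key _ p q rfl x y

theorem iota_eps (X : L) (x : Forms R L N) : iota X (eps x) = -eps (iota X x) := by
  have : iota X ∘ₗ eps = -((eps : Forms R L N →ₗ[ℝ] _) ∘ₗ iota X) := by
    refine hom_ext fun p η => ?_
    rcases p with _ | p
    · simp [eps_of, iota_of_zero]
    · simp [eps_of, iota_of_succ, pow_succ]
  exact congrArg (fun f => f x) this

theorem dF_eps (D : P.Connection N) (x : Forms R L N) : dF D (eps x) = -eps (dF D x) := by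
  have : dF D ∘ₗ eps = -((eps : Forms R L N →ₗ[ℝ] _) ∘ₗ dF D) := by
    refine hom_ext fun p η => ?_
    simp [eps_of, dF_of, pow_succ]
  exact congrArg (fun f => f x) this

theorem lieF_eps (D : P.Connection N) (X : L) (x : Forms R L N) :
    lieF D X (eps x) = eps (lieF D X x) := by
  simp only [lieF, LinearMap.add_apply, LinearMap.comp_apply, iota_eps, dF_eps, map_neg, neg_neg,
    map_add]

theorem eps_mul (B : N₁ →ₗ[R] N₂ →ₗ[R] N₃) (x : Forms R L N₁) (y : Forms R L N₂) :
    eps (mul B x y) = mul B (eps x) (eps y) := by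
  refine bilin_ext (f := (mul B).compr₂ eps)
    (g := (mul B).compl₁₂ eps eps) (fun p q θ η => ?_) x y
  change eps (mul B (of p θ) (of q η)) = mul B (eps (of p θ)) (eps (of q η))
  simp only [mul_of, eps_of, map_smul, LinearMap.smul_apply, smul_smul, pow_add]
  rw [mul_comm]

theorem lieF_mul {D₁ : P.Connection N₁} {D₂ : P.Connection N₂} {D₃ : P.Connection N₃}
    {B : N₁ →ₗ[R] N₂ →ₗ[R] N₃}
    (hB : ∀ X a b, D₃.nabla X (B a b) = B (D₁.nabla X a) b + B a (D₂.nabla X b))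
    (X : L) (x : Forms R L N₁) (y : Forms R L N₂) :
    lieF D₃ X (mul B x y) = mul B (lieF D₁ X x) y + mul B x (lieF D₂ X y) := by
  have : (mul B).compr₂ (lieF D₃ X) - mul B ∘ₗ lieF D₁ X - (mul B).compl₂ (lieF D₂ X) = 0 := by
    refine bilinear_eq_zero 1 (fun x y => ?_) fun Y x y => ?_
    · simp only [LinearMap.sub_apply, LinearMap.compr₂_apply, LinearMap.comp_apply,
        LinearMap.compl₂_apply, map_sub, scalar_lieF, scalar_mul, hB]
      abel
    · simp only [LinearMap.sub_apply, LinearMap.compr₂_apply, LinearMap.comp_apply,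
        LinearMap.compl₂_apply, map_sub, iota_lieF, iota_mul, lieF_eps, map_add,
        LinearMap.sub_apply, one_smul]
      abel
  have h := congrArg (fun f => f x y) this
  simp only [LinearMap.sub_apply, LinearMap.compr₂_apply, LinearMap.zero_apply, sub_sub] at h
  exact sub_eq_zero.mp h

theorem iota_dF (D : P.Connection N) (X : L) (x : Forms R L N) :
    iota X (dF D x) = lieF D X x - dF D (iota X x) := by
  simp [lieF]

theorem dF_mul {D₁ : P.Connection N₁} {D₂ : P.Connection N₂} {D₃ : P.Connection N₃}
    {B : N₁ →ₗ[R] N₂ →ₗ[R] N₃}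
    (hB : ∀ X a b, D₃.nabla X (B a b) = B (D₁.nabla X a) b + B a (D₂.nabla X b))
    (x : Forms R L N₁) (y : Forms R L N₂) :
    dF D₃ (mul B x y) = mul B (dF D₁ x) y + mul B (eps x) (dF D₂ y) := by
  have : (mul B).compr₂ (dF D₃) - mul B ∘ₗ dF D₁ - (mul B).compl₁₂ eps (dF D₂) = 0 := by
    refine bilinear_eq_zero (-1) (fun x y => ?_) fun Y x y => ?_
    · simp only [LinearMap.sub_apply, LinearMap.compr₂_apply, LinearMap.comp_apply,
        LinearMap.compl₁₂_apply, map_sub, scalar_dF, scalar_mul]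
      simp
    · simp only [LinearMap.sub_apply, LinearMap.compr₂_apply, LinearMap.comp_apply,
        LinearMap.compl₁₂_apply, map_sub, iota_dF, iota_mul, lieF_mul hB, dF_eps, map_add,
        LinearMap.sub_apply, neg_smul, one_smul, iota_eps, eps_eps, map_neg, LinearMap.neg_apply]
      abel
  have h := congrArg (fun f => f x y) this
  simp only [LinearMap.sub_apply, LinearMap.compr₂_apply, LinearMap.zero_apply, sub_sub] at h
  exact sub_eq_zero.mp h

theorem mul_assoc' {B : N₁ →ₗ[R] N₂ →ₗ[R] N₃} {B' : N₃ →ₗ[R] N₄ →ₗ[R] N₅}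
    {G : N₂ →ₗ[R] N₄ →ₗ[R] N₆} {G' : N₁ →ₗ[R] N₆ →ₗ[R] N₅}
    (hB : ∀ a b c, B' (B a b) c = G' a (G b c))
    (x : Forms R L N₁) (y : Forms R L N₂) (z : Forms R L N₄) :
    mul B' (mul B x y) z = mul G' x (mul G y z) := by
  have : (mul B).compr₂ (mul B') -
      LinearMap.mk₂ ℝ (fun (x : Forms R L N₁) (y : Forms R L N₂) => mul G' x ∘ₗ mul G y)
        (by intros; ext; simp) (by intros; ext; simp) (by intros; ext; simp)
        (by intros; ext; simp) = 0 := by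
    refine trilinear_eq_zero 1 (fun x y z => ?_) fun X x y z => ?_
    · simp [scalar_mul, hB]
    · simp only [LinearMap.sub_apply, LinearMap.compr₂_apply, LinearMap.comp_apply,
        LinearMap.mk₂_apply, map_sub, iota_mul, eps_mul, map_add, LinearMap.add_apply, one_smul]
      abel
  have h := congrArg (fun f => f x y z) this
  simp only [LinearMap.sub_apply, LinearMap.compr₂_apply, LinearMap.comp_apply, LinearMap.mk₂_apply,
    LinearMap.zero_apply] at h
  exact sub_eq_zero.mp h

theorem iota_add_left (X Y : L) (x : Forms R L N) : iota (X + Y) x = iota X x + iota Y x := by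
  have : iota (X + Y) = iota X + (iota Y : Forms R L N →ₗ[ℝ] _) := by
    refine hom_ext fun p η => ?_
    rcases p with _ | p
    · simp [iota_of_zero]
    · simp [iota_of_succ]
  exact congrArg (fun f => f x) this

theorem lieF_lieF {D : P.Connection N}
    (hD : ∀ X Y n, D.nabla X (D.nabla Y n) - D.nabla Y (D.nabla X n) = D.nabla (P.br X Y) n)
    (X Y : L) (x : Forms R L N) :
    lieF D X (lieF D Y x) - lieF D Y (lieF D X x) = lieF D (P.br X Y) x := by
  have : lieF D X ∘ₗ lieF D Y - lieF D Y ∘ₗ lieF D X - lieF D (P.br X Y) = 0 := by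
    refine unary_eq_zero 1 (fun x => ?_) fun Z x => ?_
    · simp [scalar_lieF, hD]
    · simp only [LinearMap.sub_apply, LinearMap.comp_apply, map_sub, iota_lieF, one_smul,
        P.jacobi X Y Z, iota_add_left]
      abel
  have h := congrArg (fun f => f x) this
  exact sub_eq_zero.mp h

theorem dF_dF {D : P.Connection N}
    (hD : ∀ X Y n, D.nabla X (D.nabla Y n) - D.nabla Y (D.nabla X n) = D.nabla (P.br X Y) n)
    (x : Forms R L N) : dF D (dF D x) = 0 := by
  have h1 : ∀ X x, lieF D X (dF D x) = dF D (lieF D X x) := by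
    intro X x
    have : lieF D X ∘ₗ dF D - dF D ∘ₗ lieF D X = 0 := by
      refine unary_eq_zero (-1) (fun x => ?_) fun Z x => ?_
      · simp [scalar_lieF, scalar_dF]
      · simp only [LinearMap.sub_apply, LinearMap.comp_apply, map_sub, iota_lieF, iota_dF, neg_smul,
          one_smul, ← lieF_lieF hD]
        abel
    have h := congrArg (fun f => f x) this
    exact sub_eq_zero.mp h
  have : dF D ∘ₗ dF D = 0 := by
    refine unary_eq_zero 1 (fun x => ?_) fun Z x => ?_
    · simp [scalar_dF]
    · simp [iota_dF, h1]
  exact congrArg (fun f => f x) this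

end Forms

end FormsAlgebra

end Cartan

section SuperAlgebra

variable {R L N N₁ N₂ N₃ NC NE : Type*} [CommRing R] [Algebra ℝ R]
  [AddCommGroup L] [Module R L] [Module ℝ L] [IsScalarTower ℝ R L]
  [AddCommGroup N] [Module R N] [Module ℝ N] [IsScalarTower ℝ R N]
  [AddCommGroup N₁] [Module R N₁] [Module ℝ N₁] [IsScalarTower ℝ R N₁]
  [AddCommGroup N₂] [Module R N₂] [Module ℝ N₂] [IsScalarTower ℝ R N₂]
  [AddCommGroup N₃] [Module R N₃] [Module ℝ N₃] [IsScalarTower ℝ R N₃]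
  [AddCommGroup NC] [Module R NC] [Module ℝ NC] [IsScalarTower ℝ R NC]
  [AddCommGroup NE] [Module R NE] [Module ℝ NE] [IsScalarTower ℝ R NE]
  {P : LieRinehartData R L}

namespace Forms

/-- Composition of the values of a form with a linear map. -/
def push (f : N₁ →ₗ[R] N₂) : Forms R L N₁ →ₗ[ℝ] Forms R L N₂ :=
  Forms.lift fun p => of p ∘ₗ (LinearMap.compAlternatingMapₗ R f).restrictScalars ℝ

theorem push_of (f : N₁ →ₗ[R] N₂) (p : ℕ) (η : L [⋀^Fin p]→ₗ[R] N₁) :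
    push f (of p η) = of p (f.compAlternatingMap η) := by
  rw [push, lift_of]; rfl

theorem iota_push (f : N₁ →ₗ[R] N₂) (X : L) (x : Forms R L N₁) :
    iota X (push f x) = push f (iota X x) := by
  have : iota X ∘ₗ push f = push f ∘ₗ iota X := by
    refine hom_ext fun p η => ?_
    rcases p with _ | p
    · simp [push_of, iota_of_zero]
    · simp [push_of, iota_of_succ, AlternatingMap.curryLeft_compAlternatingMap]
  exact congrArg (fun f => f x) this

theorem scalar_push (f : N₁ →ₗ[R] N₂) (x : Forms R L N₁) : scalar (push f x) = f (scalar x) := by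
  have : scalar ∘ₗ push f = f.restrictScalars ℝ ∘ₗ (scalar : Forms R L N₁ →ₗ[ℝ] N₁) := by
    refine hom_ext fun p η => ?_
    rcases p with _ | p
    · simp [push_of, scalar_of_zero]
    · simp [push_of, scalar_of_succ]
  exact congrArg (fun f => f x) this

theorem push_push (f : N₁ →ₗ[R] N₂) (g : N₂ →ₗ[R] N₃) (x : Forms R L N₁) :
    push g (push f x) = push (g ∘ₗ f) x := by
  have : push g ∘ₗ push f = (push (g ∘ₗ f) : Forms R L N₁ →ₗ[ℝ] _) := by
    refine hom_ext fun p η => ?_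
    simp only [LinearMap.comp_apply, push_of]
    rfl
  exact congrArg (fun f => f x) this

theorem push_zero (x : Forms R L N₁) : push (0 : N₁ →ₗ[R] N₂) x = 0 := by
  have : (push (0 : N₁ →ₗ[R] N₂) : Forms R L N₁ →ₗ[ℝ] _) = 0 := by
    refine hom_ext fun p η => ?_
    rw [push_of]
    exact _root_.map_zero (of p)
  exact congrArg (fun f => f x) this

theorem push_id (x : Forms R L N₁) : push (LinearMap.id : N₁ →ₗ[R] N₁) x = x := by
  have : (push (LinearMap.id : N₁ →ₗ[R] N₁) : Forms R L N₁ →ₗ[ℝ] _) = LinearMap.id := by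
    refine hom_ext fun p η => ?_
    rw [push_of]
    rfl
  exact congrArg (fun f => f x) this

theorem push_mul {B : N₁ →ₗ[R] N₂ →ₗ[R] N₃} {B' : N₁ →ₗ[R] NC →ₗ[R] NE} {f : N₃ →ₗ[R] NE}
    {g : N₂ →ₗ[R] NC} (h : ∀ a b, f (B a b) = B' a (g b)) (x : Forms R L N₁) (y : Forms R L N₂) :
    push f (mul B x y) = mul B' x (push g y) := by
  have : (mul B).compr₂ (push f) - (mul B').compl₂ (push g) =
      (0 : Forms R L N₁ →ₗ[ℝ] Forms R L N₂ →ₗ[ℝ] Forms R L NE) := by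
    refine bilinear_eq_zero 1 (fun x y => ?_) fun Y x y => ?_
    · simp [scalar_push, scalar_mul, h]
    · simp only [LinearMap.sub_apply, LinearMap.compr₂_apply, LinearMap.compl₂_apply, map_sub,
        iota_push, iota_mul, map_add, one_smul]
      abel
  have h := congrArg (fun f => f x y) this
  simp only [LinearMap.sub_apply, LinearMap.compr₂_apply, LinearMap.compl₂_apply,
    LinearMap.zero_apply] at h
  exact sub_eq_zero.mp h

/-- An element of `N` as a form of degree `0`. -/
def const (n : N) : Forms R L N := of 0 (AlternatingMap.constOfIsEmpty R L (Fin 0) n)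

theorem scalar_const (n : N) : scalar (const n : Forms R L N) = n := scalar_of_zero _
theorem iota_const (X : L) (n : N) : iota X (const n : Forms R L N) = 0 := iota_of_zero X _
theorem eps_const (n : N) : eps (const n : Forms R L N) = const n := by
  rw [const, eps_of, pow_zero, one_smul]
theorem push_const (f : N₁ →ₗ[R] N₂) (n : N₁) : push f (const n : Forms R L N₁) = const (f n) := by
  rw [const, push_of]; rfl

theorem of_zero_eq_const (η : L [⋀^Fin 0]→ₗ[R] N) : of 0 η = const (η ![]) := by
  rw [const]
  congr 1
  ext v
  rw [Subsingleton.elim v ![]]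
  rfl

theorem wedgeLeft_eq {p : ℕ} (θ : L [⋀^Fin p]→ₗ[R] R) (x : Forms R L N) :
    wedgeLeft θ x = mul (LinearMap.lsmul R N) (of p θ) x := by
  have : wedgeLeft θ = mul (LinearMap.lsmul R N) (of p θ) := by
    refine hom_ext fun q η => ?_
    rw [mul_of, wedgeLeft, lift_of]
    rfl
  rw [this]

/-- Multiplication of forms by a function. -/
def smulF (f : R) : Forms R L N →ₗ[ℝ] Forms R L N := push (LinearMap.lsmul R N f)

theorem mul_const_left (f : R) (x : Forms R L N) :
    mul (LinearMap.lsmul R N) (const f) x = smulF f x := by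
  have : mul (LinearMap.lsmul R N) (const f) - smulF f = (0 : Forms R L N →ₗ[ℝ] _) := by
    refine unary_eq_zero 1 (fun x => ?_) fun X x => ?_
    · simp [scalar_mul, scalar_const, smulF, scalar_push]
    · simp [iota_mul, iota_const, eps_const, smulF, iota_push]
  exact sub_eq_zero.mp (congrArg (fun f => f x) this)

theorem component_smulF (f : R) (p : ℕ) (x : Forms R L N) :
    component p (smulF f x) = f • component p x := by
  have : component p ∘ₗ smulF f = (LinearMap.mk (AddHom.mk (fun η : L [⋀^Fin p]→ₗ[R] N => f • η)
      (fun _ _ => smul_add _ _ _)) (fun c η => smul_comm f c η) : _ →ₗ[ℝ] _) ∘ₗ component p := by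
    refine hom_ext fun q η => ?_
    rcases eq_or_ne q p with rfl | h
    · simp only [LinearMap.comp_apply, smulF, push_of, component_of]; rfl
    · simp only [LinearMap.comp_apply, smulF, push_of, component_of_ne h]; simp
  exact congrArg (fun f => f x) this

/-- A linear functional as a form of degree `1`. -/
def oneForm (l : L →ₗ[R] N) : Forms R L N := of 1 (AlternatingMap.ofSubsingleton R L N 0 l)

theorem iota_oneForm (X : L) (l : L →ₗ[R] N) : iota X (oneForm l) = const (l X) := by
  rw [oneForm, iota_of_succ, of_zero_eq_const]
  rfl

theorem scalar_oneForm (l : L →ₗ[R] N) : scalar (oneForm l) = 0 := scalar_of_succ 0 _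

theorem iota_iota (X Y : L) (x : Forms R L N) : iota X (iota Y x) = -iota Y (iota X x) := by
  have : iota X ∘ₗ iota Y + iota Y ∘ₗ iota X = (0 : Forms R L N →ₗ[ℝ] _) := by
    refine hom_ext fun p η => ?_
    rcases p with _ | _ | p
    · simp [iota_of_zero]
    · simp [iota_of_zero, iota_of_succ]
    · simp only [LinearMap.add_apply, LinearMap.comp_apply, iota_of_succ, LinearMap.zero_apply]
      rw [← map_add, ← _root_.map_zero (of p)]
      congr 1
      ext v
      change η (Matrix.vecCons Y (Matrix.vecCons X v)) + η (Matrix.vecCons X (Matrix.vecCons Y v)) = 0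
      rw [alternating_swap, neg_add_cancel]
  exact eq_neg_of_add_eq_zero_left (congrArg (fun f => f x) this)

theorem iota_smul_left (f : R) (X : L) (x : Forms R L N) : iota (f • X) x = smulF f (iota X x) := by
  have : iota (f • X) = smulF f ∘ₗ (iota X : Forms R L N →ₗ[ℝ] _) := by
    refine hom_ext fun p η => ?_
    rcases p with _ | p
    · simp [iota_of_zero]
    · simp only [LinearMap.comp_apply, iota_of_succ, smulF, push_of, map_smul]
      rfl
  exact congrArg (fun f => f x) this

theorem iota_sum_left {ι : Type*} (s : Finset ι) (X : ι → L) (x : Forms R L N) :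
    iota (∑ i ∈ s, X i) x = ∑ i ∈ s, iota (X i) x := by
  classical
  induction s using Finset.induction_on with
  | empty =>
    have : iota (0 : L) x = 0 := by
      have := iota_add_left (0 : L) 0 x
      rw [add_zero] at this
      exact left_eq_add.mp this
    simpa using this
  | insert a s ha ih => rw [Finset.sum_insert ha, iota_add_left, ih, Finset.sum_insert ha]

theorem euler {k : ℕ} {χ : R} {b : Fin k → L} {l : Fin k → L →ₗ[R] R}
    (h : ∀ v, χ • v = ∑ i, l i v • b i) (p : ℕ) (η : L [⋀^Fin p]→ₗ[R] N) :
    ∑ i, mul (LinearMap.lsmul R N) (oneForm (l i)) (iota (b i) (of p η)) =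
      (p : ℝ) • smulF χ (of p η) := by
  induction p with
  | zero => simp [iota_of_zero]
  | succ p ih =>
    refine sub_eq_zero.mp (eq_zero_of_scalar ?_ fun X => ?_)
    · simp [scalar_mul, scalar_oneForm, smulF, scalar_push, scalar_of_succ]
    · have h1 : ∀ i, iota X (mul (LinearMap.lsmul R N) (oneForm (l i)) (iota (b i) (of (p + 1) η)))
          = iota (l i X • b i) (of (p + 1) η) + mul (LinearMap.lsmul R N) (oneForm (l i))
              (iota (b i) (iota X (of (p + 1) η))) := by
        intro i
        rw [iota_mul, iota_oneForm, mul_const_left, iota_smul_left, iota_iota X, oneForm, eps_of]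
        simp
      rw [map_sub, map_sum, Finset.sum_congr rfl fun i _ => h1 i, Finset.sum_add_distrib,
        ← iota_sum_left, ← h, iota_smul_left, map_smul, smulF, iota_push, iota_of_succ, ih]
      push_cast
      rw [add_smul, one_smul, smulF, add_comm, sub_self]

end Forms

open Forms

variable (R L N) in
/-- Elements of `N` are detected by the functions `χ` for which `χ L` is generated by finitely many
elements in terms of a dual family. -/
def Separated : Prop := ∀ n : N, (∀ (k : ℕ) (χ : R) (b : Fin k → L) (l : Fin k → L →ₗ[R] R),
  (∀ v, χ • v = ∑ i, l i v • b i) → χ • n = 0) → n = 0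

theorem Separated.twoTerm (h₁ : Separated R L NC) (h₂ : Separated R L NE) :
    Separated R L (TwoTerm NC NE) := fun n hn => Prod.ext
  (h₁ n.1 fun k χ b l h => congrArg Prod.fst (hn k χ b l h))
  (h₂ n.2 fun k χ b l h => congrArg Prod.snd (hn k χ b l h))

/-- An operator which commutes, up to sign, with the multiplication by scalar forms is determined
by its values on forms of degree `0`. -/
theorem Separated.eq_zero (hN : Separated R L N) {T : Module.End ℝ (Forms R L N)}
    (s : Forms R L R →ₗ[ℝ] Forms R L R) (hs : ∀ f, s (const f) = const f)
    (hT : ∀ w x, T (mul (LinearMap.lsmul R N) w x) = mul (LinearMap.lsmul R N) (s w) (T x))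
    (h0 : ∀ n, T (const n) = 0) : T = 0 := by
  refine hom_ext fun p η => ?_
  rw [LinearMap.zero_apply]
  induction p with
  | zero => rw [of_zero_eq_const, h0]
  | succ p ih =>
    refine ext_component fun q => ?_
    rw [_root_.map_zero]
    ext v
    refine hN _ fun k χ b l h => ?_
    rw [← AlternatingMap.smul_apply, ← component_smulF]
    have h1 : ((p + 1 : ℕ) : ℝ) • smulF χ (T (of (p + 1) η)) = 0 := by
      rw [← mul_const_left, ← hs, ← hT, mul_const_left, ← map_smul, ← euler h, map_sum]
      refine Finset.sum_eq_zero fun i _ => ?_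
      rw [hT, iota_of_succ, ih, _root_.map_zero]
    have h2 : smulF χ (T (of (p + 1) η)) = 0 :=
      (smul_eq_zero.mp h1).resolve_left (by positivity)
    rw [h2, _root_.map_zero]
    rfl

/-! ### The operator of a quadruple -/

/-- Scalar multiplication forms. -/
abbrev sm (R N : Type*) [CommRing R] [AddCommGroup N] [Module R N] : R →ₗ[R] N →ₗ[R] N :=
  LinearMap.lsmul R N

/-- Evaluation of homomorphisms. -/
abbrev ev (R NE NC : Type*) [CommRing R] [AddCommGroup NE] [Module R NE] [AddCommGroup NC]
    [Module R NC] : NE →ₗ[R] (NE →ₗ[R] NC) →ₗ[R] NC := LinearMap.applyₗ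

theorem sigmaOp_eq (σ : L [⋀^Fin 1]→ₗ[R] (NE →ₗ[R] NC)) (x : Forms R L (TwoTerm NC NE)) :
    sigmaOp σ x = push (ofCore R NC NE) (mul (ev R NE NC) (push (toSide R NC NE) x) (of 1 σ)) := by
  have : sigmaOp σ = push (ofCore R NC NE) ∘ₗ (mul (ev R NE NC)).flip (of 1 σ) ∘ₗ
      push (toSide R NC NE) := by
    refine hom_ext fun p η => ?_
    simp only [sigmaOp, homogOp_of, LinearMap.comp_apply, push_of, LinearMap.flip_apply, mul_of]
    rfl
  rw [this]; rfl

theorem curvatureOp_eq (Ω : L [⋀^Fin 2]→ₗ[R] (NE →ₗ[R] NC)) (x : Forms R L (TwoTerm NC NE)) :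
    curvatureOp Ω x =
      push (ofCore R NC NE) (mul (ev R NE NC) (eps (push (toSide R NC NE) x)) (of 2 Ω)) := by
  have : curvatureOp Ω = push (ofCore R NC NE) ∘ₗ (mul (ev R NE NC)).flip (of 2 Ω) ∘ₗ eps ∘ₗ
      push (toSide R NC NE) := by
    refine hom_ext fun p η => ?_
    simp only [curvatureOp, homogOp_of, LinearMap.comp_apply, push_of, LinearMap.flip_apply, mul_of,
      eps_of, map_smul, LinearMap.smul_apply]
    rfl
  rw [this]; rfl

theorem boundaryOp_eq (bd : NC →ₗ[R] NE) (x : Forms R L (TwoTerm NC NE)) :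
    boundaryOp bd x =
      push (ofSide R NC NE) (push bd (eps (push (toCore R NC NE) x))) := by
  have : (boundaryOp bd : Module.End ℝ (Forms R L (TwoTerm NC NE))) =
      push (ofSide R NC NE) ∘ₗ push bd ∘ₗ eps ∘ₗ push (toCore R NC NE) := by
    refine hom_ext fun p η => ?_
    simp only [boundaryOp, homogOp_of, LinearMap.comp_apply, push_of, eps_of, map_smul,
      LinearMap.smul_apply]
    rfl
  rw [this]; rfl

theorem coreConnOp_eq (D : P.Connection NC) (x : Forms R L (TwoTerm NC NE)) :
    coreConnOp D x = push (ofCore R NC NE) (dF D (push (toCore R NC NE) x)) := by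
  have : coreConnOp D = push (ofCore R NC NE) ∘ₗ dF D ∘ₗ push (toCore R NC NE) := by
    refine hom_ext fun p η => ?_
    simp only [coreConnOp, homogOp_of, LinearMap.comp_apply, push_of, dF_of]
    rfl
  rw [this]; rfl

theorem sideConnOp_eq (D : P.Connection NE) (x : Forms R L (TwoTerm NC NE)) :
    sideConnOp D x = push (ofSide R NC NE) (dF D (push (toSide R NC NE) x)) := by
  have : sideConnOp D = push (ofSide R NC NE) ∘ₗ dF D ∘ₗ push (toSide R NC NE) := by
    refine hom_ext fun p η => ?_
    simp only [sideConnOp, homogOp_of, LinearMap.comp_apply, push_of, dF_of]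
    rfl
  rw [this]; rfl

theorem toCore_ofCore (x : Forms R L NC) :
    push (toCore R NC NE) (push (ofCore R NC NE) x) = x := by
  rw [push_push]; exact push_id x
theorem toSide_ofSide (x : Forms R L NE) :
    push (toSide R NC NE) (push (ofSide R NC NE) x) = x := by
  rw [push_push]; exact push_id x
theorem toCore_ofSide (x : Forms R L NE) :
    push (toCore R NC NE) (push (ofSide R NC NE) x) = 0 := by
  rw [push_push]; exact push_zero x
theorem toSide_ofCore_forms (x : Forms R L NC) :
    push (toSide R NC NE) (push (ofCore R NC NE) x) = 0 := by
  rw [push_push]; exact push_zero x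

theorem twoTerm_decomp (x : Forms R L (TwoTerm NC NE)) :
    push (ofCore R NC NE) (push (toCore R NC NE) x) +
      push (ofSide R NC NE) (push (toSide R NC NE) x) = x := by
  have : push (ofCore R NC NE) ∘ₗ push (toCore R NC NE) +
      push (ofSide R NC NE) ∘ₗ push (toSide R NC NE) =
      (LinearMap.id : Forms R L (TwoTerm NC NE) →ₗ[ℝ] _) := by
    refine hom_ext fun p η => ?_
    simp only [LinearMap.add_apply, LinearMap.comp_apply, push_of, ← map_add]
    refine congrArg (of p) ?_
    ext v
    exact Prod.fst_add_snd (η v)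
  exact congrArg (fun f => f x) this

theorem twoTerm_ext {x y : Forms R L (TwoTerm NC NE)}
    (h₁ : push (toCore R NC NE) x = push (toCore R NC NE) y)
    (h₂ : push (toSide R NC NE) x = push (toSide R NC NE) y) : x = y := by
  rw [← twoTerm_decomp x, h₁, h₂, twoTerm_decomp]

namespace SuperData

variable (S : SuperData NC NE P)

theorem toCore_op (x : Forms R L (TwoTerm NC NE)) : push (toCore R NC NE) (S.op x) =
    dF S.nablaC (push (toCore R NC NE) x) +
      mul (ev R NE NC) (eps (push (toSide R NC NE) x)) (of 2 S.curv) := by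
  simp only [op, LinearMap.add_apply, boundaryOp_eq, coreConnOp_eq, sideConnOp_eq, curvatureOp_eq,
    map_add, toCore_ofCore, toCore_ofSide, zero_add, add_zero]

theorem toSide_op (x : Forms R L (TwoTerm NC NE)) : push (toSide R NC NE) (S.op x) =
    push S.bd (eps (push (toCore R NC NE) x)) + dF S.nablaS (push (toSide R NC NE) x) := by
  simp only [op, LinearMap.add_apply, boundaryOp_eq, coreConnOp_eq, sideConnOp_eq, curvatureOp_eq,
    map_add, toSide_ofCore_forms, toSide_ofSide, add_zero]

theorem push_lsmul {f : N₁ →ₗ[R] N₂} (w : Forms R L R) (x : Forms R L N₁) :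
    push f (mul (sm R N₁) w x) = mul (sm R N₂) w (push f x) :=
  push_mul (fun a b => f.map_smul a b) w x

theorem dF_lsmul (D : P.Connection N) (w : Forms R L R) (x : Forms R L N) :
    dF D (mul (sm R N) w x) =
      mul (sm R N) (dF P.trivialConnection w) x + mul (sm R N) (eps w) (dF D x) :=
  dF_mul (B := sm R N) (D₁ := P.trivialConnection) (D₂ := D) (D₃ := D)
    (fun X a b => (D.leibniz X a b).trans (add_comm _ _)) w x

theorem lsmul_ev (w : Forms R L R) (x : Forms R L NE) (y : Forms R L (NE →ₗ[R] NC)) :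
    mul (ev R NE NC) (mul (sm R NE) w x) y = mul (sm R NC) w (mul (ev R NE NC) x y) :=
  mul_assoc' (fun a b c => c.map_smul a b) w x y

theorem op_mul (w : Forms R L R) (x : Forms R L (TwoTerm NC NE)) :
    S.op (mul (sm R _) w x) =
      mul (sm R _) (dF P.trivialConnection w) x + mul (sm R _) (eps w) (S.op x) := by
  refine twoTerm_ext ?_ ?_
  · simp only [toCore_op, push_lsmul, dF_lsmul, eps_mul, lsmul_ev, map_add]
    abel
  · simp only [toSide_op, push_lsmul, dF_lsmul, eps_mul, map_add]
    abel

end SuperData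

theorem sigmaOp_lsmul (σ : L [⋀^Fin 1]→ₗ[R] (NE →ₗ[R] NC)) (w : Forms R L R)
    (x : Forms R L (TwoTerm NC NE)) :
    sigmaOp σ (mul (sm R _) w x) = mul (sm R _) w (sigmaOp σ x) := by
  simp only [sigmaOp_eq, SuperData.push_lsmul, SuperData.lsmul_ev]

/-- The form is homogeneous of degree `m`. -/
def Forms.IsHomog (x : Forms R L N) (m : ℤ) : Prop := ∀ p, component p x ≠ 0 → (p : ℤ) = m

theorem Forms.IsHomog.cases {x : Forms R L N} {m : ℤ} (h : IsHomog x m) :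
    x = 0 ∨ ∃ (p : ℕ) (η : L [⋀^Fin p]→ₗ[R] N), (p : ℤ) = m ∧ x = of p η := by
  by_cases hx : ∃ p, component p x ≠ 0
  · obtain ⟨p, hp⟩ := hx
    refine Or.inr ⟨p, component p x, h p hp, ext_component fun q => ?_⟩
    rcases eq_or_ne p q with rfl | hpq
    · rw [component_of]
    · rw [component_of_ne hpq]
      by_contra hq
      have h1 := h q hq
      have h2 := h p hp
      omega
  · push Not at hx
    exact Or.inl (ext_component fun p => by rw [hx, _root_.map_zero])

theorem Forms.isHomog_of (p : ℕ) (η : L [⋀^Fin p]→ₗ[R] N) {m : ℤ} (h : (p : ℤ) = m) :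
    IsHomog (of p η) m := by
  intro q hq
  by_contra hne
  exact hq (component_of_ne (by omega) η)

theorem Forms.isHomog_zero (m : ℤ) : IsHomog (0 : Forms R L N) m := fun p hp =>
  absurd (_root_.map_zero _) hp

theorem Forms.IsHomog.add {x y : Forms R L N} {m : ℤ} (hx : IsHomog x m) (hy : IsHomog y m) :
    IsHomog (x + y) m := by
  intro p hp
  by_contra hne
  have h1 : component p x = 0 := by by_contra h; exact hne (hx p h)
  have h2 : component p y = 0 := by by_contra h; exact hne (hy p h)
  exact hp (by rw [map_add, h1, h2, add_zero])

theorem Forms.IsHomog.dF {x : Forms R L N} {m : ℤ} (hx : IsHomog x m) (D : P.Connection N) :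
    IsHomog (dF D x) (m + 1) := by
  rcases hx.cases with rfl | ⟨p, η, hp, rfl⟩
  · rw [_root_.map_zero]; exact isHomog_zero _
  · rw [dF_of]; exact isHomog_of _ _ (by push_cast; omega)

theorem Forms.IsHomog.eps {x : Forms R L N} {m : ℤ} (hx : IsHomog x m) : IsHomog (eps x) m := by
  rcases hx.cases with rfl | ⟨p, η, hp, rfl⟩
  · rw [_root_.map_zero]; exact isHomog_zero _
  · rw [eps_of, ← map_smul]; exact isHomog_of _ _ hp

theorem Forms.IsHomog.push {x : Forms R L N₁} {m : ℤ} (hx : IsHomog x m) (f : N₁ →ₗ[R] N₂) :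
    IsHomog (push f x) m := by
  rcases hx.cases with rfl | ⟨p, η, hp, rfl⟩
  · rw [_root_.map_zero]; exact isHomog_zero _
  · rw [push_of]; exact isHomog_of _ _ hp

theorem Forms.IsHomog.mul {x : Forms R L N₁} {m : ℤ} (hx : IsHomog x m) (B : N₁ →ₗ[R] N₂ →ₗ[R] N₃)
    (q : ℕ) (η : L [⋀^Fin q]→ₗ[R] N₂) : IsHomog (mul B x (of q η)) (m + q) := by
  rcases hx.cases with rfl | ⟨p, ζ, hp, rfl⟩
  · rw [_root_.map_zero]; exact isHomog_zero _
  · rw [mul_of]; exact isHomog_of _ _ (by push_cast; omega)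

theorem component_push (f : N₁ →ₗ[R] N₂) (p : ℕ) (x : Forms R L N₁) :
    component p (push f x) = f.compAlternatingMap (component p x) := by
  have : component p ∘ₗ push f =
      (LinearMap.compAlternatingMapₗ R f).restrictScalars ℝ ∘ₗ
        (component p : Forms R L N₁ →ₗ[ℝ] _) := by
    refine hom_ext fun q η => ?_
    rcases eq_or_ne q p with rfl | h
    · simp only [LinearMap.comp_apply, push_of, component_of]; rfl
    · simp only [LinearMap.comp_apply, push_of, component_of_ne h, _root_.map_zero]
  exact congrArg (fun f => f x) this

theorem hasTotalDegree_iff (x : Forms R L (TwoTerm NC NE)) (n : ℤ) :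
    HasTotalDegree x n ↔ IsHomog (push (toCore R NC NE) x) (n + 1) ∧
      IsHomog (push (toSide R NC NE) x) n := by
  constructor
  · intro h
    refine ⟨fun p hp => ?_, fun p hp => ?_⟩
    · rw [component_push] at hp
      by_contra hne
      refine hp (AlternatingMap.ext fun v => ?_)
      by_contra hv
      have := (h p v).1 hv
      omega
    · rw [component_push] at hp
      by_contra hne
      refine hp (AlternatingMap.ext fun v => ?_)
      by_contra hv
      have := (h p v).2 hv
      omega
  · rintro ⟨h₁, h₂⟩ p v
    refine ⟨fun hv => ?_, fun hv => ?_⟩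
    · have := h₁ p (fun h0 => hv (by
        rw [component_push] at h0
        exact congrArg (fun g => g v) h0))
      omega
    · exact h₂ p (fun h0 => hv (by
        rw [component_push] at h0
        exact congrArg (fun g => g v) h0))

theorem SuperData.isSuperconnection (S : SuperData NC NE P) : IsSuperconnection P S.op where
  degree_one x n h := by
    rw [hasTotalDegree_iff] at h ⊢
    rw [S.toCore_op, S.toSide_op]
    refine ⟨(h.1.dF _).add ?_, ((h.1.eps.push _)).add (h.2.dF _)⟩
    convert h.2.eps.mul (ev R NE NC) 2 S.curv using 1
    push_cast; ring
  leibniz p θ x := by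
    rw [wedgeLeft_eq, wedgeLeft_eq, wedgeLeft_eq, S.op_mul, dF_of, eps_of, map_smul,
      LinearMap.smul_apply]

theorem IsSuperconnection.op_mul {𝒟 : Module.End ℝ (Forms R L (TwoTerm NC NE))}
    (h : IsSuperconnection P 𝒟) (w : Forms R L R) (x : Forms R L (TwoTerm NC NE)) :
    𝒟 (mul (sm R _) w x) =
      mul (sm R _) (dF P.trivialConnection w) x + mul (sm R _) (eps w) (𝒟 x) := by
  have : (mul (sm R (TwoTerm NC NE))).compr₂ 𝒟 = mul (sm R _) ∘ₗ dF P.trivialConnection +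
      (mul (sm R _)).compl₁₂ eps 𝒟 := by
    refine hom_ext fun p θ => LinearMap.ext fun x => ?_
    have := h.leibniz p θ x
    rw [wedgeLeft_eq, wedgeLeft_eq, wedgeLeft_eq] at this
    simp only [LinearMap.compr₂_apply, LinearMap.add_apply, LinearMap.comp_apply,
      LinearMap.compl₁₂_apply, this, dF_of, eps_of, map_smul, LinearMap.smul_apply]
  exact congrArg (fun f => f w x) this

theorem const_twoTerm (n : TwoTerm NC NE) : (const n : Forms R L (TwoTerm NC NE)) =
    const (ofCore R NC NE n.1) + const (ofSide R NC NE n.2) := by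
  rw [const, const, const, ← map_add]
  congr 1
  ext v
  exact (Prod.fst_add_snd n).symm

theorem const_toCore_ofCore (α : NC) : push (toCore R NC NE) (const (ofCore R NC NE α) :
    Forms R L (TwoTerm NC NE)) = const α := by rw [push_const]; rfl
theorem const_toSide_ofCore (α : NC) : push (toSide R NC NE) (const (ofCore R NC NE α) :
    Forms R L (TwoTerm NC NE)) = 0 := by
  rw [push_const, toSide_ofCore]; exact _root_.map_zero (of 0)
theorem const_toCore_ofSide (ε : NE) : push (toCore R NC NE) (const (ofSide R NC NE ε) :
    Forms R L (TwoTerm NC NE)) = 0 := by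
  rw [push_const]; exact _root_.map_zero (of 0)
theorem const_toSide_ofSide (ε : NE) : push (toSide R NC NE) (const (ofSide R NC NE ε) :
    Forms R L (TwoTerm NC NE)) = const ε := by rw [push_const]; rfl

theorem iota_iota_of_two (X Y : L) (η : L [⋀^Fin 2]→ₗ[R] N) :
    iota Y (iota X (of 2 η)) = const (η ![X, Y]) := by
  rw [iota_of_succ, iota_of_succ, of_zero_eq_const]
  rfl

theorem iota_of_one (X : L) (η : L [⋀^Fin 1]→ₗ[R] N) : iota X (of 1 η) = const (η ![X]) := by
  rw [iota_of_succ, of_zero_eq_const]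
  rfl

theorem scalar_of_one (η : L [⋀^Fin 1]→ₗ[R] N) : scalar (of 1 η) = 0 := scalar_of_succ 0 η
theorem scalar_of_two (η : L [⋀^Fin 2]→ₗ[R] N) : scalar (of 2 η) = 0 := scalar_of_succ 1 η
theorem scalar_iota_of_two (X : L) (η : L [⋀^Fin 2]→ₗ[R] N) : scalar (iota X (of 2 η)) = 0 := by
  rw [iota_of_succ]; exact scalar_of_succ 0 _

theorem eq_of_scalar {x y : Forms R L N} (h0 : scalar x = scalar y)
    (h : ∀ X, iota X x = iota X y) : x = y := by
  refine sub_eq_zero.mp (eq_zero_of_scalar (by rw [map_sub, h0, sub_self]) fun X => ?_)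
  rw [map_sub, h, sub_self]

theorem lieF_const (D : P.Connection N) (X : L) (n : N) :
    lieF D X (const n) = const (D.nabla X n) := by
  refine eq_of_scalar (by rw [scalar_lieF, scalar_const, scalar_const]) fun Y => ?_
  · rw [iota_lieF]; simp [iota_const]

theorem iota_dF_const (D : P.Connection N) (X : L) (n : N) :
    iota X (dF D (const n)) = const (D.nabla X n) := by
  rw [iota_dF, iota_const, _root_.map_zero, sub_zero, lieF_const]

theorem mul_const_right_ev (x : NE) (f : NE →ₗ[R] NC) :
    mul (ev R NE NC) (const x) (const f) = (const (f x) : Forms R L NC) := by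
  refine eq_of_scalar ?_ fun X => by simp [iota_mul, iota_const]
  simp [scalar_mul, scalar_const]

theorem const_zero : (const 0 : Forms R L N) = 0 := _root_.map_zero (of 0)
theorem const_add (m n : N) : (const (m + n) : Forms R L N) = const m + const n := by
  rw [const, const, const, ← map_add]; rfl
theorem const_neg (n : N) : (const (-n) : Forms R L N) = -const n := by
  rw [const, const, ← map_neg]; rfl
theorem const_sub (m n : N) : (const (m - n) : Forms R L N) = const m - const n := by
  rw [sub_eq_add_neg, const_add, const_neg, sub_eq_add_neg]

namespace SuperData

variable (S : SuperData NC NE P)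

theorem op_ext (hN : Separated R L (TwoTerm NC NE))
    {𝒟 𝒟' : Module.End ℝ (Forms R L (TwoTerm NC NE))}
    (h : IsSuperconnection P 𝒟) (h' : IsSuperconnection P 𝒟')
    (hc : ∀ α : NC, 𝒟 (const (ofCore R NC NE α)) = 𝒟' (const (ofCore R NC NE α)))
    (hs : ∀ ε : NE, 𝒟 (const (ofSide R NC NE ε)) = 𝒟' (const (ofSide R NC NE ε))) : 𝒟 = 𝒟' := by
  refine sub_eq_zero.mp (hN.eq_zero eps eps_const (fun w x => ?_) fun n => ?_)
  · rw [LinearMap.sub_apply, LinearMap.sub_apply, h.op_mul, h'.op_mul, map_sub]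
    abel
  · rw [const_twoTerm n, map_add, LinearMap.sub_apply, LinearMap.sub_apply, hc, hs, sub_self,
      sub_self, add_zero]

theorem curv_ext {θ η : L [⋀^Fin 2]→ₗ[R] N} (h : ∀ X Y, θ ![X, Y] = η ![X, Y]) : θ = η := by
  ext v
  have : v = ![v 0, v 1] := by
    ext i
    fin_cases i <;> rfl
  rw [this, h]

/-- A quadruple is determined by its operator. -/
theorem op_injective : Function.Injective (op : SuperData NC NE P → _) := by
  intro S S' h
  have hc : ∀ α : NC, S.op (const (ofCore R NC NE α)) = S'.op (const (ofCore R NC NE α)) :=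
    fun α => by rw [h]
  have hs : ∀ ε : NE, S.op (const (ofSide R NC NE ε)) = S'.op (const (ofSide R NC NE ε)) :=
    fun α => by rw [h]
  have h1 : S.bd = S'.bd := by
    ext α
    have := congrArg (fun x => scalar (push (toSide R NC NE) x)) (hc α)
    simpa [toSide_op, scalar_push, scalar_dF, scalar_eps, const_toCore_ofCore, scalar_const]
      using this
  have h2 : S.nablaC.nabla = S'.nablaC.nabla := by
    ext X α
    have := congrArg (fun x => scalar (iota X (push (toCore R NC NE) x))) (hc α)
    simpa [toCore_op, const_toCore_ofCore, const_toSide_ofCore, iota_dF_const, scalar_const]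
      using this
  have h3 : S.nablaS.nabla = S'.nablaS.nabla := by
    ext X ε
    have := congrArg (fun x => scalar (iota X (push (toSide R NC NE) x))) (hs ε)
    simpa [toSide_op, const_toCore_ofSide, const_toSide_ofSide, iota_dF_const, scalar_const]
      using this
  have h4 : S.curv = S'.curv := by
    refine curv_ext fun X Y => LinearMap.ext fun ε => ?_
    have := congrArg (fun x => scalar (iota Y (iota X (push (toCore R NC NE) x)))) (hs ε)
    simpa [toCore_op, const_toCore_ofSide, const_toSide_ofSide, scalar_const, iota_mul, eps_const,
      iota_const, iota_iota_of_two, mul_const_right_ev] using this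
  obtain ⟨bd, ⟨nc, lc⟩, ⟨ns, ls⟩, curv⟩ := S
  obtain ⟨bd', ⟨nc', lc'⟩, ⟨ns', ls'⟩, curv'⟩ := S'
  simp only at h1 h2 h3 h4
  subst h1 h2 h3 h4
  rfl

/-- The structure equations of a flat superconnection. -/
structure IsFlat : Prop where
  bd_nabla : ∀ X α, S.nablaS.nabla X (S.bd α) = S.bd (S.nablaC.nabla X α)
  curvC : ∀ X Y α, S.nablaC.nabla X (S.nablaC.nabla Y α) - S.nablaC.nabla Y (S.nablaC.nabla X α) -
    S.nablaC.nabla (P.br X Y) α = -S.curv ![X, Y] (S.bd α)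
  curvS : ∀ X Y ε, S.nablaS.nabla X (S.nablaS.nabla Y ε) - S.nablaS.nabla Y (S.nablaS.nabla X ε) -
    S.nablaS.nabla (P.br X Y) ε = -S.bd (S.curv ![X, Y] ε)
  bianchi : ∀ X Y Z ε,
    (S.nablaC.nabla X (S.curv ![Y, Z] ε) - S.curv ![Y, Z] (S.nablaS.nabla X ε)) +
    (S.nablaC.nabla Y (S.curv ![Z, X] ε) - S.curv ![Z, X] (S.nablaS.nabla Y ε)) +
    (S.nablaC.nabla Z (S.curv ![X, Y] ε) - S.curv ![X, Y] (S.nablaS.nabla Z ε)) -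
    S.curv ![P.br X Y, Z] ε - S.curv ![P.br Y Z, X] ε - S.curv ![P.br Z X, Y] ε = 0

end SuperData

namespace SuperData

variable (S : SuperData NC NE P)

theorem toCore_ofCore_apply (α : NC) : toCore R NC NE (ofCore R NC NE α) = α := rfl
theorem toSide_ofSide_apply (ε : NE) : toSide R NC NE (ofSide R NC NE ε) = ε := rfl
theorem toCore_ofSide_apply (ε : NE) : toCore R NC NE (ofSide R NC NE ε) = 0 := rfl

theorem curv_swap (Ω : L [⋀^Fin 2]→ₗ[R] N) (X Y : L) : Ω ![X, Y] = -Ω ![Y, X] :=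
  alternating_swap (n := 0) Ω X Y ![]

theorem toSide_sq_core (α : NC) (X : L) :
    iota X (push (toSide R NC NE) (S.op (S.op (const (ofCore R NC NE α))))) =
      const (S.nablaS.nabla X (S.bd α) - S.bd (S.nablaC.nabla X α)) := by
  simp only [toCore_ofCore_apply, toSide_ofCore, const_zero, toSide_op, toCore_op, _root_.map_zero,
    map_add, LinearMap.zero_apply, add_zero, eps_const, push_const, iota_push, iota_eps,
    iota_dF_const, map_neg, const_sub]
  abel

theorem toCore_sq_core (α : NC) (X Y : L) :
    iota Y (iota X (push (toCore R NC NE) (S.op (S.op (const (ofCore R NC NE α)))))) =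
      const (S.nablaC.nabla X (S.nablaC.nabla Y α) - S.nablaC.nabla Y (S.nablaC.nabla X α) -
        S.nablaC.nabla (P.br X Y) α + S.curv ![X, Y] (S.bd α)) := by
  simp only [toCore_ofCore_apply, toSide_ofCore, const_zero, toSide_op, toCore_op, _root_.map_zero,
    map_add, LinearMap.zero_apply, add_zero, eps_const, push_const, const_sub, iota_dF, iota_lieF,
    lieF_const, iota_mul, iota_const, map_sub, zero_add, sub_zero, iota_iota_of_two,
    mul_const_right_ev, const_add]
  abel

theorem toSide_sq_side (ε : NE) (X Y : L) :
    iota Y (iota X (push (toSide R NC NE) (S.op (S.op (const (ofSide R NC NE ε)))))) =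
      const (S.nablaS.nabla X (S.nablaS.nabla Y ε) - S.nablaS.nabla Y (S.nablaS.nabla X ε) -
        S.nablaS.nabla (P.br X Y) ε + S.bd (S.curv ![X, Y] ε)) := by
  simp only [toSide_ofSide_apply, toCore_ofSide_apply, const_zero, toSide_op, toCore_op,
    _root_.map_zero, map_add, LinearMap.zero_apply, eps_const, push_const, iota_push, iota_eps,
    map_neg, const_sub, iota_dF, iota_lieF, lieF_const, iota_mul, iota_const, map_sub, zero_add,
    sub_zero, iota_iota_of_two, mul_const_right_ev, const_add, neg_neg]
  abel

theorem toCore_sq_side (ε : NE) (X Y Z : L) :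
    iota Z (iota Y (iota X (push (toCore R NC NE) (S.op (S.op (const (ofSide R NC NE ε))))))) =
      const ((S.nablaC.nabla X (S.curv ![Y, Z] ε) - S.curv ![Y, Z] (S.nablaS.nabla X ε)) +
    (S.nablaC.nabla Y (S.curv ![Z, X] ε) - S.curv ![Z, X] (S.nablaS.nabla Y ε)) +
    (S.nablaC.nabla Z (S.curv ![X, Y] ε) - S.curv ![X, Y] (S.nablaS.nabla Z ε)) -
    S.curv ![P.br X Y, Z] ε - S.curv ![P.br Y Z, X] ε - S.curv ![P.br Z X, Y] ε) := by
  rw [curv_swap S.curv Z X, curv_swap S.curv (P.br Y Z) X, br_antisymm P X Z]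
  have h : ∀ U V : L, S.curv ![-U, V] = S.curv ![V, U] := by
    intro U V
    rw [curv_swap S.curv V U]
    exact congrArg (fun g => g ![V]) (S.curv.curryLeft.map_neg U)
  simp only [toSide_ofSide_apply, toCore_ofSide_apply, const_zero, LinearMap.neg_apply, toSide_op,
    toCore_op, _root_.map_zero, map_add, LinearMap.zero_apply, add_zero, eps_const, push_const,
    iota_eps, map_neg, const_sub, iota_dF, iota_lieF, lieF_const, iota_mul, iota_const, map_sub,
    zero_add, sub_zero, iota_iota_of_two, mul_const_right_ev, const_add, LinearMap.neg_apply,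
    const_neg, h, eps_eps]
  abel

theorem scalar_toSide_sq_core (α : NC) :
    scalar (push (toSide R NC NE) (S.op (S.op (const (ofCore R NC NE α))))) = 0 := by
  simp only [toSide_op, toCore_op, map_add, scalar_push, scalar_eps, scalar_dF, scalar_mul,
    scalar_of_two, _root_.map_zero, add_zero]

theorem scalar_toCore_sq (x : Forms R L (TwoTerm NC NE)) :
    scalar (push (toCore R NC NE) (S.op (S.op x))) = 0 := by
  simp only [LinearMap.add_apply, toSide_op, toCore_op, map_add, scalar_push, scalar_eps, scalar_dF,
    scalar_mul, scalar_of_two, _root_.map_zero, add_zero]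

theorem scalar_iota_toCore_sq_core (α : NC) (X : L) :
    scalar (iota X (push (toCore R NC NE) (S.op (S.op (const (ofCore R NC NE α)))))) = 0 := by
  simp only [toSide_op, toCore_op, const_toCore_ofCore, const_toSide_ofCore, _root_.map_zero,
    map_add, LinearMap.zero_apply, add_zero, iota_dF, scalar_lieF, scalar_dF, map_sub, iota_mul,
    scalar_mul, scalar_of_two, scalar_iota_of_two, sub_zero]

theorem scalar_toSide_sq_side (ε : NE) :
    scalar (push (toSide R NC NE) (S.op (S.op (const (ofSide R NC NE ε))))) = 0 := by
  simp only [toSide_op, toCore_op, const_toCore_ofSide, const_toSide_ofSide, map_add, scalar_push,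
    scalar_eps, scalar_dF, scalar_mul, scalar_of_two, _root_.map_zero, add_zero]

theorem scalar_iota_toSide_sq_side (ε : NE) (X : L) :
    scalar (iota X (push (toSide R NC NE) (S.op (S.op (const (ofSide R NC NE ε)))))) = 0 := by
  simp only [toSide_op, toCore_op, const_toCore_ofSide, const_toSide_ofSide, _root_.map_zero,
    map_add, LinearMap.zero_apply, add_zero, zero_add, iota_dF, scalar_lieF, scalar_dF, map_sub,
    iota_mul, scalar_mul, iota_push, iota_eps, map_neg, scalar_push, scalar_eps, neg_zero,
    iota_const, scalar_iota_of_two, sub_zero]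

theorem scalar_iota_toCore_sq_side (ε : NE) (X : L) :
    scalar (iota X (push (toCore R NC NE) (S.op (S.op (const (ofSide R NC NE ε)))))) = 0 := by
  simp only [LinearMap.neg_apply, toSide_op, toCore_op, const_toCore_ofSide, const_toSide_ofSide,
    _root_.map_zero, map_add, LinearMap.zero_apply, add_zero, zero_add, iota_dF, scalar_lieF,
    scalar_dF, map_sub, iota_mul, scalar_mul, iota_eps, map_neg, scalar_eps, neg_zero, iota_const,
    scalar_of_two, scalar_iota_of_two, sub_zero]

theorem scalar_iota_iota_toCore_sq_side (ε : NE) (X Y : L) :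
    scalar (iota Y (iota X (push (toCore R NC NE) (S.op (S.op (const (ofSide R NC NE ε))))))) =
      0 := by
  simp only [LinearMap.neg_apply, toSide_op, toCore_op, const_toCore_ofSide, const_toSide_ofSide,
    _root_.map_zero, map_add, LinearMap.zero_apply, add_zero, zero_add, iota_dF, scalar_lieF,
    scalar_dF, map_sub, iota_mul, scalar_mul, iota_eps, map_neg, scalar_eps, neg_zero, iota_const,
    scalar_iota_of_two, sub_zero, iota_lieF]

theorem IsFlat.of_sq (h : S.op * S.op = 0) : S.IsFlat where
  bd_nabla X α := by
    have := S.toSide_sq_core α X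
    rw [show ∀ x, S.op (S.op x) = 0 from fun x => congrArg (fun T => T x) h] at this
    have := congrArg scalar this
    simp only [_root_.map_zero, scalar_const] at this
    exact sub_eq_zero.mp this.symm
  curvC X Y α := by
    have := S.toCore_sq_core α X Y
    rw [show ∀ x, S.op (S.op x) = 0 from fun x => congrArg (fun T => T x) h] at this
    have := congrArg scalar this
    simp only [_root_.map_zero, scalar_const] at this
    exact eq_neg_of_add_eq_zero_left this.symm
  curvS X Y ε := by
    have := S.toSide_sq_side ε X Y
    rw [show ∀ x, S.op (S.op x) = 0 from fun x => congrArg (fun T => T x) h] at this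
    have := congrArg scalar this
    simp only [_root_.map_zero, scalar_const] at this
    exact eq_neg_of_add_eq_zero_left this.symm
  bianchi X Y Z ε := by
    have := S.toCore_sq_side ε X Y Z
    rw [show ∀ x, S.op (S.op x) = 0 from fun x => congrArg (fun T => T x) h] at this
    have := congrArg scalar this
    simp only [_root_.map_zero, scalar_const] at this
    exact this.symm

theorem IsFlat.sq (hN : Separated R L (TwoTerm NC NE))
    (hρ : ∀ X Y f, P.rho X (P.rho Y f) - P.rho Y (P.rho X f) = P.rho (P.br X Y) f)
    (h : S.IsFlat) : S.op * S.op = 0 := by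
  refine hN.eq_zero LinearMap.id (fun _ => rfl) (fun w x => ?_) fun n => ?_
  · simp only [Module.End.mul_apply, op_mul, map_add, dF_eps, eps_eps, map_neg, LinearMap.neg_apply,
      dF_dF (D := P.trivialConnection) hρ, _root_.map_zero, LinearMap.zero_apply, LinearMap.id_apply]
    abel
  · rw [const_twoTerm n, map_add]
    have h1 : (S.op * S.op) (const (ofCore R NC NE n.1)) = 0 := by
      refine twoTerm_ext ?_ ?_ <;> rw [_root_.map_zero, Module.End.mul_apply]
      · refine eq_zero_of_scalar (S.scalar_toCore_sq _) fun X =>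
          eq_zero_of_scalar (S.scalar_iota_toCore_sq_core _ X) fun Y => ?_
        rw [toCore_sq_core, h.curvC, neg_add_cancel, const_zero]
      · refine eq_zero_of_scalar (S.scalar_toSide_sq_core _) fun X => ?_
        rw [toSide_sq_core, h.bd_nabla, sub_self, const_zero]
    have h2 : (S.op * S.op) (const (ofSide R NC NE n.2)) = 0 := by
      refine twoTerm_ext ?_ ?_ <;> rw [_root_.map_zero, Module.End.mul_apply]
      · refine eq_zero_of_scalar (S.scalar_toCore_sq _) fun X =>
          eq_zero_of_scalar (S.scalar_iota_toCore_sq_side _ X) fun Y =>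
          eq_zero_of_scalar (S.scalar_iota_iota_toCore_sq_side _ X Y) fun Z => ?_
        rw [toCore_sq_side, h.bianchi, const_zero]
      · refine eq_zero_of_scalar (S.scalar_toSide_sq_side _) fun X =>
          eq_zero_of_scalar (S.scalar_iota_toSide_sq_side _ X) fun Y => ?_
        rw [toSide_sq_side, h.curvS, neg_add_cancel, const_zero]
    rw [h1, h2, add_zero]

/-- The change of a quadruple under `1 + σ`. -/
structure GaugeRel (S S' : SuperData NC NE P) (σ : L [⋀^Fin 1]→ₗ[R] (NE →ₗ[R] NC)) : Prop where
  bd : S'.bd = S.bd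
  nablaC : ∀ X α, S'.nablaC.nabla X α = S.nablaC.nabla X α + σ ![X] (S.bd α)
  nablaS : ∀ X ε, S'.nablaS.nabla X ε = S.nablaS.nabla X ε + S.bd (σ ![X] ε)
  curv : ∀ X Y ε, S'.curv ![X, Y] ε = S.curv ![X, Y] ε + σ ![P.br X Y] ε
    - (S.nablaC.nabla X (σ ![Y] ε) - σ ![Y] (S.nablaS.nabla X ε))
    + (S.nablaC.nabla Y (σ ![X] ε) - σ ![X] (S.nablaS.nabla Y ε))
    - σ ![X] (S.bd (σ ![Y] ε)) + σ ![Y] (S.bd (σ ![X] ε))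

theorem toCore_sigmaOp (σ : L [⋀^Fin 1]→ₗ[R] (NE →ₗ[R] NC)) (x : Forms R L (TwoTerm NC NE)) :
    push (toCore R NC NE) (sigmaOp σ x) =
      mul (ev R NE NC) (push (toSide R NC NE) x) (of 1 σ) := by
  rw [sigmaOp_eq, toCore_ofCore]

theorem toSide_sigmaOp (σ : L [⋀^Fin 1]→ₗ[R] (NE →ₗ[R] NC)) (x : Forms R L (TwoTerm NC NE)) :
    push (toSide R NC NE) (sigmaOp σ x) = 0 := by
  rw [sigmaOp_eq, toSide_ofCore_forms]

theorem GaugeRel.op_core {S S' : SuperData NC NE P}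
    {σ : L [⋀^Fin 1]→ₗ[R] (NE →ₗ[R] NC)} (h : GaugeRel S S' σ) (α : NC) :
    S'.op (const (ofCore R NC NE α)) = S.op (const (ofCore R NC NE α)) -
      S.op (sigmaOp σ (const (ofCore R NC NE α))) + sigmaOp σ (S.op (const (ofCore R NC NE α))) -
      sigmaOp σ (S.op (sigmaOp σ (const (ofCore R NC NE α)))) := by
  refine twoTerm_ext ?_ ?_
  · simp only [sub_zero, toCore_ofCore_apply, toSide_ofCore, const_zero, toCore_op, toSide_op,
      toCore_sigmaOp, toSide_sigmaOp, map_add, map_sub, _root_.map_zero, LinearMap.zero_apply,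
      add_zero, sub_zero, eps_const, push_const]
    refine eq_of_scalar ?_ fun X => ?_
    · simp only [scalar_dF, scalar_mul, scalar_of_one, map_add, _root_.map_zero, add_zero]
    · simp only [iota_dF_const, map_add, iota_mul, iota_const, iota_of_one, eps_const,
        mul_const_right_ev, h.nablaC, const_add, _root_.map_zero, LinearMap.zero_apply, zero_add]
  · simp only [sub_zero, toCore_ofCore_apply, toSide_ofCore, const_zero, toSide_op, toCore_sigmaOp,
      toSide_sigmaOp, map_add, map_sub, _root_.map_zero, LinearMap.zero_apply, add_zero, sub_zero,
      eps_const, push_const, h.bd, sub_zero, add_zero]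

theorem GaugeRel.op_side_toSide {S S' : SuperData NC NE P}
    {σ : L [⋀^Fin 1]→ₗ[R] (NE →ₗ[R] NC)} (h : GaugeRel S S' σ) (ε : NE) :
    push (toSide R NC NE) (S'.op (const (ofSide R NC NE ε))) =
      push (toSide R NC NE) (S.op (const (ofSide R NC NE ε)) -
      S.op (sigmaOp σ (const (ofSide R NC NE ε))) + sigmaOp σ (S.op (const (ofSide R NC NE ε))) -
      sigmaOp σ (S.op (sigmaOp σ (const (ofSide R NC NE ε))))) := by
  simp only [sub_zero, toSide_ofSide_apply, toCore_ofSide_apply, const_zero, toSide_op,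
    toCore_sigmaOp, toSide_sigmaOp, map_add, map_sub, _root_.map_zero, add_zero, zero_add, sub_zero,
    push_const]
  refine eq_of_scalar ?_ fun X => ?_
  · simp only [scalar_dF, scalar_mul, scalar_of_one, scalar_push, scalar_eps, map_sub,
      _root_.map_zero, sub_zero]
  · simp only [iota_dF_const, iota_mul, iota_const, iota_of_one, eps_const, mul_const_right_ev,
      h.nablaS, const_add, _root_.map_zero, LinearMap.zero_apply, zero_add, map_sub, iota_push,
      iota_eps, map_neg, push_const, sub_neg_eq_add]

theorem GaugeRel.op_side_toCore {S S' : SuperData NC NE P}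
    {σ : L [⋀^Fin 1]→ₗ[R] (NE →ₗ[R] NC)} (h : GaugeRel S S' σ) (ε : NE) :
    push (toCore R NC NE) (S'.op (const (ofSide R NC NE ε))) =
      push (toCore R NC NE) (S.op (const (ofSide R NC NE ε)) -
      S.op (sigmaOp σ (const (ofSide R NC NE ε))) + sigmaOp σ (S.op (const (ofSide R NC NE ε))) -
      sigmaOp σ (S.op (sigmaOp σ (const (ofSide R NC NE ε))))) := by
  simp only [toSide_ofSide_apply, toCore_ofSide_apply, const_zero, toCore_op, toSide_op,
    toCore_sigmaOp, toSide_sigmaOp, map_add, map_sub, _root_.map_zero, LinearMap.zero_apply,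
    add_zero, zero_add, eps_const, push_const]
  refine eq_of_scalar ?_ fun X => eq_of_scalar ?_ fun Y => ?_
  · simp only [scalar_dF, scalar_mul, scalar_of_one, scalar_of_two, map_add, map_sub,
      _root_.map_zero, sub_zero, add_zero]
  · simp only [LinearMap.neg_apply, scalar_dF, scalar_mul, scalar_of_one, iota_mul,
      scalar_iota_of_two, scalar_const, iota_dF, scalar_lieF, iota_const, iota_push, iota_of_one,
      map_add, map_sub, _root_.map_zero, sub_zero, add_zero, LinearMap.zero_apply, iota_eps,
      map_neg, scalar_eps, scalar_push, zero_add, LinearMap.neg_apply, neg_zero]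
  · simp only [LinearMap.neg_apply, map_sub, map_add, iota_mul, iota_dF, iota_lieF, lieF_const,
      iota_const, iota_iota_of_two, mul_const_right_ev, eps_const, iota_of_one, _root_.map_zero,
      LinearMap.zero_apply, zero_add, add_zero, sub_zero, iota_push, push_const, iota_eps, map_neg,
      h.curv, const_sub, const_add, eps_mul, eps_eps]
    abel

theorem op_eq_of_comm (hN : Separated R L (TwoTerm NC NE)) (S : SuperData NC NE P)
    (G : Module.End ℝ (Forms R L (TwoTerm NC NE)))
    (comm : ∀ w x, G (mul (sm R _) w x) =
      mul (sm R _) (dF P.trivialConnection w) x + mul (sm R _) (eps w) (G x))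
    (hc : ∀ α, S.op (const (ofCore R NC NE α)) = G (const (ofCore R NC NE α)))
    (hs : ∀ ε, S.op (const (ofSide R NC NE ε)) = G (const (ofSide R NC NE ε))) : S.op = G := by
  refine sub_eq_zero.mp (hN.eq_zero eps eps_const (fun w x => ?_) fun n => ?_)
  · rw [LinearMap.sub_apply, LinearMap.sub_apply, comm, op_mul, LinearMap.map_sub]
    abel
  · rw [LinearMap.sub_apply, const_twoTerm n, LinearMap.map_add, LinearMap.map_add, hc, hs,
      sub_self]

theorem GaugeRel.op_eq (hN : Separated R L (TwoTerm NC NE)) {S S' : SuperData NC NE P}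
    {σ : L [⋀^Fin 1]→ₗ[R] (NE →ₗ[R] NC)} (h : GaugeRel S S' σ) :
    S'.op = (gauge σ : Module.End ℝ (Forms R L (TwoTerm NC NE))) * S.op * ↑(gauge σ)⁻¹ := by
  have key : ∀ x, ((gauge σ : Module.End ℝ (Forms R L (TwoTerm NC NE))) * S.op * ↑(gauge σ)⁻¹) x =
      S.op x - S.op (sigmaOp σ x) + sigmaOp σ (S.op x) - sigmaOp σ (S.op (sigmaOp σ x)) := by
    intro x
    have e : (gauge σ : Module.End ℝ (Forms R L (TwoTerm NC NE))) * S.op * ↑(gauge σ)⁻¹ =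
      (1 + sigmaOp σ) * S.op * (1 - sigmaOp σ) := rfl
    rw [e]
    simp only [Module.End.mul_apply, LinearMap.add_apply, LinearMap.sub_apply, Module.End.one_apply,
      map_sub]
    abel
  generalize (gauge σ : Module.End ℝ (Forms R L (TwoTerm NC NE))) * S.op * ↑(gauge σ)⁻¹ = G at key
  refine op_eq_of_comm hN S' G (fun w x => ?_) (fun α => ?_) fun ε => ?_
  · have hss : sigmaOp σ (sigmaOp σ x) = 0 := by
      rw [← Module.End.mul_apply, sigmaOp_mul, LinearMap.zero_apply]
    rw [key, key, sigmaOp_lsmul, op_mul, op_mul, LinearMap.map_add, LinearMap.map_add,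
      sigmaOp_lsmul, sigmaOp_lsmul, sigmaOp_lsmul, sigmaOp_lsmul, hss, LinearMap.map_zero,
      LinearMap.map_sub, LinearMap.map_add, LinearMap.map_sub]
    generalize mul (sm R _) (dF P.trivialConnection w) x = a1
    generalize mul (sm R _) (eps w) (S.op x) = a2
    generalize mul (sm R _) (dF P.trivialConnection w) (sigmaOp σ x) = a3
    abel
  · rw [key, h.op_core]
  · rw [key]
    exact twoTerm_ext (h.op_side_toCore ε) (h.op_side_toSide ε)

end SuperData

/-- The consequences of `𝒟' = u 𝒟 u⁻¹` for iterated commutators with `σ`. -/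
theorem gauge_expansion (σ : L [⋀^Fin 1]→ₗ[R] (NE →ₗ[R] NC))
    {𝒟 𝒟' : Module.End ℝ (Forms R L (TwoTerm NC NE))}
    (h : 𝒟' = (gauge σ : Module.End ℝ (Forms R L (TwoTerm NC NE))) * 𝒟 * ↑(gauge σ)⁻¹) :
    𝒟' = 𝒟 + ⁅sigmaOp σ, 𝒟⁆ + (1 / 2 : ℝ) • ⁅sigmaOp σ, ⁅sigmaOp σ, 𝒟⁆⁆ ∧
    ⁅sigmaOp σ, ⁅sigmaOp σ, ⁅sigmaOp σ, 𝒟⁆⁆⁆ = 0 ∧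
    (∀ n : ℕ, 3 ≤ n → (fun Q => ⁅sigmaOp σ, Q⁆)^[n] 𝒟 = 0) ∧
    𝒟' = ∑ᶠ n : ℕ, ((n.factorial : ℝ)⁻¹) • (fun Q => ⁅sigmaOp σ, Q⁆)^[n] 𝒟 := by
  have hs := sigmaOp_mul σ σ
  have h' : 𝒟' = (1 + sigmaOp σ) * 𝒟 * (1 - sigmaOp σ) := h
  set s := sigmaOp σ
  have e1 : ⁅s, 𝒟⁆ = s * 𝒟 - 𝒟 * s := rfl
  have e2 : ⁅s, ⁅s, 𝒟⁆⁆ = -(2 : ℝ) • (s * 𝒟 * s) := by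
    change s * (s * 𝒟 - 𝒟 * s) - (s * 𝒟 - 𝒟 * s) * s = _
    rw [mul_sub, sub_mul, ← mul_assoc, hs, zero_mul, mul_assoc 𝒟, hs, mul_zero, ← mul_assoc,
      neg_smul, two_smul]
    abel
  have e3 : ⁅s, ⁅s, ⁅s, 𝒟⁆⁆⁆ = 0 := by
    rw [e2]
    change s * (-(2 : ℝ) • (s * 𝒟 * s)) - (-(2 : ℝ) • (s * 𝒟 * s)) * s = 0
    rw [mul_smul_comm, smul_mul_assoc, mul_assoc (s * 𝒟), hs, ← mul_assoc, ← mul_assoc, hs]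
    simp
  have hD : 𝒟' = 𝒟 + ⁅s, 𝒟⁆ + (1 / 2 : ℝ) • ⁅s, ⁅s, 𝒟⁆⁆ := by
    rw [h', e2, e1, smul_smul]
    norm_num
    rw [add_mul, one_mul, mul_sub, mul_one, add_mul]
    abel
  have e4 : ∀ n : ℕ, 3 ≤ n → (fun Q => ⁅s, Q⁆)^[n] 𝒟 = 0 := by
    intro n hn
    obtain ⟨m, rfl⟩ := Nat.exists_eq_add_of_le' hn
    rw [Function.iterate_add_apply]
    have : (fun Q => ⁅s, Q⁆)^[3] 𝒟 = 0 := e3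
    rw [this]
    induction m with
    | zero => rfl
    | succ m ih =>
      rw [Function.iterate_succ_apply', ih (by omega)]
      exact sub_eq_zero.mpr ((mul_zero s).trans (zero_mul s).symm)
  refine ⟨hD, e3, e4, ?_⟩
  rw [finsum_eq_sum_of_support_subset (s := Finset.range 3)]
  · rw [Finset.sum_range_succ, Finset.sum_range_succ, Finset.sum_range_one, hD]
    simp [Nat.factorial]
  · intro n hn
    rw [Finset.coe_range, Set.mem_Iio]
    by_contra hlt
    exact hn (by simp only []; rw [e4 n (by omega), smul_zero])

theorem Forms.const_smul (f : R) (n : N) :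
    (const (f • n) : Forms R L N) = mul (sm R N) (const f) (const n) := by
  rw [mul_const_left, smulF, push_const]
  rfl

theorem Forms.const_real_smul (c : ℝ) (n : N) :
    (const (c • n) : Forms R L N) = c • const n := by
  rw [const, const, ← LinearMap.map_smul]
  rfl

theorem Forms.IsHomog.eq_of {x : Forms R L N} {p : ℕ} (h : IsHomog x p) :
    x = of p (component p x) := by
  refine ext_component fun q => ?_
  by_cases hq : p = q
  · subst hq
    rw [component_of]
  · rw [component_of_ne hq]
    by_contra h0
    exact hq (by exact_mod_cast (h q h0).symm)

namespace IsSuperconnection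

variable {𝒟 : Module.End ℝ (Forms R L (TwoTerm NC NE))} (h : IsSuperconnection P 𝒟)
include h

theorem op_const_smul (f : R) (n : TwoTerm NC NE) : 𝒟 (const (f • n)) =
    mul (sm R _) (dF P.trivialConnection (const f)) (const n) + smulF f (𝒟 (const n)) := by
  rw [Forms.const_smul, h.op_mul, eps_const, mul_const_left]

theorem component_zero_smul (g : TwoTerm NC NE →ₗ[R] N) (f : R) (n : TwoTerm NC NE) :
    scalar (push g (𝒟 (const (f • n)))) = f • scalar (push g (𝒟 (const n))) := by
  rw [h.op_const_smul, map_add, map_add, SuperData.push_lsmul, scalar_mul, scalar_dF, smulF,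
    scalar_push, scalar_push, scalar_push]
  simp [scalar_push]

theorem component_one_smul (g : TwoTerm NC NE →ₗ[R] N) (f : R) (n : TwoTerm NC NE) (X : L) :
    scalar (iota X (push g (𝒟 (const (f • n))))) =
      f • scalar (iota X (push g (𝒟 (const n)))) + P.rho X f • g n := by
  rw [h.op_const_smul, map_add, map_add, map_add, SuperData.push_lsmul, iota_mul, push_const,
    iota_const, map_zero, add_zero, iota_dF_const, smulF, iota_push, iota_push, scalar_mul,
    scalar_const, scalar_const, scalar_push, scalar_push, iota_push, scalar_push, add_comm]
  congr 1
  exact LinearMap.map_smul _ _ _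

theorem component_two_smul (g : TwoTerm NC NE →ₗ[R] N) (f : R) (n : TwoTerm NC NE) :
    component 2 (push g (𝒟 (const (f • n)))) = f • component 2 (push g (𝒟 (const n))) := by
  rw [h.op_const_smul, map_add, map_add, SuperData.push_lsmul, push_const, const, const, dF_of,
    mul_of, component_of_ne (by omega), zero_add, smulF]
  ext v
  simp [component_push]

omit h in
theorem scalar_iota (X : L) (x : Forms R L N) : scalar (iota X x) = component 1 x ![X] := by
  change component 0 (iota X x) ![] = _
  rw [component_iota]
  rfl

/-- The quadruple of a superconnection. -/
def superData : SuperData NC NE P where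
  bd :=
    { toFun α := scalar (push (toSide R NC NE) (𝒟 (const (ofCore R NC NE α))))
      map_add' α β := by simp only [map_add, const_add]
      map_smul' f α := by rw [map_smul, h.component_zero_smul]; rfl }
  nablaC :=
    { nabla :=
      { toFun X :=
        { toFun α := scalar (iota X (push (toCore R NC NE) (𝒟 (const (ofCore R NC NE α)))))
          map_add' α β := by simp only [map_add, const_add]
          map_smul' c α := by
            have e : ofCore R NC NE (c • α) = c • ofCore R NC NE α := Prod.ext rfl (smul_zero c).symm
            rw [e, const_real_smul, LinearMap.map_smul, LinearMap.map_smul, LinearMap.map_smul,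
              LinearMap.map_smul]
            rfl }
        map_add' X Y := by
          ext α
          simp [iota_add_left]
        map_smul' f X := by
          ext α
          simp [iota_smul_left, smulF, scalar_push] }
      leibniz X f α := by
        exact (congrArg (fun n => scalar (iota X (push (toCore R NC NE) (𝒟 (const n)))))
          (map_smul (ofCore R NC NE) f α)).trans (h.component_one_smul _ f _ X) }
  nablaS :=
    { nabla :=
      { toFun X :=
        { toFun α := scalar (iota X (push (toSide R NC NE) (𝒟 (const (ofSide R NC NE α)))))
          map_add' α β := by simp only [map_add, const_add]
          map_smul' c α := by
            have e : ofSide R NC NE (c • α) = c • ofSide R NC NE α := Prod.ext (smul_zero c).symm rfl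
            rw [e, const_real_smul, LinearMap.map_smul, LinearMap.map_smul, LinearMap.map_smul,
              LinearMap.map_smul]
            rfl }
        map_add' X Y := by
          ext α
          simp [iota_add_left]
        map_smul' f X := by
          ext α
          simp [iota_smul_left, smulF, scalar_push] }
      leibniz X f α := by
        exact (congrArg (fun n => scalar (iota X (push (toSide R NC NE) (𝒟 (const n)))))
          (map_smul (ofSide R NC NE) f α)).trans (h.component_one_smul _ f _ X) }
  curv :=
    { toFun v :=
      { toFun ε := component 2 (push (toCore R NC NE) (𝒟 (const (ofSide R NC NE ε)))) v
        map_add' α β := by simp only [map_add, const_add, AlternatingMap.add_apply]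
        map_smul' f α := by rw [map_smul, h.component_two_smul]; rfl }
      map_update_add' v i X Y := by
        ext ε
        exact AlternatingMap.map_update_add _ v i X Y
      map_update_smul' v i f X := by
        ext ε
        exact AlternatingMap.map_update_smul _ v i f X
      map_eq_zero_of_eq' v i j hv hij := by
        ext ε
        exact AlternatingMap.map_eq_zero_of_eq _ v hv hij }

theorem degree_core (α : NC) :
    IsHomog (push (toCore R NC NE) (𝒟 (const (ofCore R NC NE α)))) (1 : ℕ) ∧
      IsHomog (push (toSide R NC NE) (𝒟 (const (ofCore R NC NE α)))) (0 : ℕ) := by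
  have h1 := h.degree_one (const (ofCore R NC NE α)) (-1)
    ((hasTotalDegree_iff _ _).mpr ⟨?_, ?_⟩)
  · exact (hasTotalDegree_iff _ _).mp h1
  · rw [const_toCore_ofCore]
    exact isHomog_of 0 _ rfl
  · rw [const_toSide_ofCore]
    exact isHomog_zero _

theorem degree_side (ε : NE) :
    IsHomog (push (toCore R NC NE) (𝒟 (const (ofSide R NC NE ε)))) (2 : ℕ) ∧
      IsHomog (push (toSide R NC NE) (𝒟 (const (ofSide R NC NE ε)))) (1 : ℕ) := by
  have h1 := h.degree_one (const (ofSide R NC NE ε)) 0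
    ((hasTotalDegree_iff _ _).mpr ⟨?_, ?_⟩)
  · exact (hasTotalDegree_iff _ _).mp h1
  · rw [const_toCore_ofSide]
    exact isHomog_zero _
  · rw [const_toSide_ofSide]
    exact isHomog_of 0 _ rfl

theorem superData_op (hN : Separated R L (TwoTerm NC NE)) : h.superData.op = 𝒟 := by
  refine SuperData.op_ext hN h.superData.isSuperconnection h (fun α => ?_) fun ε => ?_
  · refine twoTerm_ext ?_ ?_
    · rw [SuperData.toCore_op, const_toCore_ofCore, const_toSide_ofCore, map_zero, map_zero,
        LinearMap.zero_apply, add_zero, (h.degree_core α).1.eq_of, const, dF_of]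
      congr 1
      ext v
      rw [LieRinehartData.Connection.d_zero_apply]
      refine (scalar_iota _ _).trans ?_
      congr 1
      ext i
      fin_cases i
      rfl
    · rw [SuperData.toSide_op, const_toCore_ofCore, const_toSide_ofCore, map_zero, add_zero,
        (h.degree_core α).2.eq_of, eps_const, push_const, of_zero_eq_const]
      congr 1
  · refine twoTerm_ext ?_ ?_
    · rw [SuperData.toCore_op, const_toCore_ofSide, const_toSide_ofSide, map_zero, eps_const,
        zero_add, (h.degree_side ε).1.eq_of]
      refine eq_of_scalar ?_ fun X => eq_of_scalar ?_ fun Y => ?_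
      · simp [scalar_mul, scalar_of_two]
      · simp [iota_mul, scalar_mul, scalar_iota_of_two, iota_const]
      · simp only [iota_mul, iota_const, iota_iota_of_two, map_zero, LinearMap.zero_apply, zero_add,
          eps_const, mul_const_right_ev]
        rfl
    · rw [SuperData.toSide_op, const_toCore_ofSide, const_toSide_ofSide, map_zero, map_zero,
        zero_add, (h.degree_side ε).2.eq_of, const, dF_of]
      congr 1
      ext v
      rw [LieRinehartData.Connection.d_zero_apply]
      refine (scalar_iota _ _).trans ?_
      congr 1
      ext i
      fin_cases i
      rfl

end IsSuperconnection

end SuperAlgebra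

section Along

open Filter Topology

variable {EB : Type*} [NormedAddCommGroup EB] [NormedSpace ℝ EB]
  {HB : Type*} [TopologicalSpace HB] {I : ModelWithCorners ℝ EB HB}
  {B : Type*} [TopologicalSpace B] [ChartedSpace HB B]
  {F : Type*} [NormedAddCommGroup F] [NormedSpace ℝ F]
  {V : B → Type*} [TopologicalSpace (TotalSpace F V)]
  [∀ x, AddCommGroup (V x)] [∀ x, Module ℝ (V x)] [∀ x, TopologicalSpace (V x)]
  [FiberBundle F V] [VectorBundle ℝ F V]
  {EP : Type*} [NormedAddCommGroup EP] [NormedSpace ℝ EP]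
  {HP : Type*} [TopologicalSpace HP] {J : ModelWithCorners ℝ EP HP}
  {P : Type*} [TopologicalSpace P] [ChartedSpace HP P]

/-- The coordinate, linear in the fibre, of a vector in the trivialization at `x`. -/
def coord (F : Type*) [NormedAddCommGroup F] [NormedSpace ℝ F]
    {V : B → Type*} [TopologicalSpace (TotalSpace F V)]
    [∀ x, AddCommGroup (V x)] [∀ x, Module ℝ (V x)] [∀ x, TopologicalSpace (V x)]
    [FiberBundle F V] [VectorBundle ℝ F V] (x y : B) : V y →ₗ[ℝ] F :=
  (trivializationAt F V x).linearMapAt ℝ y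

/-- The inverse of the coordinate. -/
def coordSymm (F : Type*) [NormedAddCommGroup F] [NormedSpace ℝ F]
    (V : B → Type*) [TopologicalSpace (TotalSpace F V)]
    [∀ x, AddCommGroup (V x)] [∀ x, Module ℝ (V x)] [∀ x, TopologicalSpace (V x)]
    [FiberBundle F V] [VectorBundle ℝ F V] (x y : B) : F →ₗ[ℝ] V y :=
  (trivializationAt F V x).symmₗ ℝ y

theorem coord_eq {x y : B} (h : y ∈ (trivializationAt F V x).baseSet) (v : V y) :
    coord F x y v = (trivializationAt F V x ⟨y, v⟩).2 := by
  rw [coord, Trivialization.coe_linearMapAt_of_mem _ h]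

theorem eventually_mem_baseSet {b : P → B} {p : P} (hb : ContinuousAt b p) :
    ∀ᶠ q in 𝓝 p, b q ∈ (trivializationAt F V (b p)).baseSet :=
  hb.eventually ((trivializationAt F V (b p)).open_baseSet.mem_nhds
    (mem_baseSet_trivializationAt F V (b p)))

theorem contMDiffAt_along {b : P → B} {s : (p : P) → V (b p)} {p : P} :
    ContMDiffAt J (I.prod 𝓘(ℝ, F)) ∞ (fun q => (⟨b q, s q⟩ : TotalSpace F V)) p ↔
      ContMDiffAt J I ∞ b p ∧ ContMDiffAt J 𝓘(ℝ, F) ∞ (fun q => coord F (b p) (b q) (s q)) p := by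
  rw [Bundle.contMDiffAt_totalSpace]
  refine and_congr_right fun hb => ?_
  refine Filter.EventuallyEq.contMDiffAt_iff ?_
  filter_upwards [eventually_mem_baseSet (F := F) (V := V) hb.continuousAt] with q hq
  rw [coord_eq hq]

theorem along_add {b : P → B} {s t : (p : P) → V (b p)} {p : P}
    (hs : ContMDiffAt J (I.prod 𝓘(ℝ, F)) ∞ (fun q => (⟨b q, s q⟩ : TotalSpace F V)) p)
    (ht : ContMDiffAt J (I.prod 𝓘(ℝ, F)) ∞ (fun q => (⟨b q, t q⟩ : TotalSpace F V)) p) :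
    ContMDiffAt J (I.prod 𝓘(ℝ, F)) ∞ (fun q => (⟨b q, s q + t q⟩ : TotalSpace F V)) p := by
  rw [contMDiffAt_along] at hs ht ⊢
  refine ⟨hs.1, ?_⟩
  simp only [map_add]
  exact hs.2.add ht.2

theorem along_smul {b : P → B} {s : (p : P) → V (b p)} {f : P → ℝ} {p : P}
    (hf : ContMDiffAt J 𝓘(ℝ, ℝ) ∞ f p)
    (hs : ContMDiffAt J (I.prod 𝓘(ℝ, F)) ∞ (fun q => (⟨b q, s q⟩ : TotalSpace F V)) p) :
    ContMDiffAt J (I.prod 𝓘(ℝ, F)) ∞ (fun q => (⟨b q, f q • s q⟩ : TotalSpace F V)) p := by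
  rw [contMDiffAt_along] at hs ⊢
  refine ⟨hs.1, ?_⟩
  simp only [map_smul]
  exact hf.smul hs.2

theorem along_zero {b : P → B} {p : P} (hb : ContMDiffAt J I ∞ b p) :
    ContMDiffAt J (I.prod 𝓘(ℝ, F)) ∞ (fun q => (⟨b q, 0⟩ : TotalSpace F V)) p := by
  rw [contMDiffAt_along]
  refine ⟨hb, ?_⟩
  simp only [map_zero]
  exact contMDiffAt_const

theorem along_sum {ι : Type*} (T : Finset ι) {b : P → B} {s : ι → (p : P) → V (b p)} {p : P}
    (hb : ContMDiffAt J I ∞ b p)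
    (hs : ∀ i ∈ T, ContMDiffAt J (I.prod 𝓘(ℝ, F)) ∞
      (fun q => (⟨b q, s i q⟩ : TotalSpace F V)) p) :
    ContMDiffAt J (I.prod 𝓘(ℝ, F)) ∞ (fun q => (⟨b q, ∑ i ∈ T, s i q⟩ : TotalSpace F V)) p := by
  classical
  induction T using Finset.induction_on with
  | empty => simpa using along_zero hb
  | insert i T hi ih =>
    simp only [Finset.sum_insert hi]
    exact along_add (hs i (Finset.mem_insert_self i T))
      (ih fun j hj => hs j (Finset.mem_insert_of_mem hj))

theorem AddRel.contMDiffAt {f g k : P → TotalSpace F V} {p : P}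
    (hf : ContMDiffAt J (I.prod 𝓘(ℝ, F)) ∞ f p) (hg : ContMDiffAt J (I.prod 𝓘(ℝ, F)) ∞ g p)
    (h : ∀ q, AddRel (f q) (g q) (k q)) : ContMDiffAt J (I.prod 𝓘(ℝ, F)) ∞ k p := by
  have hex : ∀ q, ∃ t : V (f q).proj, g q = ⟨(f q).proj, t⟩ ∧
      k q = ⟨(f q).proj, (f q).snd + t⟩ := by
    intro q
    obtain ⟨x, a, b, h1, h2, h3⟩ := h q
    rw [h1]
    exact ⟨b, h2, h3⟩
  choose t h1 h2 using hex
  have e1 : g = fun q => ⟨(f q).proj, t q⟩ := funext h1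
  have e2 : k = fun q => ⟨(f q).proj, (f q).snd + t q⟩ := funext h2
  rw [e1] at hg
  rw [e2]
  exact along_add (s := fun q => (f q).snd) hf hg

theorem contMDiffAt_scale {f : P → TotalSpace F V} {c : P → ℝ} {p : P}
    (hc : ContMDiffAt J 𝓘(ℝ, ℝ) ∞ c p) (hf : ContMDiffAt J (I.prod 𝓘(ℝ, F)) ∞ f p) :
    ContMDiffAt J (I.prod 𝓘(ℝ, F)) ∞ (fun q => scale (c q) (f q)) p :=
  along_smul (s := fun q => (f q).snd) hc hf

variable [ContMDiffVectorBundle ∞ F V I]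

/-- A local section of the bundle with constant coordinate. -/
theorem contMDiffAt_symm {b : P → B} {w : P → F} {x : B} {p : P} (hb : ContMDiffAt J I ∞ b p)
    (hp : b p ∈ (trivializationAt F V x).baseSet) (hw : ContMDiffAt J 𝓘(ℝ, F) ∞ w p) :
    ContMDiffAt J (I.prod 𝓘(ℝ, F)) ∞
      (fun q => (⟨b q, coordSymm F V x (b q) (w q)⟩ : TotalSpace F V)) p := by
  rw [(trivializationAt F V x).contMDiffAt_iff (by rw [Trivialization.mem_source]; exact hp)]
  refine ⟨hb, hw.congr_of_eventuallyEq ?_⟩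
  filter_upwards [hb.continuousAt.eventually ((trivializationAt F V x).open_baseSet.mem_nhds hp)]
    with q hq
  rw [coordSymm, Trivialization.symmₗ_apply _ hq, Trivialization.apply_mk_symm _ hq]

theorem contMDiffAt_coord {f : P → TotalSpace F V} {x : B} {p : P}
    (hp : (f p).proj ∈ (trivializationAt F V x).baseSet)
    (hf : ContMDiffAt J (I.prod 𝓘(ℝ, F)) ∞ f p) :
    ContMDiffAt J 𝓘(ℝ, F) ∞ (fun q => coord F x (f q).proj (f q).snd) p := by
  have hs : f p ∈ (trivializationAt F V x).source := by rw [Trivialization.mem_source]; exact hp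
  have h := (((trivializationAt F V x).contMDiffAt_iff hs).mp hf)
  refine h.2.congr_of_eventuallyEq ?_
  filter_upwards [h.1.continuousAt.eventually
    ((trivializationAt F V x).open_baseSet.mem_nhds hp)] with q hq
  rw [coord_eq hq]

theorem coord_symm {x y : B} (h : y ∈ (trivializationAt F V x).baseSet) (w : F) :
    coord F x y (coordSymm F V x y w) = w := by
  rw [coord_eq h, coordSymm, Trivialization.symmₗ_apply _ h, Trivialization.apply_mk_symm _ h]

theorem symm_coord {x y : B} (h : y ∈ (trivializationAt F V x).baseSet) (v : V y) :
    coordSymm F V x y (coord F x y v) = v := by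
  rw [coord_eq h, coordSymm, Trivialization.symmₗ_apply _ h, Trivialization.symm_apply_apply_mk _ h]

end Along

section RightInverse

open Filter Topology

variable {E₁ : Type*} [NormedAddCommGroup E₁] [NormedSpace ℝ E₁]
  {H₁ : Type*} [TopologicalSpace H₁] {I₁ : ModelWithCorners ℝ E₁ H₁}
  {B₁ : Type*} [TopologicalSpace B₁] [ChartedSpace H₁ B₁]
  {F₁ : Type*} [NormedAddCommGroup F₁] [NormedSpace ℝ F₁] [FiniteDimensional ℝ F₁]
  {V₁ : B₁ → Type*} [TopologicalSpace (TotalSpace F₁ V₁)]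
  [∀ x, AddCommGroup (V₁ x)] [∀ x, Module ℝ (V₁ x)] [∀ x, TopologicalSpace (V₁ x)]
  [FiberBundle F₁ V₁] [VectorBundle ℝ F₁ V₁] [ContMDiffVectorBundle ∞ F₁ V₁ I₁]
  {E₂ : Type*} [NormedAddCommGroup E₂] [NormedSpace ℝ E₂]
  {H₂ : Type*} [TopologicalSpace H₂] {I₂ : ModelWithCorners ℝ E₂ H₂}
  {B₂ : Type*} [TopologicalSpace B₂] [ChartedSpace H₂ B₂]
  {F₂ : Type*} [NormedAddCommGroup F₂] [NormedSpace ℝ F₂] [FiniteDimensional ℝ F₂]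
  {V₂ : B₂ → Type*} [TopologicalSpace (TotalSpace F₂ V₂)]
  [∀ x, AddCommGroup (V₂ x)] [∀ x, Module ℝ (V₂ x)] [∀ x, TopologicalSpace (V₂ x)]
  [FiberBundle F₂ V₂] [VectorBundle ℝ F₂ V₂] [ContMDiffVectorBundle ∞ F₂ V₂ I₂]

/-- A smooth vector bundle morphism that is onto at a point has a smooth right inverse near that
point. -/
theorem exists_local_rightInverse {f : B₁ → B₂} (hf : ContMDiff I₁ I₂ ∞ f)
    (T : (b : B₁) → V₁ b →ₗ[ℝ] V₂ (f b))
    (hT : ContMDiff (I₁.prod 𝓘(ℝ, F₁)) (I₂.prod 𝓘(ℝ, F₂)) ∞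
      (fun v : TotalSpace F₁ V₁ => (⟨f v.proj, T v.proj v.snd⟩ : TotalSpace F₂ V₂)))
    (b₀ : B₁) (h₀ : Function.Surjective (T b₀)) :
    ∃ s : (b : B₁) → V₂ (f b) →ₗ[ℝ] V₁ b, ∃ U : Set B₁, IsOpen U ∧ b₀ ∈ U ∧
      (∀ b ∈ U, ∀ v, T b (s b v) = v) ∧
      ∀ {EP : Type v} [NormedAddCommGroup EP] [NormedSpace ℝ EP]
        {HP : Type w} [TopologicalSpace HP] {J : ModelWithCorners ℝ EP HP}
        {P : Type u} [TopologicalSpace P] [ChartedSpace HP P] (b : P → B₁)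
        (a : (p : P) → V₂ (f (b p))) (p : P), b p ∈ U → ContMDiffAt J I₁ ∞ b p →
        ContMDiffAt J (I₂.prod 𝓘(ℝ, F₂)) ∞ (fun q => (⟨f (b q), a q⟩ : TotalSpace F₂ V₂)) p →
        ContMDiffAt J (I₁.prod 𝓘(ℝ, F₁)) ∞
          (fun q => (⟨b q, s (b q) (a q)⟩ : TotalSpace F₁ V₁)) p := by
  let bs := Module.finBasis ℝ F₁
  set e₁ := trivializationAt F₁ V₁ b₀ with he₁
  set e₂ := trivializationAt F₂ V₂ (f b₀) with he₂
  let G₀ : B₁ → F₁ →ₗ[ℝ] F₂ := fun b => coord F₂ (f b₀) (f b) ∘ₗ T b ∘ₗ coordSymm F₁ V₁ b₀ b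
  let G : B₁ → F₁ →L[ℝ] F₂ := fun b => LinearMap.toContinuousLinearMap (G₀ b)
  have hU₀ : ∀ᶠ b in 𝓝 b₀, b ∈ e₁.baseSet ∧ f b ∈ e₂.baseSet := by
    refine (eventually_mem_baseSet (b := id) continuousAt_id).and ?_
    exact eventually_mem_baseSet (b := f) hf.continuous.continuousAt
  have hG : ∀ b, b ∈ e₁.baseSet → f b ∈ e₂.baseSet →
      ContMDiffAt I₁ 𝓘(ℝ, F₁ →L[ℝ] F₂) ∞ G b := by
    intro b h1 h2
    have h3 : ∀ j, ContMDiffAt I₁ 𝓘(ℝ, F₂) ∞ (fun c => G c (bs j)) b := by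
      intro j
      have h4 := contMDiffAt_symm (F := F₁) (V := V₁) (x := b₀) (b := id) (w := fun _ => bs j)
        (contMDiffAt_id (I := I₁) (x := b)) h1 contMDiffAt_const
      exact contMDiffAt_coord (f := fun c => ⟨f c, T c (coordSymm F₁ V₁ b₀ c (bs j))⟩)
        (x := f b₀) h2 (hT.contMDiffAt.comp b h4)
    have h5 : G = fun c => ∑ j, (LinearMap.toContinuousLinearMap (bs.coord j)).smulRight
        (G c (bs j)) := by
      funext c
      ext w
      conv_lhs => rw [← bs.sum_repr w]
      rw [map_sum]
      simp
    rw [h5]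
    refine contMDiffAt_finsetSum fun j _ => ?_
    exact ((ContinuousLinearMap.smulRightL ℝ F₁ F₂
      (LinearMap.toContinuousLinearMap (bs.coord j))).contDiff.contMDiff.contMDiffAt).comp b (h3 j)
  have hsurj : Function.Surjective (G b₀) := by
    intro w
    obtain ⟨v, hv⟩ := h₀ (coordSymm F₂ V₂ (f b₀) (f b₀) w)
    refine ⟨coord F₁ b₀ b₀ v, ?_⟩
    change coord F₂ _ _ (T b₀ (coordSymm F₁ V₁ b₀ b₀ _)) = w
    rw [symm_coord (mem_baseSet_trivializationAt F₁ V₁ b₀), hv,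
      coord_symm (mem_baseSet_trivializationAt F₂ V₂ (f b₀))]
  obtain ⟨Q₀, hQ₀⟩ := (G b₀).toLinearMap.exists_rightInverse_of_surjective
    (LinearMap.range_eq_top.mpr hsurj)
  let Q : F₂ →L[ℝ] F₁ := LinearMap.toContinuousLinearMap Q₀
  have hQ : (G b₀).comp Q = ContinuousLinearMap.id ℝ F₂ := by
    ext w
    exact congrArg (fun l => l w) hQ₀
  let K : B₁ → F₂ →L[ℝ] F₂ := fun b => (G b).comp Q
  have hK : ∀ b, b ∈ e₁.baseSet → f b ∈ e₂.baseSet →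
      ContMDiffAt I₁ 𝓘(ℝ, F₂ →L[ℝ] F₂) ∞ K b := fun b h1 h2 =>
    (hG b h1 h2).clm_comp contMDiffAt_const
  have hinv : ∀ᶠ b in 𝓝 b₀, ∃ L : F₂ ≃L[ℝ] F₂, (L : F₂ →L[ℝ] F₂) = K b := by
    have hc : ContinuousAt K b₀ := (hK b₀ hU₀.self_of_nhds.1 hU₀.self_of_nhds.2).continuousAt
    refine hc.eventually (p := fun A => ∃ L : F₂ ≃L[ℝ] F₂, (L : F₂ →L[ℝ] F₂) = A) ?_
    have : K b₀ = (ContinuousLinearEquiv.refl ℝ F₂ : F₂ →L[ℝ] F₂) := hQ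
    rw [this]
    exact ContinuousLinearEquiv.nhds _
  obtain ⟨U, hU, hUo, hbU⟩ := eventually_nhds_iff.mp (hU₀.and hinv)
  refine ⟨fun b => coordSymm F₁ V₁ b₀ b ∘ₗ (Q.comp (ContinuousLinearMap.inverse (K b))).toLinearMap ∘ₗ
    coord F₂ (f b₀) (f b), U, hUo, hbU, ?_, ?_⟩
  · intro b hb v
    obtain ⟨⟨h1, h2⟩, L, hL⟩ := hU b hb
    have h3 : coord F₂ (f b₀) (f b) (T b (coordSymm F₁ V₁ b₀ b
        (Q (ContinuousLinearMap.inverse (K b) (coord F₂ (f b₀) (f b) v))))) =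
        coord F₂ (f b₀) (f b) v := by
      change K b _ = _
      rw [← hL, ContinuousLinearMap.inverse_equiv]
      simp
    have h4 := congrArg (coordSymm F₂ V₂ (f b₀) (f b)) h3
    rw [symm_coord h2, symm_coord h2] at h4
    exact h4
  · intro EP _ _ HP _ J P _ _ b a p hp hb ha
    obtain ⟨⟨h1, h2⟩, L, hL⟩ := hU _ hp
    refine contMDiffAt_symm (F := F₁) (V := V₁) (x := b₀) hb h1 ?_
    have h3 : ContMDiffAt J 𝓘(ℝ, F₂ →L[ℝ] F₂) ∞
        (fun q => ContinuousLinearMap.inverse (K (b q))) p := by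
      have h4 : ContDiffAt ℝ ∞ (ContinuousLinearMap.inverse : (F₂ →L[ℝ] F₂) → _) (K (b p)) := by
        rw [← hL]
        exact contDiffAt_map_inverse L
      exact h4.contMDiffAt.comp p ((hK _ h1 h2).comp p hb)
    have h5 := contMDiffAt_coord (F := F₂) (V := V₂) (x := f b₀) h2 ha
    exact (contMDiffAt_const (c := Q)).clm_apply (h3.clm_apply h5)

end RightInverse

section DualSystems

open Filter Topology

variable {EM : Type*} [NormedAddCommGroup EM] [NormedSpace ℝ EM]
  {M : Type*} [TopologicalSpace M] [ChartedSpace EM M]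
  {F : Type*} [NormedAddCommGroup F] [NormedSpace ℝ F]
  {V : M → Type*} [TopologicalSpace (TotalSpace F V)]
  [∀ x, AddCommGroup (V x)] [∀ x, Module ℝ (V x)] [∀ x, TopologicalSpace (V x)]
  [FiberBundle F V] [VectorBundle ℝ F V]

local notation "JM" => 𝓘(ℝ, EM)
local notation "JF" => ModelWithCorners.prod 𝓘(ℝ, EM) 𝓘(ℝ, F)

variable (EM F V) in
/-- Finitely many sections `b_i` and fibrewise linear functions `l_i` with `χ v = ∑ l_i(v) b_i`,
where `χ` is equal to `1` near `x`. -/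
structure DualSystem (x : M) where
  n : ℕ
  χ : Fns JM M
  χ_one : ∀ᶠ y in 𝓝 x, χ y = 1
  b : Fin n → Sections JM F V
  l : Fin n → (y : M) → V y →ₗ[ℝ] ℝ
  smooth : ∀ i, ContMDiff JF 𝓘(ℝ, ℝ) ∞
    (fun v : TotalSpace F V => l i v.proj v.snd)
  eq : ∀ (y : M) (v : V y), χ y • v = ∑ i, l i y v • b i y

variable (F V) in
theorem nonempty_dualSystem [FiniteDimensional ℝ EM] [T2Space M] [IsManifold JM ∞ M]
    [FiniteDimensional ℝ F] [ContMDiffVectorBundle ∞ F V JM] (x : M) :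
    Nonempty (DualSystem EM F V x) := by
  set e := trivializationAt F V x with he
  obtain ⟨f, -, hf⟩ := (SmoothBumpFunction.nhds_basis_tsupport (I := JM) x).mem_iff.mp
    (e.open_baseSet.mem_nhds (mem_baseSet_trivializationAt F V x))
  let bs := Module.finBasis ℝ F
  have hzero : ∀ y, y ∉ tsupport f → ∀ᶠ z in 𝓝 y, f z = 0 := fun y hy =>
    notMem_tsupport_iff_eventuallyEq.mp hy
  have hnot : ∀ y, y ∉ e.baseSet → f y = 0 := fun y hy =>
    (hzero y fun h => hy (hf h)).self_of_nhds
  refine ⟨{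
    n := Module.finrank ℝ F
    χ := ⟨fun y => f y * f y, f.contMDiff.mul f.contMDiff⟩
    χ_one := by
      filter_upwards [f.eventuallyEq_one] with y hy
      change f y * f y = 1
      rw [hy]
      simp
    b := fun i => ⟨fun y => f y • coordSymm F V x y (bs i), fun y => ?_⟩
    l := fun i y => f y • (bs.coord i ∘ₗ coord F x y)
    smooth := fun i v => ?_
    eq := fun y v => ?_ }⟩
  · by_cases hy : y ∈ tsupport f
    · exact along_smul f.contMDiffAt
        (contMDiffAt_symm (b := id) (w := fun _ => bs i) contMDiffAt_id (hf hy) contMDiffAt_const)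
    · refine (along_zero (b := id) contMDiffAt_id).congr_of_eventuallyEq ?_
      filter_upwards [hzero y hy] with z hz
      simp [hz]
  · by_cases hy : v.proj ∈ tsupport f
    · refine (f.contMDiffAt.comp v (contMDiffAt_proj V)).mul ?_
      have h1 := contMDiffAt_coord (f := id) (x := x) (p := v) (hf hy)
        (contMDiffAt_id (I := 𝓘(ℝ, EM).prod 𝓘(ℝ, F)))
      exact (LinearMap.toContinuousLinearMap (bs.coord i)).contDiff.contMDiff.contMDiffAt.comp v h1
    · refine (contMDiffAt_const (c := (0 : ℝ))).congr_of_eventuallyEq ?_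
      filter_upwards [(contMDiff_proj V (IB := JM) (n := ∞)).continuous.continuousAt.eventually
        (hzero v.proj hy)] with z hz
      simp [hz]
  · by_cases hy : y ∈ e.baseSet
    · change (f y * f y) • v = ∑ i, (f y * bs.repr (coord F x y v) i) • f y •
        coordSymm F V x y (bs i)
      conv_lhs => rw [← symm_coord hy v, ← bs.sum_repr (coord F x y v), map_sum, Finset.smul_sum]
      refine Finset.sum_congr rfl fun i _ => ?_
      rw [map_smul, smul_smul, smul_smul]
      congr 1
      ring
    · change (f y * f y) • v = ∑ i, (f y * _) • f y • _
      simp [hnot y hy]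

variable (EM F V) in
/-- A choice of dual systems. -/
def dualSystem [FiniteDimensional ℝ EM] [T2Space M] [IsManifold JM ∞ M]
    [FiniteDimensional ℝ F] [ContMDiffVectorBundle ∞ F V JM] (x : M) : DualSystem EM F V x :=
  (nonempty_dualSystem F V x).some

namespace DualSystem

variable {x : M} (S : DualSystem EM F V x)

theorem χ_self : S.χ x = 1 := S.χ_one.self_of_nhds

theorem eventually_eq : ∀ᶠ y in 𝓝 x, ∀ v : V y, v = ∑ i, S.l i y v • S.b i y := by
  filter_upwards [S.χ_one] with y hy v
  rw [← S.eq, hy, one_smul]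

theorem eq_self (v : V x) : v = ∑ i, S.l i x v • S.b i x := S.eventually_eq.self_of_nhds v

/-- The coefficients of a section, as smooth functions. -/
def coef (i : Fin S.n) : Sections JM F V →ₗ[Fns JM M] Fns JM M where
  toFun X := ⟨fun y => S.l i y (X y), (S.smooth i).comp X.contMDiff⟩
  map_add' X Y := by
    ext y
    exact map_add (S.l i y) (X y) (Y y)
  map_smul' f X := by
    ext y
    exact map_smul (S.l i y) (f y) (X y)

theorem section_sum_apply {ι : Type*} (T : Finset ι) (s : ι → Sections JM F V) (y : M) :
    (∑ i ∈ T, s i) y = ∑ i ∈ T, s i y := by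
  classical
  induction T using Finset.induction_on with
  | empty => rfl
  | insert i T hi ih =>
    rw [Finset.sum_insert hi, Finset.sum_insert hi, ← ih]
    rfl

theorem χ_smul (X : Sections JM F V) : S.χ • X = ∑ i, S.coef i X • S.b i := by
  ext y
  rw [section_sum_apply]
  exact S.eq y (X y)

/-- A section through a given vector. -/
def extend (v : V x) : Sections JM F V :=
  ∑ i, (ContMDiffMap.const (S.l i x v) : Fns JM M) • S.b i

theorem extend_apply (v : V x) : S.extend v x = v := by
  rw [extend, section_sum_apply]
  exact (S.eq_self v).symm

theorem sum_of_tensorial {W : Type*} [AddCommGroup W] [Module ℝ W]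
    (φ : Sections JM F V → W) (hadd : ∀ X Y, φ (X + Y) = φ X + φ Y)
    (hsmul : ∀ (f : Fns JM M) X, φ (f • X) = f x • φ X) (X : Sections JM F V) :
    φ X = ∑ i, S.l i x (X x) • φ (S.b i) := by
  have h0 : φ 0 = 0 := by
    have := hadd 0 0
    rw [add_zero] at this
    exact left_eq_add.mp this
  have hsum : ∀ (T : Finset (Fin S.n)) (s : Fin S.n → Sections JM F V),
      φ (∑ i ∈ T, s i) = ∑ i ∈ T, φ (s i) := by
    intro T s
    classical
    induction T using Finset.induction_on with
    | empty => simpa using h0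
    | insert i T hi ih => rw [Finset.sum_insert hi, Finset.sum_insert hi, ← ih, hadd]
  have h1 := hsmul S.χ X
  rw [S.χ_self, one_smul, S.χ_smul, hsum] at h1
  rw [← h1]
  exact Finset.sum_congr rfl fun i _ => hsmul _ _

/-- A tensorial map depends on the value at the point only. -/
theorem eq_of_tensorial (S : DualSystem EM F V x) {W : Type*} [AddCommGroup W] [Module ℝ W]
    (φ : Sections JM F V → W) (hadd : ∀ X Y, φ (X + Y) = φ X + φ Y)
    (hsmul : ∀ (f : Fns JM M) X, φ (f • X) = f x • φ X) {X Y : Sections JM F V}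
    (h : X x = Y x) : φ X = φ Y := by
  rw [S.sum_of_tensorial φ hadd hsmul X, S.sum_of_tensorial φ hadd hsmul Y, h]

end DualSystem

theorem separated_sections {FA : Type*} [NormedAddCommGroup FA] [NormedSpace ℝ FA]
    {A : M → Type*} [TopologicalSpace (TotalSpace FA A)]
    [∀ x, AddCommGroup (A x)] [∀ x, Module ℝ (A x)] [∀ x, TopologicalSpace (A x)]
    [FiberBundle FA A] [VectorBundle ℝ FA A] (hS : ∀ x, Nonempty (DualSystem EM FA A x)) :
    Separated (Fns JM M) (Sections JM FA A) (Sections JM F V) := by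
  intro s hs
  ext x
  obtain ⟨S⟩ := hS x
  have h := hs S.n S.χ S.b S.coef S.χ_smul
  have h1 : S.χ x • s x = 0 := congrArg (fun t : Sections JM F V => t x) h
  rw [S.χ_self, one_smul] at h1
  exact h1

end DualSystems

section Representation

open Filter Topology

variable {EM : Type v} [NormedAddCommGroup EM] [NormedSpace ℝ EM]
  {M : Type w} [TopologicalSpace M] [ChartedSpace EM M]
  {FE : Type u} [NormedAddCommGroup FE] [NormedSpace ℝ FE]
  {E : M → Type u} [TopologicalSpace (TotalSpace FE E)]
  [∀ x, AddCommGroup (E x)] [∀ x, Module ℝ (E x)] [∀ x, TopologicalSpace (E x)]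
  [FiberBundle FE E] [VectorBundle ℝ FE E]

local notation "JM" => 𝓘(ℝ, EM)
local notation "JF" => ModelWithCorners.prod 𝓘(ℝ, EM) 𝓘(ℝ, FE)

theorem DualSystem.isFiberLinear {x : M} (S : DualSystem EM FE E x) (i : Fin S.n) :
    IsFiberLinear (EM := EM) (fun v : TotalSpace FE E => S.l i v.proj v.snd) :=
  ⟨S.smooth i, fun y => (S.l i y).isLinear⟩

theorem IsFiberLinear.add {l l' : TotalSpace FE E → ℝ} (h : IsFiberLinear (EM := EM) l)
    (h' : IsFiberLinear (EM := EM) l') : IsFiberLinear (EM := EM) (fun v => l v + l' v) :=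
  ⟨h.contMDiff.add h'.contMDiff, fun y =>
    ((h.linear y).mk' + (h'.linear y).mk' : E y →ₗ[ℝ] ℝ).isLinear⟩

theorem IsFiberLinear.mul {l : TotalSpace FE E → ℝ} (h : IsFiberLinear (EM := EM) l)
    (f : Fns JM M) : IsFiberLinear (EM := EM) (fun v => f v.proj * l v) :=
  ⟨(f.contMDiff.comp (contMDiff_proj E)).mul h.contMDiff, fun y =>
    (f y • (h.linear y).mk' : E y →ₗ[ℝ] ℝ).isLinear⟩

theorem IsFiberLinear.zero : IsFiberLinear (EM := EM) (fun _ : TotalSpace FE E => (0 : ℝ)) :=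
  ⟨contMDiff_const, fun _ => (0 : E _ →ₗ[ℝ] ℝ).isLinear⟩

theorem IsFiberLinear.sum {ι : Type*} (T : Finset ι) {l : ι → TotalSpace FE E → ℝ}
    (h : ∀ i ∈ T, IsFiberLinear (EM := EM) (l i)) :
    IsFiberLinear (EM := EM) (fun v => ∑ i ∈ T, l i v) := by
  classical
  induction T using Finset.induction_on with
  | empty => simpa using IsFiberLinear.zero
  | insert i T hi ih =>
    simp only [Finset.sum_insert hi]
    exact (h i (Finset.mem_insert_self i T)).add
      (ih fun j hj => h j (Finset.mem_insert_of_mem hj))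

/-- A fibrewise linear function applied to a section. -/
def IsFiberLinear.comp {l : TotalSpace FE E → ℝ} (h : IsFiberLinear (EM := EM) l)
    (s : Sections JM FE E) : Fns JM M :=
  ⟨fun y => l ⟨y, s y⟩, h.contMDiff.comp s.contMDiff⟩

theorem IsFiberLinear.map_sum_smul {l : TotalSpace FE E → ℝ} (h : IsFiberLinear (EM := EM) l)
    {ι : Type*} (T : Finset ι) (y : M) (c : ι → ℝ) (s : ι → E y) :
    l ⟨y, ∑ i ∈ T, c i • s i⟩ = ∑ i ∈ T, c i * l ⟨y, s i⟩ := by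
  have := map_sum (h.linear y).mk' (fun i => c i • s i) T
  simp only [map_smul] at this
  exact this

theorem DualSystem.χ_mul_fiberLinear {x : M} (S : DualSystem EM FE E x) {l : TotalSpace FE E → ℝ}
    (h : IsFiberLinear (EM := EM) l) :
    (fun v : TotalSpace FE E => S.χ v.proj * l v) =
      fun v => ∑ i, h.comp (S.b i) v.proj * S.l i v.proj v.snd := by
  funext ⟨y, v⟩
  have h1 := (h.linear y).map_smul (S.χ y) v
  rw [S.eq, h.map_sum_smul] at h1
  refine h1.symm.trans (Finset.sum_congr rfl fun i _ => mul_comm _ _)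

theorem DualSystem.eq_of_fiberLinear {x : M} (S : DualSystem EM FE E x) {v v' : E x}
    (h : ∀ l : TotalSpace FE E → ℝ, IsFiberLinear (EM := EM) l → l ⟨x, v⟩ = l ⟨x, v'⟩) : v = v' := by
  rw [S.eq_self v, S.eq_self v']
  exact Finset.sum_congr rfl fun i _ => by rw [h _ (S.isFiberLinear i)]

end Representation

section AddRelAlgebra

variable {B F : Type*} {V : B → Type*} [∀ x, AddCommGroup (V x)] [∀ x, Module ℝ (V x)]

theorem AddRel.mk (x : B) (a b : V x) :
    AddRel (⟨x, a⟩ : TotalSpace F V) ⟨x, b⟩ ⟨x, a + b⟩ := ⟨x, a, b, rfl, rfl, rfl⟩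

theorem mk_inj {x : B} {a b : V x} (h : (⟨x, a⟩ : TotalSpace F V) = ⟨x, b⟩) : a = b :=
  eq_of_heq (TotalSpace.mk.inj h).2

theorem AddRel.eq {x : B} {a b c : V x}
    (h : AddRel (⟨x, a⟩ : TotalSpace F V) ⟨x, b⟩ ⟨x, c⟩) : c = a + b := by
  obtain ⟨y, a', b', h1, h2, h3⟩ := h
  obtain rfl : x = y := (TotalSpace.mk.inj h1).1
  rw [mk_inj h1, mk_inj h2, mk_inj h3]

theorem AddRel.proj_left {p q r : TotalSpace F V} (h : AddRel p q r) : r.proj = p.proj := by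
  obtain ⟨x, a, b, rfl, rfl, rfl⟩ := h
  rfl

theorem AddRel.unique {p q r r' : TotalSpace F V} (h : AddRel p q r) (h' : AddRel p q r') :
    r = r' := by
  obtain ⟨x, a, b, rfl, rfl, rfl⟩ := h
  obtain ⟨y, a', b', h1, h2, rfl⟩ := h'
  obtain rfl : x = y := (TotalSpace.mk.inj h1).1
  rw [mk_inj h1, mk_inj h2]

theorem AddRel.cancel {p p' q r : TotalSpace F V} (h : AddRel p q r) (h' : AddRel p' q r) :
    p = p' := by
  obtain ⟨x, a, b, rfl, rfl, rfl⟩ := h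
  obtain ⟨y, a', b', rfl, h2, h3⟩ := h'
  obtain rfl : x = y := (TotalSpace.mk.inj h2).1
  have := mk_inj h3
  rw [mk_inj h2] at this
  rw [add_right_cancel this]

theorem AddRel.symm {p q r : TotalSpace F V} (h : AddRel p q r) : AddRel q p r := by
  obtain ⟨x, a, b, rfl, rfl, rfl⟩ := h
  rw [add_comm]
  exact AddRel.mk x b a

theorem exists_addRel {p q : TotalSpace F V} (h : p.proj = q.proj) : ∃ r, AddRel p q r := by
  obtain ⟨x, a⟩ := p
  obtain ⟨y, b⟩ := q
  obtain rfl : x = y := h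
  exact ⟨_, AddRel.mk x a b⟩

theorem exists_addRel_sub {q r : TotalSpace F V} (h : q.proj = r.proj) : ∃ p, AddRel p q r := by
  obtain ⟨x, a⟩ := q
  obtain ⟨y, b⟩ := r
  obtain rfl : x = y := h
  refine ⟨⟨x, b - a⟩, ?_⟩
  have := AddRel.mk (F := F) x (b - a) a
  rwa [sub_add_cancel] at this

theorem scale_zero_eq (p : TotalSpace F V) : scale 0 p = ⟨p.proj, 0⟩ := by
  rw [scale, zero_smul]

theorem scale_one_eq (p : TotalSpace F V) : scale 1 p = p := by
  rw [scale, one_smul]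

theorem scale_mk (t : ℝ) (x : B) (a : V x) : scale t (⟨x, a⟩ : TotalSpace F V) = ⟨x, t • a⟩ := rfl

end AddRelAlgebra

section ProductPullback

variable {EB : Type*} [NormedAddCommGroup EB] [NormedSpace ℝ EB]
  {HB : Type*} [TopologicalSpace HB] {I : ModelWithCorners ℝ EB HB}
  {B : Type*} [TopologicalSpace B] [ChartedSpace HB B]
  {F : Type*} [NormedAddCommGroup F] [NormedSpace ℝ F]
  {V : B → Type*} [TopologicalSpace (TotalSpace F V)]
  [∀ x, AddCommGroup (V x)] [∀ x, Module ℝ (V x)] [∀ x, TopologicalSpace (V x)]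
  [FiberBundle F V] [VectorBundle ℝ F V]
  {F' : Type*} [NormedAddCommGroup F'] [NormedSpace ℝ F']
  {V' : B → Type*} [TopologicalSpace (TotalSpace F' V')]
  [∀ x, AddCommGroup (V' x)] [∀ x, Module ℝ (V' x)] [∀ x, TopologicalSpace (V' x)]
  [FiberBundle F' V'] [VectorBundle ℝ F' V']
  {EP : Type*} [NormedAddCommGroup EP] [NormedSpace ℝ EP]
  {HP : Type*} [TopologicalSpace HP] {J : ModelWithCorners ℝ EP HP}
  {P : Type*} [TopologicalSpace P] [ChartedSpace HP P]

theorem contMDiffAt_prod_iff {b : P → B} {s : (p : P) → V (b p)} {t : (p : P) → V' (b p)} {p : P} :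
    ContMDiffAt J (I.prod 𝓘(ℝ, F × F')) ∞
        (fun q => (⟨b q, (s q, t q)⟩ : TotalSpace (F × F') (V ×ᵇ V'))) p ↔
      ContMDiffAt J (I.prod 𝓘(ℝ, F)) ∞ (fun q => (⟨b q, s q⟩ : TotalSpace F V)) p ∧
      ContMDiffAt J (I.prod 𝓘(ℝ, F')) ∞ (fun q => (⟨b q, t q⟩ : TotalSpace F' V')) p := by
  rw [Bundle.contMDiffAt_totalSpace, Bundle.contMDiffAt_totalSpace, Bundle.contMDiffAt_totalSpace]
  have h : (ContMDiffAt J 𝓘(ℝ, F × F') ∞ (fun q =>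
      (trivializationAt (F × F') (V ×ᵇ V') (b p) ⟨b q, (s q, t q)⟩).2) p) ↔
      ContMDiffAt J 𝓘(ℝ, F) ∞ (fun q => (trivializationAt F V (b p) ⟨b q, s q⟩).2) p ∧
      ContMDiffAt J 𝓘(ℝ, F') ∞ (fun q => (trivializationAt F' V' (b p) ⟨b q, t q⟩).2) p :=
    contMDiffAt_prod_module_iff _
  constructor
  · rintro ⟨h1, h2⟩
    exact ⟨⟨h1, (h.mp h2).1⟩, ⟨h1, (h.mp h2).2⟩⟩
  · rintro ⟨⟨h1, h2⟩, ⟨-, h3⟩⟩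
    exact ⟨h1, h.mpr ⟨h2, h3⟩⟩

end ProductPullback

section PullProd

variable {EB : Type*} [NormedAddCommGroup EB] [NormedSpace ℝ EB]
  {HB : Type*} [TopologicalSpace HB] {I : ModelWithCorners ℝ EB HB}
  {B : Type*} [TopologicalSpace B] [ChartedSpace HB B]
  {F : Type u} [NormedAddCommGroup F] [NormedSpace ℝ F] [FiniteDimensional ℝ F]
  {V : B → Type u} [TopologicalSpace (TotalSpace F V)]
  [∀ x, AddCommGroup (V x)] [∀ x, Module ℝ (V x)] [∀ x, TopologicalSpace (V x)]
  [FiberBundle F V] [VectorBundle ℝ F V] [ContMDiffVectorBundle ∞ F V I]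
  {F' : Type u} [NormedAddCommGroup F'] [NormedSpace ℝ F'] [FiniteDimensional ℝ F']
  {V' : B → Type u} [TopologicalSpace (TotalSpace F' V')]
  [∀ x, AddCommGroup (V' x)] [∀ x, Module ℝ (V' x)] [∀ x, TopologicalSpace (V' x)]
  [FiberBundle F' V'] [VectorBundle ℝ F' V'] [ContMDiffVectorBundle ∞ F' V' I]
  {EP : Type*} [NormedAddCommGroup EP] [NormedSpace ℝ EP]
  {HP : Type*} [TopologicalSpace HP] {J : ModelWithCorners ℝ EP HP}
  {P : Type*} [TopologicalSpace P] [ChartedSpace HP P]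
  {E' : Type*} [NormedAddCommGroup E'] [NormedSpace ℝ E']
  {H' : Type*} [TopologicalSpace H'] {I' : ModelWithCorners ℝ E' H'}
  {B' : Type*} [TopologicalSpace B'] [ChartedSpace H' B']

variable (F V F' V') in
/-- The pullback of `V ⊕ V'` under a smooth map. -/
def pullProd (f : C^∞⟮I', B'; I, B⟯) : SmoothVectorBundle.{u} I' B' where
  Model := F × F'
  Fiber := fun e => V (f e) × V' (f e)
  topologicalSpaceTotal :=
    inferInstanceAs (TopologicalSpace (TotalSpace (F × F') (f *ᵖ (V ×ᵇ V'))))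
  fiberBundle := inferInstanceAs (FiberBundle (F × F') (f *ᵖ (V ×ᵇ V')))
  vectorBundle := inferInstanceAs (VectorBundle ℝ (F × F') (f *ᵖ (V ×ᵇ V')))
  contMDiffVectorBundle :=
    inferInstanceAs (ContMDiffVectorBundle ∞ (F × F') (f *ᵖ (V ×ᵇ V')) I')

theorem contMDiffAt_pullProd_iff (f : C^∞⟮I', B'; I, B⟯) {b : P → B'}
    {s : (p : P) → V (f (b p))} {t : (p : P) → V' (f (b p))} {p : P} :
    ContMDiffAt J (I'.prod 𝓘(ℝ, (pullProd F V F' V' f).Model)) ∞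
        (fun q => (⟨b q, (s q, t q)⟩ :
          TotalSpace (pullProd F V F' V' f).Model (pullProd F V F' V' f).Fiber)) p ↔
      ContMDiffAt J I' ∞ b p ∧
      ContMDiffAt J (I.prod 𝓘(ℝ, F)) ∞ (fun q => (⟨f (b q), s q⟩ : TotalSpace F V)) p ∧
      ContMDiffAt J (I.prod 𝓘(ℝ, F')) ∞ (fun q => (⟨f (b q), t q⟩ : TotalSpace F' V')) p := by
  rw [← contMDiffAt_prod_iff, Bundle.contMDiffAt_totalSpace, Bundle.contMDiffAt_totalSpace]
  constructor
  · rintro ⟨h1, h2⟩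
    exact ⟨h1, f.contMDiff.contMDiffAt.comp p h1, h2⟩
  · rintro ⟨h1, -, h2⟩
    exact ⟨h1, h2⟩

end PullProd

section SectionOps

variable {B : Type*} [TopologicalSpace B] {EB : Type*} [NormedAddCommGroup EB] [NormedSpace ℝ EB]
  {HB : Type*} [TopologicalSpace HB] {I : ModelWithCorners ℝ EB HB} [ChartedSpace HB B]
  {F : Type*} [NormedAddCommGroup F] [NormedSpace ℝ F]
  {V : B → Type*} [TopologicalSpace (TotalSpace F V)]
  [∀ x, AddCommGroup (V x)] [∀ x, Module ℝ (V x)] [∀ x, TopologicalSpace (V x)]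
  [FiberBundle F V] [VectorBundle ℝ F V]

theorem sec_add_apply (X Y : Sections I F V) (x : B) : (X + Y) x = X x + Y x := rfl

theorem sec_sub_apply (X Y : Sections I F V) (x : B) : (X - Y) x = X x - Y x := rfl

theorem sec_neg_apply (X : Sections I F V) (x : B) : (-X) x = -X x := rfl

theorem sec_zero_apply (x : B) : (0 : Sections I F V) x = 0 := rfl

theorem sec_sum_apply {ι : Type*} (T : Finset ι) (s : ι → Sections I F V) (y : B) :
    (∑ i ∈ T, s i) y = ∑ i ∈ T, s i y := by
  classical
  induction T using Finset.induction_on with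
  | empty => rfl
  | insert i T hi ih =>
    rw [Finset.sum_insert hi, Finset.sum_insert hi, ← ih]
    rfl

end SectionOps

section Alternating

variable {R L N : Type*} [CommRing R] [AddCommGroup L] [Module R L] [AddCommGroup N] [Module R N]

/-- An alternating map of two variables. -/
def altTwo (c : L → L → N) (hadd : ∀ X X' Y, c (X + X') Y = c X Y + c X' Y)
    (hsmul : ∀ (f : R) X Y, c (f • X) Y = f • c X Y) (halt : ∀ X Y, c Y X = -c X Y)
    (hself : ∀ X, c X X = 0) : L [⋀^Fin 2]→ₗ[R] N where
  toFun v := c (v 0) (v 1)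
  map_update_add' := fun {inst} v i X Y => by
    rw [Subsingleton.elim inst (instDecidableEqFin _)]
    fin_cases i
    · simp [hadd]
    · simp only [Fin.mk_one, Function.update_self, Fin.isValue, ne_eq, zero_ne_one,
        not_false_eq_true, Function.update_of_ne]
      rw [halt _ (v 0), hadd, halt X, halt Y]
      abel
  map_update_smul' := fun {inst} v i f X => by
    rw [Subsingleton.elim inst (instDecidableEqFin _)]
    fin_cases i
    · simp [hsmul]
    · simp only [Fin.mk_one, Function.update_self, Fin.isValue, ne_eq, zero_ne_one,
        not_false_eq_true, Function.update_of_ne]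
      rw [halt _ (v 0), hsmul, halt X, smul_neg]
  map_eq_zero_of_eq' v i j hv hij := by
    have : v 0 = v 1 := by
      rcases Fin.exists_fin_two.mp ⟨i, rfl⟩ with h | h <;>
        rcases Fin.exists_fin_two.mp ⟨j, rfl⟩ with h' | h' <;> subst h <;> subst h'
      · exact absurd rfl hij
      · exact hv
      · exact hv.symm
      · exact absurd rfl hij
    rw [this, hself]

end Alternating

section Derivatives

open Filter Topology

variable {EP : Type*} [NormedAddCommGroup EP] [NormedSpace ℝ EP]
  {HP : Type*} [TopologicalSpace HP] {J : ModelWithCorners ℝ EP HP}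
  {P : Type*} [TopologicalSpace P] [ChartedSpace HP P]
  {EQ : Type*} [NormedAddCommGroup EQ] [NormedSpace ℝ EQ]
  {HQ : Type*} [TopologicalSpace HQ] {K : ModelWithCorners ℝ EQ HQ}
  {Q : Type*} [TopologicalSpace Q] [ChartedSpace HQ Q]

theorem dfun_congr {f g : P → ℝ} {p : P} (h : f =ᶠ[𝓝 p] g) (v : TangentSpace J p) :
    mvfderiv J f p v = mvfderiv J g p v := by
  change mfderiv J 𝓘(ℝ, ℝ) f p v = mfderiv J 𝓘(ℝ, ℝ) g p v
  exact congrArg (fun L : EP →L[ℝ] ℝ => L v) h.mfderiv_eq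

theorem dfun_add {f g : P → ℝ} {p : P} (hf : MDifferentiableAt J 𝓘(ℝ, ℝ) f p)
    (hg : MDifferentiableAt J 𝓘(ℝ, ℝ) g p) (v : TangentSpace J p) :
    mvfderiv J (fun q => f q + g q) p v = mvfderiv J f p v + mvfderiv J g p v :=
  congrArg (fun L : TangentSpace J p →L[ℝ] ℝ => L v) (mvfderiv_add hf hg)

theorem dfun_mul {f g : P → ℝ} {p : P} (hf : MDifferentiableAt J 𝓘(ℝ, ℝ) f p)
    (hg : MDifferentiableAt J 𝓘(ℝ, ℝ) g p) (v : TangentSpace J p) :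
    mvfderiv J (fun q => f q * g q) p v = f p * mvfderiv J g p v + g p * mvfderiv J f p v :=
  congrArg (fun L : TangentSpace J p →L[ℝ] ℝ => L v) (mvfderiv_mul hf hg)

theorem dfun_const (c : ℝ) {p : P} (v : TangentSpace J p) : mvfderiv J (fun _ => c) p v = 0 :=
  congrArg (fun L : TangentSpace J p →L[ℝ] ℝ => L v) (mvfderiv_const c)

theorem dfun_sum {ι : Type*} (T : Finset ι) {f : ι → P → ℝ} {p : P}
    (hf : ∀ i ∈ T, MDifferentiableAt J 𝓘(ℝ, ℝ) (f i) p) (v : TangentSpace J p) :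
    MDifferentiableAt J 𝓘(ℝ, ℝ) (fun q => ∑ i ∈ T, f i q) p ∧
    mvfderiv J (fun q => ∑ i ∈ T, f i q) p v = ∑ i ∈ T, mvfderiv J (f i) p v := by
  classical
  induction T using Finset.induction_on with
  | empty => exact ⟨by simpa using mdifferentiableAt_const, by simpa using dfun_const 0 v⟩
  | insert i T hi ih =>
    have h1 := ih fun j hj => hf j (Finset.mem_insert_of_mem hj)
    have h2 := hf i (Finset.mem_insert_self i T)
    simp only [Finset.sum_insert hi]
    exact ⟨h2.add h1.1, by rw [dfun_add h2 h1.1, h1.2]⟩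

theorem dfun_comp {g : Q → ℝ} {φ : P → Q} {p : P} (hg : MDifferentiableAt K 𝓘(ℝ, ℝ) g (φ p))
    (hφ : MDifferentiableAt J K φ p) (v : TangentSpace J p) :
    mvfderiv J (fun q => g (φ q)) p v = mvfderiv K g (φ p) (mfderiv J K φ p v) :=
  mvfderiv_comp_apply p hg hφ v

theorem mfderiv_pi_apply {n : ℕ} {f : P → Fin n → ℝ} {p : P}
    (hf : MDifferentiableAt J 𝓘(ℝ, Fin n → ℝ) f p) (v : TangentSpace J p) (i : Fin n) :
    (show Fin n → ℝ from mfderiv J 𝓘(ℝ, Fin n → ℝ) f p v) i = mvfderiv J (fun q => f q i) p v := by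
  have h := dfun_comp (g := fun t : Fin n → ℝ => t i) (φ := f) (K := 𝓘(ℝ, Fin n → ℝ))
    (ContinuousLinearMap.proj (R := ℝ) (φ := fun _ : Fin n => ℝ) i).mdifferentiableAt hf v
  rw [h]
  have h1 : mfderiv 𝓘(ℝ, Fin n → ℝ) 𝓘(ℝ, ℝ) (fun t : Fin n → ℝ => t i) (f p) =
      ContinuousLinearMap.proj (R := ℝ) (φ := fun _ : Fin n => ℝ) i :=
    (ContinuousLinearMap.proj (R := ℝ) (φ := fun _ : Fin n => ℝ) i).hasMFDerivAt.mfderiv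
  change _ = mfderiv 𝓘(ℝ, Fin n → ℝ) 𝓘(ℝ, ℝ) (fun t : Fin n → ℝ => t i) (f p)
    (mfderiv J 𝓘(ℝ, Fin n → ℝ) f p v)
  rw [h1]
  rfl

theorem tangentMap_congr {f g : P → Q} {w : TangentBundle J P} (h : f =ᶠ[𝓝 w.proj] g) :
    tangentMap J K f w = tangentMap J K g w := by
  refine TotalSpace.ext h.self_of_nhds (heq_of_eq ?_)
  exact congrArg (fun L : EP →L[ℝ] EQ => L w.2) h.mfderiv_eq

end Derivatives

section Tangent

open Filter Topology

variable {EM : Type v} [NormedAddCommGroup EM] [NormedSpace ℝ EM]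
  {M : Type w} [TopologicalSpace M] [ChartedSpace EM M]
  {F : Type u} [NormedAddCommGroup F] [NormedSpace ℝ F]
  {V : M → Type u} [TopologicalSpace (TotalSpace F V)]
  [∀ x, AddCommGroup (V x)] [∀ x, Module ℝ (V x)] [∀ x, TopologicalSpace (V x)]
  [FiberBundle F V] [VectorBundle ℝ F V]

local notation "JM" => 𝓘(ℝ, EM)
local notation "JF" => ModelWithCorners.prod 𝓘(ℝ, EM) 𝓘(ℝ, F)

namespace DualSystem

variable {x : M} (S : DualSystem EM F V x)

/-- The tangent vector of `M × ℝⁿ` with the given components. -/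
def pairT (p : M × (Fin S.n → ℝ)) (a : TangentSpace JM p.1) (τ : Fin S.n → ℝ) :
    TangentSpace (𝓘(ℝ, EM).prod 𝓘(ℝ, Fin S.n → ℝ)) p := (a, τ)

/-- `(y, t) ↦ ∑ t_j b_j(y)`. -/
def frame (p : M × (Fin S.n → ℝ)) : TotalSpace F V := ⟨p.1, ∑ j, p.2 j • S.b j p.1⟩

/-- `v ↦ (q(v), (l_j(v))_j)`. -/
def coords (v : TotalSpace F V) : M × (Fin S.n → ℝ) := (v.proj, fun j => S.l j v.proj v.snd)

theorem contMDiff_frame : ContMDiff (𝓘(ℝ, EM).prod 𝓘(ℝ, Fin S.n → ℝ)) JF ∞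
    S.frame := by
  intro p
  refine along_sum (b := Prod.fst) Finset.univ contMDiffAt_fst fun j _ => along_smul ?_
    ((S.b j).contMDiff.contMDiffAt.comp p contMDiffAt_fst)
  exact (contMDiffAt_pi_space.mp contMDiffAt_snd) j

theorem contMDiff_coords : ContMDiff JF (𝓘(ℝ, EM).prod 𝓘(ℝ, Fin S.n → ℝ)) ∞
    S.coords :=
  (contMDiff_proj V).prodMk (contMDiff_pi_space.mpr S.smooth)

theorem frame_coords {y : M} (hy : S.χ y = 1) (v : V y) : S.frame (S.coords ⟨y, v⟩) = ⟨y, v⟩ := by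
  have := S.eq y v
  rw [hy, one_smul] at this
  exact congrArg (fun w => (⟨y, w⟩ : TotalSpace F V)) this.symm

/-- A tangent vector is recovered from its coordinates. -/
theorem tangentMap_frame {e : TotalSpace F V} (he : ∀ᶠ y in 𝓝 e.proj, S.χ y = 1)
    (v : TangentSpace JF e) :
    tangentMap (𝓘(ℝ, EM).prod 𝓘(ℝ, Fin S.n → ℝ)) JF S.frame
      ⟨S.coords e, S.pairT _ (mfderiv JF JM TotalSpace.proj e v)
        fun j => mvfderiv JF (fun w : TotalSpace F V => S.l j w.proj w.snd) e v⟩ =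
      ⟨e, v⟩ := by
  have h1 : S.frame ∘ S.coords =ᶠ[𝓝 e] id := by
    filter_upwards [((FiberBundle.continuous_proj F V).continuousAt (x := e)).eventually he] with e' he'
    exact S.frame_coords he' e'.snd
  have h2 := tangentMap_congr (J := 𝓘(ℝ, EM).prod 𝓘(ℝ, F)) (K := 𝓘(ℝ, EM).prod 𝓘(ℝ, F))
    (w := ⟨e, v⟩) h1
  rw [tangentMap_id,
    tangentMap_comp_at _ (S.contMDiff_frame.mdifferentiable (by simp) _)
      (S.contMDiff_coords.mdifferentiable (by simp) _)] at h2
  refine Eq.trans ?_ h2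
  have h3 : MDifferentiableAt JF JM (TotalSpace.proj : TotalSpace F V → M) e :=
    (contMDiff_proj V (n := ∞)).mdifferentiable (by simp) _
  have h4 : MDifferentiableAt JF 𝓘(ℝ, Fin S.n → ℝ)
      (fun w : TotalSpace F V => fun j => S.l j w.proj w.snd) e :=
    (contMDiff_pi_space.mpr S.smooth).mdifferentiable (by simp) _
  refine congrArg _ (TotalSpace.ext rfl (heq_of_eq ?_))
  change _ = mfderiv _ _ (fun w : TotalSpace F V => (w.proj, fun j => S.l j w.proj w.snd)) e v
  rw [mfderiv_prodMk h3 h4]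
  refine Prod.ext rfl ?_
  funext j
  exact (mfderiv_pi_apply h4 v j).symm

/-- The derivative of a fibrewise linear function in terms of coordinates. -/
theorem dfun_frame {l : TotalSpace F V → ℝ} (hl : IsFiberLinear (EM := EM) l)
    (p : M × (Fin S.n → ℝ)) (a : TangentSpace JM p.1) (τ : Fin S.n → ℝ) :
    mvfderiv JF l (S.frame p)
      (mfderiv (𝓘(ℝ, EM).prod 𝓘(ℝ, Fin S.n → ℝ)) JF S.frame p (S.pairT p a τ)) =
      ∑ j, (τ j * hl.comp (S.b j) p.1 + p.2 j * mvfderiv JM (hl.comp (S.b j)) p.1 a) := by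
  have hd : MDifferentiableAt (𝓘(ℝ, EM).prod 𝓘(ℝ, Fin S.n → ℝ)) JF S.frame p :=
    S.contMDiff_frame.mdifferentiable (by simp) _
  rw [← dfun_comp (hl.contMDiff.mdifferentiable (by simp) _) hd]
  have h1 : (fun q => l (S.frame q)) = fun q => ∑ j, q.2 j * hl.comp (S.b j) q.1 := by
    funext q
    exact hl.map_sum_smul _ _ _ _
  have h2 : ∀ j, MDifferentiableAt (𝓘(ℝ, EM).prod 𝓘(ℝ, Fin S.n → ℝ)) 𝓘(ℝ, ℝ)
      (fun q : M × (Fin S.n → ℝ) => q.2 j) p := fun j =>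
    ((contMDiffAt_pi_space.mp (contMDiffAt_snd (n := ∞))) j).mdifferentiableAt (by simp)
  have h3 : ∀ j, MDifferentiableAt (𝓘(ℝ, EM).prod 𝓘(ℝ, Fin S.n → ℝ)) 𝓘(ℝ, ℝ)
      (fun q : M × (Fin S.n → ℝ) => hl.comp (S.b j) q.1) p := fun j =>
    ((hl.comp (S.b j)).contMDiff.comp contMDiff_fst).mdifferentiable (by simp) _
  have h6 : ∀ j, MDifferentiableAt (𝓘(ℝ, EM).prod 𝓘(ℝ, Fin S.n → ℝ)) 𝓘(ℝ, ℝ)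
      (fun q : M × (Fin S.n → ℝ) => q.2 j * hl.comp (S.b j) q.1) p := fun j => (h2 j).mul (h3 j)
  have h7 := (dfun_sum Finset.univ (fun j _ => h6 j) (S.pairT p a τ)).2
  rw [h1]
  refine h7.trans ?_
  refine Finset.sum_congr rfl fun j _ => ?_
  rw [dfun_mul (h2 j) (h3 j)]
  have h4 : mvfderiv (𝓘(ℝ, EM).prod 𝓘(ℝ, Fin S.n → ℝ))
      (fun q : M × (Fin S.n → ℝ) => q.2 j) p (S.pairT p a τ) =
      τ j := by
    rw [← mfderiv_pi_apply (f := Prod.snd) mdifferentiableAt_snd, mfderiv_snd]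
    rfl
  have h5 : mvfderiv (𝓘(ℝ, EM).prod 𝓘(ℝ, Fin S.n → ℝ))
      (fun q : M × (Fin S.n → ℝ) => hl.comp (S.b j) q.1) p (S.pairT p a τ) =
      mvfderiv JM (hl.comp (S.b j)) p.1 a := by
    rw [dfun_comp (φ := Prod.fst) ((hl.comp (S.b j)).contMDiff.mdifferentiable (by simp) _)
      mdifferentiableAt_fst, mfderiv_fst]
    rfl
  rw [h4, h5]
  ring

theorem proj_frame (p : M × (Fin S.n → ℝ)) (a : TangentSpace JM p.1) (τ : Fin S.n → ℝ) :
    mfderiv JF JM TotalSpace.proj (S.frame p)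
      (mfderiv (𝓘(ℝ, EM).prod 𝓘(ℝ, Fin S.n → ℝ)) JF S.frame p (S.pairT p a τ)) = a := by
  have h := mfderiv_comp_apply (I'' := JM) (g := (TotalSpace.proj : TotalSpace F V → M)) p
    ((contMDiff_proj V (n := ∞)).mdifferentiable (by simp) _)
    (S.contMDiff_frame.mdifferentiable (by simp) _) (S.pairT p a τ)
  refine h.symm.trans ?_
  change mfderiv _ _ Prod.fst p (S.pairT p a τ) = a
  rw [mfderiv_fst]
  rfl

end DualSystem

variable [FiniteDimensional ℝ EM] [T2Space M] [IsManifold 𝓘(ℝ, EM) ∞ M]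
  [FiniteDimensional ℝ F] [ContMDiffVectorBundle ∞ F V 𝓘(ℝ, EM)]

/-- Tangent vectors are separated by their projections and by fibrewise linear functions. -/
theorem tangent_ext {e : TotalSpace F V} {v v' : TangentSpace JF e}
    (h : mfderiv JF JM TotalSpace.proj e v =
      mfderiv JF JM TotalSpace.proj e v')
    (h' : ∀ l : TotalSpace F V → ℝ, IsFiberLinear (EM := EM) l →
      mvfderiv JF l e v = mvfderiv JF l e v') : v = v' := by
  let S := dualSystem EM F V e.proj
  have h1 := S.tangentMap_frame S.χ_one v
  rw [h] at h1
  simp only [h' _ (S.isFiberLinear _)] at h1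
  rw [S.tangentMap_frame S.χ_one v'] at h1
  exact (mk_inj h1).symm

/-- A derivation on the fibrewise linear functions is given by a tangent vector. -/
theorem exists_tangent (e : TotalSpace F V) (a : TangentSpace JM e.proj)
    (Λ : (TotalSpace F V → ℝ) → ℝ)
    (hadd : ∀ l l', IsFiberLinear (EM := EM) l → IsFiberLinear (EM := EM) l' →
      Λ (fun v => l v + l' v) = Λ l + Λ l')
    (hmul : ∀ (f : Fns JM M) l, IsFiberLinear (EM := EM) l →
      Λ (fun v => f v.proj * l v) = f e.proj * Λ l + mvfderiv JM f e.proj a * l e) :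
    ∃ v : TangentSpace JF e,
      mfderiv JF JM TotalSpace.proj e v = a ∧
      ∀ l, IsFiberLinear (EM := EM) l → mvfderiv JF l e v = Λ l := by
  let S := dualSystem EM F V e.proj
  have h0 : Λ (fun _ => 0) = 0 := by
    have := hmul 0 _ IsFiberLinear.zero
    simp only [mul_zero, add_zero] at this
    rw [this]
    exact zero_mul _
  have hsum : ∀ (T : Finset (Fin S.n)) (l : Fin S.n → TotalSpace F V → ℝ),
      (∀ i, IsFiberLinear (EM := EM) (l i)) → Λ (fun v => ∑ i ∈ T, l i v) = ∑ i ∈ T, Λ (l i) := by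
    intro T l hl
    classical
    induction T using Finset.induction_on with
    | empty => simpa using h0
    | insert i T hi ih =>
      simp only [Finset.sum_insert hi]
      rw [hadd _ _ (hl i) (IsFiberLinear.sum T fun j _ => hl j), ih]
  have hχ : mvfderiv JM S.χ e.proj a = 0 := by
    rw [dfun_congr (g := fun _ => (1 : ℝ)) S.χ_one, dfun_const]
  have key : ∃ v : TangentSpace JF (S.frame (S.coords e)),
      (mfderiv JF JM TotalSpace.proj (S.frame (S.coords e)) v : EM) = a ∧
      ∀ l, IsFiberLinear (EM := EM) l →
        mvfderiv JF l (S.frame (S.coords e)) v = Λ l := by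
    refine ⟨_, S.proj_frame (S.coords e) a
      (fun j => Λ (fun w : TotalSpace F V => S.l j w.proj w.snd)), fun l hl => ?_⟩
    refine (S.dfun_frame hl (S.coords e) a _).trans ?_
    have h1 := hmul S.χ l hl
    rw [hχ, zero_mul, add_zero, S.χ_self, one_mul, S.χ_mul_fiberLinear hl,
      hsum _ _ fun i => (S.isFiberLinear i).mul (hl.comp (S.b i))] at h1
    rw [← h1]
    refine Finset.sum_congr rfl fun j _ => ?_
    rw [hmul _ _ (S.isFiberLinear j)]
    change _ * hl.comp (S.b j) e.proj +
      S.l j e.proj e.snd * mvfderiv JM (hl.comp (S.b j)) e.proj a = _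
    ring
  rw [S.frame_coords S.χ_self e.snd] at key
  exact key

theorem contMDiffAt_tangent {EP : Type*} [NormedAddCommGroup EP] [NormedSpace ℝ EP]
    {HP : Type*} [TopologicalSpace HP] {J : ModelWithCorners ℝ EP HP}
    {P : Type*} [TopologicalSpace P] [ChartedSpace HP P]
    {e : P → TotalSpace F V} {v : (p : P) → TangentSpace JF (e p)} {p : P}
    (he : ContMDiffAt J JF ∞ e p)
    (h1 : ContMDiffAt J 𝓘(ℝ, EM).tangent ∞ (fun q => (⟨(e q).proj,
      mfderiv JF JM TotalSpace.proj (e q) (v q)⟩ :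
        TangentBundle JM M)) p)
    (h2 : ∀ l, IsFiberLinear (EM := EM) l →
      ContMDiffAt J 𝓘(ℝ, ℝ) ∞ (fun q => mvfderiv JF l (e q) (v q)) p) :
    ContMDiffAt J (𝓘(ℝ, EM).prod 𝓘(ℝ, F)).tangent ∞
      (fun q => (⟨e q, v q⟩ : TangentBundle JF (TotalSpace F V))) p := by
  let S := dualSystem EM F V (e p).proj
  have h3 : ContMDiffAt J 𝓘(ℝ, Fin S.n → ℝ).tangent ∞ (fun q =>
      (⟨(S.coords (e q)).2, fun j => mvfderiv JF
        (fun w : TotalSpace F V => S.l j w.proj w.snd) (e q) (v q)⟩ :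
        TangentBundle 𝓘(ℝ, Fin S.n → ℝ) (Fin S.n → ℝ))) p := by
    rw [Bundle.contMDiffAt_totalSpace]
    refine ⟨(contMDiff_snd.comp S.contMDiff_coords).contMDiffAt.comp p he, ?_⟩
    have h4 : ContMDiffAt J 𝓘(ℝ, Fin S.n → ℝ) ∞ (fun q => fun j =>
        mvfderiv JF (fun w : TotalSpace F V => S.l j w.proj w.snd) (e q) (v q)) p :=
      contMDiffAt_pi_space.mpr fun j => h2 _ (S.isFiberLinear j)
    refine h4.congr_of_eventuallyEq (Eventually.of_forall fun q => ?_)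
    simp
  have h5 := ((contMDiff_equivTangentBundleProd_symm (n := ∞)).contMDiffAt.comp p (h1.prodMk h3))
  have h6 := ((S.contMDiff_frame.contMDiff_tangentMap (m := ∞) (by simp)).contMDiffAt.comp p h5)
  refine h6.congr_of_eventuallyEq ?_
  have h7 : ContinuousAt (fun q => (e q).proj) p :=
    ((contMDiff_proj V (IB := JM) (n := ∞)).contMDiffAt.comp p he).continuousAt
  filter_upwards [h7.eventually S.χ_one.eventually_nhds] with q hq
  exact (S.tangentMap_frame hq (v q)).symm

end Tangent

section TangentAddition

variable {EM : Type v} [NormedAddCommGroup EM] [NormedSpace ℝ EM]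
  {M : Type w} [TopologicalSpace M] [ChartedSpace EM M]
  {FE : Type u} [NormedAddCommGroup FE] [NormedSpace ℝ FE]
  {E : M → Type u} [TopologicalSpace (TotalSpace FE E)]
  [∀ x, AddCommGroup (E x)] [∀ x, Module ℝ (E x)] [∀ x, TopologicalSpace (E x)]
  [FiberBundle FE E] [VectorBundle ℝ FE E]

local notation "JM" => 𝓘(ℝ, EM)
local notation "JF" => ModelWithCorners.prod 𝓘(ℝ, EM) 𝓘(ℝ, FE)

variable (EM FE E) in
theorem contMDiff_prodFst : ContMDiff (𝓘(ℝ, EM).prod 𝓘(ℝ, FE × FE)) JF ∞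
    (fun p => (⟨p.proj, p.snd.1⟩ : TotalSpace FE E) : TotalSpace (FE × FE) (E ×ᵇ E) → _) := fun p =>
  (contMDiffAt_prod_iff (b := fun q : TotalSpace (FE × FE) (E ×ᵇ E) => q.proj)
    (s := fun q => q.snd.1) (t := fun q => q.snd.2) (p := p)).mp contMDiffAt_id |>.1

variable (EM FE E) in
theorem contMDiff_prodSnd : ContMDiff (𝓘(ℝ, EM).prod 𝓘(ℝ, FE × FE)) JF ∞
    (fun p => (⟨p.proj, p.snd.2⟩ : TotalSpace FE E) : TotalSpace (FE × FE) (E ×ᵇ E) → _) := fun p =>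
  (contMDiffAt_prod_iff (b := fun q : TotalSpace (FE × FE) (E ×ᵇ E) => q.proj)
    (s := fun q => q.snd.1) (t := fun q => q.snd.2) (p := p)).mp contMDiffAt_id |>.2

variable (EM FE E) in
theorem contMDiff_prodAdd : ContMDiff (𝓘(ℝ, EM).prod 𝓘(ℝ, FE × FE)) JF ∞
    (fun p => (⟨p.proj, p.snd.1 + p.snd.2⟩ : TotalSpace FE E) : TotalSpace (FE × FE) (E ×ᵇ E) → _) :=
  fun p => along_add (contMDiff_prodFst EM FE E p) (contMDiff_prodSnd EM FE E p)

theorem TangentAdd.dfun {v₁ v₂ v : TangentBundle JF (TotalSpace FE E)}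
    (h : TangentAdd v₁ v₂ v) {l : TotalSpace FE E → ℝ} (hl : IsFiberLinear (EM := EM) l) :
    mvfderiv JF l v.proj v.snd =
      mvfderiv JF l v₁.proj v₁.snd +
      mvfderiv JF l v₂.proj v₂.snd := by
  obtain ⟨w, rfl, rfl, rfl⟩ := h
  have hd := fun e => hl.contMDiff.mdifferentiable (by simp) e
  have h1 := (contMDiff_prodFst EM FE E).mdifferentiable (by simp) w.proj
  have h2 := (contMDiff_prodSnd EM FE E).mdifferentiable (by simp) w.proj
  have h3 := (contMDiff_prodAdd EM FE E).mdifferentiable (by simp) w.proj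
  refine (dfun_comp (hd _) h3 w.snd).symm.trans
    (Eq.trans ?_ (congrArg₂ (· + ·) (dfun_comp (hd _) h1 w.snd) (dfun_comp (hd _) h2 w.snd)))
  rw [← dfun_add]
  · congr 2
    funext p
    exact (hl.linear p.proj).map_add _ _
  · exact (hd _).comp w.proj h1
  · exact (hd _).comp w.proj h2

variable [FiniteDimensional ℝ EM] [T2Space M] [IsManifold 𝓘(ℝ, EM) ∞ M]
  [FiniteDimensional ℝ FE] [ContMDiffVectorBundle ∞ FE E 𝓘(ℝ, EM)]

theorem tangentAdd_mk {x : M} {e₁ e₂ : E x}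
    {v₁ : TangentSpace JF (⟨x, e₁⟩ : TotalSpace FE E)}
    {v₂ : TangentSpace JF (⟨x, e₂⟩ : TotalSpace FE E)}
    {v : TangentSpace JF (⟨x, e₁ + e₂⟩ : TotalSpace FE E)}
    (a : TangentSpace JM x)
    (h₁ : mfderiv JF JM TotalSpace.proj _ v₁ = a)
    (h₂ : mfderiv JF JM TotalSpace.proj _ v₂ = a)
    (h : mfderiv JF JM TotalSpace.proj _ v = a)
    (hv : ∀ l : TotalSpace FE E → ℝ, IsFiberLinear (EM := EM) l →
      mvfderiv JF l _ v = mvfderiv JF l _ v₁ +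
        mvfderiv JF l _ v₂) :
    TangentAdd (⟨_, v₁⟩ : TangentBundle JF (TotalSpace FE E)) ⟨_, v₂⟩ ⟨_, v⟩ := by
  have i1 : ContMDiff JF (𝓘(ℝ, EM).prod 𝓘(ℝ, FE × FE)) ∞
      (fun p => (⟨p.proj, (p.snd, 0)⟩ : TotalSpace (FE × FE) (E ×ᵇ E)) : TotalSpace FE E → _) :=
    fun p => (contMDiffAt_prod_iff (b := fun q : TotalSpace FE E => q.proj)).mpr
      ⟨contMDiffAt_id, along_zero (contMDiffAt_proj E)⟩
  have i2 : ContMDiff JF (𝓘(ℝ, EM).prod 𝓘(ℝ, FE × FE)) ∞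
      (fun p => (⟨p.proj, (0, p.snd)⟩ : TotalSpace (FE × FE) (E ×ᵇ E)) : TotalSpace FE E → _) :=
    fun p => (contMDiffAt_prod_iff (b := fun q : TotalSpace FE E => q.proj)).mpr
      ⟨along_zero (contMDiffAt_proj E), contMDiffAt_id⟩
  have f1 : ∀ {l : TotalSpace (FE × FE) (E ×ᵇ E) → ℝ}, IsFiberLinear (EM := EM) l →
      IsFiberLinear (EM := EM) (fun p : TotalSpace FE E => l ⟨p.proj, (p.snd, 0)⟩) := fun {l} hl =>
    ⟨hl.contMDiff.comp i1, fun y => ((hl.linear y).mk' ∘ₗ LinearMap.inl ℝ (E y) (E y)).isLinear⟩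
  have f2 : ∀ {l : TotalSpace (FE × FE) (E ×ᵇ E) → ℝ}, IsFiberLinear (EM := EM) l →
      IsFiberLinear (EM := EM) (fun p : TotalSpace FE E => l ⟨p.proj, (0, p.snd)⟩) := fun {l} hl =>
    ⟨hl.contMDiff.comp i2, fun y => ((hl.linear y).mk' ∘ₗ LinearMap.inr ℝ (E y) (E y)).isLinear⟩
  have hfp : ∀ (f : Fns JM M) (e : TotalSpace FE E),
      MDifferentiableAt JF 𝓘(ℝ, ℝ) (fun e : TotalSpace FE E => f e.proj) e :=
    fun f e => (f.contMDiff.comp (contMDiff_proj E)).mdifferentiable (by simp) e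
  have hfd : ∀ (f : Fns JM M) (e : TotalSpace FE E) (v : TangentSpace _ e),
      mvfderiv JF (fun e : TotalSpace FE E => f e.proj) e v =
        mvfderiv JM f e.proj (mfderiv JF JM TotalSpace.proj e v) :=
    fun f e v => dfun_comp (f.contMDiff.mdifferentiable (by simp) _)
      ((contMDiff_proj E (n := ∞)).mdifferentiable (by simp) _) v
  obtain ⟨w, hw1, hw2⟩ := exists_tangent (EM := EM) (F := FE × FE) (V := E ×ᵇ E) ⟨x, (e₁, e₂)⟩ a
    (fun l => mvfderiv JF (fun p : TotalSpace FE E => l ⟨p.proj, (p.snd, 0)⟩) _ v₁ +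
      mvfderiv JF (fun p : TotalSpace FE E => l ⟨p.proj, (0, p.snd)⟩) _ v₂)
    (fun l l' hl hl' => by
      rw [dfun_add ((f1 hl).contMDiff.mdifferentiable (by simp) _)
          ((f1 hl').contMDiff.mdifferentiable (by simp) _),
        dfun_add ((f2 hl).contMDiff.mdifferentiable (by simp) _)
          ((f2 hl').contMDiff.mdifferentiable (by simp) _)]
      ring)
    (fun f l hl => by
      rw [dfun_mul (hfp f _) ((f1 hl).contMDiff.mdifferentiable (by simp) _),
        dfun_mul (hfp f _) ((f2 hl).contMDiff.mdifferentiable (by simp) _), hfd, hfd, h₁, h₂]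
      have h3 : l ⟨x, (e₁, e₂)⟩ = l ⟨x, (e₁, 0)⟩ + l ⟨x, (0, e₂)⟩ := by
        refine Eq.trans ?_ ((hl.linear x).map_add (e₁, 0) (0, e₂))
        rw [Prod.mk_add_mk, add_zero, zero_add]
      rw [h3]
      ring)
  have hp : ∀ {φ : TotalSpace (FE × FE) (E ×ᵇ E) → TotalSpace FE E},
      ContMDiff (𝓘(ℝ, EM).prod 𝓘(ℝ, FE × FE)) JF ∞ φ →
      (∀ p, (φ p).proj = p.proj) → ∀ (p) (u : TangentSpace (𝓘(ℝ, EM).prod 𝓘(ℝ, FE × FE)) p),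
      (mfderiv JF JM TotalSpace.proj (φ p)
        (mfderiv (𝓘(ℝ, EM).prod 𝓘(ℝ, FE × FE)) JF φ p u) : EM) =
      mfderiv (𝓘(ℝ, EM).prod 𝓘(ℝ, FE × FE)) JM TotalSpace.proj p u := by
    intro φ hφ hφp p u
    have h1 := mfderiv_comp_apply (I'' := JM) (g := (TotalSpace.proj : TotalSpace FE E → M)) p
      ((contMDiff_proj E (n := ∞)).mdifferentiable (by simp) _) (hφ.mdifferentiable (by simp) _) u
    refine h1.symm.trans ?_
    have h2 : (TotalSpace.proj : TotalSpace FE E → M) ∘ φ = TotalSpace.proj := funext hφp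
    rw [h2]
  have key : ∀ {φ : TotalSpace (FE × FE) (E ×ᵇ E) → TotalSpace FE E}
      (hφ : ContMDiff (𝓘(ℝ, EM).prod 𝓘(ℝ, FE × FE)) JF ∞ φ)
      (hφp : ∀ p, (φ p).proj = p.proj) (z : TangentSpace JF (φ ⟨x, (e₁, e₂)⟩)),
      ((mfderiv JF JM TotalSpace.proj _ z : EM) = a) →
      (∀ l (hl : IsFiberLinear (EM := EM) l), IsFiberLinear (EM := EM) (fun p => l (φ p)) ∧
        mvfderiv JF (fun p : TotalSpace FE E => l (φ ⟨p.proj, (p.snd, 0)⟩)) _ v₁ +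
        mvfderiv JF (fun p : TotalSpace FE E => l (φ ⟨p.proj, (0, p.snd)⟩)) _ v₂ =
        mvfderiv JF l _ z) →
      tangentMap (𝓘(ℝ, EM).prod 𝓘(ℝ, FE × FE)) JF φ ⟨⟨x, (e₁, e₂)⟩, w⟩ =
        ⟨φ ⟨x, (e₁, e₂)⟩, z⟩ := by
    intro φ hφ hφp z hz1 hz2
    refine congrArg _ (tangent_ext ?_ fun l hl => ?_)
    · exact (hp hφ hφp _ w).trans (hw1.trans hz1.symm)
    · rw [← (hz2 l hl).2, ← hw2 _ (hz2 l hl).1]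
      exact (dfun_comp (hl.contMDiff.mdifferentiable (by simp) _) (hφ.mdifferentiable (by simp) _) w).symm
  have hc : ∀ (l : TotalSpace FE E → ℝ), IsFiberLinear (EM := EM) l →
      ∀ (e : TotalSpace FE E) (u : TangentSpace _ e),
      mvfderiv JF (fun p : TotalSpace FE E => l ⟨p.proj, 0⟩) e u = 0 := by
    intro l hl e u
    have : (fun p : TotalSpace FE E => l ⟨p.proj, 0⟩) = fun _ => 0 := by
      funext p
      exact (hl.linear p.proj).map_zero
    rw [this, dfun_const]
  refine ⟨⟨⟨x, (e₁, e₂)⟩, w⟩, key (contMDiff_prodFst EM FE E) (fun _ => rfl) v₁ h₁ ?_,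
    key (contMDiff_prodSnd EM FE E) (fun _ => rfl) v₂ h₂ ?_,
    key (contMDiff_prodAdd EM FE E) (fun _ => rfl) v h ?_⟩
  · refine fun l hl => ⟨⟨hl.contMDiff.comp (contMDiff_prodFst EM FE E), fun y =>
      ((hl.linear y).mk' ∘ₗ LinearMap.fst ℝ (E y) (E y)).isLinear⟩, ?_⟩
    dsimp only
    rw [hc l hl, add_zero]
  · refine fun l hl => ⟨⟨hl.contMDiff.comp (contMDiff_prodSnd EM FE E), fun y =>
      ((hl.linear y).mk' ∘ₗ LinearMap.snd ℝ (E y) (E y)).isLinear⟩, ?_⟩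
    dsimp only
    rw [hc l hl, zero_add]
  · refine fun l hl => ⟨⟨hl.contMDiff.comp (contMDiff_prodAdd EM FE E), fun y =>
      ((hl.linear y).mk' ∘ₗ (LinearMap.fst ℝ (E y) (E y) + LinearMap.snd ℝ (E y) (E y))).isLinear⟩, ?_⟩
    dsimp only
    simp only [add_zero, zero_add]
    exact (hv l hl).symm

end TangentAddition

section AnchorBracket

open Filter Topology

variable {R L : Type*} [CommRing R] [Algebra ℝ R]
  [AddCommGroup L] [Module R L] [Module ℝ L] [IsScalarTower ℝ R L]

/-- The Jacobi identity and the Leibniz rule. -/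
theorem LieRinehartData.rho_br_smul (P : LieRinehartData R L) (X Y Z : L) (f : R) :
    P.rho X (P.rho Y f) • Z - P.rho Y (P.rho X f) • Z = P.rho (P.br X Y) f • Z := by
  have h := P.jacobi X Y (f • Z)
  simp only [P.leibniz, map_add, P.jacobi X Y Z, smul_add] at h
  have h2 : P.rho X (P.rho Y f) • Z = P.rho (P.br X Y) f • Z + P.rho Y (P.rho X f) • Z := by
    have h3 := sub_eq_zero.mpr h
    refine sub_eq_zero.mp (Eq.trans ?_ h3)
    abel
  rw [h2, add_sub_cancel_right]

variable {EP : Type*} [NormedAddCommGroup EP] [NormedSpace ℝ EP]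
  {HP : Type*} [TopologicalSpace HP] {I : ModelWithCorners ℝ EP HP}
  {P : Type*} [TopologicalSpace P] [ChartedSpace HP P] [IsManifold I ∞ P]
  {F : Type*} [NormedAddCommGroup F] [NormedSpace ℝ F]
  {V : P → Type*} [TopologicalSpace (TotalSpace F V)]
  [∀ x, AddCommGroup (V x)] [∀ x, Module ℝ (V x)] [∀ x, TopologicalSpace (V x)]
  [FiberBundle F V] [VectorBundle ℝ F V]

/-- The anchor of a Lie algebroid preserves brackets. -/
theorem LieAlgebroid.rho_br (LA : LieAlgebroid I F V) (X Y : Sections I F V) (f : Fns I P) :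
    LA.lieRinehart.rho X (LA.lieRinehart.rho Y f) - LA.lieRinehart.rho Y (LA.lieRinehart.rho X f) =
      LA.lieRinehart.rho (LA.lieRinehart.br X Y) f := by
  ext p
  have key : ∀ Z : Sections I F V, Z p ≠ 0 →
      (LA.lieRinehart.rho X (LA.lieRinehart.rho Y f) - LA.lieRinehart.rho Y (LA.lieRinehart.rho X f)) p =
      LA.lieRinehart.rho (LA.lieRinehart.br X Y) f p := by
    intro Z hZ
    have h := LA.lieRinehart.rho_br_smul X Y Z f
    rw [← sub_smul] at h
    have h1 := congrArg (fun s : Sections I F V => s p) h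
    exact smul_left_injective ℝ hZ h1
  have hz : ∀ (Z : Sections I F V) (g : Fns I P), Z p = 0 → LA.lieRinehart.rho Z g p = 0 := by
    intro Z g hZ
    change mvfderiv I g p (LA.anchor p (Z p)) = 0
    rw [hZ, map_zero, map_zero]
  by_cases hX : X p = 0
  · by_cases hY : Y p = 0
    · by_cases hB : LA.lieRinehart.br X Y p = 0
      · change LA.lieRinehart.rho X _ p - LA.lieRinehart.rho Y _ p = _
        rw [hz X _ hX, hz Y _ hY, hz _ _ hB, sub_zero]
      · exact key _ hB
    · exact key Y hY
  · exact key X hX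

theorem two_le_infty : (2 : WithTop ℕ∞) ≤ ∞ :=
  WithTop.coe_le_coe.mpr (le_top : ((2 : ℕ∞)) ≤ ⊤)

theorem three_le_infty : (3 : WithTop ℕ∞) ≤ ∞ :=
  WithTop.coe_le_coe.mpr (le_top : ((3 : ℕ∞)) ≤ ⊤)

/-- Vector fields. -/
def tangentAlgebroid (I : ModelWithCorners ℝ EP HP) (P : Type*) [TopologicalSpace P]
    [ChartedSpace HP P] [IsManifold I ∞ P] [CompleteSpace EP] :
    LieAlgebroid I EP (TangentSpace I : P → Type _) :=
  haveI : IsManifold I (minSmoothness ℝ 3) P := IsManifold.of_le (n := ∞) (by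
    simp only [minSmoothness_of_isRCLikeNormedField]; exact three_le_infty)
  haveI : IsManifold I ((⊤ : ℕ∞) + 1) P := IsManifold.of_le (n := ∞) (by simp)
  haveI : IsManifold I 2 P := IsManifold.of_le (n := ∞) two_le_infty
  have hd : ∀ (X : Sections I EP (TangentSpace I : P → Type _)) (p : P),
      MDifferentiableAt I I.tangent (fun x => (⟨x, X x⟩ : TangentBundle I P)) p := fun X p =>
    X.contMDiff.mdifferentiable (by simp) p
  { anchor := fun _ => LinearMap.id
    contMDiff_anchor := contMDiff_id
    bracket := LinearMap.mk₂ ℝ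
      (fun X Y => ⟨fun p => VectorField.mlieBracket I (fun x => X x) (fun x => Y x) p, fun p =>
        ContMDiffAt.mlieBracket_vectorField (m := ⊤) (n := ⊤) (X.contMDiff p) (Y.contMDiff p)
          (by simp)⟩)
      (fun X X' Y => by
        ext p
        exact VectorField.mlieBracket_add_left (hd X p) (hd X' p))
      (fun c X Y => by
        ext p
        exact VectorField.mlieBracket_const_smul_left (hd X p))
      (fun X Y Y' => by
        ext p
        exact VectorField.mlieBracket_add_right (hd Y p) (hd Y' p))
      (fun c X Y => by
        ext p
        exact VectorField.mlieBracket_const_smul_right (hd Y p))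
    bracket_self := fun X => by
      ext p
      exact congrFun VectorField.mlieBracket_self p
    jacobi := fun X Y Z => by
      ext p
      have hle : minSmoothness ℝ 2 ≤ (∞ : WithTop ℕ∞) := by
        simp only [minSmoothness_of_isRCLikeNormedField]; exact two_le_infty
      exact VectorField.leibniz_identity_mlieBracket_apply ((X.contMDiff p).of_le hle)
        ((Y.contMDiff p).of_le hle) ((Z.contMDiff p).of_le hle)
    leibniz := fun X f Y p => by
      refine Eq.trans (VectorField.mlieBracket_smul_right (mdiffAt_fn f p) (hd Y p)) ?_
      exact add_comm _ _ }

theorem tangent_eq_zero {EM : Type*} [NormedAddCommGroup EM] [NormedSpace ℝ EM]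
    [FiniteDimensional ℝ EM] {M : Type*} [TopologicalSpace M] [ChartedSpace EM M] [T2Space M]
    [IsManifold 𝓘(ℝ, EM) ∞ M] {x : M} {a : TangentSpace 𝓘(ℝ, EM) x}
    (h : ∀ f : Fns 𝓘(ℝ, EM) M, mvfderiv 𝓘(ℝ, EM) f x a = 0) : a = 0 := by
  obtain ⟨χ⟩ : Nonempty (SmoothBumpFunction 𝓘(ℝ, EM) x) := inferInstance
  have h1 : ContMDiff 𝓘(ℝ, EM) 𝓘(ℝ, EM) ∞ (fun y => χ y • extChartAt 𝓘(ℝ, EM) x y) :=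
    χ.contMDiff_smul contMDiffOn_extChartAt
  have h2 : (fun y => χ y • extChartAt 𝓘(ℝ, EM) x y) =ᶠ[𝓝 x] extChartAt 𝓘(ℝ, EM) x := by
    filter_upwards [χ.eventuallyEq_one] with y hy
    rw [hy, Pi.one_apply, one_smul]
  have : IsManifold 𝓘(ℝ, EM) 1 M := IsManifold.of_le (n := ∞) (by simp)
  have h3 : ∀ φ : EM →L[ℝ] ℝ, φ (mfderiv 𝓘(ℝ, EM) 𝓘(ℝ, EM) (extChartAt 𝓘(ℝ, EM) x) x a) = 0 := by
    intro φ
    have h4 := h ⟨fun y => φ (χ y • extChartAt 𝓘(ℝ, EM) x y), φ.contDiff.contMDiff.comp h1⟩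
    have h5 := dfun_comp (J := 𝓘(ℝ, EM)) (K := 𝓘(ℝ, EM)) (g := φ) (p := x)
      (φ.contDiff.contMDiff.mdifferentiable (n := ∞) (by simp) _) (h1.mdifferentiable (by simp) x) a
    have h6 : mfderiv 𝓘(ℝ, EM) 𝓘(ℝ, ℝ) φ (χ x • extChartAt 𝓘(ℝ, EM) x x) = φ :=
      φ.hasMFDerivAt.mfderiv
    rw [h2.mfderiv_eq] at h5
    change _ = mfderiv 𝓘(ℝ, EM) 𝓘(ℝ, ℝ) φ (χ x • extChartAt 𝓘(ℝ, EM) x x) _ at h5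
    rw [h6] at h5
    exact h5.symm.trans h4
  have h7 : mfderiv 𝓘(ℝ, EM) 𝓘(ℝ, EM) (extChartAt 𝓘(ℝ, EM) x) x a = 0 :=
    SeparatingDual.eq_zero_of_forall_dual_eq_zero (R := ℝ) (V := EM) h3
  obtain ⟨L, hL⟩ := isInvertible_mfderiv_extChartAt (mem_extChartAt_source (I := 𝓘(ℝ, EM)) x)
  rw [← hL] at h7
  exact L.injective (h7.trans (map_zero L).symm)

end AnchorBracket

section Commutator

open Filter Topology

variable {EM : Type v} [NormedAddCommGroup EM] [NormedSpace ℝ EM]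
  {M : Type w} [TopologicalSpace M] [ChartedSpace EM M]
  {F : Type u} [NormedAddCommGroup F] [NormedSpace ℝ F]
  {V : M → Type u} [TopologicalSpace (TotalSpace F V)]
  [∀ x, AddCommGroup (V x)] [∀ x, Module ℝ (V x)] [∀ x, TopologicalSpace (V x)]
  [FiberBundle F V] [VectorBundle ℝ F V]
  [FiniteDimensional ℝ EM] [T2Space M] [IsManifold 𝓘(ℝ, EM) ∞ M]
  [FiniteDimensional ℝ F] [ContMDiffVectorBundle ∞ F V 𝓘(ℝ, EM)]

local notation "JM" => 𝓘(ℝ, EM)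
local notation "JF" => ModelWithCorners.prod 𝓘(ℝ, EM) 𝓘(ℝ, F)

/-- The pullback of a function to the total space. -/
def pull (f : Fns JM M) : Fns JF (TotalSpace F V) :=
  ⟨fun e => f e.proj, f.contMDiff.comp (contMDiff_proj V)⟩

/-- A fibrewise linear function, as a smooth function. -/
def IsFiberLinear.fn {l : TotalSpace F V → ℝ} (h : IsFiberLinear (EM := EM) l) :
    Fns JF (TotalSpace F V) := ⟨l, h.contMDiff⟩

theorem dfun_pull (f : Fns JM M) (e : TotalSpace F V)
    (v : TangentSpace JF e) :
    mvfderiv JF (pull f : Fns _ (TotalSpace F V)) e v =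
      mvfderiv JM f e.proj (mfderiv JF JM TotalSpace.proj e v) :=
  dfun_comp (f.contMDiff.mdifferentiable (by simp) _)
    ((contMDiff_proj V (n := ∞)).mdifferentiable (by simp) _) v

/-- A commutator of vector fields on `V` is determined by the functions which are constant or linear
on the fibres. -/
theorem commutator_eq
    (X Y Z : Sections JF (EM × F)
      (TangentSpace JF : TotalSpace F V → Type _))
    (e : TotalSpace F V)
    (h : ∀ f : Fns JF (TotalSpace F V),
      (∃ g, f = pull g) ∨ (∃ l, ∃ hl : IsFiberLinear (EM := EM) l, f = hl.fn) →
      (tangentAlgebroid JF (TotalSpace F V)).derivFn X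
          ((tangentAlgebroid _ _).derivFn Y f) e -
        (tangentAlgebroid _ _).derivFn Y ((tangentAlgebroid _ _).derivFn X f) e =
        (tangentAlgebroid _ _).derivFn Z f e)
    (f : Fns JF (TotalSpace F V)) :
    (tangentAlgebroid JF (TotalSpace F V)).derivFn X
          ((tangentAlgebroid _ _).derivFn Y f) e -
        (tangentAlgebroid _ _).derivFn Y ((tangentAlgebroid _ _).derivFn X f) e =
        (tangentAlgebroid _ _).derivFn Z f e := by
  set T := tangentAlgebroid JF (TotalSpace F V) with hT
  have h1 : ∀ f, T.derivFn X (T.derivFn Y f) e - T.derivFn Y (T.derivFn X f) e =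
      T.derivFn (T.bracket X Y) f e := fun f =>
    congrArg (fun g : Fns JF (TotalSpace F V) => g e) (T.rho_br X Y f)
  simp only [h1] at h ⊢
  have h2 : T.bracket X Y e - Z e = 0 := by
    have h3 : ∀ f : Fns JF (TotalSpace F V),
        (∃ g, f = pull g) ∨ (∃ l, ∃ hl : IsFiberLinear (EM := EM) l, f = hl.fn) →
        mvfderiv JF f e (T.bracket X Y e - Z e) = 0 := by
      intro f hf
      rw [map_sub]
      exact sub_eq_zero.mpr (h f hf)
    refine tangent_ext ?_ fun l hl => ?_
    · rw [map_zero]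
      refine tangent_eq_zero fun f => ?_
      rw [← dfun_pull]
      exact h3 _ (Or.inl ⟨f, rfl⟩)
    · rw [map_zero]
      exact h3 hl.fn (Or.inr ⟨l, hl, rfl⟩)
  exact congrArg (fun z => mvfderiv JF f e z) (sub_eq_zero.mp h2)

end Commutator

/-- A bracket and an anchor satisfying the Leibniz rule, without the Jacobi identity. -/
structure PreLieRinehart (R L : Type*) [CommRing R] [Algebra ℝ R]
    [AddCommGroup L] [Module R L] [Module ℝ L] [IsScalarTower ℝ R L] where
  br : L →ₗ[ℝ] L →ₗ[ℝ] L
  rho : L →ₗ[R] Derivation ℝ R R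
  br_self : ∀ X, br X X = 0
  leibniz : ∀ X (f : R) Y, br X (f • Y) = f • br X Y + rho X f • Y

section Algebra

variable {R L NC NE : Type*} [CommRing R] [Algebra ℝ R]
  [AddCommGroup L] [Module R L] [Module ℝ L] [IsScalarTower ℝ R L]
  [AddCommGroup NC] [Module R NC] [Module ℝ NC] [IsScalarTower ℝ R NC]
  [AddCommGroup NE] [Module R NE] [Module ℝ NE] [IsScalarTower ℝ R NE]

/-- Forget the Jacobi identity. -/
def LieRinehartData.toPre (P : LieRinehartData R L) : PreLieRinehart R L where
  br := P.br
  rho := P.rho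
  br_self := P.br_self
  leibniz := P.leibniz

theorem PreLieRinehart.br_skew (P : PreLieRinehart R L) (X Y : L) : P.br Y X = -P.br X Y := by
  have := P.br_self (X + Y)
  simp only [map_add, LinearMap.add_apply, P.br_self, zero_add, add_zero] at this
  exact eq_neg_of_add_eq_zero_left this

/-- The connection on `Hom(E, C)`. -/
def SuperData.homConn {P : LieRinehartData R L} (S : SuperData NC NE P) (X : L) (φ : NE →ₗ[R] NC) :
    NE →ₗ[R] NC where
  toFun ε := S.nablaC.nabla X (φ ε) - φ (S.nablaS.nabla X ε)
  map_add' ε η := by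
    simp only [map_add]
    abel
  map_smul' f ε := by
    simp only [map_smul, S.nablaC.leibniz, S.nablaS.leibniz, map_add, RingHom.id_apply, smul_sub]
    abel

end Algebra

section Along

open Filter Topology

variable {EM : Type v} [NormedAddCommGroup EM] [NormedSpace ℝ EM] [FiniteDimensional ℝ EM]
  {M : Type w} [TopologicalSpace M] [ChartedSpace EM M] [T2Space M] [IsManifold 𝓘(ℝ, EM) ∞ M]
  {F : Type u} [NormedAddCommGroup F] [NormedSpace ℝ F] [FiniteDimensional ℝ F]
  {V : M → Type u} [TopologicalSpace (TotalSpace F V)]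
  [∀ x, AddCommGroup (V x)] [∀ x, Module ℝ (V x)] [∀ x, TopologicalSpace (V x)]
  [FiberBundle F V] [VectorBundle ℝ F V] [ContMDiffVectorBundle ∞ F V 𝓘(ℝ, EM)]
  {F' : Type u} [NormedAddCommGroup F'] [NormedSpace ℝ F'] [FiniteDimensional ℝ F']
  {V' : M → Type u} [TopologicalSpace (TotalSpace F' V')]
  [∀ x, AddCommGroup (V' x)] [∀ x, Module ℝ (V' x)] [∀ x, TopologicalSpace (V' x)]
  [FiberBundle F' V'] [VectorBundle ℝ F' V'] [ContMDiffVectorBundle ∞ F' V' 𝓘(ℝ, EM)]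
  {EP : Type*} [NormedAddCommGroup EP] [NormedSpace ℝ EP]
  {HP : Type*} [TopologicalSpace HP] {J : ModelWithCorners ℝ EP HP}
  {P : Type*} [TopologicalSpace P] [ChartedSpace HP P]

local notation "JM" => 𝓘(ℝ, EM)
local notation "JF" => ModelWithCorners.prod 𝓘(ℝ, EM) 𝓘(ℝ, F)

/-- A bilinear map on sections which is tensorial at `x` is given by a bilinear map on fibres. -/
theorem exists_bilin {Q : Type*} [AddCommGroup Q] [Module ℝ Q] (x : M)
    (φ : Sections JM F V → Sections JM F' V' → Q)
    (hadd : ∀ X Y Z, φ (X + Y) Z = φ X Z + φ Y Z) (hadd' : ∀ X Y Z, φ X (Y + Z) = φ X Y + φ X Z)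
    (hsmul : ∀ (f : Fns JM M) X Y, φ (f • X) Y = f x • φ X Y)
    (hsmul' : ∀ (f : Fns JM M) X Y, φ X (f • Y) = f x • φ X Y) :
    ∃ β : V x →ₗ[ℝ] V' x →ₗ[ℝ] Q, ∀ X Y, β (X x) (Y x) = φ X Y := by
  let S := dualSystem EM F V x
  let S' := dualSystem EM F' V' x
  have h1 : ∀ X Y, φ X Y = ∑ i, ∑ j, S.l i x (X x) • S'.l j x (Y x) • φ (S.b i) (S'.b j) := by
    intro X Y
    rw [S.sum_of_tensorial (fun X => φ X Y) (fun X Z => hadd X Z Y) (fun f X => hsmul f X Y) X]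
    refine Finset.sum_congr rfl fun i _ => ?_
    rw [S'.sum_of_tensorial (φ (S.b i)) (hadd' (S.b i)) (fun f Z => hsmul' f (S.b i) Z) Y,
      Finset.smul_sum]
  refine ⟨LinearMap.mk₂ ℝ (fun a b => ∑ i, ∑ j, S.l i x a • S'.l j x b • φ (S.b i) (S'.b j))
    (fun a a' b => ?_) (fun c a b => ?_) (fun a b b' => ?_) (fun c a b => ?_),
    fun X Y => (h1 X Y).symm⟩
  · simp only [map_add, add_smul, Finset.sum_add_distrib]
  · simp only [map_smul, Finset.smul_sum, smul_smul, smul_eq_mul, mul_assoc]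
  · simp only [map_add, add_smul, smul_add, Finset.sum_add_distrib]
  · simp only [map_smul, Finset.smul_sum, smul_smul, smul_eq_mul, mul_left_comm]

theorem contMDiffAt_lin {b : P → M} {s : (p : P) → V (b p)} {p : P}
    (hs : ContMDiffAt J JF ∞ (fun q => (⟨b q, s q⟩ : TotalSpace F V)) p)
    (β : (q : P) → V (b q) →ₗ[ℝ] ℝ)
    (hβ : ∀ X : Sections JM F V, ContMDiffAt J 𝓘(ℝ, ℝ) ∞ (fun q => β q (X (b q))) p) :
    ContMDiffAt J 𝓘(ℝ, ℝ) ∞ (fun q => β q (s q)) p := by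
  let S := dualSystem EM F V (b p)
  have hb : ContMDiffAt J JM ∞ b p := (contMDiffAt_along.mp hs).1
  have h1 : ContMDiffAt J 𝓘(ℝ, ℝ) ∞ (fun q => ∑ i, S.l i (b q) (s q) * β q (S.b i (b q))) p :=
    contMDiffAt_finsetSum fun i _ => ((S.smooth i).contMDiffAt.comp p hs).mul (hβ (S.b i))
  refine h1.congr_of_eventuallyEq ?_
  filter_upwards [hb.continuousAt.eventually S.eventually_eq] with q hq
  conv_lhs => rw [hq (s q)]
  simp only [map_sum, map_smul, smul_eq_mul]

theorem contMDiffAt_bilin {b : P → M} {s : (p : P) → V (b p)} {t : (p : P) → V' (b p)} {p : P}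
    (hs : ContMDiffAt J JF ∞ (fun q => (⟨b q, s q⟩ : TotalSpace F V)) p)
    (ht : ContMDiffAt J (𝓘(ℝ, EM).prod 𝓘(ℝ, F')) ∞ (fun q => (⟨b q, t q⟩ : TotalSpace F' V')) p)
    (β : (q : P) → V (b q) →ₗ[ℝ] V' (b q) →ₗ[ℝ] ℝ)
    (hβ : ∀ (X : Sections JM F V) (Y : Sections JM F' V'),
      ContMDiffAt J 𝓘(ℝ, ℝ) ∞ (fun q => β q (X (b q)) (Y (b q))) p) :
    ContMDiffAt J 𝓘(ℝ, ℝ) ∞ (fun q => β q (s q) (t q)) p :=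
  contMDiffAt_lin ht (fun q => β q (s q)) fun Y =>
    contMDiffAt_lin hs (fun q => (β q).flip (Y (b q))) fun X => hβ X Y

/-- Linear functionals on the fibrewise linear functions, depending smoothly on a parameter, are
given by a smooth map to the total space. -/
theorem exists_along_of_functional {b : P → M} (hb : ContMDiff J JM ∞ b)
    (Φ : (TotalSpace F V → ℝ) → P → ℝ)
    (hsm : ∀ l, IsFiberLinear (EM := EM) l → ContMDiff J 𝓘(ℝ, ℝ) ∞ (Φ l))
    (hadd : ∀ l l', IsFiberLinear (EM := EM) l → IsFiberLinear (EM := EM) l' →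
      ∀ p, Φ (fun v => l v + l' v) p = Φ l p + Φ l' p)
    (hmul : ∀ (f : Fns JM M) l, IsFiberLinear (EM := EM) l →
      ∀ p, Φ (fun v => f v.proj * l v) p = f (b p) * Φ l p) :
    ∃ s : (p : P) → V (b p),
      ContMDiff J JF ∞ (fun p => (⟨b p, s p⟩ : TotalSpace F V)) ∧
      ∀ l, IsFiberLinear (EM := EM) l → ∀ p, l ⟨b p, s p⟩ = Φ l p := by
  let S := dualSystem EM F V
  have h0 : ∀ p, Φ (fun _ => 0) p = 0 := by
    intro p
    have := hmul 0 _ IsFiberLinear.zero p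
    simp only [mul_zero] at this
    rw [this]
    exact zero_mul _
  have hsum : ∀ {ι : Type} (T : Finset ι) (l : ι → TotalSpace F V → ℝ),
      (∀ i, IsFiberLinear (EM := EM) (l i)) → ∀ p, Φ (fun v => ∑ i ∈ T, l i v) p =
        ∑ i ∈ T, Φ (l i) p := by
    intro ι T l hl p
    classical
    induction T using Finset.induction_on with
    | empty => simpa using h0 p
    | insert i T hi ih =>
      simp only [Finset.sum_insert hi]
      rw [hadd _ _ (hl i) (IsFiberLinear.sum T fun j _ => hl j), ih]
  let loc : (x : M) → (p : P) → V (b p) := fun x p =>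
    ∑ i, Φ (fun v => (S x).l i v.proj v.snd) p • (S x).b i (b p)
  have key : ∀ x p, (S x).χ (b p) = 1 → ∀ l, IsFiberLinear (EM := EM) l →
      l ⟨b p, loc x p⟩ = Φ l p := by
    intro x p hy l hl
    rw [hl.map_sum_smul]
    have h1 := hmul (S x).χ l hl p
    rw [hy, one_mul, (S x).χ_mul_fiberLinear hl,
      hsum Finset.univ _ fun i => ((S x).isFiberLinear i).mul (hl.comp ((S x).b i))] at h1
    rw [← h1]
    refine Finset.sum_congr rfl fun i _ => ?_
    rw [hmul _ _ ((S x).isFiberLinear i), mul_comm]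
    rfl
  refine ⟨fun p => loc (b p) p, fun p => ?_, fun l hl p => key _ p (S (b p)).χ_self l hl⟩
  have h2 : ContMDiffAt J JF ∞
      (fun q => (⟨b q, loc (b p) q⟩ : TotalSpace F V)) p :=
    along_sum Finset.univ hb.contMDiffAt fun i _ =>
      along_smul ((hsm _ ((S (b p)).isFiberLinear i)).contMDiffAt)
        (((S (b p)).b i).contMDiff.contMDiffAt.comp p hb.contMDiffAt)
  refine h2.congr_of_eventuallyEq ?_
  filter_upwards [hb.continuous.continuousAt.eventually (S (b p)).χ_one] with q hq
  have : loc (b q) q = loc (b p) q := (S (b q)).eq_of_fiberLinear fun l hl => by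
    rw [key (b p) q hq l hl, key (b q) q (S (b q)).χ_self l hl]
  rw [this]

/-- A linear functional on the fibrewise linear functions is given by a section. -/
theorem exists_section_of_functional (Φ : (TotalSpace F V → ℝ) → M → ℝ)
    (hsm : ∀ l, IsFiberLinear (EM := EM) l → ContMDiff JM 𝓘(ℝ, ℝ) ∞ (Φ l))
    (hadd : ∀ l l', IsFiberLinear (EM := EM) l → IsFiberLinear (EM := EM) l' →
      ∀ x, Φ (fun v => l v + l' v) x = Φ l x + Φ l' x)
    (hmul : ∀ (f : Fns JM M) l, IsFiberLinear (EM := EM) l →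
      ∀ x, Φ (fun v => f v.proj * l v) x = f x * Φ l x) :
    ∃ ε : Sections JM F V, ∀ l, IsFiberLinear (EM := EM) l → ∀ x, l ⟨x, ε x⟩ = Φ l x := by
  obtain ⟨s, hs, h⟩ := exists_along_of_functional (b := fun x : M => x) contMDiff_id Φ hsm hadd hmul
  exact ⟨⟨s, hs⟩, h⟩

/-- The form `dl(X, Y) = ρ(X) l(Y) - ρ(Y) l(X) - l(β(X, Y))` depends on the values of `X` and `Y`. -/
theorem exists_bracketForm {b : P → M}
    (ρ : (x : M) → V x →ₗ[ℝ] TangentSpace JM x)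
    (β : Sections JM F V → Sections JM F V → (p : P) → V (b p))
    (hskew : ∀ X Y p, β Y X p = -β X Y p)
    (hadd : ∀ X Y Z p, β X (Y + Z) p = β X Y p + β X Z p)
    (hleib : ∀ X (f : Fns JM M) Y p, β X (f • Y) p =
      f (b p) • β X Y p + mvfderiv JM f (b p) (ρ (b p) (X (b p))) • Y (b p))
    {l : TotalSpace F V → ℝ} (hl : IsFiberLinear (EM := EM) l) (p : P) :
    ∃ B : V (b p) →ₗ[ℝ] V (b p) →ₗ[ℝ] ℝ,
      ∀ X Y : Sections JM F V, B (X (b p)) (Y (b p)) =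
        mvfderiv JM (hl.comp Y) (b p) (ρ (b p) (X (b p))) -
        mvfderiv JM (hl.comp X) (b p) (ρ (b p) (Y (b p))) -
        l ⟨b p, β X Y p⟩ := by
  have hd : ∀ (f : Fns JM M) x, MDifferentiableAt JM 𝓘(ℝ, ℝ) f x := fun f x =>
    mdiffAt_fn f x
  have hla := fun y (a b : V y) => (hl.linear y).map_add a b
  have hls := fun y (c : ℝ) (a : V y) => (hl.linear y).map_smul c a
  have hD : ∀ (X : Sections JM F V) (f : Fns JM M) (v : TangentSpace JM (b p)),
      mvfderiv JM (hl.comp (f • X)) (b p) v =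
      f (b p) * mvfderiv JM (hl.comp X) (b p) v +
        l ⟨b p, X (b p)⟩ * mvfderiv JM f (b p) v := by
    intro X f v
    refine Eq.trans (congrArg (fun g : M → ℝ => mvfderiv JM g (b p) v) ?_)
      (dfun_mul (hd f _) (hd (hl.comp X) _) v)
    ext y
    exact hls _ _ _
  have hA : ∀ (X Y : Sections JM F V) (v : TangentSpace JM (b p)),
      mvfderiv JM (hl.comp (X + Y)) (b p) v =
      mvfderiv JM (hl.comp X) (b p) v +
        mvfderiv JM (hl.comp Y) (b p) v := by
    intro X Y v
    refine Eq.trans (congrArg (fun g : M → ℝ => mvfderiv JM g (b p) v) ?_)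
      (dfun_add (hd (hl.comp X) _) (hd (hl.comp Y) _) v)
    ext y
    exact hla _ _ _
  have hneg : ∀ a : V (b p), l ⟨b p, -a⟩ = -l ⟨b p, a⟩ := fun a => (hl.linear _).map_neg a
  refine exists_bilin (b p) _ (fun X Y Z => ?_) (fun X Y Z => ?_) (fun f X Y => ?_)
    (fun f X Y => ?_)
  · rw [hskew Z, hskew Z X, hskew Z Y, hadd, hneg, hneg, hneg, hla, hA, sec_add_apply, map_add,
      map_add]
    ring
  · rw [hadd, hla, hA, sec_add_apply, map_add, map_add]
    ring
  · rw [hskew Y, hskew Y X, hleib, hneg, hneg, hla, hls, hls, hD, smul_sec_apply, map_smul,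
      map_smul]
    simp only [smul_eq_mul]
    ring
  · rw [hleib, hla, hls, hls, hD, smul_sec_apply, map_smul, map_smul]
    simp only [smul_eq_mul]
    ring

/-- A bracket on the sections of the pullback of `V` along a map `b : P → M`, given an anchor `τ`
and, for fibrewise linear functions `l`, the forms `B = dl` on the pullback. -/
theorem exists_pullback_bracket [IsManifold J ∞ P] {b : P → M} (hb : ContMDiff J JM ∞ b)
    (ρ : (x : M) → V x →ₗ[ℝ] TangentSpace JM x)
    (hρ : ∀ (X : Sections JM F V) (f : Fns JM M),
      ContMDiff JM 𝓘(ℝ, ℝ) ∞ fun x => mvfderiv JM f x (ρ x (X x)))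
    (τ : (p : P) → V (b p) →ₗ[ℝ] TangentSpace J p)
    (hτ : ∀ s : (p : P) → V (b p),
      ContMDiff J JF ∞ (fun p => (⟨b p, s p⟩ : TotalSpace F V)) →
      ContMDiff J J.tangent ∞ (fun p => (⟨p, τ p (s p)⟩ : TangentBundle J P)))
    (hτρ : ∀ p v, mfderiv J JM b p (τ p v) = ρ (b p) v)
    (β : Sections JM F V → Sections JM F V → (p : P) → V (b p))
    (hβ : ∀ X Y, ContMDiff J JF ∞ (fun p => (⟨b p, β X Y p⟩ : TotalSpace F V)))
    (B : {l : TotalSpace F V → ℝ} → IsFiberLinear (EM := EM) l → (p : P) →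
      V (b p) →ₗ[ℝ] V (b p) →ₗ[ℝ] ℝ)
    (hB : ∀ {l} (hl : IsFiberLinear (EM := EM) l) p (X Y : Sections JM F V),
      B hl p (X (b p)) (Y (b p)) =
        mvfderiv JM (hl.comp Y) (b p) (ρ (b p) (X (b p))) -
        mvfderiv JM (hl.comp X) (b p) (ρ (b p) (Y (b p))) - l ⟨b p, β X Y p⟩)
    (s t : (p : P) → V (b p))
    (hs : ContMDiff J JF ∞ (fun p => (⟨b p, s p⟩ : TotalSpace F V)))
    (ht : ContMDiff J JF ∞ (fun p => (⟨b p, t p⟩ : TotalSpace F V))) :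
    ∃ r : (p : P) → V (b p),
      ContMDiff J JF ∞ (fun p => (⟨b p, r p⟩ : TotalSpace F V)) ∧
      ∀ {l : TotalSpace F V → ℝ} (hl : IsFiberLinear (EM := EM) l) (p : P), l ⟨b p, r p⟩ =
          mvfderiv J (fun q => l ⟨b q, t q⟩) p (τ p (s p)) -
          mvfderiv J (fun q => l ⟨b q, s q⟩) p (τ p (t p)) - B hl p (s p) (t p) := by
  have hd : ∀ (f : Fns JM M) x, MDifferentiableAt JM 𝓘(ℝ, ℝ) f x := fun f x =>
    mdiffAt_fn f x
  have hdl : ∀ {l : TotalSpace F V → ℝ}, IsFiberLinear (EM := EM) l → ∀ {s : (p : P) → V (b p)},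
      ContMDiff J JF ∞ (fun p => (⟨b p, s p⟩ : TotalSpace F V)) →
      ContMDiff J 𝓘(ℝ, ℝ) ∞ (fun p => l ⟨b p, s p⟩) := fun hl _ hs => hl.contMDiff.comp hs
  let X₀ := fun p => (dualSystem EM F V (b p)).extend (s p)
  let Y₀ := fun p => (dualSystem EM F V (b p)).extend (t p)
  have hX₀ : ∀ p, X₀ p (b p) = s p := fun p => DualSystem.extend_apply _ _
  have hY₀ : ∀ p, Y₀ p (b p) = t p := fun p => DualSystem.extend_apply _ _
  let Φ : (TotalSpace F V → ℝ) → P → ℝ := fun l p =>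
    mvfderiv J (fun q => l ⟨b q, t q⟩) p (τ p (s p)) -
    mvfderiv J (fun q => l ⟨b q, s q⟩) p (τ p (t p)) -
    (mvfderiv JM (fun y => l ⟨y, Y₀ p y⟩) (b p) (ρ (b p) (X₀ p (b p))) -
      mvfderiv JM (fun y => l ⟨y, X₀ p y⟩) (b p) (ρ (b p) (Y₀ p (b p))) -
      l ⟨b p, β (X₀ p) (Y₀ p) p⟩)
  have hΦ : ∀ {l : TotalSpace F V → ℝ} (hl : IsFiberLinear (EM := EM) l) p, Φ l p =
      mvfderiv J (fun q => l ⟨b q, t q⟩) p (τ p (s p)) -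
        mvfderiv J (fun q => l ⟨b q, s q⟩) p (τ p (t p)) - B hl p (s p) (t p) := by
    intro l hl p
    refine congrArg (fun z => _ - _ - z) ((hB hl p (X₀ p) (Y₀ p)).symm.trans ?_)
    rw [hX₀, hY₀]
  have hΦ₁ : ∀ l, IsFiberLinear (EM := EM) l → ContMDiff J 𝓘(ℝ, ℝ) ∞ (Φ l) := by
    intro l hl
    rw [show Φ l = _ from funext (hΦ hl)]
    refine ((contMDiff_mvfderiv_apply ⟨_, hdl hl ht⟩ _ (hτ s hs)).sub
      (contMDiff_mvfderiv_apply ⟨_, hdl hl hs⟩ _ (hτ t ht))).sub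
      fun p => contMDiffAt_bilin (hs p) (ht p) (B hl) fun X Y => ?_
    simp only [hB]
    exact ((((hρ X (hl.comp Y)).comp hb).sub ((hρ Y (hl.comp X)).comp hb)).sub
      (hdl hl (hβ X Y))).contMDiffAt
  have hΦ₂ : ∀ l l', IsFiberLinear (EM := EM) l → IsFiberLinear (EM := EM) l' →
      ∀ p, Φ (fun v => l v + l' v) p = Φ l p + Φ l' p := by
    intro l l' hl hl' p
    have h1 := fun v => dfun_add ((hdl hl hs).mdifferentiable (by simp) p)
      ((hdl hl' hs).mdifferentiable (by simp) p) v
    have h2 := fun v => dfun_add ((hdl hl ht).mdifferentiable (by simp) p)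
      ((hdl hl' ht).mdifferentiable (by simp) p) v
    have h3 := fun Z v => dfun_add (hd (hl.comp Z) (b p)) (hd (hl'.comp Z) (b p)) v
    change mvfderiv J (fun q => l ⟨b q, t q⟩ + l' ⟨b q, t q⟩) p _ -
      mvfderiv J (fun q => l ⟨b q, s q⟩ + l' ⟨b q, s q⟩) p _ -
      (mvfderiv JM (fun y => hl.comp (Y₀ p) y + hl'.comp (Y₀ p) y) (b p) _ -
        mvfderiv JM (fun y => hl.comp (X₀ p) y + hl'.comp (X₀ p) y) (b p) _ - (_ + _)) = _
    rw [h1, h2, h3, h3]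
    change _ = _ - _ - (mvfderiv JM (hl.comp (Y₀ p)) (b p) _ -
        mvfderiv JM (hl.comp (X₀ p)) (b p) _ - _) + (_ - _ -
      (mvfderiv JM (hl'.comp (Y₀ p)) (b p) _ -
        mvfderiv JM (hl'.comp (X₀ p)) (b p) _ - _))
    ring
  have hΦ₃ : ∀ (f : Fns JM M) l, IsFiberLinear (EM := EM) l →
      ∀ p, Φ (fun v => f v.proj * l v) p = f (b p) * Φ l p := by
    intro f l hl p
    have h0 : ContMDiff J 𝓘(ℝ, ℝ) ∞ fun q => f (b q) := f.contMDiff.comp hb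
    have h1 := fun v => dfun_mul (h0.mdifferentiable (by simp) p)
      ((hdl hl hs).mdifferentiable (by simp) p) v
    have h2 := fun v => dfun_mul (h0.mdifferentiable (by simp) p)
      ((hdl hl ht).mdifferentiable (by simp) p) v
    have h3 := fun Z v => dfun_mul (hd f (b p)) (hd (hl.comp Z) (b p)) v
    have h4 : ∀ v, mvfderiv J (fun q => f (b q)) p (τ p v) = mvfderiv JM f (b p) (ρ (b p) v) := by
      intro v
      rw [← hτρ]
      exact dfun_comp (hd f _) (hb.mdifferentiable (by simp) p) _
    change mvfderiv J (fun q => f (b q) * l ⟨b q, t q⟩) p _ -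
      mvfderiv J (fun q => f (b q) * l ⟨b q, s q⟩) p _ -
      (mvfderiv JM (fun y => f y * hl.comp (Y₀ p) y) (b p) _ -
        mvfderiv JM (fun y => f y * hl.comp (X₀ p) y) (b p) _ - f (b p) * _) = f (b p) * (_ - _ -
          (mvfderiv JM (hl.comp (Y₀ p)) (b p) _ -
            mvfderiv JM (hl.comp (X₀ p)) (b p) _ - _))
    rw [h1, h2, h3, h3, h4, h4]
    change _ - _ - (_ + l ⟨b p, Y₀ p (b p)⟩ * _ - (_ + l ⟨b p, X₀ p (b p)⟩ * _) - _) = _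
    rw [hX₀, hY₀]
    ring
  obtain ⟨r, hr, hrl⟩ := exists_along_of_functional hb Φ hΦ₁ hΦ₂ hΦ₃
  exact ⟨r, hr, fun hl p => (hrl _ hl p).trans (hΦ hl p)⟩

end Along

section DoubleVectorBundles

variable {EM : Type v} [NormedAddCommGroup EM] [NormedSpace ℝ EM]
  {M : Type w} [TopologicalSpace M] [ChartedSpace EM M]
  {FA : Type u} [NormedAddCommGroup FA] [NormedSpace ℝ FA]
  {A : M → Type u} [TopologicalSpace (Bundle.TotalSpace FA A)]
  [∀ x, AddCommGroup (A x)] [∀ x, Module ℝ (A x)] [∀ x, TopologicalSpace (A x)]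
  [FiberBundle FA A] [VectorBundle ℝ FA A]
  {FE : Type u} [NormedAddCommGroup FE] [NormedSpace ℝ FE]
  {E : M → Type u} [TopologicalSpace (Bundle.TotalSpace FE E)]
  [∀ x, AddCommGroup (E x)] [∀ x, Module ℝ (E x)] [∀ x, TopologicalSpace (E x)]
  [FiberBundle FE E] [VectorBundle ℝ FE E]
  {FC : Type u} [NormedAddCommGroup FC] [NormedSpace ℝ FC]
  {C : M → Type u} [TopologicalSpace (Bundle.TotalSpace FC C)]
  [∀ x, AddCommGroup (C x)] [∀ x, Module ℝ (C x)] [∀ x, TopologicalSpace (C x)]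
  [FiberBundle FC C] [VectorBundle ℝ FC C]
  [FiniteDimensional ℝ EM] [IsManifold 𝓘(ℝ, EM) ∞ M] [T2Space M]
  [FiniteDimensional ℝ FA] [ContMDiffVectorBundle ∞ FA A 𝓘(ℝ, EM)]
  [FiniteDimensional ℝ FE] [ContMDiffVectorBundle ∞ FE E 𝓘(ℝ, EM)]
  [FiniteDimensional ℝ FC] [ContMDiffVectorBundle ∞ FC C 𝓘(ℝ, EM)]

local notation "JM" => 𝓘(ℝ, EM)
local notation "JE" => ModelWithCorners.prod 𝓘(ℝ, EM) 𝓘(ℝ, FE)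
local notation "TotE" => TotalSpace FE E
local notation "ΓA" => Sections 𝓘(ℝ, EM) FA A
local notation "ΓE" => Sections 𝓘(ℝ, EM) FE E
local notation "ΓC" => Sections 𝓘(ℝ, EM) FC C
local notation "CM" => Fns 𝓘(ℝ, EM) M
local notation "CE" => Fns (ModelWithCorners.prod 𝓘(ℝ, EM) 𝓘(ℝ, FE)) (TotalSpace FE E)

section

namespace DoubleVectorBundle

variable (D : DoubleVectorBundle EM FA A FE E FC C)

theorem exists_projA (e : TotE) (d : D.overE.Fiber e) :
    ∃ a : A e.proj, D.projA ⟨e, d⟩ = ⟨e.proj, a⟩ := by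
  have h : (D.projA ⟨e, d⟩).proj = e.proj := D.proj_comm ⟨e, d⟩
  revert h
  generalize D.projA ⟨e, d⟩ = z
  intro h
  obtain ⟨x, a⟩ := z
  cases h
  exact ⟨a, rfl⟩

/-- The projection `D → A` on the fibres of `D → E`. -/
def pA (e : TotE) : D.overE.Fiber e →ₗ[ℝ] A e.proj where
  toFun d := (D.exists_projA e d).choose
  map_add' d d' := by
    have h := D.projA_add ⟨e, d⟩ ⟨e, d'⟩ ⟨e, d + d'⟩ (AddRel.mk e d d')
    change AddRel (D.projA _) (D.projA _) (D.projA _) at h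
    rw [(D.exists_projA e d).choose_spec, (D.exists_projA e d').choose_spec,
      (D.exists_projA e (d + d')).choose_spec] at h
    exact h.eq
  map_smul' t d := by
    have h := D.projA_scale t ⟨e, d⟩
    change D.projA ⟨e, t • d⟩ = scale t (D.projA ⟨e, d⟩) at h
    rw [(D.exists_projA e d).choose_spec, (D.exists_projA e (t • d)).choose_spec] at h
    exact mk_inj h

theorem projA_mk (e : TotE) (d : D.overE.Fiber e) :
    D.projA ⟨e, d⟩ = ⟨e.proj, D.pA e d⟩ := (D.exists_projA e d).choose_spec

theorem projA_zeroE (e : TotE) : D.projA (D.zeroE e) = ⟨e.proj, 0⟩ := by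
  rw [zeroE, projA_mk, map_zero]

theorem exists_addA {d₁ d₂ : D.Total} (h : D.projA d₁ = D.projA d₂) : ∃ d, D.AddA d₁ d₂ d := by
  obtain ⟨r, hr⟩ := exists_addRel h
  exact ⟨D.swap.symm r, by rwa [AddA, D.swap.apply_symm_apply]⟩

variable {D} in
theorem AddA.unique {d₁ d₂ d d' : D.Total} (h : D.AddA d₁ d₂ d) (h' : D.AddA d₁ d₂ d') : d = d' :=
  D.swap.injective (AddRel.unique h h')

variable {D} in
theorem AddA.projA_eq {d₁ d₂ d : D.Total} (h : D.AddA d₁ d₂ d) : D.projA d = D.projA d₁ :=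
  AddRel.proj_left h

variable {D} in
theorem AddA.symm {d₁ d₂ d : D.Total} (h : D.AddA d₁ d₂ d) : D.AddA d₂ d₁ d := AddRel.symm h

variable {D} in
theorem AddA.projE_eq {d₁ d₂ d : D.Total} (h : D.AddA d₁ d₂ d) : AddRel d₁.proj d₂.proj d.proj :=
  D.projE_add _ _ _ h

theorem exists_mk {e : TotE} {d : D.Total} (h : d.proj = e) :
    ∃ v : D.overE.Fiber e, d = ⟨e, v⟩ := by
  subst h
  exact ⟨d.snd, rfl⟩

theorem projA_core (x : M) (c : C x) : D.projA (D.core ⟨x, c⟩) = ⟨x, 0⟩ := D.core_projA ⟨x, c⟩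

theorem projE_core (x : M) (c : C x) : (D.core ⟨x, c⟩).proj = ⟨x, 0⟩ := D.core_projE ⟨x, c⟩

theorem exists_iota (e : TotE) (c : C e.proj) :
    ∃ d : D.overE.Fiber e, D.AddA (D.core ⟨e.proj, c⟩) (D.zeroE e) ⟨e, d⟩ := by
  obtain ⟨d, hd⟩ := D.exists_addA ((D.projA_core e.proj c).trans (D.projA_zeroE e).symm)
  have h1 := hd.projE_eq
  rw [projE_core] at h1
  have h2 : d.proj = e := by
    have h3 := AddRel.mk (F := FE) e.proj (0 : E e.proj) e.snd
    rw [zero_add] at h3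
    exact h1.unique h3
  obtain ⟨v, rfl⟩ := D.exists_mk h2
  exact ⟨v, hd⟩

/-- The inclusion `c ↦ c +_A 0_e` of the core in the fibre over `e`. -/
def iotaC (e : TotE) : C e.proj →ₗ[ℝ] D.overE.Fiber e where
  toFun c := (D.exists_iota e c).choose
  map_add' c c' := by
    have h0 : AddRel (D.zeroE e) (D.zeroE e) (D.zeroE e) := by
      have := AddRel.mk (F := D.overE.Model) (V := D.overE.Fiber) e 0 0
      rwa [add_zero] at this
    exact (D.interchange _ _ _ _ _ _ _ _ _ (D.core_add _ _ _ (AddRel.mk e.proj c c')) h0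
      (D.exists_iota e c).choose_spec (D.exists_iota e c').choose_spec
      (D.exists_iota e (c + c')).choose_spec).eq
  map_smul' t c := by
    have h := D.scaleE_add t _ _ _ (D.exists_iota e c).choose_spec
    have h0 : scale t (D.zeroE e) = D.zeroE e :=
      congrArg (fun v => (⟨e, v⟩ : D.Total)) (smul_zero t)
    rw [← D.core_scale, scale_mk, h0, scale_mk] at h
    exact mk_inj (AddA.unique (D.exists_iota e (t • c)).choose_spec h)

theorem addA_iotaC (e : TotE) (c : C e.proj) :
    D.AddA (D.core ⟨e.proj, c⟩) (D.zeroE e) ⟨e, D.iotaC e c⟩ := (D.exists_iota e c).choose_spec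

theorem eq_iotaC {e : TotE} {c : C e.proj} {d : D.overE.Fiber e}
    (h : D.AddA (D.core ⟨e.proj, c⟩) (D.zeroE e) ⟨e, d⟩) : d = D.iotaC e c :=
  mk_inj (h.unique (D.addA_iotaC e c))

theorem pA_iotaC (e : TotE) (c : C e.proj) : D.pA e (D.iotaC e c) = 0 := by
  have h := (D.addA_iotaC e c).projA_eq
  rw [projA_mk, projA_core] at h
  exact mk_inj h

theorem core_injective (x : M) {c c' : C x} (h : D.core ⟨x, c⟩ = D.core ⟨x, c'⟩) : c = c' := by
  obtain ⟨k, -, hk⟩ := D.core_exists_unique x (D.core ⟨x, c⟩) (D.projE_core x c) (D.projA_core x c)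
  exact mk_inj ((hk ⟨x, c⟩ ⟨rfl, rfl⟩).trans (hk ⟨x, c'⟩ ⟨rfl, h.symm⟩).symm)

theorem iotaC_injective (e : TotE) : Function.Injective (D.iotaC e) := by
  intro c c' h
  have h1 := D.addA_iotaC e c
  rw [h] at h1
  exact D.core_injective _ (D.swap.injective (AddRel.cancel h1 (D.addA_iotaC e c')))

theorem exists_iotaC_eq (e : TotE) (d : D.overE.Fiber e) (h : D.pA e d = 0) :
    ∃ c, D.iotaC e c = d := by
  have h1 : D.projA (D.zeroE e) = D.projA ⟨e, d⟩ := by rw [projA_zeroE, projA_mk, h]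
  obtain ⟨r, hr⟩ := exists_addRel_sub (F := D.overA.Model) (V := D.overA.Fiber) h1
  obtain ⟨k, rfl⟩ := D.swap.surjective r
  have h2 : D.AddA k (D.zeroE e) ⟨e, d⟩ := hr
  have h3 : k.proj = ⟨e.proj, 0⟩ := by
    have h4 := AddRel.mk (F := FE) e.proj (0 : E e.proj) e.snd
    rw [zero_add] at h4
    exact AddRel.cancel h2.projE_eq h4
  have h5 : D.projA k = ⟨e.proj, 0⟩ := by
    rw [← h2.projA_eq, projA_mk, h]
  obtain ⟨⟨x, c⟩, ⟨rfl, h6⟩, -⟩ := D.core_exists_unique e.proj k h3 h5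
  rw [← h6] at h2
  exact ⟨c, (D.eq_iotaC h2).symm⟩

variable {EP : Type*} [NormedAddCommGroup EP] [NormedSpace ℝ EP]
  {HP : Type*} [TopologicalSpace HP] {J : ModelWithCorners ℝ EP HP}
  {P : Type*} [TopologicalSpace P] [ChartedSpace HP P]

variable {D} in
theorem AddA.contMDiffAt {f g k : P → D.Total} {p : P}
    (hf : ContMDiffAt J ((𝓘(ℝ, EM).prod 𝓘(ℝ, FE)).prod 𝓘(ℝ, D.overE.Model)) ∞ f p)
    (hg : ContMDiffAt J ((𝓘(ℝ, EM).prod 𝓘(ℝ, FE)).prod 𝓘(ℝ, D.overE.Model)) ∞ g p)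
    (h : ∀ q, D.AddA (f q) (g q) (k q)) :
    ContMDiffAt J ((𝓘(ℝ, EM).prod 𝓘(ℝ, FE)).prod 𝓘(ℝ, D.overE.Model)) ∞ k p := by
  have h1 := AddRel.contMDiffAt (D.swap.contMDiff.contMDiffAt.comp p hf)
    (D.swap.contMDiff.contMDiffAt.comp p hg) h
  refine (D.swap.symm.contMDiff.contMDiffAt.comp p h1).congr_of_eventuallyEq
    (Filter.Eventually.of_forall fun q => ?_)
  exact (D.swap.symm_apply_apply _).symm

theorem contMDiffAt_scaleA {f : P → D.Total} {c : P → ℝ} {p : P}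
    (hc : ContMDiffAt J 𝓘(ℝ, ℝ) ∞ c p)
    (hf : ContMDiffAt J ((𝓘(ℝ, EM).prod 𝓘(ℝ, FE)).prod 𝓘(ℝ, D.overE.Model)) ∞ f p) :
    ContMDiffAt J ((𝓘(ℝ, EM).prod 𝓘(ℝ, FE)).prod 𝓘(ℝ, D.overE.Model)) ∞
      (fun q => D.scaleA (c q) (f q)) p :=
  D.swap.symm.contMDiff.contMDiffAt.comp p
    (contMDiffAt_scale hc (D.swap.contMDiff.contMDiffAt.comp p hf))

theorem contMDiff_projA : ContMDiff ((𝓘(ℝ, EM).prod 𝓘(ℝ, FE)).prod 𝓘(ℝ, D.overE.Model))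
    (𝓘(ℝ, EM).prod 𝓘(ℝ, FA)) ∞ D.projA :=
  (contMDiff_proj D.overA.Fiber).comp D.swap.contMDiff

theorem contMDiff_zeroE : ContMDiff JE
    ((𝓘(ℝ, EM).prod 𝓘(ℝ, FE)).prod 𝓘(ℝ, D.overE.Model)) ∞ D.zeroE :=
  contMDiff_zeroSection ℝ D.overE.Fiber

theorem contMDiffAt_iotaC {e : P → TotE} {c : (p : P) → C (e p).proj} {p : P}
    (he : ContMDiffAt J JE ∞ e p)
    (hc : ContMDiffAt J (𝓘(ℝ, EM).prod 𝓘(ℝ, FC)) ∞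
      (fun q => (⟨(e q).proj, c q⟩ : TotalSpace FC C)) p) :
    ContMDiffAt J ((𝓘(ℝ, EM).prod 𝓘(ℝ, FE)).prod 𝓘(ℝ, D.overE.Model)) ∞
      (fun q => (⟨e q, D.iotaC (e q) (c q)⟩ : D.Total)) p :=
  AddA.contMDiffAt (D.contMDiff_core.contMDiffAt.comp p hc)
    (D.contMDiff_zeroE.contMDiffAt.comp p he) fun q => D.addA_iotaC (e q) (c q)

end DoubleVectorBundle

end

section

variable (EM FE E) in
/-- The projection `E → M`, as a smooth map. -/
def projM : C^∞⟮𝓘(ℝ, EM).prod 𝓘(ℝ, FE), TotE; JM, M⟯ :=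
  ⟨TotalSpace.proj, contMDiff_proj E⟩

namespace DoubleVectorBundle

variable {D : DoubleVectorBundle EM FA A FE E FC C}

namespace HorizontalLift

variable (h : HorizontalLift D)

theorem lift_congr {X Y : ΓA} {e : TotE}
    (hXY : X e.proj = Y e.proj) : h.lift X e = h.lift Y e :=
  (dualSystem EM FA A e.proj).eq_of_tensorial (fun X => h.lift X e)
    (fun X Y => by rw [h.lift_add]; rfl) (fun f X => h.lift_smul f X e) hXY

/-- The horizontal lift on fibres. -/
def hor (e : TotE) : A e.proj →ₗ[ℝ] D.overE.Fiber e where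
  toFun a := h.lift ((dualSystem EM FA A e.proj).extend a) e
  map_add' a b := by
    rw [← sec_add_apply, ← h.lift_add]
    refine h.lift_congr ?_
    rw [sec_add_apply]
    simp only [DualSystem.extend_apply]
  map_smul' t a := by
    have h1 := h.lift_smul (ContMDiffMap.const t) ((dualSystem EM FA A e.proj).extend a) e
    refine Eq.trans ?_ h1
    refine h.lift_congr ?_
    rw [smul_sec_apply]
    simp only [DualSystem.extend_apply]
    rfl

theorem lift_apply (X : ΓA) (e : TotE) :
    h.lift X e = h.hor e (X e.proj) :=
  h.lift_congr (DualSystem.extend_apply _ _).symm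

theorem pA_lift (X : ΓA) (e : TotE) :
    D.pA e (h.lift X e) = X e.proj := by
  have h1 := (h.isLinearOver X).projA_eq e
  rw [at_, projA_mk] at h1
  exact mk_inj h1

theorem pA_hor (e : TotE) (a : A e.proj) : D.pA e (h.hor e a) = a :=
  (h.pA_lift _ e).trans (DualSystem.extend_apply _ _)

theorem exists_kap (e : TotE) (d : D.overE.Fiber e) :
    ∃ c, d = h.hor e (D.pA e d) + D.iotaC e c := by
  obtain ⟨c, hc⟩ := D.exists_iotaC_eq e (d - h.hor e (D.pA e d)) (by rw [map_sub, pA_hor, sub_self])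
  exact ⟨c, by rw [hc]; abel⟩

/-- The core component with respect to a horizontal lift, as a function. -/
def kapFun (e : TotE) (d : D.overE.Fiber e) : C e.proj := (h.exists_kap e d).choose

theorem iotaC_kapFun (e : TotE) (d : D.overE.Fiber e) :
    D.iotaC e (h.kapFun e d) = d - h.hor e (D.pA e d) :=
  eq_sub_of_add_eq' (h.exists_kap e d).choose_spec.symm

/-- The core component with respect to a horizontal lift. -/
def kap (e : TotE) : D.overE.Fiber e →ₗ[ℝ] C e.proj where
  toFun d := h.kapFun e d
  map_add' d d' := D.iotaC_injective e (by
    rw [map_add]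
    simp only [iotaC_kapFun, map_add]
    abel)
  map_smul' t d := D.iotaC_injective e (by
    rw [map_smul]
    simp only [iotaC_kapFun, map_smul, smul_sub, RingHom.id_apply])

theorem decomp (e : TotE) (d : D.overE.Fiber e) :
    d = h.hor e (D.pA e d) + D.iotaC e (h.kap e d) := (h.exists_kap e d).choose_spec

theorem kap_iotaC (e : TotE) (c : C e.proj) : h.kap e (D.iotaC e c) = c :=
  D.iotaC_injective e (by
    have := h.decomp e (D.iotaC e c)
    rw [pA_iotaC, map_zero, zero_add] at this
    exact this.symm)

theorem kap_hor (e : TotE) (a : A e.proj) : h.kap e (h.hor e a) = 0 :=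
  D.iotaC_injective e (by
    have := h.decomp e (h.hor e a)
    rw [pA_hor] at this
    rw [map_zero]
    exact left_eq_add.mp this)

variable {EP : Type*} [NormedAddCommGroup EP] [NormedSpace ℝ EP]
  {HP : Type*} [TopologicalSpace HP] {J : ModelWithCorners ℝ EP HP}
  {P : Type*} [TopologicalSpace P] [ChartedSpace HP P]

theorem contMDiffAt_hor {e : P → TotE} {a : (p : P) → A (e p).proj} {p : P}
    (he : ContMDiffAt J JE ∞ e p)
    (ha : ContMDiffAt J (𝓘(ℝ, EM).prod 𝓘(ℝ, FA)) ∞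
      (fun q => (⟨(e q).proj, a q⟩ : TotalSpace FA A)) p) :
    ContMDiffAt J ((𝓘(ℝ, EM).prod 𝓘(ℝ, FE)).prod 𝓘(ℝ, D.overE.Model)) ∞
      (fun q => (⟨e q, h.hor (e q) (a q)⟩ : D.Total)) p := by
  let S := dualSystem EM FA A (e p).proj
  have h1 : ContMDiffAt J ((𝓘(ℝ, EM).prod 𝓘(ℝ, FE)).prod 𝓘(ℝ, D.overE.Model)) ∞
      (fun q => (⟨e q, ∑ i, S.l i _ (a q) • h.lift (S.b i) (e q)⟩ : D.Total)) p :=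
    along_sum Finset.univ he fun i _ => along_smul ((S.smooth i).contMDiffAt.comp p ha)
      ((h.lift (S.b i)).contMDiff.contMDiffAt.comp p he)
  refine h1.congr_of_eventuallyEq ?_
  have h2 : ContinuousAt (fun q => (e q).proj) p :=
    ((contMDiff_proj E (IB := JM) (n := ∞)).contMDiffAt.comp p he).continuousAt
  filter_upwards [h2.eventually S.eventually_eq] with q hq
  conv_lhs => rw [hq (a q)]
  rw [map_sum]
  simp only [map_smul, lift_apply]

theorem contMDiffAt_kap {e : P → TotE} {d : (p : P) → D.overE.Fiber (e p)} {p : P}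
    (hd : ContMDiffAt J ((𝓘(ℝ, EM).prod 𝓘(ℝ, FE)).prod 𝓘(ℝ, D.overE.Model)) ∞
      (fun q => (⟨e q, d q⟩ : D.Total)) p) :
    ContMDiffAt J (𝓘(ℝ, EM).prod 𝓘(ℝ, FC)) ∞
      (fun q => (⟨(e q).proj, h.kap (e q) (d q)⟩ : TotalSpace FC C)) p := by
  have he : ContMDiffAt J JE ∞ e p :=
    (contMDiff_proj D.overE.Fiber).contMDiffAt.comp p hd
  let W := pullProd FA A FC C (projM EM FE E)
  let T : (e : TotE) → W.Fiber e →ₗ[ℝ] D.overE.Fiber (id e) :=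
    fun e => (h.hor e).coprod (D.iotaC e)
  have hT : ContMDiff ((𝓘(ℝ, EM).prod 𝓘(ℝ, FE)).prod 𝓘(ℝ, W.Model))
      ((𝓘(ℝ, EM).prod 𝓘(ℝ, FE)).prod 𝓘(ℝ, D.overE.Model)) ∞
      (fun v : TotalSpace W.Model W.Fiber => (⟨id v.proj, T v.proj v.snd⟩ : D.Total)) := by
    intro v
    have h1 := (contMDiffAt_pullProd_iff (F := FA) (V := A) (F' := FC) (V' := C) (projM EM FE E)
      (b := fun q : TotalSpace W.Model W.Fiber => q.proj) (s := fun q => q.snd.1)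
      (t := fun q => q.snd.2) (p := v)).mp (contMDiffAt_id (n := ∞))
    exact along_add (h.contMDiffAt_hor h1.1 h1.2.1) (D.contMDiffAt_iotaC h1.1 h1.2.2)
  have hsurj : ∀ e, Function.Surjective (T e) := fun e d =>
    ⟨(D.pA e d, h.kap e d), (h.decomp e d).symm⟩
  have hinj : ∀ e, Function.Injective (T e) := by
    intro e x y hxy
    have key : ∀ (a a' : A e.proj) (c c' : C e.proj),
        h.hor e a + D.iotaC e c = h.hor e a' + D.iotaC e c' → a = a' ∧ c = c' := by
      intro a a' c c' hac
      have h1 := congrArg (D.pA e) hac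
      have h2 := congrArg (h.kap e) hac
      simp only [map_add, pA_hor, pA_iotaC, add_zero, kap_hor, kap_iotaC, zero_add] at h1 h2
      exact ⟨h1, h2⟩
    have h3 := key x.1 y.1 x.2 y.2 hxy
    exact Prod.ext h3.1 h3.2
  obtain ⟨s, U, hUo, hpU, hs, hsm⟩ := exists_local_rightInverse
    (V₁ := W.Fiber) (F₁ := W.Model) (f := id) contMDiff_id T hT (e p) (hsurj (e p))
  have h1 := hsm e d p hpU he hd
  have h2 := ((contMDiffAt_pullProd_iff (F := FA) (V := A) (F' := FC) (V' := C) (projM EM FE E)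
    (b := e) (s := fun q => (s (e q) (d q)).1) (t := fun q => (s (e q) (d q)).2)).mp h1).2.2
  refine h2.congr_of_eventuallyEq ?_
  filter_upwards [he.continuousAt.eventually (hUo.mem_nhds hpU)] with q hq
  have h3 : s (e q) (d q) = (D.pA (e q) (d q), h.kap (e q) (d q)) := hinj _ ((hs _ hq _).trans
    (h.decomp _ _))
  rw [h3]
  rfl

end HorizontalLift

end DoubleVectorBundle

end

section

namespace DoubleVectorBundle

variable (D : DoubleVectorBundle EM FA A FE E FC C)

theorem exists_projE (a : TotalSpace FA A) (d : D.overA.Fiber a) :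
    ∃ e : E a.proj, (D.swap.symm ⟨a, d⟩).proj = ⟨a.proj, e⟩ := by
  have h : (D.swap.symm ⟨a, d⟩).proj.proj = a.proj := by
    rw [← D.proj_comm, D.swap.apply_symm_apply]
  revert h
  generalize (D.swap.symm ⟨a, d⟩).proj = z
  intro h
  obtain ⟨x, e⟩ := z
  cases h
  exact ⟨e, rfl⟩

/-- The projection `D → E` on the fibres of `D → A`. -/
def pE (a : TotalSpace FA A) : D.overA.Fiber a →ₗ[ℝ] E a.proj where
  toFun d := (D.exists_projE a d).choose
  map_add' d d' := by
    have h := D.projE_add (D.swap.symm ⟨a, d⟩) (D.swap.symm ⟨a, d'⟩) (D.swap.symm ⟨a, d + d'⟩) (by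
      simp only [D.swap.apply_symm_apply]
      exact AddRel.mk a d d')
    rw [(D.exists_projE a d).choose_spec, (D.exists_projE a d').choose_spec,
      (D.exists_projE a (d + d')).choose_spec] at h
    exact h.eq
  map_smul' t d := by
    have h := D.projE_scale t (D.swap.symm ⟨a, d⟩)
    rw [D.swap.apply_symm_apply, scale_mk, (D.exists_projE a d).choose_spec,
      (D.exists_projE a (t • d)).choose_spec] at h
    exact mk_inj h

theorem projE_mk (a : TotalSpace FA A) (d : D.overA.Fiber a) :
    (D.swap.symm ⟨a, d⟩).proj = ⟨a.proj, D.pE a d⟩ := (D.exists_projE a d).choose_spec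

theorem contMDiff_pA : ContMDiff ((𝓘(ℝ, EM).prod 𝓘(ℝ, FE)).prod 𝓘(ℝ, D.overE.Model))
    (𝓘(ℝ, EM).prod 𝓘(ℝ, FA)) ∞
    (fun v : D.Total => (⟨v.proj.proj, D.pA v.proj v.snd⟩ : TotalSpace FA A)) :=
  D.contMDiff_projA.congr fun v => (D.projA_mk v.proj v.snd).symm

theorem projA_scaleA (t : ℝ) (d : D.Total) : D.projA (D.scaleA t d) = D.projA d := by
  rw [scaleA, projA, D.swap.apply_symm_apply]
  rfl

theorem pA_surjective (e : TotE) : Function.Surjective (D.pA e) := by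
  have hzero : ∀ x : M, Function.Surjective (D.pA ⟨x, 0⟩) := by
    intro x a
    have h1 := D.projE_mk ⟨x, a⟩ 0
    rw [map_zero] at h1
    obtain ⟨v, hv⟩ := D.exists_mk h1
    refine ⟨v, ?_⟩
    have h2 := D.projA_mk _ v
    rw [← hv, projA, D.swap.apply_symm_apply] at h2
    exact (mk_inj h2).symm
  obtain ⟨s, U, hUo, hU, hs, -⟩ := exists_local_rightInverse.{0, 0, 0, _, _, _, _, _, _, _, _, _, _}
    (contMDiff_proj E) D.pA D.contMDiff_pA
    ⟨e.proj, 0⟩ (hzero e.proj)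
  have hc : ContinuousAt (fun t : ℝ => scale t e) 0 :=
    (contMDiffAt_scale (J := 𝓘(ℝ, ℝ)) (I := JM) (c := id) (f := fun _ => e) contMDiffAt_id
      contMDiffAt_const).continuousAt
  have h0 : ∀ᶠ t in nhds (0 : ℝ), scale t e ∈ U := by
    refine hc.eventually (hUo.mem_nhds ?_)
    change scale 0 e ∈ U
    rw [scale_zero_eq]
    exact hU
  obtain ⟨t, ht0, htU⟩ : ∃ t : ℝ, t ≠ 0 ∧ scale t e ∈ U := by
    obtain ⟨r, hr, hball⟩ := Metric.eventually_nhds_iff.mp h0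
    refine ⟨r / 2, by positivity, hball ?_⟩
    rw [Real.dist_eq, sub_zero, abs_of_pos (by positivity)]
    linarith
  intro a
  have h1 := D.projE_scale t⁻¹ ⟨scale t e, s (scale t e) a⟩
  have h2 : scale t⁻¹ (scale t e) = e := by
    rw [scale, scale, smul_smul, inv_mul_cancel₀ ht0, one_smul]
  rw [h2] at h1
  obtain ⟨v, hv⟩ := D.exists_mk h1
  refine ⟨v, ?_⟩
  have h3 := D.projA_scaleA t⁻¹ ⟨scale t e, s (scale t e) a⟩
  have h4 : D.pA (scale t e) (s (scale t e) a) = a := hs _ htU a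
  rw [projA_mk D (scale t e), h4] at h3
  have h5 := D.projA_mk e v
  rw [← hv] at h5
  exact (mk_inj (h3.symm.trans h5)).symm

/-- A horizontal lift over an open set. -/
structure LocalLift (x₀ : M) where
  W : Set M
  isOpen : IsOpen W
  mem : x₀ ∈ W
  k : (e : TotE) → A e.proj → D.overE.Fiber e
  pA_k : ∀ e, e.proj ∈ W → ∀ a, D.pA e (k e a) = a
  k_add : ∀ e, e.proj ∈ W → ∀ a b, k e (a + b) = k e a + k e b
  k_smul : ∀ e, e.proj ∈ W → ∀ (t : ℝ) a, k e (t • a) = t • k e a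
  add : ∀ x ∈ W, ∀ (e₁ e₂ : E x) (a : A x),
    D.AddA ⟨⟨x, e₁⟩, k ⟨x, e₁⟩ a⟩ ⟨⟨x, e₂⟩, k ⟨x, e₂⟩ a⟩ ⟨⟨x, e₁ + e₂⟩, k ⟨x, e₁ + e₂⟩ a⟩
  scale : ∀ x ∈ W, ∀ (t : ℝ) (e : E x) (a : A x),
    (⟨⟨x, t • e⟩, k ⟨x, t • e⟩ a⟩ : D.Total) = D.scaleA t ⟨⟨x, e⟩, k ⟨x, e⟩ a⟩
  smooth : ∀ (X : ΓA) e, e.proj ∈ W →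
    ContMDiffAt JE ((𝓘(ℝ, EM).prod 𝓘(ℝ, FE)).prod 𝓘(ℝ, D.overE.Model)) ∞
      (fun e => (⟨e, k e (X e.proj)⟩ : D.Total)) e

theorem nonempty_localLift (x₀ : M) : Nonempty (D.LocalLift x₀) := by
  let S := dualSystem EM FE E x₀
  choose s U hUo hU hs hsm using fun j : Fin S.n =>
    exists_local_rightInverse (contMDiff_proj E) D.pA D.contMDiff_pA ⟨x₀, S.b j x₀⟩
      (D.pA_surjective _)
  have hN : ∀ᶠ x in nhds x₀, (∀ j, (⟨x, S.b j x⟩ : TotE) ∈ U j) ∧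
      ∀ v : E x, v = ∑ i, S.l i x v • S.b i x := by
    refine (Filter.eventually_all.mpr fun j => ?_).and S.eventually_eq
    exact (S.b j).contMDiff.continuous.continuousAt.eventually ((hUo j).mem_nhds (hU j))
  obtain ⟨W, hW, hWo, hxW⟩ := eventually_nhds_iff.mp hN
  -- the chosen elements of `D`, as elements of the fibres of `D → A`
  have hw : ∀ (j : Fin S.n) (x : M) (a : A x), ∃ w : D.overA.Fiber ⟨x, a⟩, x ∈ W →
      D.swap ⟨⟨x, S.b j x⟩, s j ⟨x, S.b j x⟩ a⟩ = ⟨⟨x, a⟩, w⟩ := by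
    intro j x a
    by_cases hx : x ∈ W
    · have h1 := D.projA_mk ⟨x, S.b j x⟩ (s j ⟨x, S.b j x⟩ a)
      have h2 : D.pA ⟨x, S.b j x⟩ (s j ⟨x, S.b j x⟩ a) = a := hs j _ ((hW x hx).1 j) a
      rw [h2, projA] at h1
      revert h1
      generalize D.swap ⟨⟨x, S.b j x⟩, s j ⟨x, S.b j x⟩ a⟩ = z
      intro h1
      obtain ⟨y, w⟩ := z
      change y = _ at h1
      subst h1
      exact ⟨w, fun _ => rfl⟩
    · exact ⟨0, fun h => absurd h hx⟩
  choose w hw using hw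
  have hpE : ∀ j x (a : A x), x ∈ W → D.pE ⟨x, a⟩ (w j x a) = S.b j x := by
    intro j x a hx
    have h1 := D.projE_mk ⟨x, a⟩ (w j x a)
    rw [← hw j x a hx, D.swap.symm_apply_apply] at h1
    exact (mk_inj h1).symm
  have hk : ∀ (e : TotE) (a : A e.proj), ∃ d : D.overE.Fiber e, e.proj ∈ W →
      D.swap ⟨e, d⟩ = ⟨⟨e.proj, a⟩, ∑ j, S.l j e.proj e.snd • w j e.proj a⟩ := by
    intro e a
    by_cases hx : e.proj ∈ W
    · have h1 := D.projE_mk ⟨e.proj, a⟩ (∑ j, S.l j e.proj e.snd • w j e.proj a)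
      have h2 : D.pE ⟨e.proj, a⟩ (∑ j, S.l j e.proj e.snd • w j e.proj a) = e.snd := by
        rw [map_sum, (hW _ hx).2 e.snd]
        refine Finset.sum_congr rfl fun j _ => ?_
        rw [map_smul, hpE j _ a hx, ← (hW _ hx).2 e.snd]
      rw [h2] at h1
      obtain ⟨d, hd⟩ := D.exists_mk h1
      exact ⟨d, fun _ => by rw [← hd, D.swap.apply_symm_apply]⟩
    · exact ⟨0, fun h => absurd h hx⟩
  choose k hk using hk
  -- partial sums
  let T : (e : TotE) → (a : A e.proj) → Finset (Fin S.n) → D.Total := fun e a Q =>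
    D.swap.symm ⟨⟨e.proj, a⟩, ∑ j ∈ Q, S.l j e.proj e.snd • w j e.proj a⟩
  have hT : ∀ e (a : A e.proj), e.proj ∈ W → T e a Finset.univ = ⟨e, k e a⟩ := by
    intro e a hx
    rw [← D.swap.symm_apply_apply ⟨e, k e a⟩, hk e a hx]
  have hTins : ∀ e (a : A e.proj), e.proj ∈ W → ∀ j Q, j ∉ Q → D.AddA (D.scaleA (S.l j e.proj e.snd)
      ⟨⟨e.proj, S.b j e.proj⟩, s j ⟨e.proj, S.b j e.proj⟩ a⟩) (T e a Q) (T e a (insert j Q)) := by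
    intro e a hx j Q hj
    rw [AddA, scaleA, D.swap.apply_symm_apply, D.swap.apply_symm_apply, D.swap.apply_symm_apply,
      hw j _ a hx, Finset.sum_insert hj, scale_mk]
    exact AddRel.mk _ _ _
  have hTadd : ∀ e (a b : A e.proj), e.proj ∈ W → ∀ Q, AddRel (T e a Q) (T e b Q) (T e (a + b) Q) := by
    intro e a b hx Q
    classical
    induction Q using Finset.induction_on with
    | empty =>
      have h0 : ∀ c : A e.proj, T e c ∅ = D.scaleA 0 ⟨e, k e c⟩ := by
        intro c
        change D.swap.symm ⟨⟨e.proj, c⟩, ∑ j ∈ ∅, _⟩ = D.swap.symm _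
        rw [hk e c hx, scale_mk, zero_smul, Finset.sum_empty]
      have h1 : ∀ c : A e.proj, ∃ v : D.overE.Fiber ⟨e.proj, 0⟩, T e c ∅ = ⟨⟨e.proj, 0⟩, v⟩ := by
        intro c
        refine D.exists_mk ?_
        have := D.projE_mk ⟨e.proj, c⟩ 0
        rw [map_zero] at this
        change (D.swap.symm ⟨⟨e.proj, c⟩, ∑ j ∈ ∅, _⟩).proj = _
        rw [Finset.sum_empty]
        exact this
      have h2 : ∀ c : A e.proj, D.AddA (T e c ∅) (T e c ∅) (T e c ∅) := by
        intro c
        change AddRel (D.swap (D.swap.symm _)) (D.swap (D.swap.symm _)) (D.swap (D.swap.symm _))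
        rw [D.swap.apply_symm_apply, Finset.sum_empty]
        have := AddRel.mk (F := D.overA.Model) (V := D.overA.Fiber) ⟨e.proj, c⟩ 0 0
        rwa [add_zero] at this
      obtain ⟨va, ha⟩ := h1 a
      obtain ⟨vb, hb⟩ := h1 b
      -- the sum is a zero vector of `D → A`
      have h3 : AddRel (T e a ∅) (T e b ∅) ⟨⟨e.proj, 0⟩, va + vb⟩ := by
        rw [ha, hb]
        exact AddRel.mk _ _ _
      have h4 := D.scaleA_add 0 _ _ _ h3
      have h5 : ∀ c : A e.proj, D.swap.symm (VBA.scale 0 (D.swap (T e c ∅))) = T e c ∅ := by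
        intro c
        change D.swap.symm (VBA.scale 0 (D.swap (D.swap.symm _))) = D.swap.symm _
        rw [D.swap.apply_symm_apply, scale_mk, zero_smul, Finset.sum_empty]
      rw [h5, h5] at h4
      have h6 : D.swap.symm (VBA.scale 0 (D.swap (⟨⟨e.proj, 0⟩, va + vb⟩ : D.Total))) =
          T e (a + b) ∅ := by
        have h7 := D.projA_add _ _ _ h3
        have h8 : ∀ c : A e.proj, (D.swap (T e c ∅)).proj = ⟨e.proj, c⟩ := by
          intro c
          change (D.swap (D.swap.symm _)).proj = _
          rw [D.swap.apply_symm_apply]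
        rw [h8, h8] at h7
        have h9 := h7.unique (AddRel.mk (F := FA) e.proj a b)
        change _ = D.swap.symm _
        rw [scale_zero_eq, h9, Finset.sum_empty]
      rwa [h6] at h4
    | insert j Q hj ih =>
      have hd : AddRel (⟨⟨e.proj, S.b j e.proj⟩, s j ⟨e.proj, S.b j e.proj⟩ a⟩ : D.Total)
          ⟨⟨e.proj, S.b j e.proj⟩, s j ⟨e.proj, S.b j e.proj⟩ b⟩
          ⟨⟨e.proj, S.b j e.proj⟩, s j ⟨e.proj, S.b j e.proj⟩ (a + b)⟩ := by
        rw [(s j ⟨e.proj, S.b j e.proj⟩).map_add a b]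
        exact AddRel.mk _ _ _
      exact D.interchange _ _ _ _ _ _ _ _ _ (D.scaleA_add (S.l j e.proj e.snd) _ _ _ hd) ih
        (hTins e a hx j Q hj) (hTins e b hx j Q hj) (hTins e (a + b) hx j Q hj)
  have hTscale : ∀ (t : ℝ) e (a : A e.proj), e.proj ∈ W → ∀ Q, VBA.scale t (T e a Q) = T e (t • a) Q := by
    intro t e a hx Q
    classical
    induction Q using Finset.induction_on with
    | empty =>
      have h0 : ∀ c : A e.proj, T e c ∅ = D.swap.symm ⟨⟨e.proj, c⟩, 0⟩ := by
        intro c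
        change D.swap.symm ⟨⟨e.proj, c⟩, ∑ j ∈ ∅, _⟩ = _
        rw [Finset.sum_empty]
      have h1 : T e a ∅ = D.swap.symm (VBA.scale 0 (D.swap ⟨e, k e a⟩)) := by
        rw [hk e a hx, scale_mk, zero_smul, h0]
      rw [h1, ← D.scale_comm, scale_zero_eq, D.projA_scale, hk e a hx, h0]
      rfl
    | insert j Q hj ih =>
      have h1 := D.scaleE_add t _ _ _ (hTins e a hx j Q hj)
      change D.AddA _ _ _ at h1
      have h2 : VBA.scale t (⟨⟨e.proj, S.b j e.proj⟩, s j ⟨e.proj, S.b j e.proj⟩ a⟩ : D.Total) =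
          ⟨⟨e.proj, S.b j e.proj⟩, s j ⟨e.proj, S.b j e.proj⟩ (t • a)⟩ :=
        congrArg (fun v => (⟨⟨e.proj, S.b j e.proj⟩, v⟩ : D.Total))
          (_root_.map_smul (s j ⟨e.proj, S.b j e.proj⟩) t a).symm
      rw [ih, scaleA, ← D.scale_comm, h2] at h1
      exact AddA.unique h1 (hTins e (t • a) hx j Q hj)
  have hEadd : ∀ x ∈ W, ∀ (e₁ e₂ : E x) (a : A x),
      D.AddA ⟨⟨x, e₁⟩, k ⟨x, e₁⟩ a⟩ ⟨⟨x, e₂⟩, k ⟨x, e₂⟩ a⟩ ⟨⟨x, e₁ + e₂⟩, k ⟨x, e₁ + e₂⟩ a⟩ := by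
    intro x hx e₁ e₂ a
    rw [AddA, hk ⟨x, e₁⟩ a hx, hk ⟨x, e₂⟩ a hx, hk ⟨x, e₁ + e₂⟩ a hx]
    have h1 : ∑ j, S.l j x (e₁ + e₂) • w j x a = ∑ j, S.l j x e₁ • w j x a +
        ∑ j, S.l j x e₂ • w j x a := by
      simp only [_root_.map_add, add_smul, Finset.sum_add_distrib]
    change AddRel _ _ ⟨_, ∑ j, S.l j x (e₁ + e₂) • w j x a⟩
    rw [h1]
    exact AddRel.mk _ _ _
  refine ⟨⟨W, hWo, hxW, k, ?_, ?_, ?_, hEadd, ?_, ?_⟩⟩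
  · intro e hx a
    have h1 := D.projA_mk e (k e a)
    rw [projA, hk e a hx] at h1
    exact (mk_inj h1).symm
  · intro e hx a b
    have h1 := hTadd e a b hx Finset.univ
    rw [hT e a hx, hT e b hx, hT e (a + b) hx] at h1
    exact h1.eq
  · intro e hx t a
    have h1 := hTscale t e a hx Finset.univ
    rw [hT e a hx, hT e (t • a) hx] at h1
    exact (mk_inj h1).symm
  · intro x hx t e a
    refine D.swap.injective ?_
    change D.swap _ = D.swap _
    rw [hk ⟨x, t • e⟩ a hx, scaleA, D.swap.apply_symm_apply, hk ⟨x, e⟩ a hx, scale_mk,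
      Finset.smul_sum]
    simp only [_root_.map_smul, smul_smul, smul_eq_mul]
  · intro X e hx
    have hp : ContMDiffAt JE JM ∞ (TotalSpace.proj : TotE → M) e :=
      contMDiffAt_proj E
    have hnear : ∀ᶠ e' in nhds e, e'.proj ∈ W := hp.continuousAt.eventually (hWo.mem_nhds hx)
    have hXe : ContMDiffAt JE (𝓘(ℝ, EM).prod 𝓘(ℝ, FA)) ∞
        (fun e' : TotE => (⟨e'.proj, X e'.proj⟩ : TotalSpace FA A)) e :=
      X.contMDiff.contMDiffAt.comp e hp
    have h1 : ∀ j, ContMDiffAt JE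
        ((𝓘(ℝ, EM).prod 𝓘(ℝ, FA)).prod 𝓘(ℝ, D.overA.Model)) ∞
        (fun e' : TotE => (⟨⟨e'.proj, X e'.proj⟩, w j e'.proj (X e'.proj)⟩ :
          TotalSpace D.overA.Model D.overA.Fiber)) e := by
      intro j
      have h2 := hsm j (fun e' : TotE => (⟨e'.proj, S.b j e'.proj⟩ : TotE))
        (fun e' => X e'.proj) e ((hW _ hx).1 j) ((S.b j).contMDiff.contMDiffAt.comp e hp) hXe
      refine (D.swap.contMDiff.contMDiffAt.comp e h2).congr_of_eventuallyEq ?_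
      filter_upwards [hnear] with e' he'
      exact (hw j e'.proj (X e'.proj) he').symm
    have h3 := along_sum Finset.univ hXe fun j _ => along_smul (S.smooth j).contMDiffAt (h1 j)
    refine (D.swap.symm.contMDiff.contMDiffAt.comp e h3).congr_of_eventuallyEq ?_
    filter_upwards [hnear] with e' he'
    exact (hT e' (X e'.proj) he').symm

end DoubleVectorBundle

end

section

namespace DoubleVectorBundle

variable {D : DoubleVectorBundle EM FA A FE E FC C}

theorem AddA.add {e₁ e₂ e₃ : TotE} {d₁ d₁' : D.overE.Fiber e₁}
    {d₂ d₂' : D.overE.Fiber e₂} {d₃ d₃' : D.overE.Fiber e₃}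
    (h : D.AddA ⟨e₁, d₁⟩ ⟨e₂, d₂⟩ ⟨e₃, d₃⟩) (h' : D.AddA ⟨e₁, d₁'⟩ ⟨e₂, d₂'⟩ ⟨e₃, d₃'⟩) :
    D.AddA ⟨e₁, d₁ + d₁'⟩ ⟨e₂, d₂ + d₂'⟩ ⟨e₃, d₃ + d₃'⟩ := by
  have h1 := D.projA_add _ _ _ (AddRel.mk (F := D.overE.Model) e₁ d₁ d₁')
  have h2 := D.projA_add _ _ _ (AddRel.mk (F := D.overE.Model) e₂ d₂ d₂')
  have h3 : D.projA ⟨e₁, d₁⟩ = D.projA ⟨e₂, d₂⟩ := by rw [← h.projA_eq, ← h.symm.projA_eq]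
  have h4 : D.projA ⟨e₁, d₁'⟩ = D.projA ⟨e₂, d₂'⟩ := by rw [← h'.projA_eq, ← h'.symm.projA_eq]
  have h5 : D.projA ⟨e₁, d₁ + d₁'⟩ = D.projA ⟨e₂, d₂ + d₂'⟩ := by
    change AddRel (D.projA _) (D.projA _) _ at h2
    rw [← h3, ← h4] at h2
    exact h1.unique h2
  obtain ⟨d, hd⟩ := D.exists_addA h5
  have h6 := D.interchange _ _ _ _ _ _ _ _ _ (AddRel.mk (F := D.overE.Model) e₁ d₁ d₁')
    (AddRel.mk (F := D.overE.Model) e₂ d₂ d₂') h h' hd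
  rwa [h6.unique (AddRel.mk (F := D.overE.Model) e₃ d₃ d₃')] at hd

theorem AddA.smul {e₁ e₂ e₃ : TotE} {d₁ : D.overE.Fiber e₁}
    {d₂ : D.overE.Fiber e₂} {d₃ : D.overE.Fiber e₃}
    (h : D.AddA ⟨e₁, d₁⟩ ⟨e₂, d₂⟩ ⟨e₃, d₃⟩) (t : ℝ) :
    D.AddA ⟨e₁, t • d₁⟩ ⟨e₂, t • d₂⟩ ⟨e₃, t • d₃⟩ :=
  D.scaleE_add t _ _ _ h

variable (D) in
theorem addA_zero (x : M) (e₁ e₂ : E x) :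
    D.AddA ⟨⟨x, e₁⟩, 0⟩ ⟨⟨x, e₂⟩, 0⟩ ⟨⟨x, e₁ + e₂⟩, 0⟩ := by
  obtain ⟨d, hd⟩ := D.exists_addA
    ((D.projA_zeroE ⟨x, e₁⟩).trans (D.projA_zeroE ⟨x, e₂⟩).symm)
  have h1 := hd.projE_eq.unique (AddRel.mk (F := FE) x e₁ e₂)
  obtain ⟨v, rfl⟩ := D.exists_mk h1
  have h2 := AddA.smul hd 0
  simpa only [zero_smul] using h2

theorem AddA.sum {ι : Type*} (T : Finset ι) {x : M} {e₁ e₂ : E x}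
    {d₁ : ι → D.overE.Fiber ⟨x, e₁⟩} {d₂ : ι → D.overE.Fiber ⟨x, e₂⟩}
    {d₃ : ι → D.overE.Fiber ⟨x, e₁ + e₂⟩}
    (h : ∀ i ∈ T, D.AddA ⟨_, d₁ i⟩ ⟨_, d₂ i⟩ ⟨_, d₃ i⟩) :
    D.AddA ⟨_, ∑ i ∈ T, d₁ i⟩ ⟨_, ∑ i ∈ T, d₂ i⟩ ⟨_, ∑ i ∈ T, d₃ i⟩ := by
  classical
  induction T using Finset.induction_on with
  | empty => simpa only [Finset.sum_empty] using D.addA_zero x e₁ e₂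
  | insert i T hi ih =>
    simp only [Finset.sum_insert hi]
    exact (h i (Finset.mem_insert_self i T)).add
      (ih fun j hj => h j (Finset.mem_insert_of_mem hj))

variable (D) in
theorem exists_mulA (t : ℝ) (e : TotE) (d : D.overE.Fiber e) :
    ∃ v : D.overE.Fiber (VBA.scale t e), D.scaleA t ⟨e, d⟩ = ⟨VBA.scale t e, v⟩ :=
  D.exists_mk (D.projE_scale t ⟨e, d⟩)

variable (D) in
/-- Scalar multiplication in the fibres of `D → A`, on the fibres of `D → E`. -/
def mulA (t : ℝ) (e : TotE) : D.overE.Fiber e →ₗ[ℝ] D.overE.Fiber (VBA.scale t e) where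
  toFun d := (D.exists_mulA t e d).choose
  map_add' d d' := by
    have h := D.scaleA_add t ⟨e, d⟩ ⟨e, d'⟩ ⟨e, d + d'⟩ (AddRel.mk e d d')
    change AddRel (D.scaleA t _) (D.scaleA t _) (D.scaleA t _) at h
    rw [(D.exists_mulA t e d).choose_spec, (D.exists_mulA t e d').choose_spec,
      (D.exists_mulA t e (d + d')).choose_spec] at h
    exact h.eq
  map_smul' s d := by
    have h := D.scale_comm t s ⟨e, d⟩
    change D.scaleA t ⟨e, s • d⟩ = VBA.scale s (D.scaleA t ⟨e, d⟩) at h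
    rw [(D.exists_mulA t e d).choose_spec, (D.exists_mulA t e (s • d)).choose_spec] at h
    exact mk_inj h

theorem scaleA_mk (t : ℝ) (e : TotE) (d : D.overE.Fiber e) :
    D.scaleA t ⟨e, d⟩ = ⟨VBA.scale t e, D.mulA t e d⟩ := (D.exists_mulA t e d).choose_spec

theorem scaleA_eq_iff {t : ℝ} {e : TotE} {d : D.overE.Fiber e}
    {d' : D.overE.Fiber (VBA.scale t e)} :
    (⟨VBA.scale t e, d'⟩ : D.Total) = D.scaleA t ⟨e, d⟩ ↔ d' = D.mulA t e d := by
  rw [scaleA_mk]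
  exact ⟨mk_inj, fun h => by rw [h]⟩

theorem isLinearOver_iff {X : D.SectionsE} {X₀ : ΓA} :
    IsLinearOver X X₀ ↔ (∀ e, D.pA e (X e) = X₀ e.proj) ∧
      (∀ (x : M) (e₁ e₂ : E x), D.AddA (at_ X ⟨x, e₁⟩) (at_ X ⟨x, e₂⟩) (at_ X ⟨x, e₁ + e₂⟩)) ∧
      ∀ (t : ℝ) e, X (VBA.scale t e) = D.mulA t e (X e) := by
  constructor
  · rintro ⟨h1, h2, h3⟩
    refine ⟨fun e => ?_, fun x e₁ e₂ => h2 _ _ _ (AddRel.mk x e₁ e₂), fun t e => ?_⟩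
    · have h4 := h1 e
      rw [at_, projA_mk] at h4
      exact mk_inj h4
    · exact scaleA_eq_iff.mp (h3 t e)
  · rintro ⟨h1, h2, h3⟩
    refine ⟨fun e => ?_, ?_, fun t e => scaleA_eq_iff.mpr (h3 t e)⟩
    · rw [at_, projA_mk, h1]
    · rintro _ _ _ ⟨x, a, b, rfl, rfl, rfl⟩
      exact h2 x a b

theorem IsLinearOver.sec_add {X Y : D.SectionsE} {X₀ Y₀ : ΓA}
    (hX : IsLinearOver X X₀) (hY : IsLinearOver Y Y₀) : IsLinearOver (X + Y) (X₀ + Y₀) := by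
  rw [isLinearOver_iff] at hX hY ⊢
  refine ⟨fun e => ?_, fun x e₁ e₂ => (hX.2.1 x e₁ e₂).add (hY.2.1 x e₁ e₂), fun t e => ?_⟩
  · rw [sec_add_apply, sec_add_apply, map_add, hX.1, hY.1]
  · rw [sec_add_apply, sec_add_apply, map_add, hX.2.2, hY.2.2]

theorem IsLinearOver.neg {X : D.SectionsE} {X₀ : ΓA}
    (hX : IsLinearOver X X₀) : IsLinearOver (-X) (-X₀) := by
  rw [isLinearOver_iff] at hX ⊢
  refine ⟨fun e => ?_, fun x e₁ e₂ => ?_, fun t e => ?_⟩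
  · rw [sec_neg_apply, sec_neg_apply, map_neg, hX.1]
  · have h1 := (hX.2.1 x e₁ e₂).smul (-1)
    simp only [neg_smul, one_smul] at h1
    exact h1
  · rw [sec_neg_apply, sec_neg_apply, map_neg, hX.2.2]

theorem IsLinearOver.sub {X Y : D.SectionsE} {X₀ Y₀ : ΓA}
    (hX : IsLinearOver X X₀) (hY : IsLinearOver Y Y₀) : IsLinearOver (X - Y) (X₀ - Y₀) := by
  rw [sub_eq_add_neg, sub_eq_add_neg]
  exact hX.sec_add hY.neg

/-- Every double vector bundle over a σ-compact base has a horizontal lift. -/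
theorem nonempty_horizontalLift [SigmaCompactSpace M]
    (D : DoubleVectorBundle EM FA A FE E FC C) : Nonempty (HorizontalLift D) := by
  have hL : ∀ x : M, Nonempty (D.LocalLift x) := D.nonempty_localLift
  let L : (x : M) → D.LocalLift x := fun x => (hL x).some
  obtain ⟨ρ, hρ⟩ := SmoothPartitionOfUnity.exists_isSubordinate JM (s := (Set.univ : Set M))
    isClosed_univ (fun x => (L x).W) (fun x => (L x).isOpen)
    (fun x _ => Set.mem_iUnion.mpr ⟨x, (L x).mem⟩)
  have hmem' : ∀ {x i}, i ∈ ρ.fintsupport x → x ∈ (L i).W := fun {x i} hi =>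
    hρ i ((ρ.mem_fintsupport_iff x i).mp hi)
  have hmem : ∀ {x i}, i ∈ ρ.finsupport x → x ∈ (L i).W := fun {x i} hi =>
    hmem' (ρ.finsupport_subset_fintsupport x hi)
  have hone : ∀ x, ∑ i ∈ ρ.finsupport x, ρ i x = 1 := fun x => ρ.sum_finsupport x (Set.mem_univ x)
  let g : (e : TotE) → A e.proj → D.overE.Fiber e := fun e a =>
    ∑ i ∈ ρ.finsupport e.proj, ρ i e.proj • (L i).k e a
  have gA : ∀ e a, D.pA e (g e a) = a := by
    intro e a
    simp only [g]
    rw [_root_.map_sum, ← one_smul ℝ a, ← hone e.proj, Finset.sum_smul]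
    refine Finset.sum_congr rfl fun i hi => ?_
    rw [_root_.map_smul, (L i).pA_k e (hmem hi), ← Finset.sum_smul, hone, one_smul]
  have hsm : ∀ X : ΓA, ContMDiff JE
      ((𝓘(ℝ, EM).prod 𝓘(ℝ, FE)).prod 𝓘(ℝ, D.overE.Model)) ∞
      (fun e => (⟨e, g e (X e.proj)⟩ : D.Total)) := by
    intro X e
    have h1 : ContMDiffAt JE
        ((𝓘(ℝ, EM).prod 𝓘(ℝ, FE)).prod 𝓘(ℝ, D.overE.Model)) ∞
        (fun e' => (⟨e', ∑ i ∈ ρ.fintsupport e.proj, ρ i e'.proj • (L i).k e' (X e'.proj)⟩ :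
          D.Total)) e :=
      along_sum (b := id) _ contMDiffAt_id fun i hi => along_smul
        ((ρ i).contMDiff.contMDiffAt.comp e (contMDiffAt_proj E)) ((L i).smooth X e (hmem' hi))
    refine h1.congr_of_eventuallyEq ?_
    have h2 : ContinuousAt (TotalSpace.proj : TotE → M) e :=
      (FiberBundle.continuous_proj FE E).continuousAt
    filter_upwards [h2.eventually (ρ.eventually_finsupport_subset e.proj)] with e' he'
    change (⟨e', ∑ i ∈ _, _⟩ : D.Total) = _
    rw [Finset.sum_subset he' fun i _ hi => ?_]
    rw [SmoothPartitionOfUnity.mem_finsupport, Function.notMem_support] at hi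
    rw [hi, zero_smul]
  refine ⟨⟨fun X => ⟨fun e => g e (X e.proj), hsm X⟩, fun X Y => ?_, fun f X e => ?_, fun X => ?_⟩⟩
  · ext e
    change ∑ i ∈ _, ρ i e.proj • (L i).k e (X e.proj + Y e.proj) = ∑ i ∈ _, _ + ∑ i ∈ _, _
    rw [← Finset.sum_add_distrib]
    refine Finset.sum_congr rfl fun i hi => ?_
    rw [(L i).k_add e (hmem hi), smul_add]
  · change ∑ i ∈ _, ρ i e.proj • (L i).k e (f e.proj • X e.proj) = f e.proj • ∑ i ∈ _, _
    rw [Finset.smul_sum]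
    refine Finset.sum_congr rfl fun i hi => ?_
    rw [(L i).k_smul e (hmem hi), smul_comm]
  · rw [isLinearOver_iff]
    refine ⟨fun e => gA e (X e.proj), fun x e₁ e₂ => ?_, fun t e => ?_⟩
    · exact AddA.sum _ fun i hi => ((L i).add x (hmem hi) e₁ e₂ (X x)).smul (ρ i x)
    · change ∑ i ∈ _, ρ i e.proj • (L i).k (VBA.scale t e) (X e.proj) = D.mulA t e (∑ i ∈ _, _)
      rw [_root_.map_sum]
      refine Finset.sum_congr rfl fun i hi => ?_
      rw [_root_.map_smul]
      congr 1
      exact scaleA_eq_iff.mp ((L i).scale e.proj (hmem hi) t e.snd (X e.proj))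

end DoubleVectorBundle

end

section

/-- The action of a homomorphism of sections on fibres. -/
def homFib (φ : ΓE →ₗ[CM] ΓC) (x : M) :
    E x →ₗ[ℝ] C x where
  toFun v := φ ((dualSystem EM FE E x).extend v) x
  map_add' v w := by
    rw [← sec_add_apply, ← map_add]
    refine (dualSystem EM FE E x).eq_of_tensorial (fun ε => φ ε x) (fun ε η => ?_)
      (fun f ε => ?_) ?_
    · rw [map_add]; rfl
    · rw [map_smul]; rfl
    · rw [sec_add_apply]
      simp only [DualSystem.extend_apply]
  map_smul' t v := by
    refine Eq.trans ?_ (congrArg (fun s : ΓC => s x)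
      (φ.map_smul (ContMDiffMap.const t) ((dualSystem EM FE E x).extend v)))
    refine (dualSystem EM FE E x).eq_of_tensorial (fun ε => φ ε x) (fun ε η => ?_)
      (fun f ε => ?_) ?_
    · rw [map_add]; rfl
    · rw [map_smul]; rfl
    · rw [smul_sec_apply]
      simp only [DualSystem.extend_apply]
      rfl

theorem homFib_apply (φ : ΓE →ₗ[CM] ΓC)
    (ε : ΓE) (x : M) : homFib φ x (ε x) = φ ε x := by
  refine (dualSystem EM FE E x).eq_of_tensorial (fun ε => φ ε x) (fun ε η => ?_)
    (fun f ε => ?_) ?_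
  · rw [map_add]; rfl
  · rw [map_smul]; rfl
  · rw [DualSystem.extend_apply]

theorem contMDiff_homFib
    (φ : ΓE →ₗ[CM] ΓC) :
    ContMDiff JE (𝓘(ℝ, EM).prod 𝓘(ℝ, FC)) ∞
      (fun e : TotE => (⟨e.proj, homFib φ e.proj e.snd⟩ : TotalSpace FC C)) := by
  intro e
  let S := dualSystem EM FE E e.proj
  have h1 : ContMDiffAt JE (𝓘(ℝ, EM).prod 𝓘(ℝ, FC)) ∞
      (fun e : TotE => (⟨e.proj, ∑ i, S.l i e.proj e.snd • φ (S.b i) e.proj⟩ :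
        TotalSpace FC C)) e :=
    along_sum Finset.univ (contMDiffAt_proj E) fun i _ => along_smul (S.smooth i).contMDiffAt
      ((φ (S.b i)).contMDiff.contMDiffAt.comp e (contMDiffAt_proj E))
  refine h1.congr_of_eventuallyEq ?_
  filter_upwards [((FiberBundle.continuous_proj FE E).continuousAt (x := e)).eventually
    S.eventually_eq] with e' he'
  conv_lhs => rw [he' e'.snd]
  rw [map_sum]
  simp only [map_smul, homFib_apply]

theorem exists_eq_apply (e : TotE) :
    ∃ ε : ΓE, e = ⟨e.proj, ε e.proj⟩ :=
  ⟨(dualSystem EM FE E e.proj).extend e.snd, by rw [DualSystem.extend_apply]⟩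

namespace DoubleVectorBundle

variable (D : DoubleVectorBundle EM FA A FE E FC C)

/-- The core section defined by a section of `C`. -/
def coreSec (α : ΓC) : D.SectionsE :=
  ⟨fun e => D.iotaC e (α e.proj), fun e => D.contMDiffAt_iotaC (e := id) contMDiffAt_id
    (α.contMDiff.contMDiffAt.comp e (contMDiffAt_proj E))⟩

theorem coreSec_apply (α : ΓC) (e : TotE) :
    D.coreSec α e = D.iotaC e (α e.proj) := rfl

theorem coreSec_add (α β : ΓC) :
    D.coreSec (α + β) = D.coreSec α + D.coreSec β := by
  ext e
  exact map_add (D.iotaC e) _ _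

theorem coreSec_sub (α β : ΓC) :
    D.coreSec (α - β) = D.coreSec α - D.coreSec β := by
  ext e
  exact map_sub (D.iotaC e) _ _

theorem coreSec_smul (f : CM) (α : ΓC) :
    D.coreSec (f • α) = (pull f : Fns _ TotE) • D.coreSec α := by
  ext e
  exact map_smul (D.iotaC e) _ _

theorem coreSec_injective : Function.Injective D.coreSec := by
  intro α β h
  ext x
  exact D.iotaC_injective ⟨x, 0⟩ (congrArg (fun s : D.SectionsE => s ⟨x, 0⟩) h)

theorem isCoreOf_iff {X : D.SectionsE} {α : ΓC} :
    IsCoreOf X α ↔ X = D.coreSec α := by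
  constructor
  · intro h
    ext e
    exact D.eq_iotaC (h e)
  · rintro rfl e
    exact D.addA_iotaC e _

/-- The linear section over `0` defined by a homomorphism. -/
def homSec (φ : ΓE →ₗ[CM] ΓC) : D.SectionsE :=
  ⟨fun e => D.iotaC e (homFib φ e.proj e.snd), fun e => D.contMDiffAt_iotaC (e := id) contMDiffAt_id
    (contMDiff_homFib φ e)⟩

variable (φ ψ : Sections 𝓘(ℝ, EM) FE E →ₗ[Fns 𝓘(ℝ, EM) M] Sections 𝓘(ℝ, EM) FC C)

theorem homSec_apply (e : TotE) :
    D.homSec φ e = D.iotaC e (homFib φ e.proj e.snd) := rfl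

theorem homSec_mk (ε : ΓE) (x : M) :
    D.homSec φ ⟨x, ε x⟩ = D.iotaC ⟨x, ε x⟩ (φ ε x) :=
  congrArg (D.iotaC ⟨x, ε x⟩) (homFib_apply φ ε x)

theorem ext_mk {X Y : D.SectionsE} (h : ∀ (ε : ΓE) x,
    X ⟨x, ε x⟩ = Y ⟨x, ε x⟩) : X = Y := by
  ext e
  obtain ⟨ε, hε⟩ := exists_eq_apply (EM := EM) e
  rw [hε]
  exact h ε _

theorem homSec_add : D.homSec (φ + ψ) = D.homSec φ + D.homSec ψ := by
  refine D.ext_mk fun ε x => ?_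
  rw [sec_add_apply]
  simp only [homSec_mk]
  exact map_add (D.iotaC _) _ _

theorem homSec_sub : D.homSec (φ - ψ) = D.homSec φ - D.homSec ψ := by
  refine D.ext_mk fun ε x => ?_
  rw [sec_sub_apply]
  simp only [homSec_mk]
  exact map_sub (D.iotaC _) _ _

theorem homSec_neg : D.homSec (-φ) = -D.homSec φ := by
  refine D.ext_mk fun ε x => ?_
  rw [sec_neg_apply]
  simp only [homSec_mk]
  exact map_neg (D.iotaC _) _

theorem homSec_smul (f : CM) :
    D.homSec (f • φ) = (pull f : Fns _ TotE) • D.homSec φ := by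
  refine D.ext_mk fun ε x => ?_
  rw [smul_sec_apply]
  simp only [homSec_mk]
  exact map_smul (D.iotaC _) _ _

theorem homSec_injective : Function.Injective D.homSec := by
  intro φ ψ h
  ext ε x
  have h1 := congrArg (fun s : D.SectionsE => s ⟨x, ε x⟩) h
  simp only [homSec_mk] at h1
  exact D.iotaC_injective _ h1

theorem isHomSection_iff {X : D.SectionsE} : IsHomSection X φ ↔ X = D.homSec φ := by
  constructor
  · intro h
    refine D.ext_mk fun ε x => ?_
    rw [homSec_mk]
    exact D.eq_iotaC (e := ⟨x, ε x⟩) (h ε x)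
  · rintro rfl ε x
    rw [at_, homSec_mk]
    exact D.addA_iotaC ⟨x, ε x⟩ _

theorem pull_smul_homSec {x : M} (S : DualSystem EM FE E x) :
    (pull S.χ : Fns _ TotE) • D.homSec φ =
      ∑ i, (S.isFiberLinear i).fn • D.coreSec (φ (S.b i)) := by
  ext e
  rw [sec_sum_apply, smul_sec_apply]
  change S.χ e.proj • D.iotaC e (homFib φ e.proj e.snd) =
    ∑ i, S.l i e.proj e.snd • D.iotaC e (φ (S.b i) e.proj)
  rw [← map_smul, ← map_smul, S.eq, map_sum, map_sum]
  simp only [map_smul, homFib_apply]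

variable {D}

theorem HorizontalLift.lift_pull_smul (h : HorizontalLift D) (f : CM)
    (X : ΓA) :
    h.lift (f • X) = (pull f : Fns _ TotE) • h.lift X := by
  ext e
  exact h.lift_smul f X e

theorem HorizontalLift.eq_zero_of_tensorial (h : HorizontalLift D) {W : Type*} [AddCommGroup W]
    [Module ℝ W] (e : TotE) (T : D.SectionsE → W) (hadd : ∀ X Y, T (X + Y) = T X + T Y)
    (hsmul : ∀ (f : CE) X, T (f • X) = f e • T X)
    (hlift : ∀ X, T (h.lift X) = 0) (hcore : ∀ α, T (D.coreSec α) = 0) (Z : D.SectionsE) :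
    T Z = 0 := by
  let SA := dualSystem EM FA A e.proj
  let SC := dualSystem EM FC C e.proj
  have hsum : ∀ {n : ℕ} (s : Fin n → D.SectionsE), T (∑ i, s i) = ∑ i, T (s i) := fun s =>
    map_sum (AddMonoidHom.mk' T hadd) s Finset.univ
  let a : (i : Fin SA.n) → CE := fun i =>
    ⟨fun e => SC.χ e.proj * SA.l i e.proj (D.pA e (Z e)),
      (SC.χ.contMDiff.comp (contMDiff_proj E)).mul
        ((SA.smooth i).comp (D.contMDiff_pA.comp Z.contMDiff))⟩
  let c : (i : Fin SC.n) → CE := fun i =>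
    ⟨fun e => SA.χ e.proj * SC.l i e.proj (h.kap e (Z e)),
      (SA.χ.contMDiff.comp (contMDiff_proj E)).mul
        ((SC.smooth i).comp fun e => h.contMDiffAt_kap Z.contMDiff.contMDiffAt)⟩
  have key : (pull (SA.χ * SC.χ) : Fns _ TotE) • Z =
      ∑ i, a i • h.lift (SA.b i) + ∑ i, c i • D.coreSec (SC.b i) := by
    ext e
    rw [sec_add_apply, sec_sum_apply, sec_sum_apply, smul_sec_apply]
    change (SA.χ e.proj * SC.χ e.proj) • Z e =
      ∑ i, (SC.χ e.proj * SA.l i e.proj (D.pA e (Z e))) • h.lift (SA.b i) e +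
      ∑ i, (SA.χ e.proj * SC.l i e.proj (h.kap e (Z e))) • D.coreSec (SC.b i) e
    conv_lhs => rw [h.decomp e (Z e), smul_add]
    congr 1
    · rw [mul_comm, mul_smul, ← map_smul, SA.eq, map_sum, Finset.smul_sum]
      simp only [map_smul, HorizontalLift.lift_apply, mul_smul]
    · rw [mul_smul, ← map_smul, SC.eq, map_sum, Finset.smul_sum]
      simp only [map_smul, coreSec_apply, mul_smul]
  have h1 := congrArg T key
  rw [hsmul, hadd, hsum, hsum] at h1
  simp only [hsmul, hlift, hcore, smul_zero, Finset.sum_const_zero, add_zero] at h1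
  have h2 : (pull (SA.χ * SC.χ) : CE) e = 1 := by
    change SA.χ e.proj * SC.χ e.proj = 1
    rw [SA.χ_self, SC.χ_self, one_mul]
  rwa [h2, one_smul] at h1

end DoubleVectorBundle

end

section

theorem smul_apply_of_one {EP : Type*} [NormedAddCommGroup EP] [NormedSpace ℝ EP]
    {HP : Type*} [TopologicalSpace HP] {I : ModelWithCorners ℝ EP HP}
    {P : Type*} [TopologicalSpace P] [ChartedSpace HP P]
    {F : Type*} [NormedAddCommGroup F] [NormedSpace ℝ F]
    {V : P → Type*} [TopologicalSpace (TotalSpace F V)]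
    [∀ x, AddCommGroup (V x)] [∀ x, Module ℝ (V x)] [∀ x, TopologicalSpace (V x)]
    [FiberBundle F V] [VectorBundle ℝ F V] {f : Fns I P} {p : P} (hf : f p = 1)
    (s : Sections I F V) : (f • s) p = s p := by
  rw [smul_sec_apply, hf, one_smul]

theorem DualSystem.dfun_χ {F : Type*} [NormedAddCommGroup F] [NormedSpace ℝ F]
    {V : M → Type*} [TopologicalSpace (TotalSpace F V)]
    [∀ x, AddCommGroup (V x)] [∀ x, Module ℝ (V x)] [∀ x, TopologicalSpace (V x)]
    [FiberBundle F V] [VectorBundle ℝ F V] {x : M} (S : DualSystem EM F V x)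
    (v : TangentSpace JM x) : mvfderiv JM S.χ x v = 0 :=
  (dfun_congr (g := fun _ => 1) S.χ_one v).trans (dfun_const 1 v)

/-- The value at `x` of the derivative of a section multiplied by a function which is `1` near `x`. -/
theorem LieAlgebroid.nabla_χ_smul {FN : Type*} [NormedAddCommGroup FN] [NormedSpace ℝ FN]
    {N : M → Type*} [TopologicalSpace (TotalSpace FN N)]
    [∀ x, AddCommGroup (N x)] [∀ x, Module ℝ (N x)] [∀ x, TopologicalSpace (N x)]
    [FiberBundle FN N] [VectorBundle ℝ FN N] (LA : LieAlgebroid JM FA A)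
    (K : LA.lieRinehart.Connection (Sections JM FN N)) {x : M} (S : DualSystem EM FE E x)
    (X : ΓA) (s : Sections JM FN N) :
    K.nabla X (S.χ • s) x = K.nabla X s x := by
  rw [K.leibniz, sec_add_apply, smul_apply_of_one S.χ_self, smul_sec_apply]
  have h : LA.lieRinehart.rho X S.χ x = 0 := S.dfun_χ (LA.anchor x (X x))
  rw [h, zero_smul, add_zero]

variable (LA : LieAlgebroid 𝓘(ℝ, EM) FA A) {D : DoubleVectorBundle EM FA A FE E FC C}

open DoubleVectorBundle

/-- The bracket and the anchor `Q` on the sections of `D → E` are described, on the linear sections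
`h(X)` and the core sections, by the quadruple `S`. -/
structure Realizes (Q : PreLieRinehart CE D.SectionsE)
    (h : HorizontalLift D)
    (S : SuperData ΓC ΓE LA.lieRinehart) : Prop where
  basic : ∀ (Z : D.SectionsE) (f : CM) (e : TotE),
    Q.rho Z (pull f) e = mvfderiv JM f e.proj (LA.anchor e.proj (D.pA e (Z e)))
  core_fn : ∀ (α : ΓC) {l : TotE → ℝ}
    (hl : IsFiberLinear (EM := EM) l) (e : TotE),
    Q.rho (D.coreSec α) hl.fn e = -l ⟨e.proj, S.bd α e.proj⟩
  lift_fn : ∀ (X : ΓA) {l : TotE → ℝ}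
    (hl : IsFiberLinear (EM := EM) l) (ε : ΓE) (x : M),
    Q.rho (h.lift X) hl.fn ⟨x, ε x⟩ =
      mvfderiv JM (hl.comp ε) x (LA.anchor x (X x)) - l ⟨x, S.nablaS.nabla X ε x⟩
  lift_core : ∀ (X : ΓA) (α : ΓC),
    Q.br (h.lift X) (D.coreSec α) = D.coreSec (S.nablaC.nabla X α)
  lift_lift : ∀ X Y : ΓA,
    Q.br (h.lift X) (h.lift Y) = h.lift (LA.bracket X Y) - D.homSec (S.curv ![X, Y])
  core_core : ∀ α β : ΓC, Q.br (D.coreSec α) (D.coreSec β) = 0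

namespace Realizes

variable {LA} {Q : PreLieRinehart (Fns (𝓘(ℝ, EM).prod 𝓘(ℝ, FE)) (TotalSpace FE E)) D.SectionsE}
    {h : HorizontalLift D}
    {S : SuperData (Sections 𝓘(ℝ, EM) FC C) (Sections 𝓘(ℝ, EM) FE E) LA.lieRinehart}
    (φ ψ : Sections 𝓘(ℝ, EM) FE E →ₗ[Fns 𝓘(ℝ, EM) M] Sections 𝓘(ℝ, EM) FC C)

theorem rho_χ (H : Realizes LA Q h S) {V : M → Type*} {F : Type*} [NormedAddCommGroup F] [NormedSpace ℝ F]
    [TopologicalSpace (TotalSpace F V)]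
    [∀ x, AddCommGroup (V x)] [∀ x, Module ℝ (V x)] [∀ x, TopologicalSpace (V x)]
    [FiberBundle F V] [VectorBundle ℝ F V] (e : TotE) (T : DualSystem EM F V e.proj)
    (Z : D.SectionsE) : Q.rho Z (pull T.χ) e = 0 := by
  rw [H.basic, T.dfun_χ]

theorem br_homSec_apply (H : Realizes LA Q h S) (Y : D.SectionsE) (e : TotE) (T : DualSystem EM FE E e.proj) :
    Q.br Y (D.homSec φ) e = ∑ i, (T.l i e.proj e.snd • Q.br Y (D.coreSec (φ (T.b i))) e +
      Q.rho Y (T.isFiberLinear i).fn e • D.iotaC e (φ (T.b i) e.proj)) := by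
  have h1 : Q.br Y ((pull T.χ : Fns _ TotE) • D.homSec φ) e =
      Q.br Y (D.homSec φ) e := by
    rw [Q.leibniz, sec_add_apply, smul_apply_of_one (show (pull T.χ : CE) e = 1 from T.χ_self),
      smul_sec_apply, H.rho_χ, zero_smul, add_zero]
  rw [← h1, pull_smul_homSec, map_sum, sec_sum_apply]
  refine Finset.sum_congr rfl fun i _ => ?_
  rw [Q.leibniz]
  rfl

theorem rho_homSec (f : CE) (e : TotE)
    (T : DualSystem EM FE E e.proj) :
    Q.rho (D.homSec φ) f e = ∑ i, T.l i e.proj e.snd * Q.rho (D.coreSec (φ (T.b i))) f e := by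
  have h1 : Q.rho ((pull T.χ : Fns _ TotE) • D.homSec φ) f e =
      Q.rho (D.homSec φ) f e := by
    rw [map_smul]
    change T.χ e.proj * Q.rho (D.homSec φ) f e = _
    rw [T.χ_self, one_mul]
  rw [← h1, pull_smul_homSec, map_sum]
  have h2 : ∀ {n : ℕ} (s : Fin n → Derivation ℝ CE
      CE), (∑ i, s i) f e = ∑ i, s i f e := by
    intro n s
    let ev : Derivation ℝ CE
      CE →+ ℝ :=
      { toFun := fun δ => δ f e, map_zero' := rfl, map_add' := fun _ _ => rfl }
    exact map_sum ev s Finset.univ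
  rw [h2]
  refine Finset.sum_congr rfl fun i _ => ?_
  rw [map_smul]
  rfl

theorem homSec_fn (H : Realizes LA Q h S) {l : TotE → ℝ} (hl : IsFiberLinear (EM := EM) l)
    (ε : ΓE) (x : M) :
    Q.rho (D.homSec φ) hl.fn ⟨x, ε x⟩ = -l ⟨x, S.bd (φ ε) x⟩ := by
  let T := dualSystem EM FE E x
  rw [rho_homSec φ hl.fn ⟨x, ε x⟩ T]
  have h1 : S.bd (φ ε) x = ∑ i, T.l i x (ε x) • S.bd (φ (T.b i)) x := by
    refine T.sum_of_tensorial (fun η => S.bd (φ η) x) (fun η ζ => ?_) (fun f η => ?_) ε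
    · rw [map_add, map_add]; rfl
    · rw [map_smul, map_smul]; rfl
  rw [h1, hl.map_sum_smul, ← Finset.sum_neg_distrib]
  refine Finset.sum_congr rfl fun i _ => ?_
  rw [H.core_fn, mul_neg]

theorem core_homSec (H : Realizes LA Q h S) (α : ΓC) :
    Q.br (D.coreSec α) (D.homSec φ) = -D.coreSec (φ (S.bd α)) := by
  refine D.ext_mk fun ε x => ?_
  let T := dualSystem EM FE E x
  rw [H.br_homSec_apply φ _ ⟨x, ε x⟩ T, sec_neg_apply, coreSec_apply]
  have h1 : φ (S.bd α) x = ∑ i, T.l i x (S.bd α x) • φ (T.b i) x := by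
    refine T.sum_of_tensorial (fun η => φ η x) (fun η ζ => ?_) (fun f η => ?_) _
    · rw [map_add]; rfl
    · rw [map_smul]; rfl
  change _ = -D.iotaC ⟨x, ε x⟩ (φ (S.bd α) x)
  rw [h1, map_sum, ← Finset.sum_neg_distrib]
  refine Finset.sum_congr rfl fun i _ => ?_
  rw [H.core_core, H.core_fn, sec_zero_apply, smul_zero, zero_add, neg_smul, map_smul]

theorem lift_homSec (H : Realizes LA Q h S) (X : ΓA) :
    Q.br (h.lift X) (D.homSec φ) = D.homSec (S.homConn X φ) := by
  refine D.ext_mk fun ε x => ?_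
  let T := dualSystem EM FE E x
  rw [H.br_homSec_apply φ _ ⟨x, ε x⟩ T, homSec_mk]
  have h1 : φ (S.nablaS.nabla X ε) x = ∑ i, T.l i x (S.nablaS.nabla X ε x) • φ (T.b i) x := by
    refine T.sum_of_tensorial (fun η => φ η x) (fun η ζ => ?_) (fun f η => ?_) _
    · rw [map_add]; rfl
    · rw [map_smul]; rfl
  have h2 : S.nablaC.nabla X (φ ε) x = ∑ i, (T.l i x (ε x) • S.nablaC.nabla X (φ (T.b i)) x +
      mvfderiv JM ((T.isFiberLinear i).comp ε) x (LA.anchor x (X x)) • φ (T.b i) x) := by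
    rw [← LA.nabla_χ_smul S.nablaC T, ← map_smul, T.χ_smul, map_sum, map_sum, sec_sum_apply]
    refine Finset.sum_congr rfl fun i _ => ?_
    rw [map_smul, S.nablaC.leibniz, sec_add_apply]
    rfl
  change _ = D.iotaC ⟨x, ε x⟩ (S.nablaC.nabla X (φ ε) x - φ (S.nablaS.nabla X ε) x)
  rw [h1, h2, ← Finset.sum_sub_distrib, map_sum]
  refine Finset.sum_congr rfl fun i _ => ?_
  rw [H.lift_core, H.lift_fn, map_sub, map_add, map_smul, map_smul, map_smul, sub_smul,
    add_sub_assoc]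
  rfl

theorem homSec_homSec (H : Realizes LA Q h S) :
    Q.br (D.homSec φ) (D.homSec ψ) = D.homSec (φ ∘ₗ S.bd ∘ₗ ψ - ψ ∘ₗ S.bd ∘ₗ φ) := by
  refine D.ext_mk fun ε x => ?_
  let T := dualSystem EM FE E x
  rw [H.br_homSec_apply ψ _ ⟨x, ε x⟩ T, homSec_mk]
  have h1 : ψ (S.bd (φ ε)) x = ∑ i, T.l i x (S.bd (φ ε) x) • ψ (T.b i) x := by
    refine T.sum_of_tensorial (fun η => ψ η x) (fun η ζ => ?_) (fun f η => ?_) _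
    · rw [map_add]; rfl
    · rw [map_smul]; rfl
  have h2 : φ (S.bd (ψ ε)) x = ∑ i, T.l i x (ε x) • φ (S.bd (ψ (T.b i))) x := by
    refine T.sum_of_tensorial (fun η => φ (S.bd (ψ η)) x) (fun η ζ => ?_) (fun f η => ?_) _
    · simp only [map_add]; rfl
    · simp only [map_smul]; rfl
  change _ = D.iotaC ⟨x, ε x⟩ (φ (S.bd (ψ ε)) x - ψ (S.bd (φ ε)) x)
  rw [h1, h2, ← Finset.sum_sub_distrib, map_sum]
  refine Finset.sum_congr rfl fun i _ => ?_
  rw [Q.br_skew, H.core_homSec, neg_neg, H.homSec_fn, map_sub, map_smul, map_smul, neg_smul,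
    sub_eq_add_neg]
  rfl

end Realizes

end

section

theorem AddRel.assoc {B F : Type*} {V : B → Type*} [∀ x, AddCommGroup (V x)]
    {p q r s t u : TotalSpace F V} (h₁ : AddRel p q r) (h₂ : AddRel r s t) (h₃ : AddRel q s u) :
    AddRel p u t := by
  obtain ⟨x, a, b, rfl, rfl, rfl⟩ := h₁
  obtain ⟨y, c, d, h1, rfl, rfl⟩ := h₂
  obtain rfl : x = y := congrArg TotalSpace.proj h1
  obtain ⟨z, e, g, h2, h3, rfl⟩ := h₃
  obtain rfl : x = z := congrArg TotalSpace.proj h2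
  obtain rfl := eq_of_heq (TotalSpace.mk.inj h1).2
  obtain rfl := eq_of_heq (TotalSpace.mk.inj h2).2
  obtain rfl := eq_of_heq (TotalSpace.mk.inj h3).2
  exact ⟨x, a, b + d, rfl, rfl, by rw [add_assoc]⟩

theorem section_ext {ε η : ΓE}
    (h : ∀ l : TotE → ℝ, IsFiberLinear (EM := EM) l → ∀ x, l ⟨x, ε x⟩ = l ⟨x, η x⟩) :
    ε = η := by
  ext x
  exact (dualSystem EM FE E x).eq_of_fiberLinear fun l hl => h l hl x

namespace DoubleVectorBundle

variable {D : DoubleVectorBundle EM FA A FE E FC C}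

theorem addA_iotaC_add (x : M) (e₁ e₂ : E x) (c₁ c₂ : C x) :
    D.AddA ⟨⟨x, e₁⟩, D.iotaC ⟨x, e₁⟩ c₁⟩ ⟨⟨x, e₂⟩, D.iotaC ⟨x, e₂⟩ c₂⟩
      ⟨⟨x, e₁ + e₂⟩, D.iotaC ⟨x, e₁ + e₂⟩ (c₁ + c₂)⟩ := by
  have key : ∀ (e₁ e₂ : E x) (c : C x), D.AddA ⟨⟨x, e₁⟩, D.iotaC ⟨x, e₁⟩ c⟩ ⟨⟨x, e₂⟩, 0⟩
      ⟨⟨x, e₁ + e₂⟩, D.iotaC ⟨x, e₁ + e₂⟩ c⟩ := by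
    intro e₁ e₂ c
    have h1 : D.AddA (D.core ⟨x, c⟩) ⟨⟨x, e₁⟩, 0⟩ ⟨⟨x, e₁⟩, D.iotaC ⟨x, e₁⟩ c⟩ :=
      D.addA_iotaC ⟨x, e₁⟩ c
    have h2 : D.AddA (D.core ⟨x, c⟩) ⟨⟨x, e₁ + e₂⟩, 0⟩ ⟨⟨x, e₁ + e₂⟩, D.iotaC ⟨x, e₁ + e₂⟩ c⟩ :=
      D.addA_iotaC ⟨x, e₁ + e₂⟩ c
    obtain ⟨d, hd⟩ := D.exists_addA (d₁ := ⟨⟨x, e₁⟩, D.iotaC ⟨x, e₁⟩ c⟩) (d₂ := ⟨⟨x, e₂⟩, 0⟩) (by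
      rw [projA_mk, projA_mk, pA_iotaC, map_zero])
    have h3 : D.AddA (D.core ⟨x, c⟩) ⟨⟨x, e₁ + e₂⟩, 0⟩ d := AddRel.assoc h1 hd (D.addA_zero x e₁ e₂)
    rwa [h3.unique h2] at hd
  have h2 : D.AddA ⟨⟨x, e₁⟩, 0⟩ ⟨⟨x, e₂⟩, D.iotaC ⟨x, e₂⟩ c₂⟩
      ⟨⟨x, e₁ + e₂⟩, D.iotaC ⟨x, e₁ + e₂⟩ c₂⟩ := by
    rw [add_comm]
    exact (key e₂ e₁ c₂).symm
  have h3 := (key e₁ e₂ c₁).add h2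
  rwa [add_zero, zero_add, ← map_add] at h3

theorem HorizontalLift.mulA_iotaC (h : HorizontalLift D) (t : ℝ) (e : TotE)
    (c : C e.proj) : D.mulA t e (D.iotaC e c) = D.iotaC (VBA.scale t e) (t • c) := by
  have hp : ∀ t, D.pA (VBA.scale t e) (D.mulA t e (D.iotaC e c)) = 0 := by
    intro t
    have h1 := D.projA_scaleA t ⟨e, D.iotaC e c⟩
    rw [scaleA_mk, projA_mk, projA_mk, pA_iotaC] at h1
    exact mk_inj h1
  have hi : ∀ t, D.mulA t e (D.iotaC e c) = D.iotaC (VBA.scale t e)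
      (h.kap (VBA.scale t e) (D.mulA t e (D.iotaC e c))) := by
    intro t
    have h1 := h.decomp (VBA.scale t e) (D.mulA t e (D.iotaC e c))
    rwa [hp, map_zero, zero_add] at h1
  obtain ⟨x, v⟩ := e
  let F : ℝ → C x := fun t => h.kap (VBA.scale t ⟨x, v⟩) (D.mulA t ⟨x, v⟩ (D.iotaC ⟨x, v⟩ c))
  have hadd : ∀ s t : ℝ, F (s + t) = F s + F t := by
    intro s t
    have h1 : D.AddA (D.scaleA s ⟨⟨x, v⟩, D.iotaC ⟨x, v⟩ c⟩) (D.scaleA t ⟨⟨x, v⟩, D.iotaC ⟨x, v⟩ c⟩)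
        (D.scaleA (s + t) ⟨⟨x, v⟩, D.iotaC ⟨x, v⟩ c⟩) := by
      simp only [AddA, scaleA, D.swap.apply_symm_apply]
      refine ⟨_, _, _, rfl, rfl, ?_⟩
      rw [← add_smul]
      rfl
    rw [scaleA_mk, scaleA_mk, scaleA_mk, hi s, hi t, hi (s + t)] at h1
    have h2 := addA_iotaC_add (D := D) x (s • v) (t • v)
      (F s) (F t)
    change D.AddA _ _ ⟨⟨x, (s + t) • v⟩, D.iotaC ⟨x, (s + t) • v⟩ (F (s + t))⟩ at h1
    rw [add_smul] at h1
    exact D.iotaC_injective ⟨x, s • v + t • v⟩ (mk_inj (AddA.unique h1 h2))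
  have hsm : ContMDiff 𝓘(ℝ, ℝ) (𝓘(ℝ, EM).prod 𝓘(ℝ, FC)) ∞ (fun t : ℝ =>
      (⟨x, F t⟩ : TotalSpace FC C)) := by
    intro t
    refine h.contMDiffAt_kap (e := fun t => VBA.scale t ⟨x, v⟩) ?_
    have h1 := D.contMDiffAt_scaleA (J := 𝓘(ℝ, ℝ)) (f := fun _ => ⟨⟨x, v⟩, D.iotaC ⟨x, v⟩ c⟩)
      (contMDiffAt_id (x := t)) contMDiffAt_const
    simp only [scaleA_mk] at h1
    exact h1
  have h1 : F 1 = c := by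
    have h2 : D.scaleA 1 ⟨⟨x, v⟩, D.iotaC ⟨x, v⟩ c⟩ = ⟨⟨x, v⟩, D.iotaC ⟨x, v⟩ c⟩ := by
      rw [scaleA, scale_one_eq, D.swap.symm_apply_apply]
    rw [scaleA_mk, hi] at h2
    change (⟨⟨x, (1 : ℝ) • v⟩, D.iotaC ⟨x, (1 : ℝ) • v⟩ (F 1)⟩ : D.Total) = _ at h2
    rw [one_smul] at h2
    exact D.iotaC_injective ⟨x, v⟩ (mk_inj h2)
  rw [hi t]
  congr 1
  refine (dualSystem EM FC C x).eq_of_fiberLinear fun l hl => ?_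
  let g : ℝ →+ ℝ := AddMonoidHom.mk'
    (fun t => l ⟨x, F t⟩) (by
      intro s t
      rw [hadd]
      exact (hl.linear x).map_add _ _)
  have hg : Continuous g := (hl.contMDiff.comp hsm).continuous
  have h2 := map_real_smul g hg t 1
  rw [smul_eq_mul, mul_one] at h2
  refine h2.trans ?_
  refine Eq.trans ?_ ((hl.linear x).map_smul t c).symm
  exact congrArg (fun z : C x => t • l ⟨x, z⟩) h1

/-- A linear section over zero is given by a homomorphism. -/
theorem exists_homSec (h : HorizontalLift D) {Z : D.SectionsE} (hZ : IsLinearOver Z 0) :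
    ∃ φ, Z = D.homSec φ := by
  rw [isLinearOver_iff] at hZ
  have hZe : ∀ e, Z e = D.iotaC e (h.kap e (Z e)) := by
    intro e
    have h1 := h.decomp e (Z e)
    have h2 : D.pA e (Z e) = 0 := hZ.1 e
    rwa [h2, map_zero, zero_add] at h1
  have hadd : ∀ x (e₁ e₂ : E x), h.kap ⟨x, e₁ + e₂⟩ (Z ⟨x, e₁ + e₂⟩) =
      h.kap ⟨x, e₁⟩ (Z ⟨x, e₁⟩) + h.kap ⟨x, e₂⟩ (Z ⟨x, e₂⟩) := by
    intro x e₁ e₂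
    have h1 := hZ.2.1 x e₁ e₂
    simp only [at_] at h1
    rw [hZe ⟨x, e₁⟩, hZe ⟨x, e₂⟩, hZe ⟨x, e₁ + e₂⟩] at h1
    exact D.iotaC_injective ⟨x, e₁ + e₂⟩ (mk_inj (h1.unique (addA_iotaC_add x e₁ e₂ _ _)))
  have hsm : ContMDiff JE (𝓘(ℝ, EM).prod 𝓘(ℝ, FC)) ∞
      (fun e : TotE => (⟨e.proj, h.kap e (Z e)⟩ : TotalSpace FC C)) := fun e =>
    h.contMDiffAt_kap (e := id) Z.contMDiff.contMDiffAt
  have hsmul : ∀ (t : ℝ) x (e : E x), h.kap ⟨x, t • e⟩ (Z ⟨x, t • e⟩) =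
      t • h.kap ⟨x, e⟩ (Z ⟨x, e⟩) := by
    intro t x e
    have h1 := hZ.2.2 t ⟨x, e⟩
    rw [hZe ⟨x, e⟩, h.mulA_iotaC] at h1
    exact (congrArg (h.kap ⟨x, t • e⟩) h1).trans (h.kap_iotaC ⟨x, t • e⟩ _)
  refine ⟨{ toFun := fun ε => ⟨fun x => h.kap ⟨x, ε x⟩ (Z ⟨x, ε x⟩), hsm.comp ε.contMDiff⟩
            map_add' := fun ε η => ?_
            map_smul' := fun f ε => ?_ }, ?_⟩
  · ext x
    exact hadd x _ _
  · ext x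
    exact hsmul (f x) x _
  · refine D.ext_mk fun ε x => ?_
    rw [homSec_mk]
    exact hZe _

theorem HorizontalLift.homSec_isLinearOver (h : HorizontalLift D)
    (φ : ΓE →ₗ[CM] ΓC) :
    IsLinearOver (D.homSec φ) 0 := by
  rw [isLinearOver_iff]
  refine ⟨fun e => D.pA_iotaC _ _, fun x e₁ e₂ => ?_, fun t e => ?_⟩
  · have h1 := addA_iotaC_add (D := D) x e₁ e₂ (homFib φ x e₁) (homFib φ x e₂)
    rwa [← map_add] at h1
  · rw [homSec_apply, homSec_apply, h.mulA_iotaC]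
    exact congrArg (D.iotaC (VBA.scale t e)) (map_smul (homFib φ e.proj) t e.snd)

end DoubleVectorBundle

end

section

theorem rho_mul_fn {Q : Derivation ℝ CE
    CE} (f : CM)
    {l : TotE → ℝ} (hl : IsFiberLinear (EM := EM) l) (e : TotE) :
    Q (hl.mul f).fn e = f e.proj * Q hl.fn e + l e * Q (pull f) e := by
  have h : (hl.mul f).fn = pull f * hl.fn := rfl
  rw [h, Q.leibniz]
  rfl

theorem rho_add_fn {Q : Derivation ℝ CE
    CE}
    {l l' : TotE → ℝ} (hl : IsFiberLinear (EM := EM) l)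
    (hl' : IsFiberLinear (EM := EM) l') (e : TotE) :
    Q (hl.add hl').fn e = Q hl.fn e + Q hl'.fn e := by
  have h : (hl.add hl').fn = hl.fn + hl'.fn := rfl
  rw [h, map_add]
  rfl

namespace VBAlgebroid

open DoubleVectorBundle

variable {LA : LieAlgebroid 𝓘(ℝ, EM) FA A} (D : VBAlgebroid FE E FC C LA)

/-- The bracket and the anchor of a VB-algebroid. -/
abbrev pre : PreLieRinehart CE D.dvb.SectionsE :=
  D.alg.lieRinehart.toPre

theorem proj_anchor (e : TotE) (d : D.dvb.overE.Fiber e) :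
    mfderiv JE JM TotalSpace.proj e (D.alg.anchor e d) =
      LA.anchor e.proj (D.dvb.pA e d) := by
  have h1 := D.anchor_base ⟨e, d⟩
  rw [projA_mk] at h1
  exact mk_inj h1

theorem rho_pull (Z : D.dvb.SectionsE) (f : CM) (e : TotE) :
    D.pre.rho Z (pull f) e =
      mvfderiv JM f e.proj (LA.anchor e.proj (D.dvb.pA e (Z e))) := by
  rw [← proj_anchor]
  exact dfun_pull f e _

theorem rho_pull_lift (h : HorizontalLift D.dvb) (X : ΓA)
    (f : CM) : D.pre.rho (h.lift X) (pull f) = pull (LA.lieRinehart.rho X f) := by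
  ext e
  rw [rho_pull, h.pA_lift]
  rfl

theorem rho_pull_core (α : ΓC) (f : CM) :
    D.pre.rho (D.dvb.coreSec α) (pull f) = 0 := by
  ext e
  rw [rho_pull, coreSec_apply, pA_iotaC, map_zero, map_zero]
  rfl

theorem anchor_iotaC {l : TotE → ℝ} (hl : IsFiberLinear (EM := EM) l) (x : M)
    (e : E x) (c : C x) :
    mvfderiv JE l ⟨x, e⟩ (D.alg.anchor ⟨x, e⟩ (D.dvb.iotaC ⟨x, e⟩ c)) =
    mvfderiv JE l ⟨x, 0⟩ (D.alg.anchor ⟨x, 0⟩ (D.dvb.iotaC ⟨x, 0⟩ c)) := by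
  have key : ∀ e : E x,
      mvfderiv JE l ⟨x, e⟩ (D.alg.anchor ⟨x, e⟩ (D.dvb.iotaC ⟨x, e⟩ c)) =
      mvfderiv JE l (D.alg.anchorMap (D.dvb.core ⟨x, c⟩)).proj
        (D.alg.anchorMap (D.dvb.core ⟨x, c⟩)).snd := by
    intro e
    have h1 := (D.anchor_add _ _ _ (D.dvb.addA_iotaC ⟨x, e⟩ c)).dfun hl
    refine h1.trans ?_
    have h2 : mvfderiv JE l ⟨x, e⟩ (D.alg.anchor ⟨x, e⟩ 0) = 0 := by
      rw [map_zero, map_zero]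
    exact (congrArg (fun z => _ + z) h2).trans (add_zero _)
  rw [key, key]

theorem exists_bd : ∃ bd : ΓC →ₗ[CM] ΓE,
    ∀ (α : ΓC) (l : TotE → ℝ) (hl : IsFiberLinear (EM := EM) l)
    (e : TotE), l ⟨e.proj, bd α e.proj⟩ = -D.pre.rho (D.dvb.coreSec α) hl.fn e := by
  have h1 : ∀ α : ΓC, ∃ ε : ΓE,
      ∀ l (hl : IsFiberLinear (EM := EM) l) x,
        l ⟨x, ε x⟩ = -D.pre.rho (D.dvb.coreSec α) hl.fn ⟨x, 0⟩ := by
    intro α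
    obtain ⟨ε, hε⟩ := exists_section_of_functional (EM := EM) (F := FE) (V := E)
      (fun l x => -mvfderiv JE l ⟨x, 0⟩
        (D.alg.anchor ⟨x, 0⟩ (D.dvb.coreSec α ⟨x, 0⟩)))
      (fun l hl => ((D.pre.rho (D.dvb.coreSec α) hl.fn).contMDiff.comp
        (contMDiff_zeroSection ℝ E)).neg)
      (fun l l' hl hl' x => by
        have h2 := rho_add_fn (Q := D.pre.rho (D.dvb.coreSec α)) hl hl' ⟨x, 0⟩
        refine (congrArg Neg.neg h2).trans ?_
        exact neg_add _ _)
      (fun f l hl x => by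
        have h2 := rho_mul_fn (Q := D.pre.rho (D.dvb.coreSec α)) f hl ⟨x, 0⟩
        rw [rho_pull_core] at h2
        refine (congrArg Neg.neg h2).trans ?_
        change -(_ + _ * (0 : ℝ)) = _
        rw [mul_zero, add_zero]
        exact neg_mul_eq_mul_neg _ _)
    exact ⟨ε, fun l hl x => hε l hl x⟩
  choose bd hbd using h1
  refine ⟨{ toFun := bd
            map_add' := fun α β => ?_
            map_smul' := fun f α => ?_ }, fun α l hl e => ?_⟩
  · refine section_ext fun l hl x => ?_
    rw [sec_add_apply]
    refine Eq.trans ?_ ((hl.linear x).map_add _ _).symm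
    rw [hbd _ l hl, hbd _ l hl, hbd _ l hl, coreSec_add, map_add, ← neg_add]
    rfl
  · refine section_ext fun l hl x => ?_
    rw [RingHom.id_apply, smul_sec_apply]
    refine Eq.trans ?_ ((hl.linear x).map_smul _ _).symm
    rw [hbd _ l hl, hbd _ l hl, coreSec_smul, map_smul, smul_neg]
    rfl
  · refine (hbd α l hl e.proj).trans (congrArg Neg.neg ?_)
    exact (D.anchor_iotaC hl e.proj e.snd _).symm

variable (h : HorizontalLift D.dvb)

theorem rho_lift_add (X : ΓA) {l : TotE → ℝ}
    (hl : IsFiberLinear (EM := EM) l) (x : M) (e₁ e₂ : E x) :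
    D.pre.rho (h.lift X) hl.fn ⟨x, e₁ + e₂⟩ =
      D.pre.rho (h.lift X) hl.fn ⟨x, e₁⟩ + D.pre.rho (h.lift X) hl.fn ⟨x, e₂⟩ :=
  (D.anchor_add _ _ _ ((h.isLinearOver X).add _ _ _ (AddRel.mk x e₁ e₂))).dfun hl

theorem rho_lift_smul (X : ΓA) {l : TotE → ℝ}
    (hl : IsFiberLinear (EM := EM) l) (t : ℝ) (x : M) (e : E x) :
    D.pre.rho (h.lift X) hl.fn ⟨x, t • e⟩ = t * D.pre.rho (h.lift X) hl.fn ⟨x, e⟩ := by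
  have h1 := D.anchor_scale t (at_ (h.lift X) ⟨x, e⟩)
  rw [← (h.isLinearOver X).scale] at h1
  have h2 := congrArg (fun v : TangentBundle JE TotE =>
    mvfderiv JE l v.proj v.snd) h1
  refine h2.trans ?_
  have hs : ContMDiff JE JE ∞
      (VBA.scale t : TotE → TotE) := fun e =>
    contMDiffAt_scale (f := id) contMDiffAt_const contMDiffAt_id
  refine (dfun_comp (hl.contMDiff.mdifferentiable (by simp) _)
    (hs.mdifferentiable (by simp) (⟨x, e⟩ : TotE)) _).symm.trans ?_
  have h3 : (fun e : TotE => l (VBA.scale t e)) = fun e => t * l e := by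
    funext e
    exact (hl.linear e.proj).map_smul t e.snd
  rw [h3]
  refine (dfun_mul (J := JE) mdifferentiableAt_const
    (hl.contMDiff.mdifferentiable (by simp) _) _).trans ?_
  refine (congrArg (fun z : ℝ => t * mvfderiv JE l ⟨x, e⟩
    (D.alg.anchor ⟨x, e⟩ (h.lift X ⟨x, e⟩)) + l ⟨x, e⟩ * z)
    (dfun_const (J := JE) (p := (⟨x, e⟩ : TotE)) t _)).trans ?_
  rw [mul_zero, add_zero]
  rfl

theorem exists_nablaS : ∃ K : LA.lieRinehart.Connection ΓE,
    ∀ (X : ΓA) (ε : ΓE) (l : TotE → ℝ)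
    (hl : IsFiberLinear (EM := EM) l) (x : M), l ⟨x, K.nabla X ε x⟩ =
      LA.lieRinehart.rho X (hl.comp ε) x - D.pre.rho (h.lift X) hl.fn ⟨x, ε x⟩ := by
  have h1 : ∀ (X : ΓA) (ε : ΓE),
      ∃ η : ΓE, ∀ l (hl : IsFiberLinear (EM := EM) l) x, l ⟨x, η x⟩ =
      LA.lieRinehart.rho X (hl.comp ε) x - D.pre.rho (h.lift X) hl.fn ⟨x, ε x⟩ := by
    intro X ε
    obtain ⟨η, hη⟩ := exists_section_of_functional (EM := EM) (F := FE) (V := E)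
      (fun l x => mvfderiv JM (fun y => l ⟨y, ε y⟩) x (LA.anchor x (X x)) -
        mvfderiv JE l ⟨x, ε x⟩
        (D.alg.anchor ⟨x, ε x⟩ (h.lift X ⟨x, ε x⟩)))
      (fun l hl => (LA.lieRinehart.rho X (hl.comp ε)).contMDiff.sub
        ((D.pre.rho (h.lift X) hl.fn).contMDiff.comp ε.contMDiff))
      (fun l l' hl hl' x => by
        have h2 := rho_add_fn (Q := D.pre.rho (h.lift X)) hl hl' ⟨x, ε x⟩
        have h3 := congrArg (fun f : CM => f x)
          ((LA.lieRinehart.rho X).map_add (hl.comp ε) (hl'.comp ε))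
        refine (congrArg₂ HSub.hSub h3 h2).trans ?_
        exact add_sub_add_comm _ _ _ _)
      (fun f l hl x => by
        have h2 := rho_mul_fn (Q := D.pre.rho (h.lift X)) f hl ⟨x, ε x⟩
        rw [rho_pull_lift] at h2
        have h3 := congrArg (fun f : CM => f x)
          ((LA.lieRinehart.rho X).leibniz f (hl.comp ε))
        refine (congrArg₂ HSub.hSub h3 h2).trans ?_
        change (f x * LA.lieRinehart.rho X (hl.comp ε) x + l ⟨x, ε x⟩ * LA.lieRinehart.rho X f x) -
          (f x * D.pre.rho (h.lift X) hl.fn ⟨x, ε x⟩ + l ⟨x, ε x⟩ * LA.lieRinehart.rho X f x) =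
          f x * (LA.lieRinehart.rho X (hl.comp ε) x - D.pre.rho (h.lift X) hl.fn ⟨x, ε x⟩)
        ring)
    exact ⟨η, fun l hl x => hη l hl x⟩
  choose K hK using h1
  have hcadd : ∀ {l : TotE → ℝ} (hl : IsFiberLinear (EM := EM) l)
      (ε η : ΓE), hl.comp (ε + η) = hl.comp ε + hl.comp η := by
    intro l hl ε η
    ext x
    exact (hl.linear x).map_add _ _
  have hcsmul : ∀ {l : TotE → ℝ} (hl : IsFiberLinear (EM := EM) l)
      (f : CM) (ε : ΓE), hl.comp (f • ε) = f * hl.comp ε := by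
    intro l hl f ε
    ext x
    exact (hl.linear x).map_smul _ _
  have hadd : ∀ X ε η, K X (ε + η) = K X ε + K X η := by
    intro X ε η
    refine section_ext fun l hl x => ?_
    rw [sec_add_apply]
    refine Eq.trans ?_ ((hl.linear x).map_add _ _).symm
    rw [hK _ _ l hl, hK _ _ l hl, hK _ _ l hl, hcadd, map_add, sec_add_apply, rho_lift_add]
    exact add_sub_add_comm _ _ _ _
  have hlei : ∀ X (f : CM) ε, K X (f • ε) = f • K X ε + LA.lieRinehart.rho X f • ε := by
    intro X f ε
    refine section_ext fun l hl x => ?_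
    rw [sec_add_apply, smul_sec_apply, smul_sec_apply]
    refine Eq.trans ?_ ((hl.linear x).map_add _ _).symm
    refine Eq.trans ?_ (congrArg₂ HAdd.hAdd ((hl.linear x).map_smul _ _)
      ((hl.linear x).map_smul _ _)).symm
    rw [hK _ _ l hl, hcsmul, smul_sec_apply, rho_lift_smul, Derivation.leibniz]
    change (f x * LA.lieRinehart.rho X (hl.comp ε) x + l ⟨x, ε x⟩ * LA.lieRinehart.rho X f x) -
          (f x * D.pre.rho (h.lift X) hl.fn ⟨x, ε x⟩) =
          f x * l ⟨x, K X ε x⟩ + LA.lieRinehart.rho X f x * l ⟨x, ε x⟩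
    rw [hK _ _ l hl]
    ring
  refine ⟨⟨{ toFun := fun X =>
               { toFun := K X
                 map_add' := hadd X
                 map_smul' := fun t ε => ?_ }
             map_add' := fun X Y => ?_
             map_smul' := fun f X => ?_ }, hlei⟩, hK⟩
  · have h2 := hlei X (algebraMap ℝ CM t) ε
    rw [Derivation.map_algebraMap, zero_smul, add_zero, algebraMap_smul, algebraMap_smul] at h2
    exact h2
  · refine LinearMap.ext fun ε => section_ext fun l hl x => ?_
    change l ⟨x, K (X + Y) ε x⟩ = l ⟨x, (K X ε + K Y ε) x⟩
    rw [sec_add_apply]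
    refine Eq.trans ?_ ((hl.linear x).map_add _ _).symm
    rw [hK _ _ l hl, hK _ _ l hl, hK _ _ l hl, h.lift_add, map_add, map_add]
    exact add_sub_add_comm _ _ _ _
  · refine LinearMap.ext fun ε => section_ext fun l hl x => ?_
    change l ⟨x, K (f • X) ε x⟩ = l ⟨x, (f • K X ε) x⟩
    rw [smul_sec_apply]
    refine Eq.trans ?_ ((hl.linear x).map_smul _ _).symm
    rw [hK _ _ l hl, hK _ _ l hl, h.lift_pull_smul, map_smul, map_smul]
    exact (mul_sub _ _ _).symm

theorem exists_nablaC : ∃ K : LA.lieRinehart.Connection ΓC,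
    ∀ (X : ΓA) (α : ΓC),
      D.pre.br (h.lift X) (D.dvb.coreSec α) = D.dvb.coreSec (K.nabla X α) := by
  have h1 : ∀ (X : ΓA) (α : ΓC), ∃ β,
      D.pre.br (h.lift X) (D.dvb.coreSec α) = D.dvb.coreSec β := by
    intro X α
    obtain ⟨β, hβ⟩ := D.bracket_core _ X _ α (h.isLinearOver X) ((isCoreOf_iff _).mpr rfl)
    exact ⟨β, (isCoreOf_iff _).mp hβ⟩
  choose K hK using h1
  have hlei : ∀ X (f : CM) α, K X (f • α) = f • K X α + LA.lieRinehart.rho X f • α := by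
    intro X f α
    refine D.dvb.coreSec_injective ?_
    rw [← hK, coreSec_smul, coreSec_add, coreSec_smul, coreSec_smul, D.pre.leibniz, hK,
      rho_pull_lift]
  have hadd : ∀ X α β, K X (α + β) = K X α + K X β := by
    intro X α β
    refine D.dvb.coreSec_injective ?_
    rw [← hK, coreSec_add, coreSec_add, map_add, hK, hK]
  refine ⟨⟨{ toFun := fun X =>
               { toFun := K X
                 map_add' := hadd X
                 map_smul' := fun t α => ?_ }
             map_add' := fun X Y => ?_
             map_smul' := fun f X => ?_ }, hlei⟩, hK⟩
  · have h2 := hlei X (algebraMap ℝ CM t) α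
    rw [Derivation.map_algebraMap, zero_smul, add_zero, algebraMap_smul, algebraMap_smul] at h2
    exact h2
  · refine LinearMap.ext fun α => D.dvb.coreSec_injective ?_
    change D.dvb.coreSec (K (X + Y) α) = D.dvb.coreSec (K X α + K Y α)
    rw [← hK, h.lift_add, map_add, LinearMap.add_apply, hK, hK, coreSec_add]
  · refine LinearMap.ext fun α => D.dvb.coreSec_injective ?_
    change D.dvb.coreSec (K (f • X) α) = D.dvb.coreSec (f • K X α)
    rw [← hK, h.lift_pull_smul, coreSec_smul, ← hK]
    refine (LieRinehartData.br_smul_left (P := D.alg.lieRinehart) _ _ _).trans ?_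
    have h3 : D.alg.lieRinehart.rho (D.dvb.coreSec α) (pull f) = 0 := D.rho_pull_core α f
    rw [h3, zero_smul, sub_zero]
    rfl

theorem exists_curv : ∃ Ω : ΓA [⋀^Fin 2]→ₗ[CM]
      (ΓE →ₗ[CM] ΓC),
    ∀ X Y : ΓA,
      D.pre.br (h.lift X) (h.lift Y) = h.lift (LA.bracket X Y) - D.dvb.homSec (Ω ![X, Y]) := by
  have h1 : ∀ X Y : ΓA, ∃ φ,
      h.lift (LA.bracket X Y) - D.pre.br (h.lift X) (h.lift Y) = D.dvb.homSec φ := by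
    intro X Y
    refine exists_homSec h ?_
    have h2 := (h.isLinearOver (LA.bracket X Y)).sub
      (D.bracket_linear _ _ _ _ (h.isLinearOver X) (h.isLinearOver Y))
    rwa [sub_self] at h2
  choose c hc using h1
  have hneg : ∀ X, h.lift (-X) = -h.lift X := by
    intro X
    have h2 := h.lift_add X (-X)
    have h3 := h.lift_add 0 0
    rw [add_zero] at h3
    rw [add_neg_cancel, left_eq_add.mp h3] at h2
    exact (neg_eq_of_add_eq_zero_right h2.symm).symm
  have hskew : ∀ X Y, LA.bracket Y X = -LA.bracket X Y := LA.lieRinehart.toPre.br_skew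
  refine ⟨altTwo c ?_ ?_ ?_ ?_, fun X Y => ?_⟩
  · intro X X' Y
    refine D.dvb.homSec_injective ?_
    rw [homSec_add, ← hc, ← hc, ← hc, map_add, LinearMap.add_apply, h.lift_add, h.lift_add, map_add,
      LinearMap.add_apply]
    abel
  · intro f X Y
    refine D.dvb.homSec_injective ?_
    rw [homSec_smul, ← hc, ← hc]
    have h2 : LA.bracket (f • X) Y = f • LA.bracket X Y + -(LA.lieRinehart.rho Y f • X) := by
      rw [← sub_eq_add_neg]
      exact LA.lieRinehart.br_smul_left X f Y
    have h3 := D.alg.lieRinehart.br_smul_left (h.lift X) (pull f) (h.lift Y)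
    rw [h2, h.lift_add, hneg, h.lift_pull_smul, h.lift_pull_smul, h.lift_pull_smul]
    refine (congrArg (fun z => _ - z) h3).trans ?_
    have h4 : D.alg.lieRinehart.rho (h.lift Y) (pull f) = pull (LA.lieRinehart.rho Y f) :=
      D.rho_pull_lift h Y f
    rw [h4, smul_sub]
    change _ - ((pull f : Fns _ TotE) • D.pre.br (h.lift X) (h.lift Y) - _) = _
    abel
  · intro X Y
    refine D.dvb.homSec_injective ?_
    rw [homSec_neg, ← hc, ← hc, hskew, D.pre.br_skew, hneg]
    abel
  · intro X
    refine D.dvb.homSec_injective ?_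
    rw [← hc, LA.bracket_self, D.pre.br_self, sub_zero]
    have h3 := h.lift_add 0 0
    rw [add_zero] at h3
    rw [left_eq_add.mp h3]
    have h4 := D.dvb.homSec_add 0 0
    rw [add_zero] at h4
    exact (left_eq_add.mp h4).symm
  · change _ = _ - D.dvb.homSec (c X Y)
    rw [← hc, sub_sub_cancel]

theorem isAssociated_iff
    {S : SuperData ΓC ΓE LA.lieRinehart} :
    IsAssociated D h S ↔ Realizes LA D.pre h S := by
  constructor
  · intro H
    refine ⟨D.rho_pull, fun α l hl e => ?_, fun X l hl ε x => ?_, fun X α => ?_, fun X Y => ?_,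
      fun α β => ?_⟩
    · rw [H.bd α _ ((isCoreOf_iff _).mpr rfl) l hl e, neg_neg]
      rfl
    · rw [H.nablaS X ε l hl x]
      exact (sub_sub_cancel _ _).symm
    · exact (isCoreOf_iff _).mp (H.nablaC X α _ ((isCoreOf_iff _).mpr rfl))
    · rw [← (isHomSection_iff _ _).mp (H.curv X Y), sub_sub_cancel]
      rfl
    · exact D.bracket_core_core _ _ _ _ ((isCoreOf_iff _).mpr rfl) ((isCoreOf_iff _).mpr rfl)
  · intro H
    refine ⟨fun α a ha l hl e => ?_, fun X α a ha => ?_, fun X ε l hl x => ?_, fun X Y => ?_⟩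
    · rw [(isCoreOf_iff _).mp ha]
      exact (neg_eq_iff_eq_neg.mpr (H.core_fn α hl e)).symm
    · rw [isCoreOf_iff, (isCoreOf_iff _).mp ha]
      exact H.lift_core X α
    · refine eq_sub_of_add_eq' (eq_sub_iff_add_eq.mp ?_)
      exact H.lift_fn X hl ε x
    · rw [isHomSection_iff]
      exact sub_eq_iff_eq_add.mpr (eq_sub_iff_add_eq'.mp (H.lift_lift X Y)).symm

theorem exists_isAssociated :
    ∃ S : SuperData ΓC ΓE LA.lieRinehart,
      IsAssociated D h S := by
  obtain ⟨bd, hbd⟩ := D.exists_bd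
  obtain ⟨Kc, hKc⟩ := D.exists_nablaC h
  obtain ⟨Ks, hKs⟩ := D.exists_nablaS h
  obtain ⟨Ω, hΩ⟩ := D.exists_curv h
  refine ⟨⟨bd, Kc, Ks, Ω⟩, (D.isAssociated_iff h).mpr ⟨D.rho_pull, fun α l hl e => ?_,
    fun X l hl ε x => ?_, hKc, hΩ, fun α β => ?_⟩⟩
  · rw [hbd α l hl e, neg_neg]
  · rw [hKs X ε l hl x]
    exact (sub_sub_cancel _ _).symm
  · exact D.bracket_core_core _ _ _ _ ((isCoreOf_iff _).mpr rfl) ((isCoreOf_iff _).mpr rfl)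

end VBAlgebroid

/-- The quadruple realized by a bracket and an anchor is unique. -/
theorem Realizes.unique {LA : LieAlgebroid JM FA A} {D : DoubleVectorBundle EM FA A FE E FC C}
    {Q : PreLieRinehart CE D.SectionsE}
    {h : DoubleVectorBundle.HorizontalLift D}
    {S S' : SuperData ΓC ΓE LA.lieRinehart}
    (H : Realizes LA Q h S) (H' : Realizes LA Q h S') : S = S' := by
  have h1 : S.bd = S'.bd := LinearMap.ext fun α => section_ext fun l hl x =>
    neg_injective ((H.core_fn α hl ⟨x, 0⟩).symm.trans (H'.core_fn α hl ⟨x, 0⟩))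
  have h2 : S.nablaC.nabla = S'.nablaC.nabla := LinearMap.ext fun X => LinearMap.ext fun α =>
    D.coreSec_injective ((H.lift_core X α).symm.trans (H'.lift_core X α))
  have h3 : S.nablaS.nabla = S'.nablaS.nabla := LinearMap.ext fun X => LinearMap.ext fun ε =>
    section_ext fun l hl x =>
      sub_right_injective ((H.lift_fn X hl ε x).symm.trans (H'.lift_fn X hl ε x))
  have h4 : S.curv = S'.curv := SuperData.curv_ext fun X Y =>
    D.homSec_injective (sub_right_injective ((H.lift_lift X Y).symm.trans (H'.lift_lift X Y)))
  obtain ⟨bd, ⟨Kc, hc⟩, ⟨Ks, hs⟩, Ω⟩ := S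
  obtain ⟨bd', ⟨Kc', hc'⟩, ⟨Ks', hs'⟩, Ω'⟩ := S'
  obtain rfl : bd = bd' := h1
  obtain rfl : Kc = Kc' := h2
  obtain rfl : Ks = Ks' := h3
  obtain rfl : Ω = Ω' := h4
  rfl

end

section

open DoubleVectorBundle

namespace Realizes

variable {LA : LieAlgebroid 𝓘(ℝ, EM) FA A} {D : DoubleVectorBundle EM FA A FE E FC C}
    {Q : PreLieRinehart (Fns (𝓘(ℝ, EM).prod 𝓘(ℝ, FE)) (TotalSpace FE E)) D.SectionsE}
    {h : HorizontalLift D}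
    {S : SuperData (Sections 𝓘(ℝ, EM) FC C) (Sections 𝓘(ℝ, EM) FE E) LA.lieRinehart}

theorem rho_pull_lift (H : Realizes LA Q h S) (X : ΓA)
    (f : CM) : Q.rho (h.lift X) (pull f) = pull (LA.lieRinehart.rho X f) := by
  ext e
  rw [H.basic, h.pA_lift]
  rfl

theorem rho_pull_core (H : Realizes LA Q h S) (α : ΓC) (f : CM) :
    Q.rho (D.coreSec α) (pull f) = 0 := by
  ext e
  rw [H.basic, coreSec_apply, pA_iotaC, map_zero, map_zero]
  rfl

theorem rho_core_fn (H : Realizes LA Q h S) (α : ΓC) {l : TotE → ℝ}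
    (hl : IsFiberLinear (EM := EM) l) : Q.rho (D.coreSec α) hl.fn = -pull (hl.comp (S.bd α)) := by
  ext e
  exact H.core_fn α hl e

theorem isFiberLinear_lift (H : Realizes LA Q h S) (X : ΓA)
    {l : TotE → ℝ} (hl : IsFiberLinear (EM := EM) l) :
    IsFiberLinear (EM := EM) (Q.rho (h.lift X) hl.fn) := by
  refine ⟨(Q.rho (h.lift X) hl.fn).contMDiff, fun x => ⟨fun v w => ?_, fun t v => ?_⟩⟩
  · let ε := (dualSystem EM FE E x).extend v
    let η := (dualSystem EM FE E x).extend w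
    have hv : ε x = v := DualSystem.extend_apply _ _
    have hw : η x = w := DualSystem.extend_apply _ _
    have h1 := H.lift_fn X hl (ε + η) x
    have h2 : hl.comp (ε + η) = hl.comp ε + hl.comp η := by
      ext x
      exact (hl.linear x).map_add _ _
    have h3 : l ⟨x, S.nablaS.nabla X (ε + η) x⟩ = l ⟨x, S.nablaS.nabla X ε x⟩ +
        l ⟨x, S.nablaS.nabla X η x⟩ := by
      rw [map_add]
      exact (hl.linear x).map_add _ _
    have h4 : mvfderiv JM (hl.comp (ε + η)) x (LA.anchor x (X x)) =
        mvfderiv JM (hl.comp ε) x (LA.anchor x (X x)) +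
        mvfderiv JM (hl.comp η) x (LA.anchor x (X x)) := by
      rw [h2]
      exact congrArg (fun f : CM => f x)
        ((LA.lieRinehart.rho X).map_add (hl.comp ε) (hl.comp η))
    rw [h3, h4, sec_add_apply, add_sub_add_comm, ← H.lift_fn, ← H.lift_fn, hv, hw] at h1
    exact h1
  · let ε := (dualSystem EM FE E x).extend v
    have hv : ε x = v := DualSystem.extend_apply _ _
    have h1 := H.lift_fn X hl (t • ε) x
    have h2 : hl.comp (t • ε) = t • hl.comp ε := by
      ext x
      exact (hl.linear x).map_smul _ _
    have h3 : l ⟨x, S.nablaS.nabla X (t • ε) x⟩ = t • l ⟨x, S.nablaS.nabla X ε x⟩ := by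
      rw [map_smul]
      exact (hl.linear x).map_smul _ _
    have h4 : mvfderiv JM (hl.comp (t • ε)) x (LA.anchor x (X x)) =
        t • mvfderiv JM (hl.comp ε) x (LA.anchor x (X x)) := by
      rw [h2]
      exact congrArg (fun f : CM => f x)
        ((LA.lieRinehart.rho X).map_smul t (hl.comp ε))
    rw [h3, h4, ← smul_sub, ← H.lift_fn] at h1
    change Q.rho (h.lift X) hl.fn ⟨x, t • ε x⟩ = t • Q.rho (h.lift X) hl.fn ⟨x, ε x⟩ at h1
    rwa [hv] at h1

theorem commutator_lift_core (H : Realizes LA Q h S) (X : ΓA)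
    (α : ΓC) {l : TotE → ℝ} (hl : IsFiberLinear (EM := EM) l)
    (e : TotE) :
    Q.rho (h.lift X) (Q.rho (D.coreSec α) hl.fn) e - Q.rho (D.coreSec α) (Q.rho (h.lift X) hl.fn) e =
      -l ⟨e.proj, S.nablaS.nabla X (S.bd α) e.proj⟩ := by
  rw [rho_core_fn H, map_neg, H.rho_pull_lift]
  have h1 := H.core_fn α (H.isFiberLinear_lift X hl) e
  rw [H.lift_fn] at h1
  refine (congrArg (fun z => _ - z) h1).trans ?_
  change -LA.lieRinehart.rho X (hl.comp (S.bd α)) e.proj -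
    -(LA.lieRinehart.rho X (hl.comp (S.bd α)) e.proj - _) = _
  ring

theorem commutator_lift_lift (H : Realizes LA Q h S) (X Y : ΓA)
    {l : TotE → ℝ} (hl : IsFiberLinear (EM := EM) l)
    (ε : ΓE) (x : M) :
    Q.rho (h.lift X) (Q.rho (h.lift Y) hl.fn) ⟨x, ε x⟩ -
      Q.rho (h.lift Y) (Q.rho (h.lift X) hl.fn) ⟨x, ε x⟩ =
    LA.lieRinehart.rho (LA.bracket X Y) (hl.comp ε) x -
      l ⟨x, S.nablaS.nabla X (S.nablaS.nabla Y ε) x⟩ +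
      l ⟨x, S.nablaS.nabla Y (S.nablaS.nabla X ε) x⟩ := by
  have key : ∀ X Y : ΓA, Q.rho (h.lift X) (Q.rho (h.lift Y) hl.fn) ⟨x, ε x⟩ =
      LA.lieRinehart.rho X (LA.lieRinehart.rho Y (hl.comp ε)) x -
      LA.lieRinehart.rho X (hl.comp (S.nablaS.nabla Y ε)) x -
      LA.lieRinehart.rho Y (hl.comp (S.nablaS.nabla X ε)) x +
      l ⟨x, S.nablaS.nabla Y (S.nablaS.nabla X ε) x⟩ := by
    intro X Y
    have h1 := H.lift_fn X (H.isFiberLinear_lift Y hl) ε x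
    have h2 : (H.isFiberLinear_lift Y hl).comp ε = LA.lieRinehart.rho Y (hl.comp ε) -
        hl.comp (S.nablaS.nabla Y ε) := by
      ext y
      exact H.lift_fn Y hl ε y
    have h3 : mvfderiv JM ((H.isFiberLinear_lift Y hl).comp ε) x (LA.anchor x (X x)) =
      LA.lieRinehart.rho X (LA.lieRinehart.rho Y (hl.comp ε)) x -
      LA.lieRinehart.rho X (hl.comp (S.nablaS.nabla Y ε)) x := by
      rw [h2]
      exact congrArg (fun f : CM => f x) ((LA.lieRinehart.rho X).map_sub _ _)
    rw [h3, H.lift_fn Y hl (S.nablaS.nabla X ε) x] at h1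
    refine h1.trans ?_
    change _ - (LA.lieRinehart.rho Y (hl.comp (S.nablaS.nabla X ε)) x - _) = _
    ring
  have h4 := congrArg (fun f : CM => f x) (LA.rho_br X Y (hl.comp ε))
  change LA.lieRinehart.rho X (LA.lieRinehart.rho Y (hl.comp ε)) x -
    LA.lieRinehart.rho Y (LA.lieRinehart.rho X (hl.comp ε)) x =
    LA.lieRinehart.rho (LA.bracket X Y) (hl.comp ε) x at h4
  rw [key, key, ← h4]
  ring

theorem jacobi_lift_lift_core (H : Realizes LA Q h S) (X Y : ΓA)
    (α : ΓC) :
    Q.br (h.lift X) (Q.br (h.lift Y) (D.coreSec α)) - Q.br (Q.br (h.lift X) (h.lift Y)) (D.coreSec α) -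
      Q.br (h.lift Y) (Q.br (h.lift X) (D.coreSec α)) =
    D.coreSec (S.nablaC.nabla X (S.nablaC.nabla Y α) - S.nablaC.nabla Y (S.nablaC.nabla X α) -
      S.nablaC.nabla (LA.bracket X Y) α + S.curv ![X, Y] (S.bd α)) := by
  rw [H.lift_lift, map_sub, LinearMap.sub_apply, Q.br_skew (D.coreSec α) (D.homSec _),
    H.core_homSec, H.lift_core, H.lift_core, H.lift_core, H.lift_core, H.lift_core, coreSec_add,
    coreSec_sub, coreSec_sub]
  abel

theorem jacobi_lift_lift_lift (H : Realizes LA Q h S) (X Y Z : ΓA) :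
    Q.br (h.lift X) (Q.br (h.lift Y) (h.lift Z)) - Q.br (Q.br (h.lift X) (h.lift Y)) (h.lift Z) -
      Q.br (h.lift Y) (Q.br (h.lift X) (h.lift Z)) =
    -D.homSec (S.homConn X (S.curv ![Y, Z]) + S.homConn Y (S.curv ![Z, X]) +
      S.homConn Z (S.curv ![X, Y]) - S.curv ![LA.bracket X Y, Z] - S.curv ![LA.bracket Y Z, X] -
      S.curv ![LA.bracket Z X, Y]) := by
  have hs : ∀ U V : ΓA, S.curv ![U, V] = -S.curv ![V, U] := by
    intro U V
    have h1 := S.curv.map_swap ![V, U] (i := 0) (j := 1) (by decide)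
    rw [← h1]
    congr 1
    ext i
    fin_cases i <;> rfl
  have hn : ∀ (φ : ΓE →ₗ[CM] ΓC),
      S.homConn Y (-φ) = -S.homConn Y φ := by
    intro φ
    ext1 ε
    change S.nablaC.nabla Y (-φ ε) - -φ (S.nablaS.nabla Y ε) =
      -(S.nablaC.nabla Y (φ ε) - φ (S.nablaS.nabla Y ε))
    rw [map_neg]
    abel
  have hL := LA.jacobi X Y Z
  simp only [H.lift_lift, map_sub, LinearMap.sub_apply, H.lift_homSec]
  rw [Q.br_skew (h.lift Z) (D.homSec _), H.lift_homSec, hs Z X, hn, hs (LA.bracket Y Z) X,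
    show LA.bracket Z X = -LA.bracket X Z from LA.lieRinehart.toPre.br_skew X Z]
  change _ = -D.homSec (_ - S.curv ![-LA.bracket X Z, Y])
  have h5 : S.curv ![-LA.bracket X Z, Y] = S.curv ![Y, LA.bracket X Z] := by
    rw [hs Y]
    exact congrArg (fun g : ΓA [⋀^Fin 1]→ₗ[CM] _ => g ![Y])
      (S.curv.curryLeft.map_neg (LA.bracket X Z))
  rw [h5, hL, h.lift_add]
  simp only [homSec_add, homSec_sub, homSec_neg]
  abel

/-- The structure equations follow from the Jacobi identity and the compatibility of the anchor. -/
theorem isFlat (H : Realizes LA Q h S)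
    (hj : ∀ X Y Z, Q.br X (Q.br Y Z) = Q.br (Q.br X Y) Z + Q.br Y (Q.br X Z))
    (hρ : ∀ X Y f, Q.rho X (Q.rho Y f) - Q.rho Y (Q.rho X f) = Q.rho (Q.br X Y) f) : S.IsFlat := by
  have hρe : ∀ X Y f e, Q.rho X (Q.rho Y f) e - Q.rho Y (Q.rho X f) e = Q.rho (Q.br X Y) f e :=
    fun X Y f e => congrArg
      (fun g : CE => g e) (hρ X Y f)
  have hj' : ∀ X Y Z, Q.br X (Q.br Y Z) - Q.br (Q.br X Y) Z - Q.br Y (Q.br X Z) = 0 := by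
    intro X Y Z
    rw [hj X Y Z]
    abel
  refine ⟨fun X α => ?_, fun X Y α => ?_, fun X Y ε => ?_, fun X Y Z ε => ?_⟩
  · refine section_ext fun l hl x => neg_injective ?_
    have h1 := H.commutator_lift_core X α hl ⟨x, 0⟩
    rw [hρe, H.lift_core, H.core_fn] at h1
    exact h1.symm
  · have h1 := H.jacobi_lift_lift_core X Y α
    rw [hj'] at h1
    have h2 : D.coreSec 0 = 0 := by
      have h3 := D.coreSec_sub 0 0
      rwa [sub_self, sub_self] at h3
    rw [← h2] at h1
    exact eq_neg_of_add_eq_zero_left (D.coreSec_injective h1).symm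
  · refine section_ext fun l hl x => ?_
    have h1 := H.commutator_lift_lift X Y hl ε x
    rw [hρe, H.lift_lift, map_sub] at h1
    have h2 : Q.rho (h.lift (LA.bracket X Y)) hl.fn ⟨x, ε x⟩ -
        Q.rho (D.homSec (S.curv ![X, Y])) hl.fn ⟨x, ε x⟩ =
      LA.lieRinehart.rho (LA.bracket X Y) (hl.comp ε) x -
      l ⟨x, S.nablaS.nabla X (S.nablaS.nabla Y ε) x⟩ +
      l ⟨x, S.nablaS.nabla Y (S.nablaS.nabla X ε) x⟩ := h1
    rw [H.lift_fn, H.homSec_fn] at h2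
    change LA.lieRinehart.rho (LA.bracket X Y) (hl.comp ε) x - _ - _ = _ at h2
    have hsub : ∀ a b : E x, l ⟨x, a - b⟩ = l ⟨x, a⟩ - l ⟨x, b⟩ := fun a b => (hl.linear x).map_sub a b
    have hneg : ∀ a : E x, l ⟨x, -a⟩ = -l ⟨x, a⟩ := fun a => (hl.linear x).map_neg a
    simp only [sec_sub_apply, sec_neg_apply, hsub, hneg]
    change _ - _ - l ⟨x, S.nablaS.nabla (LA.bracket X Y) ε x⟩ = _
    linarith
  · have h1 := H.jacobi_lift_lift_lift X Y Z
    rw [hj'] at h1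
    have h2 : D.homSec 0 = 0 := by
      have h3 := D.homSec_sub 0 0
      rwa [sub_self, sub_self] at h3
    rw [zero_eq_neg, ← h2] at h1
    exact congrArg (fun φ : ΓE →ₗ[CM] ΓC => φ ε)
      (D.homSec_injective h1)

end Realizes

end

section

open DoubleVectorBundle VBAlgebroid

section ChangeOfLift

variable {LA : LieAlgebroid 𝓘(ℝ, EM) FA A} {D : DoubleVectorBundle EM FA A FE E FC C}
    {Q : PreLieRinehart (Fns (𝓘(ℝ, EM).prod 𝓘(ℝ, FE)) (TotalSpace FE E)) D.SectionsE}
    {h h' : HorizontalLift D}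
    {S S' : SuperData (Sections 𝓘(ℝ, EM) FC C) (Sections 𝓘(ℝ, EM) FE E) LA.lieRinehart}
    {σ : Sections 𝓘(ℝ, EM) FA A [⋀^Fin 1]→ₗ[Fns 𝓘(ℝ, EM) M]
      (Sections 𝓘(ℝ, EM) FE E →ₗ[Fns 𝓘(ℝ, EM) M] Sections 𝓘(ℝ, EM) FC C)}

theorem differBy_iff : DifferBy h h' σ ↔ ∀ X, h'.lift X = h.lift X + D.homSec (σ ![X]) := by
  refine forall_congr' fun X => ?_
  rw [isHomSection_iff, sub_eq_iff_eq_add']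

theorem existsUnique_differBy (h h' : HorizontalLift D) : ∃! σ, DifferBy h h' σ := by
  have h1 : ∀ X, ∃ φ, h'.lift X - h.lift X = D.homSec φ := by
    intro X
    refine exists_homSec h ?_
    have h2 := (h'.isLinearOver X).sub (h.isLinearOver X)
    rwa [sub_self] at h2
  choose s hs using h1
  let s' : ΓA →ₗ[CM]
      (ΓE →ₗ[CM] ΓC) :=
    { toFun := s
      map_add' := fun X Y => D.homSec_injective (by
        rw [homSec_add, ← hs, ← hs, ← hs, h.lift_add, h'.lift_add]
        abel)
      map_smul' := fun f X => D.homSec_injective (by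
        rw [RingHom.id_apply, homSec_smul, ← hs, ← hs, h.lift_pull_smul, h'.lift_pull_smul,
          smul_sub]) }
  refine ⟨AlternatingMap.ofSubsingleton _ _ _ (0 : Fin 1) s', fun X => ?_, fun τ hτ => ?_⟩
  · rw [isHomSection_iff]
    exact hs X
  · ext1 v
    have hv : v = ![v 0] := by
      ext i
      fin_cases i
      rfl
    refine D.homSec_injective ?_
    have h2 := (isHomSection_iff _ _).mp (hτ (v 0))
    rw [← hv, hs] at h2
    exact h2.symm

/-- The horizontal lift `h + σ`. -/
def DoubleVectorBundle.HorizontalLift.addHom (h : HorizontalLift D)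
    (σ : ΓA [⋀^Fin 1]→ₗ[CM]
      (ΓE →ₗ[CM] ΓC)) : HorizontalLift D where
  lift X := h.lift X + D.homSec (σ ![X])
  lift_add X Y := by
    have h1 : σ ![X + Y] = σ ![X] + σ ![Y] :=
      congrArg (fun g : ΓA [⋀^Fin 0]→ₗ[CM]
        (ΓE →ₗ[CM] ΓC) => g ![])
        (σ.curryLeft.map_add X Y)
    rw [h1, homSec_add, h.lift_add]
    abel
  lift_smul f X e := by
    have h1 : σ ![f • X] = f • σ ![X] :=
      congrArg (fun g : ΓA [⋀^Fin 0]→ₗ[CM]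
        (ΓE →ₗ[CM] ΓC) => g ![])
        (σ.curryLeft.map_smul f X)
    rw [h1, homSec_smul, h.lift_pull_smul, ← smul_add]
    rfl
  isLinearOver X := by
    have h1 := (h.isLinearOver X).sec_add (h.homSec_isLinearOver (σ ![X]))
    rwa [add_zero] at h1

theorem Realizes.gaugeRel (H : Realizes LA Q h S) (H' : Realizes LA Q h' S')
    (hσ : DifferBy h h' σ) : SuperData.GaugeRel S S' σ := by
  rw [differBy_iff] at hσ
  refine ⟨LinearMap.ext fun α => section_ext fun l hl x => ?_, fun X α => ?_, fun X ε => ?_,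
    fun X Y ε => ?_⟩
  · exact neg_injective ((H'.core_fn α hl ⟨x, 0⟩).symm.trans (H.core_fn α hl ⟨x, 0⟩))
  · refine D.coreSec_injective ?_
    rw [← H'.lift_core, hσ, map_add, LinearMap.add_apply, H.lift_core, Q.br_skew (D.coreSec α),
      H.core_homSec, neg_neg, coreSec_add]
  · refine section_ext fun l hl x => ?_
    have h1 := H'.lift_fn X hl ε x
    rw [hσ, map_add] at h1
    have h2 : Q.rho (h.lift X) hl.fn ⟨x, ε x⟩ + Q.rho (D.homSec (σ ![X])) hl.fn ⟨x, ε x⟩ = _ := h1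
    rw [H.lift_fn, H.homSec_fn] at h2
    rw [sec_add_apply]
    refine Eq.trans ?_ ((hl.linear x).map_add _ _).symm
    linarith
  · have h1 := H'.lift_lift X Y
    rw [hσ, hσ, hσ, map_add, map_add, LinearMap.add_apply, LinearMap.add_apply, H.lift_lift,
      H.lift_homSec, Q.br_skew (h.lift Y), H.lift_homSec, H.homSec_homSec] at h1
    have h2 : D.homSec (S'.curv ![X, Y]) = D.homSec (S.curv ![X, Y] + σ ![LA.bracket X Y] -
        S.homConn X (σ ![Y]) + S.homConn Y (σ ![X]) -
        (σ ![X] ∘ₗ S.bd ∘ₗ σ ![Y] - σ ![Y] ∘ₗ S.bd ∘ₗ σ ![X])) := by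
      have h3 := eq_sub_iff_add_eq'.mp h1
      rw [← eq_sub_iff_add_eq] at h3
      rw [h3]
      simp only [homSec_add, homSec_sub]
      abel
    have h4 := congrArg (fun φ : ΓE →ₗ[CM]
      ΓC => φ ε) (D.homSec_injective h2)
    refine h4.trans ?_
    change S.curv ![X, Y] ε + σ ![LA.bracket X Y] ε -
      (S.nablaC.nabla X (σ ![Y] ε) - σ ![Y] (S.nablaS.nabla X ε)) +
      (S.nablaC.nabla Y (σ ![X] ε) - σ ![X] (S.nablaS.nabla Y ε)) -
      (σ ![X] (S.bd (σ ![Y] ε)) - σ ![Y] (S.bd (σ ![X] ε))) = _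
    change _ = S.curv ![X, Y] ε + σ ![LA.bracket X Y] ε -
      (S.nablaC.nabla X (σ ![Y] ε) - σ ![Y] (S.nablaS.nabla X ε)) +
      (S.nablaC.nabla Y (σ ![X] ε) - σ ![X] (S.nablaS.nabla Y ε)) -
      σ ![X] (S.bd (σ ![Y] ε)) + σ ![Y] (S.bd (σ ![X] ε))
    abel

end ChangeOfLift

variable (FA A FE E FC C EM) in
theorem separated_twoTerm : Separated CM ΓA
    (TwoTerm ΓC ΓE) :=
  (separated_sections fun x => ⟨dualSystem EM FA A x⟩).twoTerm
    (separated_sections fun x => ⟨dualSystem EM FA A x⟩)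

namespace VBAlgebroid

variable {LA : LieAlgebroid 𝓘(ℝ, EM) FA A} {D : VBAlgebroid FE E FC C LA}
    {h h' : HorizontalLift D.dvb}
    {S S' : SuperData (Sections 𝓘(ℝ, EM) FC C) (Sections 𝓘(ℝ, EM) FE E) LA.lieRinehart}

theorem IsAssociated.isFlat (H : IsAssociated D h S) : S.IsFlat :=
  ((isAssociated_iff D h).mp H).isFlat D.alg.jacobi D.alg.rho_br

theorem IsAssociated.sq (H : IsAssociated D h S) : S.op * S.op = 0 :=
  SuperData.IsFlat.sq S (separated_twoTerm EM FA A FE E FC C) LA.rho_br H.isFlat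

theorem existsUnique_isAssociated (D : VBAlgebroid FE E FC C LA) (h : HorizontalLift D.dvb) :
    ∃! S : SuperData ΓC ΓE LA.lieRinehart,
      IsAssociated D h S := by
  obtain ⟨S, hS⟩ := D.exists_isAssociated h
  exact ⟨S, hS, fun S' hS' => ((isAssociated_iff D h).mp hS').unique ((isAssociated_iff D h).mp hS)⟩

theorem IsAssociated.op_eq (H : IsAssociated D h S) (H' : IsAssociated D h' S')
    {σ : ΓA [⋀^Fin 1]→ₗ[CM]
      (ΓE →ₗ[CM] ΓC)} (hσ : DifferBy h h' σ) :
    S'.op = (gauge σ : Module.End ℝ _) * S.op * (↑(gauge σ)⁻¹ : Module.End ℝ _) :=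
  (((isAssociated_iff D h).mp H).gaugeRel ((isAssociated_iff D h').mp H') hσ).op_eq
    (separated_twoTerm EM FA A FE E FC C)

end VBAlgebroid

end

section

open DoubleVectorBundle VBAlgebroid

namespace DoubleVectorBundle

theorem core_eq (D : DoubleVectorBundle EM FA A FE E FC C) (x : M) (c : C x) :
    D.core ⟨x, c⟩ = ⟨⟨x, 0⟩, D.iotaC ⟨x, 0⟩ c⟩ := by
  have h1 := D.addA_zero x 0 0
  rw [add_zero] at h1
  obtain ⟨a, u, v, h2, h3, h4⟩ := h1
  have h5 : (⟨a, u⟩ : TotalSpace D.overA.Model D.overA.Fiber) = ⟨a, u + v⟩ := h2.symm.trans h4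
  have h6 : (⟨a, v⟩ : TotalSpace D.overA.Model D.overA.Fiber) = ⟨a, u + v⟩ := h3.symm.trans h4
  have h7 : v = 0 := left_eq_add.mp (mk_inj h5)
  have h8 : D.AddA (D.core ⟨x, c⟩) ⟨⟨x, 0⟩, 0⟩ ⟨⟨x, 0⟩, D.iotaC ⟨x, 0⟩ c⟩ := D.addA_iotaC ⟨x, 0⟩ c
  obtain ⟨b, p, q, h9, h10, h11⟩ := h8
  rw [h3, h7] at h10
  obtain rfl : a = b := congrArg TotalSpace.proj h10
  rw [← mk_inj h10, add_zero] at h11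
  exact D.swap.injective (h9.trans h11.symm)

namespace HorizontalLift

variable {D D' D'' : DoubleVectorBundle EM FA A FE E FC C} (h : HorizontalLift D)
  (h' : HorizontalLift D')

theorem addA_hor (x : M) (e₁ e₂ : E x) (a : A x) :
    D.AddA ⟨⟨x, e₁⟩, h.hor ⟨x, e₁⟩ a⟩ ⟨⟨x, e₂⟩, h.hor ⟨x, e₂⟩ a⟩
      ⟨⟨x, e₁ + e₂⟩, h.hor ⟨x, e₁ + e₂⟩ a⟩ :=
  (h.isLinearOver _).add _ _ _ (AddRel.mk x e₁ e₂)

theorem mulA_hor (t : ℝ) (e : TotE) (a : A e.proj) :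
    D.mulA t e (h.hor e a) = h.hor (VBA.scale t e) a :=
  (scaleA_eq_iff.mp ((h.isLinearOver _).scale t e)).symm

/-- The point with components `a` and `c`. -/
def pt (e : TotE) (a : A e.proj) (c : C e.proj) : D.overE.Fiber e :=
  h.hor e a + D.iotaC e c

theorem pA_pt (e : TotE) (a : A e.proj) (c : C e.proj) : D.pA e (h.pt e a c) = a := by
  rw [pt, map_add, pA_hor, pA_iotaC, add_zero]

theorem kap_pt (e : TotE) (a : A e.proj) (c : C e.proj) : h.kap e (h.pt e a c) = c := by
  rw [pt, map_add, kap_hor, kap_iotaC, zero_add]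

theorem eq_pt (e : TotE) (d : D.overE.Fiber e) :
    d = h.pt e (D.pA e d) (h.kap e d) := h.decomp e d

theorem addA_pt (x : M) (e₁ e₂ : E x) (a : A x) (c₁ c₂ : C x) :
    D.AddA ⟨⟨x, e₁⟩, h.pt ⟨x, e₁⟩ a c₁⟩ ⟨⟨x, e₂⟩, h.pt ⟨x, e₂⟩ a c₂⟩
      ⟨⟨x, e₁ + e₂⟩, h.pt ⟨x, e₁ + e₂⟩ a (c₁ + c₂)⟩ :=
  (h.addA_hor x e₁ e₂ a).add (addA_iotaC_add x e₁ e₂ c₁ c₂)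

theorem mulA_pt (t : ℝ) (e : TotE) (a : A e.proj) (c : C e.proj) :
    D.mulA t e (h.pt e a c) = h.pt (VBA.scale t e) a (t • c) := by
  rw [pt, map_add, mulA_hor, h.mulA_iotaC]
  rfl

/-- The comparison of two double vector bundles with horizontal lifts, on fibres. -/
def trans (e : TotE) : D.overE.Fiber e →ₗ[ℝ] D'.overE.Fiber e :=
  h'.hor e ∘ₗ D.pA e + D'.iotaC e ∘ₗ h.kap e

theorem trans_apply (e : TotE) (d : D.overE.Fiber e) :
    h.trans h' e d = h'.pt e (D.pA e d) (h.kap e d) := rfl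

theorem trans_pt (e : TotE) (a : A e.proj) (c : C e.proj) :
    h.trans h' e (h.pt e a c) = h'.pt e a c := by
  rw [trans_apply, pA_pt, kap_pt]

theorem trans_trans (e : TotE) (d : D.overE.Fiber e) :
    h'.trans h e (h.trans h' e d) = d := by
  rw [trans_apply h, trans_pt]
  exact (h.eq_pt e d).symm

theorem contMDiff_trans : ContMDiff ((𝓘(ℝ, EM).prod 𝓘(ℝ, FE)).prod 𝓘(ℝ, D.overE.Model))
    ((𝓘(ℝ, EM).prod 𝓘(ℝ, FE)).prod 𝓘(ℝ, D'.overE.Model)) ∞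
    (fun d : D.Total => (⟨d.proj, h.trans h' d.proj d.snd⟩ : D'.Total)) := by
  intro d
  have h1 : ContMDiffAt ((𝓘(ℝ, EM).prod 𝓘(ℝ, FE)).prod 𝓘(ℝ, D.overE.Model))
      JE ∞ (fun d : D.Total => d.proj) d := contMDiffAt_proj D.overE.Fiber
  exact along_add (h'.contMDiffAt_hor h1 D.contMDiff_pA.contMDiffAt)
    (D'.contMDiffAt_iotaC h1 (h.contMDiffAt_kap (e := fun d : D.Total => d.proj)
      (d := fun d => d.snd) contMDiffAt_id))

/-- The comparison of two double vector bundles with horizontal lifts. -/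
def transport : Diffeomorph ((𝓘(ℝ, EM).prod 𝓘(ℝ, FE)).prod 𝓘(ℝ, D.overE.Model))
    ((𝓘(ℝ, EM).prod 𝓘(ℝ, FE)).prod 𝓘(ℝ, D'.overE.Model)) D.Total D'.Total ∞ where
  toFun d := ⟨d.proj, h.trans h' d.proj d.snd⟩
  invFun d := ⟨d.proj, h'.trans h d.proj d.snd⟩
  left_inv d := by
    change (⟨d.proj, h'.trans h d.proj (h.trans h' d.proj d.snd)⟩ : D.Total) = d
    rw [trans_trans]
  right_inv d := by
    change (⟨d.proj, h.trans h' d.proj (h'.trans h d.proj d.snd)⟩ : D'.Total) = d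
    rw [trans_trans]
  contMDiff_toFun := h.contMDiff_trans h'
  contMDiff_invFun := h'.contMDiff_trans h

theorem transport_mk (e : TotE) (d : D.overE.Fiber e) :
    h.transport h' ⟨e, d⟩ = ⟨e, h.trans h' e d⟩ := rfl

theorem transport_transport (d : D.Total) : h'.transport h (h.transport h' d) = d :=
  (h.transport h').left_inv d

theorem addE_of_addE {d₁ d₂ d : D.Total} (hd : AddRel d₁ d₂ d) :
    AddRel (h.transport h' d₁) (h.transport h' d₂) (h.transport h' d) := by
  obtain ⟨e, u, v, rfl, rfl, rfl⟩ := hd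
  rw [transport_mk, transport_mk, transport_mk, map_add]
  exact AddRel.mk _ _ _

theorem addA_of_addA {d₁ d₂ d : D.Total} (hd : D.AddA d₁ d₂ d) :
    D'.AddA (h.transport h' d₁) (h.transport h' d₂) (h.transport h' d) := by
  obtain ⟨e₁, v₁⟩ := d₁
  obtain ⟨e₂, v₂⟩ := d₂
  obtain ⟨e, v⟩ := d
  obtain ⟨x, w₁, w₂, rfl, rfl, rfl⟩ := hd.projE_eq
  have h1 := hd.projA_eq
  have h2 := hd.symm.projA_eq
  rw [projA_mk, projA_mk] at h1 h2
  have h3 : D.pA ⟨x, w₂⟩ v₂ = D.pA ⟨x, w₁⟩ v₁ := mk_inj (h2.symm.trans h1)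
  have h4 := h.eq_pt ⟨x, w₁⟩ v₁
  have h5 := h.eq_pt ⟨x, w₂⟩ v₂
  rw [h3] at h5
  revert h4 h5
  generalize D.pA ⟨x, w₁⟩ v₁ = a
  generalize h.kap ⟨x, w₁⟩ v₁ = c₁
  generalize h.kap ⟨x, w₂⟩ v₂ = c₂
  rintro rfl rfl
  have h6 := mk_inj (AddA.unique hd (h.addA_pt x w₁ w₂ a c₁ c₂))
  rw [h6]
  simp only [transport_mk]
  have h7 := h'.addA_pt x w₁ w₂ a c₁ c₂
  rw [← h.trans_pt h' ⟨x, w₁⟩, ← h.trans_pt h' ⟨x, w₂⟩, ← h.trans_pt h' ⟨x, w₁ + w₂⟩] at h7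
  exact h7

theorem transport_scaleA (t : ℝ) (d : D.Total) :
    h.transport h' (D.scaleA t d) = D'.scaleA t (h.transport h' d) := by
  obtain ⟨e, v⟩ := d
  rw [transport_mk, scaleA_mk, scaleA_mk, transport_mk, h.eq_pt e v, h.trans_pt, mulA_pt, mulA_pt]
  exact congrArg (fun z => (⟨VBA.scale t e, z⟩ : D'.Total)) (h.trans_pt h' (VBA.scale t e) _ _)

theorem transport_core (c : TotalSpace FC C) : h.transport h' (D.core c) = D'.core c := by
  obtain ⟨x, c⟩ := c
  have h1 := h.trans_pt h' ⟨x, 0⟩ 0 c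
  rw [pt, pt, map_zero, map_zero, zero_add, zero_add] at h1
  rw [core_eq, core_eq, transport_mk, h1]

/-- The comparison of sections. -/
def transSec (X : D.SectionsE) : D'.SectionsE :=
  ⟨fun e => h.trans h' e (X e), (h.transport h').contMDiff.comp X.contMDiff⟩

theorem transSec_apply (X : D.SectionsE) (e : TotE) :
    h.transSec h' X e = h.trans h' e (X e) := rfl

theorem trans_hor (e : TotE) (a : A e.proj) :
    h.trans h' e (h.hor e a) = h'.hor e a := by
  rw [trans_apply, pA_hor, kap_hor, pt, map_zero, add_zero]

theorem trans_iotaC (e : TotE) (c : C e.proj) :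
    h.trans h' e (D.iotaC e c) = D'.iotaC e c := by
  rw [trans_apply, pA_iotaC, kap_iotaC, pt, map_zero, zero_add]

theorem transSec_lift (X : ΓA) : h.transSec h' (h.lift X) = h'.lift X := by
  ext e
  rw [transSec_apply, lift_apply, lift_apply, trans_hor]

theorem transSec_coreSec (α : ΓC) :
    h.transSec h' (D.coreSec α) = D'.coreSec α := by
  ext e
  rw [transSec_apply, coreSec_apply, trans_iotaC, coreSec_apply]

theorem transSec_homSec
    (φ : ΓE →ₗ[CM] ΓC) :
    h.transSec h' (D.homSec φ) = D'.homSec φ := by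
  ext e
  rw [transSec_apply, homSec_apply, trans_iotaC, homSec_apply]

theorem transSec_add (X Y : D.SectionsE) :
    h.transSec h' (X + Y) = h.transSec h' X + h.transSec h' Y := by
  ext e
  exact map_add (h.trans h' e) _ _

theorem transSec_sub (X Y : D.SectionsE) :
    h.transSec h' (X - Y) = h.transSec h' X - h.transSec h' Y := by
  ext e
  exact map_sub (h.trans h' e) _ _

theorem transSec_neg (X : D.SectionsE) : h.transSec h' (-X) = -h.transSec h' X := by
  ext e
  exact map_neg (h.trans h' e) _

theorem transSec_zero : h.transSec h' 0 = 0 := by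
  ext e
  exact map_zero (h.trans h' e)

theorem transSec_smul (f : CE) (X : D.SectionsE) :
    h.transSec h' (f • X) = f • h.transSec h' X := by
  ext e
  exact map_smul (h.trans h' e) _ _

end HorizontalLift

end DoubleVectorBundle

namespace VBAlgebroid

variable {LA : LieAlgebroid 𝓘(ℝ, EM) FA A} {D D' : VBAlgebroid FE E FC C LA}
    {h : HorizontalLift D.dvb} {h' : HorizontalLift D'.dvb}
    {S : SuperData (Sections 𝓘(ℝ, EM) FC C) (Sections 𝓘(ℝ, EM) FE E) LA.lieRinehart}

theorem anchor_trans (H : Realizes LA D.pre h S) (H' : Realizes LA D'.pre h' S)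
    (e : TotE) (d : D.dvb.overE.Fiber e) :
    D'.alg.anchor e (h.trans h' e d) = D.alg.anchor e d := by
  refine tangent_ext ?_ fun l hl => ?_
  · rw [proj_anchor, proj_anchor, h.trans_apply, h'.pA_pt]
  · obtain ⟨ε, hε⟩ := exists_eq_apply (EM := EM) e
    have hX : ∀ a : A e.proj, mvfderiv JE l e (D'.alg.anchor e (h'.hor e a)) =
        mvfderiv JE l e (D.alg.anchor e (h.hor e a)) := by
      intro a
      have h1 := (H'.lift_fn ((dualSystem EM FA A e.proj).extend a) hl ε e.proj).trans
        (H.lift_fn ((dualSystem EM FA A e.proj).extend a) hl ε e.proj).symm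
      rw [← hε] at h1
      exact h1
    have hα : ∀ c : C e.proj, mvfderiv JE l e
        (D'.alg.anchor e (D'.dvb.iotaC e c)) =
        mvfderiv JE l e (D.alg.anchor e (D.dvb.iotaC e c)) := by
      intro c
      have h1 := (H'.core_fn ((dualSystem EM FC C e.proj).extend c) hl e).trans
        (H.core_fn ((dualSystem EM FC C e.proj).extend c) hl e).symm
      have h2 : (dualSystem EM FC C e.proj).extend c e.proj = c := DualSystem.extend_apply _ _
      change mvfderiv JE l e (D'.alg.anchor e (D'.dvb.iotaC e _)) =
        mvfderiv JE l e (D.alg.anchor e (D.dvb.iotaC e _)) at h1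
      rwa [h2] at h1
    conv_rhs => rw [h.decomp e d]
    rw [h.trans_apply, HorizontalLift.pt]
    simp only [map_add]
    rw [hX, hα]

theorem bracket_trans (H : Realizes LA D.pre h S) (H' : Realizes LA D'.pre h' S)
    (X Y : D.dvb.SectionsE) :
    h.transSec h' (D.pre.br X Y) = D'.pre.br (h.transSec h' X) (h.transSec h' Y) := by
  have hrho : ∀ (X : D.dvb.SectionsE) f, D'.pre.rho (h.transSec h' X) f = D.pre.rho X f := by
    intro X f
    ext e
    change mvfderiv JE f e (D'.alg.anchor e (h.trans h' e (X e))) = _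
    rw [anchor_trans H H']
    rfl
  let T : D.dvb.SectionsE → D.dvb.SectionsE → D'.dvb.SectionsE := fun X Y =>
    h.transSec h' (D.pre.br X Y) - D'.pre.br (h.transSec h' X) (h.transSec h' Y)
  have hadd : ∀ X Y Z, T X (Y + Z) = T X Y + T X Z := by
    intro X Y Z
    simp only [T, map_add, h.transSec_add]
    abel
  have hsmul : ∀ X (f : CE) Z,
      T X (f • Z) = f • T X Z := by
    intro X f Z
    simp only [T, PreLieRinehart.leibniz, h.transSec_add, h.transSec_smul, hrho, smul_sub]
    abel
  have hskew : ∀ X Y, T X Y = -T Y X := by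
    intro X Y
    simp only [T]
    rw [D.pre.br_skew X Y, D'.pre.br_skew (h.transSec h' X), h.transSec_neg]
    abel
  have hsum : ∀ X, (∀ Y, T X (h.lift Y) = 0) → (∀ α, T X (D.dvb.coreSec α) = 0) → ∀ Y, T X Y = 0 := by
    intro X h1 h2 Y
    ext e
    refine h.eq_zero_of_tensorial e (fun Y => T X Y e) (fun Y Z => ?_) (fun f Z => ?_)
      (fun Y => ?_) (fun α => ?_) Y
    · rw [hadd]; rfl
    · rw [hsmul]; rfl
    · rw [h1]; rfl
    · rw [h2]; rfl
  have hLL : ∀ X Y, T (h.lift X) (h.lift Y) = 0 := by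
    intro X Y
    simp only [T]
    rw [h.transSec_lift, h.transSec_lift, H.lift_lift, H'.lift_lift, h.transSec_sub,
      h.transSec_lift, h.transSec_homSec, sub_self]
  have hLC : ∀ X α, T (h.lift X) (D.dvb.coreSec α) = 0 := by
    intro X Y
    simp only [T]
    rw [h.transSec_lift, h.transSec_coreSec, H.lift_core, H'.lift_core, h.transSec_coreSec,
      sub_self]
  have hCC : ∀ α β, T (D.dvb.coreSec α) (D.dvb.coreSec β) = 0 := by
    intro X Y
    simp only [T]
    rw [h.transSec_coreSec, h.transSec_coreSec, H.core_core, H'.core_core, h.transSec_zero,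
      sub_self]
  have hL := fun X => hsum (h.lift X) (hLL X) (hLC X)
  have hC := fun α => hsum (D.dvb.coreSec α) (fun X => by rw [hskew, hLC, neg_zero]) (hCC α)
  exact sub_eq_zero.mp (hsum X (fun Y => by rw [hskew, hL, neg_zero])
    (fun α => by rw [hskew, hC, neg_zero]) Y)

/-- VB-algebroids with the same superconnection are isomorphic. -/
theorem nonempty_iso (H : Realizes LA D.pre h S) (H' : Realizes LA D'.pre h' S) :
    Nonempty (Iso D D') := by
  refine ⟨⟨h.transport h', fun _ => rfl, fun d => ?_, fun d₁ d₂ d => ⟨fun hd => ?_,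
    h.addE_of_addE h'⟩, fun t d => ?_, fun d₁ d₂ d => ⟨fun hd => ?_, h.addA_of_addA h'⟩,
    h.transport_scaleA h', h.transport_core h', fun d => ?_, fun X Y X' Y' hX hY e => ?_⟩⟩
  · obtain ⟨e, v⟩ := d
    rw [h.transport_mk, projA_mk, projA_mk, h.trans_apply, h'.pA_pt]
  · have h1 := h'.addE_of_addE h hd
    simpa only [h.transport_transport h'] using h1
  · exact congrArg (fun z => (⟨d.proj, z⟩ : D'.dvb.Total)) (map_smul (h.trans h' d.proj) t d.snd)
  · have h1 := h'.addA_of_addA h hd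
    simpa only [h.transport_transport h'] using h1
  · obtain ⟨e, v⟩ := d
    exact congrArg (fun z => (⟨e, z⟩ : TangentBundle JE TotE))
      (anchor_trans H H' e v)
  · have key : ∀ (Z : D.dvb.SectionsE) (Z' : D'.dvb.SectionsE),
        (∀ e, h.transport h' (at_ Z e) = at_ Z' e) → Z' = h.transSec h' Z := by
      intro Z Z' hZ
      ext e
      exact (mk_inj (hZ e)).symm
    rw [key X X' hX, key Y Y' hY]
    change _ = at_ (D'.pre.br _ _) e
    rw [← bracket_trans H H']
    rfl

end VBAlgebroid

end

section

open DoubleVectorBundle VBAlgebroid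

namespace VBAlgebroid.Iso

variable {LA : LieAlgebroid 𝓘(ℝ, EM) FA A} {D D' : VBAlgebroid FE E FC C LA} (Φ : Iso D D')

theorem exists_sec (Z : D.dvb.SectionsE) :
    ∃ Z' : D'.dvb.SectionsE, ∀ e, Φ.map (at_ Z e) = at_ Z' e := by
  choose s hs using fun e => D'.dvb.exists_mk (Φ.projE (at_ Z e))
  exact ⟨⟨s, (Φ.map.contMDiff.comp Z.contMDiff).congr fun e => (hs e).symm⟩, hs⟩

/-- The image of a section of `D → E` under an isomorphism. -/
def sec (Z : D.dvb.SectionsE) : D'.dvb.SectionsE := (Φ.exists_sec Z).choose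

theorem map_at (Z : D.dvb.SectionsE) (e : TotE) : Φ.map (at_ Z e) = at_ (Φ.sec Z) e :=
  (Φ.exists_sec Z).choose_spec e

variable {Φ} in
theorem sec_eq {Z : D.dvb.SectionsE} {Z' : D'.dvb.SectionsE}
    (h : ∀ e, Φ.map (at_ Z e) = at_ Z' e) : Φ.sec Z = Z' := by
  ext e
  exact mk_inj ((Φ.map_at Z e).symm.trans (h e))

theorem sec_add (Y Z : D.dvb.SectionsE) : Φ.sec (Y + Z) = Φ.sec Y + Φ.sec Z := by
  ext e
  have h := (Φ.addE _ _ _).mpr (AddRel.mk e (Y e) (Z e))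
  have hY := Φ.map_at Y e
  have hZ := Φ.map_at Z e
  have hYZ := Φ.map_at (Y + Z) e
  unfold at_ at hY hZ hYZ
  rw [hY, hZ] at h
  change AddRel _ _ (Φ.map ⟨e, (Y + Z) e⟩) at h
  rw [hYZ] at h
  exact h.eq

theorem sec_smul (t : ℝ) (Z : D.dvb.SectionsE) : Φ.sec (t • Z) = t • Φ.sec Z :=
  sec_eq fun e => (Φ.scaleE t (at_ Z e)).trans (congrArg (scale t) (Φ.map_at Z e))

theorem sec_sub (Y Z : D.dvb.SectionsE) : Φ.sec (Y - Z) = Φ.sec Y - Φ.sec Z := by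
  rw [sub_eq_add_neg, sub_eq_add_neg, ← neg_one_smul ℝ Z, sec_add, sec_smul, neg_one_smul]

theorem map_zeroE (e : TotE) : Φ.map (D.dvb.zeroE e) = D'.dvb.zeroE e := by
  have h := Φ.scaleE 0 (D.dvb.zeroE e)
  rw [scale_zero_eq, scale_zero_eq, Φ.projE] at h
  exact h

theorem sec_coreSec (α : ΓC) :
    Φ.sec (D.dvb.coreSec α) = D'.dvb.coreSec α := by
  refine (isCoreOf_iff _).mp fun e => ?_
  rw [← Φ.map_at, ← Φ.core, ← Φ.map_zeroE]
  exact (Φ.addA _ _ _).mpr ((isCoreOf_iff _).mpr rfl e)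

theorem sec_homSec (φ : ΓE →ₗ[CM] ΓC) :
    Φ.sec (D.dvb.homSec φ) = D'.dvb.homSec φ := by
  refine (isHomSection_iff _ _).mp fun ε x => ?_
  rw [← Φ.map_at, ← Φ.core, ← Φ.map_zeroE]
  exact (Φ.addA _ _ _).mpr ((isHomSection_iff _ _).mpr rfl ε x)

theorem sec_bracket (Y Z : D.dvb.SectionsE) :
    Φ.sec (D.alg.bracket Y Z) = D'.alg.bracket (Φ.sec Y) (Φ.sec Z) :=
  sec_eq (Φ.bracket Y Z _ _ (Φ.map_at Y) (Φ.map_at Z))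

theorem anchor_sec (Z : D.dvb.SectionsE) (e : TotE) :
    D'.alg.anchor e (Φ.sec Z e) = D.alg.anchor e (Z e) := by
  have h := Φ.anchor (at_ Z e)
  rw [Φ.map_at] at h
  exact eq_of_heq (TotalSpace.mk.inj h).2

/-- The image of a horizontal lift under an isomorphism. -/
def mapLift (h : HorizontalLift D.dvb) : HorizontalLift D'.dvb where
  lift X := Φ.sec (h.lift X)
  lift_add X Y := by rw [h.lift_add, sec_add]
  lift_smul f X e := by
    have h1 := (Φ.map_at (h.lift (f • X)) e).symm.trans
      ((congrArg (fun v => Φ.map ⟨e, v⟩) (h.lift_smul f X e)).trans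
        ((Φ.scaleE (f e.proj) (at_ (h.lift X) e)).trans
          (congrArg (scale (f e.proj)) (Φ.map_at (h.lift X) e))))
    exact mk_inj h1
  isLinearOver X :=
    { projA_eq := fun e => by rw [← Φ.map_at, Φ.projA, (h.isLinearOver X).projA_eq]
      add := fun e₁ e₂ e he => by
        rw [← Φ.map_at, ← Φ.map_at, ← Φ.map_at, Φ.addA]
        exact (h.isLinearOver X).add e₁ e₂ e he
      scale := fun t e => by rw [← Φ.map_at, ← Φ.map_at, ← Φ.scaleA, (h.isLinearOver X).scale] }

theorem isAssociated_mapLift {h : HorizontalLift D.dvb}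
    {S : SuperData ΓC ΓE LA.lieRinehart}
    (H : IsAssociated D h S) : IsAssociated D' (Φ.mapLift h) S where
  bd α a ha l hl e := by
    rw [(isCoreOf_iff _).mp ha, ← Φ.sec_coreSec, Φ.anchor_sec]
    exact H.bd α _ ((isCoreOf_iff _).mpr rfl) l hl e
  nablaC X α a ha := by
    rw [(isCoreOf_iff _).mp ha, ← Φ.sec_coreSec, isCoreOf_iff, ← Φ.sec_coreSec]
    change D'.alg.bracket (Φ.sec _) _ = _
    rw [← Φ.sec_bracket]
    exact congrArg Φ.sec ((isCoreOf_iff _).mp (H.nablaC X α _ ((isCoreOf_iff _).mpr rfl)))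
  nablaS X ε l hl x := by
    change _ = _ - mvfderiv _ l _ (D'.alg.anchor _ (Φ.sec _ _))
    rw [Φ.anchor_sec]
    exact H.nablaS X ε l hl x
  curv X Y := by
    rw [isHomSection_iff, ← Φ.sec_homSec, ← (isHomSection_iff _ _).mp (H.curv X Y), sec_sub,
      sec_bracket]
    rfl

end VBAlgebroid.Iso

end

section

variable (EM A E C)

variable (FA FE FC) in
/-- The manifold `A ×_M E ×_M C`, as a vector bundle over `E`. -/
abbrev splitE : SmoothVectorBundle.{u} JE TotE :=
  pullProd FA A FC C (projM EM FE E)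

local notation "TotD" =>
  TotalSpace (SmoothVectorBundle.Model (splitE EM FA A FE E FC C))
    (SmoothVectorBundle.Fiber (splitE EM FA A FE E FC C))

variable (FA FE FC) in
/-- The fibrewise interchange of the sides of `A ×_M E ×_M C`. -/
def splitSwap (d : TotD) :
    TotalSpace (splitE EM FE E FA A FC C).Model (splitE EM FE E FA A FC C).Fiber :=
  ⟨⟨d.proj.proj, d.snd.1⟩, (d.proj.snd, d.snd.2)⟩

theorem contMDiff_splitSwap : ContMDiff
    ((𝓘(ℝ, EM).prod 𝓘(ℝ, FE)).prod 𝓘(ℝ, (splitE EM FA A FE E FC C).Model))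
    ((𝓘(ℝ, EM).prod 𝓘(ℝ, FA)).prod 𝓘(ℝ, (splitE EM FE E FA A FC C).Model)) ∞
    (splitSwap EM FA A FE E FC C) := by
  intro d
  obtain ⟨h1, h2, h3⟩ := (contMDiffAt_pullProd_iff (projM EM FE E)
    (b := fun d : TotD => d.proj)
    (s := fun d => d.snd.1) (t := fun d => d.snd.2)).mp (contMDiffAt_id (x := d))
  exact (contMDiffAt_pullProd_iff (projM EM FA A)
    (b := fun d : TotD =>
      (⟨d.proj.proj, d.snd.1⟩ : TotalSpace FA A))
    (s := fun d => d.proj.snd) (t := fun d => d.snd.2)).mpr ⟨h2, h1, h3⟩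

variable {EM A E C}

theorem split_inj {x : M} {e e' : E x} {a a' : A x} {c c' : C x}
    (h : (⟨⟨x, e⟩, (a, c)⟩ : TotD) =
      ⟨⟨x, e'⟩, (a', c')⟩) : e = e' ∧ a = a' ∧ c = c' := by
  obtain rfl : e = e' := mk_inj (congrArg TotalSpace.proj h)
  have h1 := mk_inj h
  exact ⟨rfl, Prod.mk.inj h1⟩

theorem splitSwap_addRel {d₁ d₂ d : TotD} :
    AddRel (splitSwap EM FA A FE E FC C d₁) (splitSwap EM FA A FE E FC C d₂)
      (splitSwap EM FA A FE E FC C d) ↔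
    ∃ (x : M) (a : A x) (e e' : E x) (c c' : C x),
      d₁ = ⟨⟨x, e⟩, (a, c)⟩ ∧ d₂ = ⟨⟨x, e'⟩, (a, c')⟩ ∧ d = ⟨⟨x, e + e'⟩, (a, c + c')⟩ := by
  have hs : ∀ d, splitSwap EM FE E FA A FC C (splitSwap EM FA A FE E FC C d) = d := fun _ => rfl
  constructor
  · rintro ⟨⟨x, a⟩, ⟨e, c⟩, ⟨e', c'⟩, h1, h2, h3⟩
    refine ⟨x, a, e, e', c, c', ?_, ?_, ?_⟩
    · rw [← hs d₁, h1]; rfl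
    · rw [← hs d₂, h2]; rfl
    · rw [← hs d, h3]; rfl
  · rintro ⟨x, a, e, e', c, c', rfl, rfl, rfl⟩
    exact ⟨⟨x, a⟩, (e, c), (e', c'), rfl, rfl, rfl⟩

variable (EM FA A FE E FC C) in
/-- The split double vector bundle `A ×_M E ×_M C`. -/
def splitDVB : DoubleVectorBundle EM FA A FE E FC C where
  overE := splitE EM FA A FE E FC C
  overA := splitE EM FE E FA A FC C
  swap :=
    { toFun := splitSwap EM FA A FE E FC C
      invFun := splitSwap EM FE E FA A FC C
      left_inv := fun _ => rfl
      right_inv := fun _ => rfl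
      contMDiff_toFun := contMDiff_splitSwap EM A E C
      contMDiff_invFun := contMDiff_splitSwap EM E A C }
  proj_comm _ := rfl
  projA_add := by
    rintro _ _ _ ⟨e, ⟨a, c⟩, ⟨a', c'⟩, rfl, rfl, rfl⟩
    exact AddRel.mk _ a a'
  projA_scale _ _ := rfl
  projE_add := by
    intro d₁ d₂ d h
    obtain ⟨x, a, e, e', c, c', rfl, rfl, rfl⟩ := splitSwap_addRel.mp h
    exact AddRel.mk _ e e'
  projE_scale _ _ := rfl
  interchange := by
    rintro _ _ _ _ _ _ d₁₃ d₂₄ d ⟨⟨x, e⟩, ⟨a, c⟩, ⟨a', c'⟩, rfl, rfl, rfl⟩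
      ⟨⟨y, f⟩, ⟨b, k⟩, ⟨b', k'⟩, rfl, rfl, rfl⟩ h1 h2 h3
    obtain ⟨x₁, a₁, e₁, f₁, c₁, k₁, h4, h5, rfl⟩ := splitSwap_addRel.mp h1
    obtain rfl : x = x₁ := congrArg (fun d => d.proj.proj) h4
    obtain rfl : y = x := congrArg (fun d => d.proj.proj) h5
    obtain ⟨rfl, rfl, rfl⟩ := split_inj h4
    obtain ⟨rfl, rfl, rfl⟩ := split_inj h5
    obtain ⟨x₁, a₁, e₁, f₁, c₁, k₁, h4, h5, rfl⟩ := splitSwap_addRel.mp h2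
    obtain rfl : y = x₁ := congrArg (fun d => d.proj.proj) h4
    obtain ⟨rfl, rfl, rfl⟩ := split_inj h4
    obtain ⟨rfl, rfl, rfl⟩ := split_inj h5
    obtain ⟨x₁, a₁, e₁, f₁, c₁, k₁, h4, h5, rfl⟩ := splitSwap_addRel.mp h3
    obtain rfl : y = x₁ := congrArg (fun d => d.proj.proj) h4
    obtain ⟨rfl, rfl, rfl⟩ := split_inj h4
    obtain ⟨rfl, -, rfl⟩ := split_inj h5
    refine ⟨⟨y, e + f⟩, (b, HAdd.hAdd (α := C y) (β := C y) c k),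
      (b', HAdd.hAdd (α := C y) (β := C y) c' k'), rfl, rfl, ?_⟩
    exact congrArg (fun z => (⟨⟨y, e + f⟩, (b + b', z)⟩ :
      TotD))
      (add_add_add_comm (G := C y) c c' k k')
  scaleA_add := by
    rintro t _ _ _ ⟨⟨x, e⟩, ⟨a, c⟩, ⟨a', c'⟩, rfl, rfl, rfl⟩
    refine ⟨⟨x, t • e⟩, (a, t • c), (a', t • c'), rfl, rfl, ?_⟩
    exact congrArg (fun z => (⟨⟨x, t • e⟩, (a + a', z)⟩ :
      TotD)) (smul_add t c c')
  scaleE_add := by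
    intro t d₁ d₂ d h
    obtain ⟨x, a, e, e', c, c', rfl, rfl, rfl⟩ := splitSwap_addRel.mp h
    refine splitSwap_addRel.mpr ⟨x, t • a, e, e', t • c, t • c', rfl, rfl, ?_⟩
    exact congrArg (fun z => (⟨⟨x, e + e'⟩, (t • a, z)⟩ :
      TotD)) (smul_add t c c')
  scale_comm s t d := congrArg (fun z => (⟨⟨d.proj.proj, s • d.proj.snd⟩, (t • d.snd.1, z)⟩ :
      TotD))
      (smul_comm s t d.snd.2)
  core c := ⟨⟨c.proj, 0⟩, (0, c.snd)⟩
  contMDiff_core c := (contMDiffAt_pullProd_iff (projM EM FE E)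
    (b := fun c : TotalSpace FC C => (⟨c.proj, 0⟩ : TotE))
    (s := fun _ => 0) (t := fun c => c.snd)).mpr
      ⟨along_zero (contMDiffAt_proj C), along_zero (contMDiffAt_proj C), contMDiffAt_id⟩
  core_projE _ := rfl
  core_projA _ := rfl
  core_add := by
    rintro _ _ _ ⟨x, c, c', rfl, rfl, rfl⟩
    refine ⟨⟨x, 0⟩, (0, c), (0, c'), rfl, rfl, ?_⟩
    exact congrArg (fun z => (⟨⟨x, 0⟩, (z, c + c')⟩ :
      TotD)) (add_zero (0 : A x)).symm
  core_scale t c := congrArg (fun z => (⟨⟨c.proj, 0⟩, (z, t • c.snd)⟩ :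
      TotD)) (smul_zero (A := A c.proj) t).symm
  core_exists_unique := by
    rintro x ⟨e, ⟨a, c⟩⟩ (rfl : e = ⟨x, 0⟩) h2
    obtain rfl : a = 0 := mk_inj h2
    refine ⟨⟨x, c⟩, ⟨rfl, rfl⟩, ?_⟩
    rintro ⟨y, c'⟩ ⟨(rfl : y = x), h3⟩
    obtain rfl : c' = c := (split_inj h3).2.2
    rfl

theorem splitDVB_addA {x : M} {a : A x} {e e' : E x} {c c' : C x} :
    (splitDVB EM FA A FE E FC C).AddA ⟨⟨x, e⟩, (a, c)⟩ ⟨⟨x, e'⟩, (a, c')⟩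
      ⟨⟨x, e + e'⟩, (a, c + c')⟩ :=
  splitSwap_addRel.mpr ⟨x, a, e, e', c, c', rfl, rfl, rfl⟩

theorem splitDVB_pA (e : TotE) (d : A e.proj × C e.proj) :
    (splitDVB EM FA A FE E FC C).pA e d = d.1 :=
  mk_inj ((splitDVB EM FA A FE E FC C).projA_mk e d).symm

theorem splitDVB_iotaC (e : TotE) (c : C e.proj) :
    (splitDVB EM FA A FE E FC C).iotaC e c = ((0, c) : A e.proj × C e.proj) := by
  refine (DoubleVectorBundle.eq_iotaC _ ?_).symm
  have h := splitDVB_addA (EM := EM) (FA := FA) (FE := FE) (FC := FC)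
    (a := (0 : A e.proj)) (e := 0) (e' := e.snd) (c := c) (c' := 0)
  rw [zero_add, add_zero] at h
  exact h

/-- A pair of sections of `A` and `C`, pulled back to `E`. -/
def splitSec (X : ΓA) (α : ΓC) :
    (splitDVB EM FA A FE E FC C).SectionsE :=
  ⟨fun e => ((X e.proj, α e.proj) : A e.proj × C e.proj), fun e =>
    (contMDiffAt_pullProd_iff (projM EM FE E) (b := fun e : TotE => e)
      (s := fun e => X e.proj) (t := fun e => α e.proj)).mpr ⟨contMDiffAt_id,
        X.contMDiff.contMDiffAt.comp e (contMDiffAt_proj E),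
        α.contMDiff.contMDiffAt.comp e (contMDiffAt_proj E)⟩⟩

variable (EM FA A FE E FC C) in
/-- The horizontal lift `X ↦ (X, 0)`. -/
def splitLift : DoubleVectorBundle.HorizontalLift (splitDVB EM FA A FE E FC C) where
  lift X := splitSec X 0
  lift_add X Y := by
    ext e
    exact Prod.ext rfl (add_zero (0 : C e.proj)).symm
  lift_smul f X e := Prod.ext rfl (smul_zero (A := C e.proj) _).symm
  isLinearOver X :=
    { projA_eq := fun _ => rfl
      add := by
        rintro _ _ _ ⟨x, e, e', rfl, rfl, rfl⟩
        have h := splitDVB_addA (EM := EM) (FA := FA) (FE := FE) (FC := FC)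
          (a := X x) (e := e) (e' := e') (c := (0 : C x)) (c' := 0)
        rw [add_zero] at h
        exact h
      scale := fun t e => congrArg (fun z => (⟨⟨e.proj, t • e.snd⟩, (X e.proj, z)⟩ :
        TotD))
        (smul_zero (A := C e.proj) t).symm }

theorem splitDVB_coreSec (α : ΓC) :
    (splitDVB EM FA A FE E FC C).coreSec α = splitSec 0 α := by
  ext e
  exact splitDVB_iotaC e (α e.proj)

end

section

variable {LA : LieAlgebroid 𝓘(ℝ, EM) FA A}
  (S : SuperData (Sections 𝓘(ℝ, EM) FC C) (Sections 𝓘(ℝ, EM) FE E) LA.lieRinehart)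

namespace SuperData

/-- The function `ρ_A(X)⟨ε, l⟩ - ⟨∇^s_X ε, l⟩` depends on the values of `X` and `ε` only. -/
theorem exists_sideForm {l : TotE → ℝ} (hl : IsFiberLinear (EM := EM) l) (x : M) :
    ∃ B : A x →ₗ[ℝ] E x →ₗ[ℝ] ℝ, ∀ (X : ΓA) (ε : ΓE),
      B (X x) (ε x) = mvfderiv JM (hl.comp ε) x (LA.anchor x (X x)) -
        l ⟨x, S.nablaS.nabla X ε x⟩ := by
  have hla := fun (a b : E x) => (hl.linear x).map_add a b
  have hls := fun (c : ℝ) (a : E x) => (hl.linear x).map_smul c a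
  refine exists_bilin x _ (fun X Y ε => ?_) (fun X ε η => ?_) (fun f X ε => ?_) (fun f X ε => ?_)
  · rw [map_add, LinearMap.add_apply, sec_add_apply, sec_add_apply, map_add, map_add, hla]
    ring
  · have h1 : mvfderiv JM (hl.comp (ε + η)) x (LA.anchor x (X x)) =
        mvfderiv JM (hl.comp ε) x (LA.anchor x (X x)) +
        mvfderiv JM (hl.comp η) x (LA.anchor x (X x)) := by
      have h2 : hl.comp (ε + η) = hl.comp ε + hl.comp η := by
        ext y
        exact (hl.linear y).map_add _ _
      rw [h2]
      exact congrArg (fun f : CM => f x)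
        ((LA.lieRinehart.rho X).map_add (hl.comp ε) (hl.comp η))
    rw [h1, map_add, sec_add_apply, hla]
    ring
  · rw [map_smul, LinearMap.smul_apply, smul_sec_apply, smul_sec_apply, map_smul, map_smul, hls]
    simp only [smul_eq_mul]
    ring
  · have h1 : mvfderiv JM (hl.comp (f • ε)) x (LA.anchor x (X x)) =
        f x * mvfderiv JM (hl.comp ε) x (LA.anchor x (X x)) +
        l ⟨x, ε x⟩ * mvfderiv JM f x (LA.anchor x (X x)) := by
      rw [← show hl.comp ε x = l ⟨x, ε x⟩ from rfl,
        ← dfun_mul (mdiffAt_fn f x) (mdiffAt_fn (hl.comp ε) x)]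
      refine congrArg (fun g : M → ℝ => mvfderiv JM g x _) ?_
      ext y
      exact (hl.linear y).map_smul _ _
    rw [h1, S.nablaS.leibniz, sec_add_apply, smul_sec_apply, smul_sec_apply, hla, hls, hls]
    change _ - (_ + mvfderiv JM f x (LA.anchor x (X x)) • _) = _
    simp only [smul_eq_mul]
    ring

/-- The bilinear form `(X, ε) ↦ ρ_A(X)⟨ε, l⟩ - ⟨∇^s_X ε, l⟩` on the fibres. -/
def sideForm {l : TotE → ℝ} (hl : IsFiberLinear (EM := EM) l) (x : M) :
    A x →ₗ[ℝ] E x →ₗ[ℝ] ℝ := (S.exists_sideForm hl x).choose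

theorem sideForm_apply {l : TotE → ℝ} (hl : IsFiberLinear (EM := EM) l) (x : M)
    (X : ΓA) (ε : ΓE) :
    S.sideForm hl x (X x) (ε x) = mvfderiv JM (hl.comp ε) x (LA.anchor x (X x)) -
      l ⟨x, S.nablaS.nabla X ε x⟩ := (S.exists_sideForm hl x).choose_spec X ε

theorem exists_anchor (e : TotE) (d : A e.proj × C e.proj) :
    ∃ v : TangentSpace JE e,
      mfderiv JE JM TotalSpace.proj e v = LA.anchor e.proj d.1 ∧
      ∀ l (hl : IsFiberLinear (EM := EM) l), mvfderiv JE l e v =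
        S.sideForm hl e.proj d.1 e.snd - l ⟨e.proj, homFib S.bd e.proj d.2⟩ := by
  let X₀ := (dualSystem EM FA A e.proj).extend d.1
  let ε₀ := (dualSystem EM FE E e.proj).extend e.snd
  have hX₀ : X₀ e.proj = d.1 := DualSystem.extend_apply _ _
  have hε₀ : ε₀ e.proj = e.snd := DualSystem.extend_apply _ _
  obtain ⟨v, hv, hvl⟩ := exists_tangent e (LA.anchor e.proj d.1) (fun l =>
    mvfderiv JM (fun y => l ⟨y, ε₀ y⟩) e.proj (LA.anchor e.proj d.1) -
      l ⟨e.proj, S.nablaS.nabla X₀ ε₀ e.proj⟩ - l ⟨e.proj, homFib S.bd e.proj d.2⟩)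
    (fun l l' hl hl' => by
      have h1 := dfun_add (mdiffAt_fn (hl.comp ε₀) e.proj) (mdiffAt_fn (hl'.comp ε₀) e.proj)
        (LA.anchor e.proj d.1)
      refine (congrArg (fun z => z - _ - _) h1).trans ?_
      change _ = mvfderiv JM (hl.comp ε₀) _ _ - _ - _ +
        (mvfderiv JM (hl'.comp ε₀) _ _ - _ - _)
      ring)
    (fun f l hl => by
      have h1 := dfun_mul (mdiffAt_fn f e.proj) (mdiffAt_fn (hl.comp ε₀) e.proj)
        (LA.anchor e.proj d.1)
      refine (congrArg (fun z => z - _ - _) h1).trans ?_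
      have h2 : hl.comp ε₀ e.proj = l e := congrArg (fun z => l ⟨e.proj, z⟩) hε₀
      rw [h2]
      change _ = _ * (mvfderiv JM (hl.comp ε₀) _ _ - _ - _) + _
      ring)
  refine ⟨v, hv, fun l hl => (hvl l hl).trans ?_⟩
  have h1 := S.sideForm_apply hl e.proj X₀ ε₀
  rw [hX₀, hε₀] at h1
  rw [h1]
  rfl

/-- The anchor of the split VB-algebroid. -/
def anchor (e : TotE) :
    A e.proj × C e.proj →ₗ[ℝ] TangentSpace JE e where
  toFun d := (S.exists_anchor e d).choose
  map_add' d d' := by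
    obtain ⟨h1, h2⟩ := (S.exists_anchor e d).choose_spec
    obtain ⟨h3, h4⟩ := (S.exists_anchor e d').choose_spec
    obtain ⟨h5, h6⟩ := (S.exists_anchor e (d + d')).choose_spec
    refine tangent_ext ?_ fun l hl => ?_
    · rw [h5, map_add, h1, h3, Prod.fst_add, map_add]
    · rw [h6 l hl, map_add, h2 l hl, h4 l hl, Prod.fst_add, Prod.snd_add, map_add, map_add,
        LinearMap.add_apply, (hl.linear _).map_add]
      ring
  map_smul' t d := by
    obtain ⟨h1, h2⟩ := (S.exists_anchor e d).choose_spec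
    obtain ⟨h5, h6⟩ := (S.exists_anchor e (t • d)).choose_spec
    refine tangent_ext ?_ fun l hl => ?_
    · rw [h5, map_smul, RingHom.id_apply, h1, Prod.smul_fst, map_smul]
    · rw [h6 l hl, map_smul, RingHom.id_apply, h2 l hl, Prod.smul_fst, Prod.smul_snd, map_smul,
        map_smul, LinearMap.smul_apply, (hl.linear _).map_smul, smul_sub]

theorem proj_anchor (e : TotE) (d : A e.proj × C e.proj) :
    mfderiv JE JM TotalSpace.proj e (S.anchor e d) =
      LA.anchor e.proj d.1 :=
  (S.exists_anchor e d).choose_spec.1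

theorem anchor_fn (e : TotE) (d : A e.proj × C e.proj) {l : TotE → ℝ}
    (hl : IsFiberLinear (EM := EM) l) :
    mvfderiv JE l e (S.anchor e d) =
      S.sideForm hl e.proj d.1 e.snd - l ⟨e.proj, homFib S.bd e.proj d.2⟩ :=
  (S.exists_anchor e d).choose_spec.2 l hl

theorem contMDiff_anchor :
    ContMDiff ((𝓘(ℝ, EM).prod 𝓘(ℝ, FE)).prod 𝓘(ℝ, (splitE EM FA A FE E FC C).Model))
      (𝓘(ℝ, EM).prod 𝓘(ℝ, FE)).tangent ∞
      (fun d : TotalSpace (splitE EM FA A FE E FC C).Model (splitE EM FA A FE E FC C).Fiber =>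
        (⟨d.proj, S.anchor d.proj d.snd⟩ :
          TangentBundle JE TotE)) := by
  intro d
  obtain ⟨h1, h2, h3⟩ := (contMDiffAt_pullProd_iff (projM EM FE E)
    (b := fun d : TotalSpace (splitE EM FA A FE E FC C).Model (splitE EM FA A FE E FC C).Fiber => d.proj)
    (s := fun d => d.snd.1) (t := fun d => d.snd.2)).mp (contMDiffAt_id (x := d))
  refine contMDiffAt_tangent (v := fun d : TotalSpace (splitE EM FA A FE E FC C).Model
    (splitE EM FA A FE E FC C).Fiber => S.anchor d.proj d.snd) h1 ?_ fun l hl => ?_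
  · refine (LA.contMDiff_anchor.contMDiffAt.comp d h2).congr_of_eventuallyEq
      (Filter.Eventually.of_forall fun q => ?_)
    exact congrArg (fun v => (⟨q.proj.proj, v⟩ : TangentBundle JM M))
      (S.proj_anchor q.proj q.snd)
  · refine ((contMDiffAt_bilin h2 h1 (fun d : TotalSpace (splitE EM FA A FE E FC C).Model
      (splitE EM FA A FE E FC C).Fiber => S.sideForm hl d.proj.proj) fun X ε => ?_).sub
      (hl.contMDiff.contMDiffAt.comp d
        ((contMDiff_homFib S.bd).contMDiffAt.comp d h3))).congr_of_eventuallyEq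
      (Filter.Eventually.of_forall fun q => S.anchor_fn q.proj q.snd hl)
    refine (((LA.lieRinehart.rho X (hl.comp ε)).contMDiff.sub
      (hl.comp (S.nablaS.nabla X ε)).contMDiff).contMDiffAt.comp d
        ((contMDiffAt_proj E).comp d h1)).congr_of_eventuallyEq
      (Filter.Eventually.of_forall fun q => S.sideForm_apply hl q.proj.proj X ε)

end SuperData

end

section

/-- A pair of sections of `A` and `C`, as a section of `A ⊕ C`. -/
def pairSec (X : ΓA) (α : ΓC) :
    Sections JM (FA × FC) (A ×ᵇ C) :=
  ⟨fun x => (X x, α x), fun x => (contMDiffAt_prod_iff (b := fun y : M => y)).mpr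
    ⟨X.contMDiff x, α.contMDiff x⟩⟩

/-- The first component of a section of `A ⊕ C`. -/
def fstSec (W : Sections JM (FA × FC) (A ×ᵇ C)) : ΓA :=
  ⟨fun x => (W x).1, fun x => ((contMDiffAt_prod_iff (b := fun y : M => y) (s := fun x => (W x).1)
    (t := fun x => (W x).2)).mp (W.contMDiff x)).1⟩

/-- The second component of a section of `A ⊕ C`. -/
def sndSec (W : Sections JM (FA × FC) (A ×ᵇ C)) : ΓC :=
  ⟨fun x => (W x).2, fun x => ((contMDiffAt_prod_iff (b := fun y : M => y) (s := fun x => (W x).1)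
    (t := fun x => (W x).2)).mp (W.contMDiff x)).2⟩

theorem pair_along {s : (e : TotE) → A e.proj × C e.proj} :
    ContMDiff JE (𝓘(ℝ, EM).prod 𝓘(ℝ, FA × FC)) ∞
      (fun e => (⟨e.proj, s e⟩ : TotalSpace (FA × FC) (A ×ᵇ C))) ↔
    ContMDiff JE
      ((𝓘(ℝ, EM).prod 𝓘(ℝ, FE)).prod 𝓘(ℝ, (splitE EM FA A FE E FC C).Model)) ∞
      (fun e => (⟨e, s e⟩ :
        TotalSpace (splitE EM FA A FE E FC C).Model (splitE EM FA A FE E FC C).Fiber)) := by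
  refine forall_congr' fun e => ?_
  have h1 := contMDiffAt_prod_iff (F := FA) (V := A) (F' := FC) (V' := C) (I := JM) (J := JE) (p := e)
    (b := fun e : TotE => e.proj) (s := fun e => (s e).1) (t := fun e => (s e).2)
  have h2 := contMDiffAt_pullProd_iff (F := FA) (V := A) (F' := FC) (V' := C) (I := JM) (J := JE)
    (p := e) (projM EM FE E)
    (b := fun e : TotE => e) (s := fun e => (s e).1) (t := fun e => (s e).2)
  exact h1.trans (((and_iff_right contMDiffAt_id).symm).trans h2.symm)

variable {LA : LieAlgebroid 𝓘(ℝ, EM) FA A}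
  (S : SuperData (Sections 𝓘(ℝ, EM) FC C) (Sections 𝓘(ℝ, EM) FE E) LA.lieRinehart)

namespace SuperData

/-- The brackets of the sections pulled back from `A ⊕ C`. -/
def basicBracket (W W' : Sections JM (FA × FC) (A ×ᵇ C)) (e : TotE) :
    A e.proj × C e.proj :=
  (LA.bracket (fstSec (FC := FC) (C := C) W) (fstSec (FC := FC) (C := C) W') e.proj,
    S.nablaC.nabla (fstSec W) (sndSec W') e.proj - S.nablaC.nabla (fstSec W') (sndSec W) e.proj -
      homFib (EM := EM) (S.curv ![fstSec W, fstSec W']) e.proj e.snd)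

theorem homFib_curv_swap (X Y : ΓA) (e : TotE) :
    homFib (S.curv ![Y, X]) e.proj e.snd = -homFib (S.curv ![X, Y]) e.proj e.snd := by
  obtain ⟨ε, hε⟩ := exists_eq_apply (EM := EM) e
  rw [hε, homFib_apply, homFib_apply, curv_swap S.curv]
  rfl

theorem homFib_curv_add (X Y Z : ΓA) (e : TotE) :
    homFib (S.curv ![X + Y, Z]) e.proj e.snd =
      homFib (S.curv ![X, Z]) e.proj e.snd + homFib (S.curv ![Y, Z]) e.proj e.snd := by
  obtain ⟨ε, hε⟩ := exists_eq_apply (EM := EM) e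
  rw [hε, homFib_apply, homFib_apply, homFib_apply, S.curv.map_vecCons_add]
  rfl

theorem homFib_curv_smul (f : CM) (X Z : ΓA) (e : TotE) :
    homFib (S.curv ![f • X, Z]) e.proj e.snd = f e.proj • homFib (S.curv ![X, Z]) e.proj e.snd := by
  obtain ⟨ε, hε⟩ := exists_eq_apply (EM := EM) e
  rw [hε, homFib_apply, homFib_apply, S.curv.map_vecCons_smul]
  rfl

theorem basicBracket_skew (X Y : Sections JM (FA × FC) (A ×ᵇ C)) (e : TotE) :
    S.basicBracket Y X e = -S.basicBracket X Y e := by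
  refine Prod.ext ?_ ?_
  · exact congrArg (fun s : ΓA => s e.proj)
      (LA.lieRinehart.toPre.br_skew (fstSec X) (fstSec Y))
  · change _ - _ - _ = -(_ - _ - _)
    rw [homFib_curv_swap]
    abel

theorem basicBracket_add (X Y Z : Sections JM (FA × FC) (A ×ᵇ C)) (e : TotE) :
    S.basicBracket X (Y + Z) e = S.basicBracket X Y e + S.basicBracket X Z e := by
  have h1 : fstSec (Y + Z) = fstSec Y + fstSec Z := rfl
  have h2 : sndSec (Y + Z) = sndSec Y + sndSec Z := rfl
  refine Prod.ext ?_ ?_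
  · change LA.bracket _ _ _ = LA.bracket _ _ _ + LA.bracket _ _ _
    rw [h1, map_add, sec_add_apply]
  · change _ - _ - _ = (_ - _ - _) + (_ - _ - _)
    rw [h1, h2, map_add, map_add, LinearMap.add_apply, sec_add_apply, sec_add_apply,
      homFib_curv_swap, homFib_curv_add, homFib_curv_swap S (fstSec X),
      homFib_curv_swap S (fstSec X)]
    abel

theorem basicBracket_leibniz (X : Sections JM (FA × FC) (A ×ᵇ C)) (f : CM)
    (Y : Sections JM (FA × FC) (A ×ᵇ C)) (e : TotE) :
    S.basicBracket X (f • Y) e = f e.proj • S.basicBracket X Y e +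
      mvfderiv JM f e.proj (LA.anchor e.proj (X e.proj).1) • Y e.proj := by
  have h1 : fstSec (f • Y) = f • fstSec Y := rfl
  have h2 : sndSec (f • Y) = f • sndSec Y := rfl
  refine Prod.ext ?_ ?_
  · exact (congrArg (fun s => LA.bracket (fstSec X) s e.proj) h1).trans (LA.leibniz _ _ _ _)
  · change _ - _ - _ = f e.proj • (_ - _ - _) + _
    rw [h1, h2, S.nablaC.leibniz, map_smul, LinearMap.smul_apply, sec_add_apply, smul_sec_apply,
      smul_sec_apply, smul_sec_apply, homFib_curv_swap, homFib_curv_smul,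
      homFib_curv_swap S (fstSec X), smul_sub, smul_sub, smul_neg]
    change _ + mvfderiv JM f e.proj (LA.anchor e.proj (X e.proj).1) • (Y e.proj).2 - _ - _ =
      _ + mvfderiv JM f e.proj (LA.anchor e.proj (X e.proj).1) • (Y e.proj).2
    abel

theorem contMDiff_basicBracket (X Y : Sections JM (FA × FC) (A ×ᵇ C)) :
    ContMDiff JE (𝓘(ℝ, EM).prod 𝓘(ℝ, FA × FC)) ∞
      (fun e : TotE =>
        (⟨e.proj, S.basicBracket X Y e⟩ : TotalSpace (FA × FC) (A ×ᵇ C))) := by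
  intro e
  refine (contMDiffAt_prod_iff (b := fun e : TotE => e.proj)).mpr ⟨?_, ?_⟩
  · exact (LA.bracket (fstSec X) (fstSec Y)).contMDiff.contMDiffAt.comp e (contMDiffAt_proj E)
  · have h1 := (S.nablaC.nabla (fstSec X) (sndSec Y) -
      S.nablaC.nabla (fstSec Y) (sndSec X)).contMDiff.contMDiffAt.comp e (contMDiffAt_proj E)
    refine AddRel.contMDiffAt h1 (contMDiff_homFib (S.curv ![fstSec Y, fstSec X])).contMDiffAt
      fun e' => ⟨e'.proj, _, _, rfl, rfl, ?_⟩
    rw [homFib_curv_swap]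
    exact congrArg (fun z => (⟨e'.proj, z⟩ : TotalSpace FC C)) (sub_neg_eq_add _ _)

/-- The differential of a section of `A* ⊕ C*`, as a form on the fibres of the pullback. -/
def bracketForm {l : TotalSpace (FA × FC) (A ×ᵇ C) → ℝ} (hl : IsFiberLinear (EM := EM) l)
    (e : TotE) : A e.proj × C e.proj →ₗ[ℝ] A e.proj × C e.proj →ₗ[ℝ] ℝ :=
  (exists_bracketForm (b := fun e : TotE => e.proj)
    (fun x => LA.anchor x ∘ₗ LinearMap.fst ℝ (A x) (C x)) S.basicBracket S.basicBracket_skew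
    S.basicBracket_add S.basicBracket_leibniz hl e).choose

theorem bracketForm_apply {l : TotalSpace (FA × FC) (A ×ᵇ C) → ℝ}
    (hl : IsFiberLinear (EM := EM) l) (e : TotE)
    (X Y : Sections JM (FA × FC) (A ×ᵇ C)) :
    S.bracketForm hl e (X e.proj) (Y e.proj) =
      mvfderiv JM (hl.comp Y) e.proj (LA.anchor e.proj (X e.proj).1) -
      mvfderiv JM (hl.comp X) e.proj (LA.anchor e.proj (Y e.proj).1) -
      l ⟨e.proj, S.basicBracket X Y e⟩ :=
  (exists_bracketForm (b := fun e : TotE => e.proj)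
    (fun x => LA.anchor x ∘ₗ LinearMap.fst ℝ (A x) (C x)) S.basicBracket S.basicBracket_skew
    S.basicBracket_add S.basicBracket_leibniz hl e).choose_spec X Y

theorem exists_bracket (Z W : (splitDVB EM FA A FE E FC C).SectionsE) :
    ∃ R : (splitDVB EM FA A FE E FC C).SectionsE,
      ∀ {l : TotalSpace (FA × FC) (A ×ᵇ C) → ℝ} (hl : IsFiberLinear (EM := EM) l)
        (e : TotE), l ⟨e.proj, R e⟩ =
          mvfderiv JE (fun q : TotE => l ⟨q.proj, W q⟩) e
            (S.anchor e (Z e)) -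
          mvfderiv JE (fun q : TotE => l ⟨q.proj, Z q⟩) e
            (S.anchor e (W e)) -
          S.bracketForm hl e (Z e) (W e) := by
  obtain ⟨r, hr, hrl⟩ := exists_pullback_bracket (J := JE) (contMDiff_proj E)
    (fun x => LA.anchor x ∘ₗ LinearMap.fst ℝ (A x) (C x))
    (fun X f => (LA.lieRinehart.rho (fstSec X) f).contMDiff) S.anchor
    (fun s hs => S.contMDiff_anchor.comp (pair_along.mp hs)) S.proj_anchor S.basicBracket
    S.contMDiff_basicBracket S.bracketForm S.bracketForm_apply Z W (pair_along.mpr Z.contMDiff)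
    (pair_along.mpr W.contMDiff)
  exact ⟨⟨r, pair_along.mp hr⟩, hrl⟩

end SuperData

end

section

variable {LA : LieAlgebroid 𝓘(ℝ, EM) FA A}
  (S : SuperData (Sections 𝓘(ℝ, EM) FC C) (Sections 𝓘(ℝ, EM) FE E) LA.lieRinehart)

open DoubleVectorBundle

/-- A fibrewise linear function on `A ⊕ C`, applied to a section of the pullback of `A ⊕ C`. -/
def IsFiberLinear.along {l : TotalSpace (FA × FC) (A ×ᵇ C) → ℝ} (hl : IsFiberLinear (EM := EM) l)
    (Z : (splitDVB EM FA A FE E FC C).SectionsE) :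
    CE :=
  ⟨fun e => l ⟨e.proj, Z e⟩, hl.contMDiff.comp (pair_along.mpr Z.contMDiff)⟩

theorem IsFiberLinear.along_add {l : TotalSpace (FA × FC) (A ×ᵇ C) → ℝ}
    (hl : IsFiberLinear (EM := EM) l) (Z W : (splitDVB EM FA A FE E FC C).SectionsE) :
    hl.along (Z + W) = hl.along Z + hl.along W := by
  ext e
  exact (hl.linear e.proj).map_add _ _

theorem IsFiberLinear.along_smul {l : TotalSpace (FA × FC) (A ×ᵇ C) → ℝ}
    (hl : IsFiberLinear (EM := EM) l) (f : CE)
    (Z : (splitDVB EM FA A FE E FC C).SectionsE) : hl.along (f • Z) = f • hl.along Z := by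
  ext e
  exact (hl.linear e.proj).map_smul _ _

theorem splitDVB_ext {Z W : (splitDVB EM FA A FE E FC C).SectionsE}
    (h : ∀ (l : TotalSpace (FA × FC) (A ×ᵇ C) → ℝ) (hl : IsFiberLinear (EM := EM) l) e,
      hl.along Z e = hl.along W e) : Z = W := by
  ext e
  exact (dualSystem EM (FA × FC) (A ×ᵇ C) e.proj).eq_of_fiberLinear fun l hl => h l hl e

namespace SuperData

/-- The vector field on `E` defined by a section of `D → E`. -/
def anchorSec : (splitDVB EM FA A FE E FC C).SectionsE
    →ₗ[CE]
    Sections JE (EM × FE)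
      (TangentSpace JE : TotE → Type _) where
  toFun Z := ⟨fun e => S.anchor e (Z e), S.contMDiff_anchor.comp Z.contMDiff⟩
  map_add' Z W := by
    ext e
    exact map_add (S.anchor e) _ _
  map_smul' f Z := by
    ext e
    exact map_smul (S.anchor e) _ _

/-- The bracket of the split VB-algebroid. -/
def splitBracket (Z W : (splitDVB EM FA A FE E FC C).SectionsE) :
    (splitDVB EM FA A FE E FC C).SectionsE := (S.exists_bracket Z W).choose

/-- The derivation of `C^∞(E)` defined by a section of `D → E`. -/
def splitRho : (splitDVB EM FA A FE E FC C).SectionsE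
    →ₗ[CE]
    Derivation ℝ CE
      CE :=
  (tangentAlgebroid JE TotE).lieRinehart.rho ∘ₗ S.anchorSec

theorem along_splitBracket (Z W : (splitDVB EM FA A FE E FC C).SectionsE)
    {l : TotalSpace (FA × FC) (A ×ᵇ C) → ℝ} (hl : IsFiberLinear (EM := EM) l)
    (e : TotE) : hl.along (S.splitBracket Z W) e =
      S.splitRho Z (hl.along W) e - S.splitRho W (hl.along Z) e -
        S.bracketForm hl e (Z e) (W e) :=
  (S.exists_bracket Z W).choose_spec hl e

theorem homFib_zero (e : TotE) :
    homFib (0 : ΓE →ₗ[CM] ΓC)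
      e.proj e.snd = 0 := by
  obtain ⟨ε, hε⟩ := exists_eq_apply (EM := EM) e
  rw [hε, homFib_apply]
  rfl

theorem bracketForm_isAlt {l : TotalSpace (FA × FC) (A ×ᵇ C) → ℝ}
    (hl : IsFiberLinear (EM := EM) l) (e : TotE) : (S.bracketForm hl e).IsAlt := by
  intro v
  let X := (dualSystem EM (FA × FC) (A ×ᵇ C) e.proj).extend v
  have hX : X e.proj = v := DualSystem.extend_apply _ _
  have h1 := S.bracketForm_apply hl e X X
  have h2 : l ⟨e.proj, S.basicBracket X X e⟩ = -l ⟨e.proj, S.basicBracket X X e⟩ :=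
    (congrArg (fun z => l ⟨e.proj, z⟩) (S.basicBracket_skew X X e)).trans
      ((hl.linear e.proj).map_neg _)
  rw [hX, sub_self, zero_sub] at h1
  linarith

theorem splitBracket_self (Z : (splitDVB EM FA A FE E FC C).SectionsE) :
    S.splitBracket Z Z = 0 := by
  refine splitDVB_ext fun l hl e => ?_
  rw [along_splitBracket, sub_self, zero_sub]
  refine (congrArg Neg.neg (S.bracketForm_isAlt hl e (Z e))).trans (neg_zero.trans ?_)
  exact (hl.linear e.proj).map_zero.symm

theorem splitBracket_skew (Z W : (splitDVB EM FA A FE E FC C).SectionsE) :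
    S.splitBracket W Z = -S.splitBracket Z W := by
  refine splitDVB_ext fun l hl e => ?_
  have h1 : hl.along (-S.splitBracket Z W) e = -hl.along (S.splitBracket Z W) e :=
    (hl.linear e.proj).map_neg _
  have h2 : -S.bracketForm hl e (Z e) (W e) = S.bracketForm hl e (W e) (Z e) :=
    (S.bracketForm_isAlt hl e).neg (Z e) (W e)
  rw [h1, along_splitBracket, along_splitBracket, ← h2]
  ring

theorem splitBracket_add (Z W W' : (splitDVB EM FA A FE E FC C).SectionsE) :
    S.splitBracket Z (W + W') = S.splitBracket Z W + S.splitBracket Z W' := by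
  refine splitDVB_ext fun l hl e => ?_
  have h2 : S.bracketForm hl e (Z e) ((W + W') e) =
      S.bracketForm hl e (Z e) (W e) + S.bracketForm hl e (Z e) (W' e) :=
    (S.bracketForm hl e (Z e)).map_add (W e) (W' e)
  have h3 : S.splitRho Z (hl.along W + hl.along W') e =
      S.splitRho Z (hl.along W) e + S.splitRho Z (hl.along W') e :=
    congrArg (fun g : CE => g e)
      ((S.splitRho Z).map_add _ _)
  have h4 : S.splitRho (W + W') (hl.along Z) e =
      S.splitRho W (hl.along Z) e + S.splitRho W' (hl.along Z) e := by
    rw [map_add]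
    rfl
  rw [hl.along_add]
  change _ = hl.along _ e + hl.along _ e
  rw [along_splitBracket, along_splitBracket, along_splitBracket, h2, hl.along_add, h3, h4]
  ring

theorem splitBracket_leibniz (Z : (splitDVB EM FA A FE E FC C).SectionsE)
    (f : CE)
    (W : (splitDVB EM FA A FE E FC C).SectionsE) :
    S.splitBracket Z (f • W) = f • S.splitBracket Z W + S.splitRho Z f • W := by
  refine splitDVB_ext fun l hl e => ?_
  have h2 : S.bracketForm hl e (Z e) ((f • W) e) = f e * S.bracketForm hl e (Z e) (W e) :=
    (S.bracketForm hl e (Z e)).map_smul (f e) (W e)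
  have h3 : S.splitRho (f • W) (hl.along Z) e = f e * S.splitRho W (hl.along Z) e := by
    rw [map_smul]
    rfl
  have h4 : S.splitRho Z (f • hl.along W) e =
      f e * S.splitRho Z (hl.along W) e + hl.along W e * S.splitRho Z f e :=
    congrArg (fun g : CE => g e)
      ((S.splitRho Z).leibniz f (hl.along W))
  rw [hl.along_add, hl.along_smul, hl.along_smul]
  change _ = f e * hl.along _ e + S.splitRho Z f e * hl.along W e
  rw [along_splitBracket, along_splitBracket, h2, hl.along_smul, h3, h4]
  ring

/-- The bracket and the anchor of the split VB-algebroid. -/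
def splitPre : PreLieRinehart CE
    (splitDVB EM FA A FE E FC C).SectionsE :=
  have hsmul : ∀ (c : ℝ) Z W, S.splitBracket Z (c • W) = c • S.splitBracket Z W := fun c Z W => by
    rw [← algebraMap_smul CE c W, splitBracket_leibniz, Derivation.map_algebraMap, zero_smul,
      add_zero, algebraMap_smul]
  { br := LinearMap.mk₂ ℝ S.splitBracket
      (fun Z Z' W => by
        rw [splitBracket_skew, splitBracket_add, S.splitBracket_skew Z, S.splitBracket_skew Z',
          neg_add, neg_neg, neg_neg])
      (fun c Z W => by rw [splitBracket_skew, hsmul, S.splitBracket_skew Z, smul_neg, neg_neg])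
      S.splitBracket_add hsmul
    rho := S.splitRho
    br_self := S.splitBracket_self
    leibniz := S.splitBracket_leibniz }

/-- The bracket of two sections pulled back from `A ⊕ C`. -/
theorem splitBracket_pair (X Y : ΓA) (α β : ΓC)
    (e : TotE) : S.splitBracket (splitSec X α) (splitSec Y β) e =
      S.basicBracket (pairSec X α) (pairSec Y β) e := by
  refine (dualSystem EM (FA × FC) (A ×ᵇ C) e.proj).eq_of_fiberLinear fun l hl => ?_
  have h1 : ∀ (X Y : ΓA) (α β : ΓC),
      S.splitRho (splitSec X α) (hl.along (splitSec Y β)) e =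
      mvfderiv JM (hl.comp (pairSec Y β)) e.proj (LA.anchor e.proj (X e.proj)) := by
    intro X Y α β
    refine (dfun_pull (hl.comp (pairSec Y β)) e (S.anchor e (X e.proj, α e.proj))).trans ?_
    rw [proj_anchor]
  refine (S.along_splitBracket _ _ hl e).trans ?_
  rw [h1, h1]
  have h2 := S.bracketForm_apply hl e (pairSec X α) (pairSec Y β)
  refine (congrArg (fun z => _ - z) h2).trans ?_
  exact sub_sub_cancel _ _

/-- The bracket and the anchor of the split VB-algebroid are described by the given quadruple. -/
theorem realizes_splitPre : Realizes LA S.splitPre (splitLift EM FA A FE E FC C) S := by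
  refine ⟨fun Z f e => ?_, fun α l hl e => ?_, fun X l hl ε x => ?_, fun X α => ?_, fun X Y => ?_,
    fun α β => ?_⟩
  · refine (dfun_pull f e (S.anchor e (Z e))).trans ?_
    refine (congrArg (mvfderiv JM f e.proj) (S.proj_anchor e (Z e))).trans ?_
    exact congrArg (fun a => mvfderiv JM f e.proj (LA.anchor e.proj a))
      (splitDVB_pA e (Z e)).symm
  · rw [splitDVB_coreSec]
    refine (S.anchor_fn e ((0 : A e.proj), α e.proj) hl).trans ?_
    rw [map_zero, homFib_apply]
    exact zero_sub _
  · refine (S.anchor_fn ⟨x, ε x⟩ (X x, (0 : C x)) hl).trans ?_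
    rw [map_zero, S.sideForm_apply]
    have h1 : l ⟨x, 0⟩ = 0 := (hl.linear x).map_zero
    exact (congrArg (fun z => _ - z) h1).trans (sub_zero _)
  · rw [splitDVB_coreSec, splitDVB_coreSec]
    ext e
    refine (S.splitBracket_pair X 0 0 α e).trans (Prod.ext ?_ ?_)
    · change LA.bracket X 0 e.proj = 0
      rw [map_zero]
      rfl
    · change S.nablaC.nabla X α e.proj - S.nablaC.nabla 0 0 e.proj -
        homFib (S.curv ![X, 0]) e.proj e.snd = S.nablaC.nabla X α e.proj
      rw [S.curv.map_coord_zero (i := 1) rfl, map_zero, homFib_zero, sec_zero_apply, sub_zero,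
        sub_zero]
  · ext e
    refine (S.splitBracket_pair X Y 0 0 e).trans ?_
    rw [sec_sub_apply, homSec_apply]
    refine Eq.trans ?_ (congrArg (fun z => ((LA.bracket X Y e.proj, 0) : A e.proj × C e.proj) - z)
      (splitDVB_iotaC e (homFib (S.curv ![X, Y]) e.proj e.snd)).symm)
    refine Prod.ext ?_ ?_
    · exact (sub_zero (LA.bracket X Y e.proj)).symm
    · change S.nablaC.nabla X 0 e.proj - S.nablaC.nabla Y 0 e.proj -
        homFib (S.curv ![X, Y]) e.proj e.snd = 0 - homFib (S.curv ![X, Y]) e.proj e.snd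
      rw [map_zero, map_zero, sub_self]
  · rw [splitDVB_coreSec, splitDVB_coreSec]
    ext e
    refine (S.splitBracket_pair 0 0 α β e).trans (Prod.ext ?_ ?_)
    · change LA.bracket 0 0 e.proj = 0
      rw [map_zero]
      rfl
    · change S.nablaC.nabla 0 β e.proj - S.nablaC.nabla 0 α e.proj -
        homFib (S.curv ![0, 0]) e.proj e.snd = 0
      rw [S.curv.map_coord_zero (i := 1) rfl, map_zero, homFib_zero, LinearMap.zero_apply,
        LinearMap.zero_apply, sec_zero_apply, sub_zero, sub_zero]

end SuperData

end

section

open DoubleVectorBundle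

namespace PreLieRinehart

variable {R L : Type*} [CommRing R] [Algebra ℝ R]
  [AddCommGroup L] [Module R L] [Module ℝ L] [IsScalarTower ℝ R L] (Q : PreLieRinehart R L)

/-- The deviation of the anchor from a homomorphism of brackets. -/
def anchorDefect (X Y : L) (f : R) : R := Q.rho X (Q.rho Y f) - Q.rho Y (Q.rho X f) - Q.rho (Q.br X Y) f

theorem anchorDefect_swap (X Y : L) (f : R) : Q.anchorDefect Y X f = -Q.anchorDefect X Y f := by
  rw [anchorDefect, anchorDefect, Q.br_skew X Y, map_neg, Derivation.neg_apply]
  ring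

theorem anchorDefect_add (X Y Y' : L) (f : R) :
    Q.anchorDefect X (Y + Y') f = Q.anchorDefect X Y f + Q.anchorDefect X Y' f := by
  simp only [anchorDefect, map_add, Derivation.add_apply]
  ring

theorem anchorDefect_smul (X : L) (g : R) (Y : L) (f : R) :
    Q.anchorDefect X (g • Y) f = g • Q.anchorDefect X Y f := by
  simp only [anchorDefect, map_add, map_smul, Derivation.add_apply, Derivation.smul_apply,
    Q.leibniz, smul_eq_mul, Derivation.leibniz]
  ring

/-- The Jacobiator. -/
def jacobiator (X Y Z : L) : L := Q.br X (Q.br Y Z) - Q.br (Q.br X Y) Z - Q.br Y (Q.br X Z)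

theorem jacobiator_swap (X Y Z : L) : Q.jacobiator Y X Z = -Q.jacobiator X Y Z := by
  rw [jacobiator, jacobiator, Q.br_skew X Y, map_neg, LinearMap.neg_apply]
  abel

theorem jacobiator_swap_right (X Y Z : L) : Q.jacobiator X Z Y = -Q.jacobiator X Y Z := by
  rw [jacobiator, jacobiator, Q.br_skew Y Z, Q.br_skew Y (Q.br X Z), Q.br_skew Z (Q.br X Y),
    map_neg]
  abel

theorem jacobiator_add (X Y Z Z' : L) :
    Q.jacobiator X Y (Z + Z') = Q.jacobiator X Y Z + Q.jacobiator X Y Z' := by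
  simp only [jacobiator, map_add]
  abel

theorem jacobiator_smul (X Y : L) (f : R) (Z : L) :
    Q.jacobiator X Y (f • Z) = f • Q.jacobiator X Y Z + Q.anchorDefect X Y f • Z := by
  simp only [jacobiator, anchorDefect, map_add, Q.leibniz, smul_sub, sub_smul]
  abel

end PreLieRinehart

namespace Realizes

variable {LA : LieAlgebroid 𝓘(ℝ, EM) FA A} {D : DoubleVectorBundle EM FA A FE E FC C}
    {Q : PreLieRinehart (Fns (𝓘(ℝ, EM).prod 𝓘(ℝ, FE)) (TotalSpace FE E)) D.SectionsE}
    {h : HorizontalLift D}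
    {S : SuperData (Sections 𝓘(ℝ, EM) FC C) (Sections 𝓘(ℝ, EM) FE E) LA.lieRinehart}

theorem anchorDefect_pull (H : Realizes LA Q h S) :
    (∀ X Y (f : CM), Q.anchorDefect (h.lift X) (h.lift Y) (pull f) = 0) ∧
    (∀ X α (f : CM), Q.anchorDefect (h.lift X) (D.coreSec α) (pull f) = 0) ∧
    ∀ α β (f : CM), Q.anchorDefect (D.coreSec α) (D.coreSec β) (pull f) = 0 := by
  refine ⟨fun X Y f => ?_, fun X α f => ?_, fun α β f => ?_⟩
  · have h1 : Q.rho (D.homSec (S.curv ![X, Y])) (pull f) = 0 := by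
      ext e
      rw [H.basic, homSec_apply, pA_iotaC, map_zero, map_zero]
      rfl
    rw [PreLieRinehart.anchorDefect, H.lift_lift, map_sub, Derivation.sub_apply, h1, sub_zero,
      H.rho_pull_lift, H.rho_pull_lift, H.rho_pull_lift, H.rho_pull_lift, H.rho_pull_lift]
    refine sub_eq_zero.mpr ?_
    ext e
    exact congrArg (fun f : CM => f e.proj) (LA.rho_br X Y f)
  · rw [PreLieRinehart.anchorDefect, H.lift_core, H.rho_pull_core, H.rho_pull_core, H.rho_pull_lift,
      H.rho_pull_core, map_zero, sub_zero, sub_zero]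
  · rw [PreLieRinehart.anchorDefect, H.core_core, H.rho_pull_core, H.rho_pull_core, map_zero,
      map_zero, map_zero, Derivation.zero_apply, sub_zero, sub_zero]

theorem anchorDefect_fn (H : Realizes LA Q h S) (hS : S.IsFlat) {l : TotE → ℝ}
    (hl : IsFiberLinear (EM := EM) l) :
    (∀ X Y, Q.anchorDefect (h.lift X) (h.lift Y) hl.fn = 0) ∧
    (∀ X α, Q.anchorDefect (h.lift X) (D.coreSec α) hl.fn = 0) ∧
    ∀ α β, Q.anchorDefect (D.coreSec α) (D.coreSec β) hl.fn = 0 := by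
  refine ⟨fun X Y => ?_, fun X α => ?_, fun α β => ?_⟩
  · ext e
    obtain ⟨ε, hε⟩ := exists_eq_apply (EM := EM) e
    rw [hε]
    have h1 := H.commutator_lift_lift X Y hl ε e.proj
    have h2 := H.lift_fn (LA.bracket X Y) hl ε e.proj
    have h3 := H.homSec_fn (S.curv ![X, Y]) hl ε e.proj
    have h4 := congrArg (fun s : ΓE => l ⟨e.proj, s e.proj⟩) (hS.curvS X Y ε)
    have hsub : ∀ a b : E e.proj, l ⟨e.proj, a - b⟩ = l ⟨e.proj, a⟩ - l ⟨e.proj, b⟩ :=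
      fun a b => (hl.linear e.proj).map_sub a b
    have hneg : ∀ a : E e.proj, l ⟨e.proj, -a⟩ = -l ⟨e.proj, a⟩ :=
      fun a => (hl.linear e.proj).map_neg a
    simp only [sec_sub_apply, sec_neg_apply, hsub, hneg] at h4
    change _ - _ - Q.rho (Q.br (h.lift X) (h.lift Y)) hl.fn ⟨e.proj, ε e.proj⟩ = 0
    rw [H.lift_lift, map_sub]
    change _ - _ - (Q.rho (h.lift (LA.bracket X Y)) hl.fn ⟨e.proj, ε e.proj⟩ -
      Q.rho (D.homSec (S.curv ![X, Y])) hl.fn ⟨e.proj, ε e.proj⟩) = 0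
    rw [h1, h2, h3]
    change LA.lieRinehart.rho (LA.bracket X Y) (hl.comp ε) e.proj - _ + _ -
      (LA.lieRinehart.rho (LA.bracket X Y) (hl.comp ε) e.proj -
        l ⟨e.proj, S.nablaS.nabla (LA.lieRinehart.br X Y) ε e.proj⟩ - _) = 0
    linarith
  · ext e
    have h1 := H.commutator_lift_core X α hl e
    rw [hS.bd_nabla] at h1
    change _ - _ - Q.rho (Q.br (h.lift X) (D.coreSec α)) hl.fn e = 0
    rw [H.lift_core, H.core_fn, h1, sub_self]
  · rw [PreLieRinehart.anchorDefect, H.core_core, H.rho_core_fn, H.rho_core_fn, map_neg, map_neg,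
      H.rho_pull_core, H.rho_pull_core, map_zero, Derivation.zero_apply, sub_zero, sub_self]

theorem anchorDefect_eq_zero (H : Realizes LA Q h S) (hS : S.IsFlat)
    (hQ : ∀ (Z W : D.SectionsE) (e : TotE),
      (∀ f, (∃ g, f = pull g) ∨ (∃ l, ∃ hl : IsFiberLinear (EM := EM) l, f = hl.fn) →
        Q.anchorDefect Z W f e = 0) → ∀ f, Q.anchorDefect Z W f e = 0)
    (Z W : D.SectionsE) (f : CE) :
    Q.anchorDefect Z W f = 0 := by
  have hz : ∀ e, (0 : CE) e = 0 := fun _ => rfl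
  have hgen : ∀ Z W : D.SectionsE, (∀ g, Q.anchorDefect Z W (pull g) = 0) →
      (∀ l, ∀ hl : IsFiberLinear (EM := EM) l, Q.anchorDefect Z W hl.fn = 0) →
      ∀ f, Q.anchorDefect Z W f = 0 := by
    intro Z W h1 h2 f
    ext e
    refine hQ Z W e ?_ f
    rintro f (⟨g, rfl⟩ | ⟨l, hl, rfl⟩)
    · rw [h1, hz]
    · rw [h2, hz]
  have hll := fun X Y => hgen _ _ (H.anchorDefect_pull.1 X Y)
    fun l hl => (H.anchorDefect_fn hS hl).1 X Y
  have hlc := fun X α => hgen _ _ (H.anchorDefect_pull.2.1 X α)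
    fun l hl => (H.anchorDefect_fn hS hl).2.1 X α
  have hcc := fun α β => hgen _ _ (H.anchorDefect_pull.2.2 α β)
    fun l hl => (H.anchorDefect_fn hS hl).2.2 α β
  have key : ∀ Z, (∀ X f, Q.anchorDefect Z (h.lift X) f = 0) →
      (∀ α f, Q.anchorDefect Z (D.coreSec α) f = 0) → ∀ W f, Q.anchorDefect Z W f = 0 := by
    intro Z h1 h2 W f
    ext e
    refine h.eq_zero_of_tensorial e (fun W => Q.anchorDefect Z W f e) (fun W W' => ?_)
      (fun g W => ?_) (fun X => ?_) (fun α => ?_) W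
    · rw [Q.anchorDefect_add]; rfl
    · rw [Q.anchorDefect_smul]; rfl
    · rw [h1, hz]
    · rw [h2, hz]
  refine key Z (fun X f => ?_) (fun α f => ?_) W f
  · rw [Q.anchorDefect_swap, key _ (hll X) (hlc X), neg_zero]
  · refine (Q.anchorDefect_swap _ _ f).trans ?_
    rw [key _ (fun X f => ?_) (hcc α), neg_zero]
    rw [Q.anchorDefect_swap, hlc, neg_zero]

theorem jacobiator_eq_zero (H : Realizes LA Q h S) (hS : S.IsFlat)
    (hρ : ∀ X Y f, Q.anchorDefect X Y f = 0) (X Y Z : D.SectionsE) : Q.jacobiator X Y Z = 0 := by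
  have hcz : D.coreSec 0 = 0 := by
    have h3 := D.coreSec_sub 0 0
    rwa [sub_self, sub_self] at h3
  have hhz : D.homSec 0 = 0 := by
    have h3 := D.homSec_sub 0 0
    rwa [sub_self, sub_self] at h3
  have hlll : ∀ X Y Z, Q.jacobiator (h.lift X) (h.lift Y) (h.lift Z) = 0 := by
    intro X Y Z
    refine (H.jacobi_lift_lift_lift X Y Z).trans ?_
    rw [neg_eq_zero]
    refine Eq.trans (congrArg D.homSec ?_) hhz
    ext1 ε
    exact hS.bianchi X Y Z ε
  have hllc : ∀ X Y α, Q.jacobiator (h.lift X) (h.lift Y) (D.coreSec α) = 0 := by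
    intro X Y α
    refine (H.jacobi_lift_lift_core X Y α).trans ?_
    refine Eq.trans (congrArg D.coreSec ?_) hcz
    exact (congrArg (fun z => z + _) (hS.curvC X Y α)).trans (neg_add_cancel _)
  have hlcc : ∀ X α β, Q.jacobiator (h.lift X) (D.coreSec α) (D.coreSec β) = 0 := by
    intro X α β
    rw [PreLieRinehart.jacobiator, H.core_core, H.lift_core, H.lift_core, H.core_core, H.core_core,
      map_zero, sub_zero, sub_zero]
  have hccc : ∀ α β γ, Q.jacobiator (D.coreSec α) (D.coreSec β) (D.coreSec γ) = 0 := by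
    intro α β γ
    rw [PreLieRinehart.jacobiator, H.core_core, H.core_core, H.core_core, map_zero, map_zero,
      map_zero, LinearMap.zero_apply, sub_zero, sub_zero]
  have key : ∀ X Y, (∀ Z, Q.jacobiator X Y (h.lift Z) = 0) →
      (∀ γ, Q.jacobiator X Y (D.coreSec γ) = 0) → ∀ Z, Q.jacobiator X Y Z = 0 := by
    intro X Y h1 h2 Z
    ext e
    refine h.eq_zero_of_tensorial e (fun Z => Q.jacobiator X Y Z e) (fun Z Z' => ?_)
      (fun g Z => ?_) (fun Z => ?_) (fun γ => ?_) Z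
    · rw [Q.jacobiator_add]; rfl
    · rw [Q.jacobiator_smul, hρ, zero_smul, add_zero]; rfl
    · rw [h1]; rfl
    · rw [h2]; rfl
  have hs := Q.jacobiator_swap
  have hr := Q.jacobiator_swap_right
  have h2l : ∀ X Y Z, Q.jacobiator (h.lift X) Y Z = 0 := by
    intro X Y Z
    refine key _ _ (fun Y' => ?_) (fun β => ?_) Z
    · rw [hr, key _ _ (hlll X Y') (hllc X Y'), neg_zero]
    · rw [hr, key _ _ (fun Z' => ?_) (hlcc X β), neg_zero]
      rw [hr, hllc, neg_zero]
  have h2c : ∀ α Y Z, Q.jacobiator (D.coreSec α) Y Z = 0 := by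
    intro α Y Z
    refine key _ _ (fun Y' => ?_) (fun β => ?_) Z
    · rw [hr, hs, h2l, neg_zero, neg_zero]
    · rw [hr, key _ _ (fun Z' => ?_) (hccc α β), neg_zero]
      rw [hr, hs, h2l, neg_zero, neg_zero]
  refine key _ _ (fun Z' => ?_) (fun γ => ?_) Z
  · rw [hr, hs, h2l, neg_zero, neg_zero]
  · rw [hr, hs, h2c, neg_zero, neg_zero]

end Realizes

end

section

open DoubleVectorBundle

namespace Realizes

variable {LA : LieAlgebroid 𝓘(ℝ, EM) FA A} {D : DoubleVectorBundle EM FA A FE E FC C}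
    {Q : PreLieRinehart (Fns (𝓘(ℝ, EM).prod 𝓘(ℝ, FE)) (TotalSpace FE E)) D.SectionsE}
    {h : HorizontalLift D}
    {S : SuperData (Sections 𝓘(ℝ, EM) FC C) (Sections 𝓘(ℝ, EM) FE E) LA.lieRinehart}

/-- A linear section over `X₀` is the sum of `h(X₀)` and a homomorphism. -/
theorem _root_.VBA.DoubleVectorBundle.HorizontalLift.exists_lift_add_homSec (h : HorizontalLift D)
    {X : D.SectionsE} {X₀ : ΓA} (hX : IsLinearOver X X₀) :
    ∃ φ, X = h.lift X₀ + D.homSec φ := by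
  have h1 := hX.sub (h.isLinearOver X₀)
  rw [sub_self] at h1
  obtain ⟨φ, hφ⟩ := exists_homSec h h1
  exact ⟨φ, eq_add_of_sub_eq' hφ⟩

theorem br_linear (H : Realizes LA Q h S) {X Y : D.SectionsE} {X₀ Y₀ : ΓA}
    (hX : IsLinearOver X X₀) (hY : IsLinearOver Y Y₀) :
    IsLinearOver (Q.br X Y) (LA.bracket X₀ Y₀) := by
  obtain ⟨φ, rfl⟩ := h.exists_lift_add_homSec hX
  obtain ⟨ψ, rfl⟩ := h.exists_lift_add_homSec hY
  have h1 : Q.br (h.lift X₀ + D.homSec φ) (h.lift Y₀ + D.homSec ψ) = h.lift (LA.bracket X₀ Y₀) +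
      D.homSec (-S.curv ![X₀, Y₀] + S.homConn X₀ ψ - S.homConn Y₀ φ +
        (φ ∘ₗ S.bd ∘ₗ ψ - ψ ∘ₗ S.bd ∘ₗ φ)) := by
    rw [map_add, map_add, LinearMap.add_apply, LinearMap.add_apply, H.lift_lift, H.lift_homSec,
      H.homSec_homSec, Q.br_skew (h.lift Y₀) (D.homSec φ), H.lift_homSec]
    simp only [homSec_add, homSec_sub, homSec_neg]
    abel
  rw [h1]
  have h2 := (h.isLinearOver (LA.bracket X₀ Y₀)).sec_add (h.homSec_isLinearOver
    (-S.curv ![X₀, Y₀] + S.homConn X₀ ψ - S.homConn Y₀ φ + (φ ∘ₗ S.bd ∘ₗ ψ - ψ ∘ₗ S.bd ∘ₗ φ)))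
  rwa [add_zero] at h2

theorem br_core (H : Realizes LA Q h S) {X a : D.SectionsE} {X₀ : ΓA}
    {α : ΓC} (hX : IsLinearOver X X₀) (ha : IsCoreOf a α) :
    ∃ β, IsCoreOf (Q.br X a) β := by
  obtain ⟨φ, rfl⟩ := h.exists_lift_add_homSec hX
  refine ⟨S.nablaC.nabla X₀ α + φ (S.bd α), (isCoreOf_iff _).mpr ?_⟩
  rw [(isCoreOf_iff _).mp ha, map_add, LinearMap.add_apply, H.lift_core,
    Q.br_skew (D.coreSec α) (D.homSec φ), H.core_homSec, neg_neg, coreSec_add]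

end Realizes

variable {LA : LieAlgebroid 𝓘(ℝ, EM) FA A}
  {S : SuperData (Sections 𝓘(ℝ, EM) FC C) (Sections 𝓘(ℝ, EM) FE E) LA.lieRinehart}

namespace SuperData

theorem splitPre_anchorDefect (hS : S.IsFlat) (Z W : (splitDVB EM FA A FE E FC C).SectionsE)
    (f : CE) : S.splitPre.anchorDefect Z W f = 0 := by
  refine S.realizes_splitPre.anchorDefect_eq_zero hS (fun Z W e hf f => ?_) Z W f
  refine sub_eq_zero.mpr (commutator_eq (S.anchorSec Z) (S.anchorSec W)
    (S.anchorSec (S.splitBracket Z W)) e (fun f hf' => ?_) f)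
  exact sub_eq_zero.mp (hf f hf')

/-- The Lie algebroid of the split VB-algebroid. -/
def splitAlgebroid (hS : S.IsFlat) : LieAlgebroid JE
    (splitDVB EM FA A FE E FC C).overE.Model (splitDVB EM FA A FE E FC C).overE.Fiber where
  anchor := S.anchor
  contMDiff_anchor := S.contMDiff_anchor
  bracket := S.splitPre.br
  bracket_self := S.splitPre.br_self
  jacobi X Y Z := by
    have h1 := S.realizes_splitPre.jacobiator_eq_zero hS (S.splitPre_anchorDefect hS) X Y Z
    rw [PreLieRinehart.jacobiator, sub_sub] at h1
    exact sub_eq_zero.mp h1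
  leibniz X f Y e := congrArg (fun s : (splitDVB EM FA A FE E FC C).SectionsE => s e)
    (S.splitPre.leibniz X f Y)

theorem anchor_scale (t : ℝ) (e : TotE) (a : A e.proj) (c : C e.proj) :
    (⟨scale t e, S.anchor (scale t e) (a, t • c)⟩ :
      TangentBundle JE TotE) =
    tangentMap JE JE (scale t)
      ⟨e, S.anchor e (a, c)⟩ := by
  have hs : ContMDiff JE JE ∞
      (scale t : TotE → TotE) := fun e =>
    contMDiffAt_scale contMDiffAt_const contMDiffAt_id
  have hsd := hs.mdifferentiable (by simp) e
  refine congrArg (fun v => (⟨scale t e, v⟩ :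
    TangentBundle JE TotE)) (tangent_ext ?_ fun l hl => ?_)
  · refine (S.proj_anchor (scale t e) (a, t • c)).trans ((S.proj_anchor e (a, c)).symm.trans ?_)
    exact mfderiv_comp_apply e
      ((contMDiff_proj E (n := ∞)).mdifferentiable (by simp) (scale t e)) hsd (S.anchor e (a, c))
  · refine (S.anchor_fn (scale t e) (a, t • c) hl).trans ?_
    refine Eq.trans ?_ (dfun_comp (hl.contMDiff.mdifferentiable (by simp) _) hsd _)
    have h1 : (fun q => l (scale t q)) = (fun _ : TotE => t) • l := by
      ext q
      exact (hl.linear q.proj).map_smul t q.snd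
    rw [h1, mvfderiv_smul mdifferentiableAt_const (hl.contMDiff.mdifferentiable (by simp) _),
      mvfderiv_const]
    have h2 := S.anchor_fn e (a, c) hl
    have h3 : l ⟨e.proj, homFib S.bd e.proj (t • c)⟩ = t * l ⟨e.proj, homFib S.bd e.proj c⟩ := by
      rw [map_smul]
      exact (hl.linear e.proj).map_smul _ _
    have h4 := (S.sideForm hl e.proj a).map_smul t e.snd
    refine (congrArg₂ (fun y z : ℝ => y - z) h4 h3).trans ?_
    simp [h2, mul_sub]

variable (S) in
/-- The split VB-algebroid defined by a flat superconnection. -/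
def splitVB (hS : S.IsFlat) : VBAlgebroid FE E FC C LA where
  dvb := splitDVB EM FA A FE E FC C
  alg := S.splitAlgebroid hS
  anchor_base d := congrArg (fun v => (⟨d.proj.proj, v⟩ : TangentBundle JM M))
    (S.proj_anchor d.proj d.snd)
  anchor_add := by
    intro d₁ d₂ d h
    obtain ⟨x, a, e, f, c, k, rfl, rfl, rfl⟩ := splitSwap_addRel.mp h
    refine tangentAdd_mk (LA.anchor x a) (S.proj_anchor ⟨x, e⟩ (a, c))
      (S.proj_anchor ⟨x, f⟩ (a, k)) (S.proj_anchor ⟨x, e + f⟩ (a, c + k)) fun l hl => ?_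
    refine (S.anchor_fn ⟨x, e + f⟩ (a, c + k) hl).trans ?_
    have h1 := S.anchor_fn ⟨x, e⟩ (a, c) hl
    have h2 := S.anchor_fn ⟨x, f⟩ (a, k) hl
    have h3 : l ⟨x, homFib S.bd x (c + k)⟩ = l ⟨x, homFib S.bd x c⟩ + l ⟨x, homFib S.bd x k⟩ := by
      rw [map_add]
      exact (hl.linear x).map_add _ _
    have h4 := (S.sideForm hl x a).map_add e f
    refine Eq.trans ?_ (congrArg₂ (fun y z : ℝ => y + z) h1 h2).symm
    refine (congrArg₂ (fun y z : ℝ => y - z) h4 h3).trans ?_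
    ring
  anchor_scale t d := S.anchor_scale t d.proj d.snd.1 d.snd.2
  bracket_linear X X₀ Y Y₀ hX hY := S.realizes_splitPre.br_linear hX hY
  bracket_core X X₀ a α hX ha := S.realizes_splitPre.br_core hX ha
  bracket_core_core a α b β ha hb := by
    rw [(isCoreOf_iff _).mp ha, (isCoreOf_iff _).mp hb]
    exact S.realizes_splitPre.core_core α β

theorem isAssociated_splitVB (hS : S.IsFlat) :
    VBAlgebroid.IsAssociated (S.splitVB hS) (splitLift EM FA A FE E FC C) S :=
  ((S.splitVB hS).isAssociated_iff _).mpr S.realizes_splitPre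

end SuperData

end

section

open DoubleVectorBundle

namespace VBAlgebroid

variable {LA : LieAlgebroid 𝓘(ℝ, EM) FA A} {D D' : VBAlgebroid FE E FC C LA}
  {h : HorizontalLift D.dvb} {h' : HorizontalLift D'.dvb}

theorem IsSuperconnectionOf.isSuperconnection
    {𝒟 : Module.End ℝ (Forms CM ΓA
      (TwoTerm ΓC ΓE))}
    (H : IsSuperconnectionOf D h 𝒟) : IsSuperconnection LA.lieRinehart 𝒟 ∧ 𝒟 * 𝒟 = 0 := by
  obtain ⟨S, hS, rfl⟩ := H
  exact ⟨S.isSuperconnection, hS.sq⟩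

theorem IsSuperconnectionOf.eq_gauge {h' : HorizontalLift D.dvb}
    {𝒟 𝒟' : Module.End ℝ (Forms CM ΓA
      (TwoTerm ΓC ΓE))}
    (H : IsSuperconnectionOf D h 𝒟) (H' : IsSuperconnectionOf D h' 𝒟')
    {σ : ΓA [⋀^Fin 1]→ₗ[CM]
      (ΓE →ₗ[CM] ΓC)} (hσ : DifferBy h h' σ) :
    𝒟' = (gauge σ : Module.End ℝ _) * 𝒟 * (↑(gauge σ)⁻¹ : Module.End ℝ _) := by
  obtain ⟨S, hS, rfl⟩ := H
  obtain ⟨S', hS', rfl⟩ := H'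
  exact hS.op_eq hS' hσ

/-- The superconnection of a horizontal lift. -/
theorem exists_superconnection (h : HorizontalLift D.dvb) :
    ∃ 𝒟 : FlatSuperconnection ΓC ΓE LA.lieRinehart,
      IsSuperconnectionOf D h 𝒟.op := by
  obtain ⟨S, hS⟩ := D.exists_isAssociated h
  exact ⟨⟨S.op, S.isSuperconnection, hS.sq⟩, S, hS, rfl⟩

theorem Iso.equivalent (Φ : Iso D D')
    {𝒟 𝒟' : FlatSuperconnection ΓC ΓE LA.lieRinehart}
    (H : IsSuperconnectionOf D h 𝒟.op) (H' : IsSuperconnectionOf D' h' 𝒟'.op) :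
    FlatSuperconnection.Equivalent 𝒟 𝒟' := by
  obtain ⟨S, hS, e⟩ := H
  obtain ⟨S', hS', e'⟩ := H'
  obtain ⟨σ, hσ, -⟩ := existsUnique_differBy (Φ.mapLift h) h'
  refine ⟨σ, ?_⟩
  rw [e, e']
  exact (Φ.isAssociated_mapLift hS).op_eq hS' hσ

theorem nonempty_iso_of_equivalent
    {𝒟 𝒟' : FlatSuperconnection ΓC ΓE LA.lieRinehart}
    (H : IsSuperconnectionOf D h 𝒟.op) (H' : IsSuperconnectionOf D' h' 𝒟'.op)
    (h𝒟 : FlatSuperconnection.Equivalent 𝒟 𝒟') : Nonempty (Iso D D') := by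
  obtain ⟨S, hS, e⟩ := H
  obtain ⟨S', hS', e'⟩ := H'
  obtain ⟨σ, hσ⟩ := h𝒟
  obtain ⟨T, hT⟩ := D.exists_isAssociated (h.addHom σ)
  have h1 := hS.op_eq hT (differBy_iff.mpr fun _ => rfl)
  rw [← e, ← hσ, e'] at h1
  obtain rfl := SuperData.op_injective h1
  exact nonempty_iso ((isAssociated_iff _ _).mp hT) ((isAssociated_iff _ _).mp hS')

theorem exists_isSuperconnectionOf
    (𝒟 : FlatSuperconnection ΓC ΓE LA.lieRinehart) :
    ∃ (D : VBAlgebroid FE E FC C LA) (h : HorizontalLift D.dvb), IsSuperconnectionOf D h 𝒟.op := by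
  have h1 := 𝒟.isSuperconnection.superData_op (separated_twoTerm EM FA A FE E FC C)
  have h2 : 𝒟.isSuperconnection.superData.IsFlat := SuperData.IsFlat.of_sq _ (by
    rw [h1]
    exact 𝒟.flat)
  exact ⟨_, _, _, SuperData.isAssociated_splitVB h2, h1.symm⟩

variable (FE E FC C LA) in
theorem exists_equiv_classes [SigmaCompactSpace M] :
    ∃ Φ : Quotient (VBAlgebroid.setoid FE E FC C LA) ≃
        Quotient (FlatSuperconnection.setoid ΓC ΓE
          LA.lieRinehart),
      ∀ (D : VBAlgebroid FE E FC C LA) (h : HorizontalLift D.dvb)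
        (𝒟 : FlatSuperconnection ΓC ΓE
          LA.lieRinehart),
        IsSuperconnectionOf D h 𝒟.op → Φ (Quotient.mk _ D) = Quotient.mk _ 𝒟 := by
  let lft : (D : VBAlgebroid FE E FC C LA) → HorizontalLift D.dvb := fun D =>
    (nonempty_horizontalLift D.dvb).some
  choose con hcon using fun D : VBAlgebroid FE E FC C LA => exists_superconnection (lft D)
  let Φ : Quotient (VBAlgebroid.setoid FE E FC C LA) →
      Quotient (FlatSuperconnection.setoid ΓC ΓE
        LA.lieRinehart) :=
    Quotient.lift (fun D => Quotient.mk _ (con D)) fun D D' ⟨Ψ⟩ =>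
      Quotient.sound (Ψ.equivalent (hcon D) (hcon D'))
  have hΦ : ∀ D (h : HorizontalLift D.dvb) 𝒟, IsSuperconnectionOf D h 𝒟.op →
      Φ (Quotient.mk _ D) = Quotient.mk _ 𝒟 := fun D h 𝒟 H =>
    Quotient.sound ((Iso.refl D).equivalent (hcon D) H)
  refine ⟨Equiv.ofBijective Φ ⟨?_, ?_⟩, hΦ⟩
  · rintro ⟨D⟩ ⟨D'⟩ hDD'
    exact Quotient.sound (nonempty_iso_of_equivalent (hcon D) (hcon D') (Quotient.exact hDD'))
  · rintro ⟨𝒟⟩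
    obtain ⟨D, h, H⟩ := exists_isSuperconnectionOf 𝒟
    exact ⟨Quotient.mk _ D, hΦ D h 𝒟 H⟩

end VBAlgebroid

end

end DoubleVectorBundles

end VBA

end

theorem mainTheorem2
    {EM : Type v} [NormedAddCommGroup EM] [NormedSpace ℝ EM] [FiniteDimensional ℝ EM]
    {M : Type w} [TopologicalSpace M] [ChartedSpace EM M] [IsManifold 𝓘(ℝ, EM) ∞ M]
    [T2Space M] [SigmaCompactSpace M]
    {FA : Type u} [NormedAddCommGroup FA] [NormedSpace ℝ FA] [FiniteDimensional ℝ FA]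
    {A : M → Type u} [TopologicalSpace (TotalSpace FA A)]
    [∀ x, AddCommGroup (A x)] [∀ x, Module ℝ (A x)] [∀ x, TopologicalSpace (A x)]
    [FiberBundle FA A] [VectorBundle ℝ FA A] [ContMDiffVectorBundle ∞ FA A 𝓘(ℝ, EM)]
    {FE : Type u} [NormedAddCommGroup FE] [NormedSpace ℝ FE] [FiniteDimensional ℝ FE]
    {E : M → Type u} [TopologicalSpace (TotalSpace FE E)]
    [∀ x, AddCommGroup (E x)] [∀ x, Module ℝ (E x)] [∀ x, TopologicalSpace (E x)]
    [FiberBundle FE E] [VectorBundle ℝ FE E] [ContMDiffVectorBundle ∞ FE E 𝓘(ℝ, EM)]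
    {FC : Type u} [NormedAddCommGroup FC] [NormedSpace ℝ FC] [FiniteDimensional ℝ FC]
    {C : M → Type u} [TopologicalSpace (TotalSpace FC C)]
    [∀ x, AddCommGroup (C x)] [∀ x, Module ℝ (C x)] [∀ x, TopologicalSpace (C x)]
    [FiberBundle FC C] [VectorBundle ℝ FC C] [ContMDiffVectorBundle ∞ FC C 𝓘(ℝ, EM)]
    (LA : LieAlgebroid 𝓘(ℝ, EM) FA A) :
    -- every VB-algebroid has a horizontal lift, and each lift has a unique flat superconnection
    (∀ D : VBAlgebroid FE E FC C LA, Nonempty (DoubleVectorBundle.HorizontalLift D.dvb)) ∧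
    (∀ (D : VBAlgebroid FE E FC C LA) (h : DoubleVectorBundle.HorizontalLift D.dvb),
      ∃! S : SuperData (Sections 𝓘(ℝ, EM) FC C) (Sections 𝓘(ℝ, EM) FE E) LA.lieRinehart,
        VBAlgebroid.IsAssociated D h S) ∧
    (∀ (D : VBAlgebroid FE E FC C LA) (h : DoubleVectorBundle.HorizontalLift D.dvb)
      (𝒟 : Module.End ℝ (Forms (Fns 𝓘(ℝ, EM) M) (Sections 𝓘(ℝ, EM) FA A)
        (TwoTerm (Sections 𝓘(ℝ, EM) FC C) (Sections 𝓘(ℝ, EM) FE E)))),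
      VBAlgebroid.IsSuperconnectionOf D h 𝒟 →
        IsSuperconnection LA.lieRinehart 𝒟 ∧ 𝒟 * 𝒟 = 0) ∧
    -- change of the horizontal lift
    (∀ (D : VBAlgebroid FE E FC C LA) (h h' : DoubleVectorBundle.HorizontalLift D.dvb),
      (∃! σ, VBAlgebroid.DifferBy h h' σ) ∧
      ∀ σ, VBAlgebroid.DifferBy h h' σ →
      ∀ 𝒟 𝒟' : Module.End ℝ (Forms (Fns 𝓘(ℝ, EM) M) (Sections 𝓘(ℝ, EM) FA A)
        (TwoTerm (Sections 𝓘(ℝ, EM) FC C) (Sections 𝓘(ℝ, EM) FE E))),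
      VBAlgebroid.IsSuperconnectionOf D h 𝒟 → VBAlgebroid.IsSuperconnectionOf D h' 𝒟' →
        𝒟' = 𝒟 + ⁅sigmaOp σ, 𝒟⁆ + (1 / 2 : ℝ) • ⁅sigmaOp σ, ⁅sigmaOp σ, 𝒟⁆⁆ ∧
        ⁅sigmaOp σ, ⁅sigmaOp σ, ⁅sigmaOp σ, 𝒟⁆⁆⁆ = 0 ∧
        (∀ n : ℕ, 3 ≤ n → (fun Q => ⁅sigmaOp σ, Q⁆)^[n] 𝒟 = 0) ∧
        𝒟' = ∑ᶠ n : ℕ, ((n.factorial : ℝ)⁻¹) • (fun Q => ⁅sigmaOp σ, Q⁆)^[n] 𝒟 ∧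
        ∃ u : (Module.End ℝ (Forms (Fns 𝓘(ℝ, EM) M) (Sections 𝓘(ℝ, EM) FA A)
            (TwoTerm (Sections 𝓘(ℝ, EM) FC C) (Sections 𝓘(ℝ, EM) FE E))))ˣ,
          (u : Module.End ℝ _) = 1 + sigmaOp σ ∧
          𝒟' = (u : Module.End ℝ _) * 𝒟 * (↑u⁻¹ : Module.End ℝ _)) ∧
    -- the induced bijection of classes
    (∃ Φ : Quotient (VBAlgebroid.setoid FE E FC C LA) ≃
        Quotient (FlatSuperconnection.setoid (Sections 𝓘(ℝ, EM) FC C) (Sections 𝓘(ℝ, EM) FE E)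
          LA.lieRinehart),
      ∀ (D : VBAlgebroid FE E FC C LA) (h : DoubleVectorBundle.HorizontalLift D.dvb)
        (𝒟 : FlatSuperconnection (Sections 𝓘(ℝ, EM) FC C) (Sections 𝓘(ℝ, EM) FE E)
          LA.lieRinehart),
        VBAlgebroid.IsSuperconnectionOf D h 𝒟.op → Φ (Quotient.mk _ D) = Quotient.mk _ 𝒟) := by
  refine ⟨fun D => D.dvb.nonempty_horizontalLift, VBAlgebroid.existsUnique_isAssociated, ?_, ?_,
    VBAlgebroid.exists_equiv_classes FE E FC C LA⟩
  · intro D h 𝒟 H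
    exact H.isSuperconnection
  · intro D h h'
    refine ⟨existsUnique_differBy h h', ?_⟩
    intro σ hσ 𝒟 𝒟' H H'
    have h1 := H.eq_gauge H' hσ
    obtain ⟨h2, h3, h4, h5⟩ := gauge_expansion σ h1
    exact ⟨h2, h3, h4, h5, gauge σ, rfl, h1⟩
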